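/- **Proposition (categorical representation of the extended affine braid group).** Let $r\ge 3$; all indices $1,\dots,r$ are understood modulo $r$. Let $\hat{\mathcal B}$ be the extended affine braid group of type $\hat A_{r-1}$, i.e. the group generated by $\sigma_1,\dots,\sigma_r,\rho$ subject to $$\sigma_i\sigma_j=\sigma_j\sigma_i\ \ (j\not\equiv i\pm1 \bmod r),\qquad \sigma_i\sigma_{i+1}\sigma_i=\sigma_{i+1}\sigma_i\sigma_{i+1},\qquad \rho\sigma_i\rho^{-1}=\sigma_{i+1}\qquad(i,j=1,\dots,r).$$ Let $R=\mathbb Q[y][x_1,\dots,x_r]$, graded by $\deg y=\deg x_i=2$, and consider the automorphisms of $R$ that fix $y$ and are given by $\rho(x_i)=x_{i+1}$ for $i<r$, $\rho(x_r)=x_1-y$; $\sigma_j$ exchanges $x_j$ and $x_{j+1}$ and fixes the other variables for $j<r$; $\sigma_r(x_1)=x_r+y$, $\sigma_r(x_r)=x_1-y$, $\sigma_r(x_i)=x_i$ otherwise. Put $X_i=x_{i+1}-x_i$ for $i<r$ and $X_r=x_1-x_r-y$. Consider the graded $R$-bimodules $R$, $B_i=R\otimes_{R^{\sigma_i}}R$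 (where $R^{\sigma_i}$ is the subring of $\sigma_i$-invariants) and $B_{\rho^{\pm1}}$, which is $R$ as a left module and on which $a\in R$ acts on the right as multiplication by $\rho^{\pm1}(a)$. For a graded bimodule $M$ let $M\{p\}_i=M_{i-p}$. Let $\mathrm{EBim}$ be the category of the graded bimodules obtained from $R$, $B_1,\dots,B_r$, $B_\rho$, $B_{\rho^{-1}}$ by tensor products over $R$, finite direct sums and grading shifts, with the degree-preserving bimodule maps as morphisms; let $\mathrm{Kar}(\mathrm{EBim})$ be its Karoubi envelope and $\mathcal K$ the homotopy category of bounded cochain complexes in $\mathrm{Kar}(\mathrm{EBim})$, which is monoidal under the tensor product of complexes over $R$. Put $$F(\sigma_i)=\bigl(R\{2\}\xrightarrow{\ 1\mapsto\frac12(X_i\otimes1+1\otimes X_i)\ }B_i\bigr),\qquad F(\sigma_i^{-1})=\bigl(B_i\{-2\}\xrightarrow{\ a\otimes b\,\mapsto\, ab\ }R\{-2\}\bigr),$$ with $B_i$, respectively $B_i\{-2\}$, in cohomological degree $0$; let $F(\rho^{\pm1})=B_{\rho^{\pm1}}$ in cohomological degree $0$; and, for a word $w$ in the letters $\sigma_i^{\pm1},\rho^{\pm1}$,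 let $F(w)$ be the tensor product over $R$ of the complexes assigned to its letters, in order, with $F(\emptyset)=R$ in degree $0$. Then $F$ defines a categorical representation of $\hat{\mathcal B}$ in $\mathcal K$: there is a (strong) monoidal functor $\Phi$ from $\hat{\mathcal B}$, regarded as a discrete monoidal category (objects the elements of the group, only identity morphisms, tensor product the group law), to $\mathcal K$ such that for every word $w$, with $\bar w$ the element of $\hat{\mathcal B}$ that it represents, $\Phi(\bar w)\cong F(w)$ in $\mathcal K$. In particular $F(w)\cong F(w')$ in $\mathcal K$ whenever $w$ and $w'$ represent the same element of $\hat{\mathcal B}$. -/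

import Mathlib

open CategoryTheory Limits MonoidalCategory
open scoped TensorProduct DirectSum

namespace ExtSoergel

section Grading

variable {k : Type} [CommRing k]

/-- Criterion for a family of submodules to be a grading: the existence of a compatible additive
map sending each element to its family of homogeneous components. -/
theorem isInternal_of_components {V : Type} [AddCommGroup V] [Module k V]
    (gr : ℤ → Submodule k V) (δ : V →+ (ℤ →₀ V)) (h₁ : ∀ v n, δ v n ∈ gr n)
    (h₂ : ∀ v, (δ v).sum (fun _ x => x) = v)
    (h₃ : ∀ n, ∀ x ∈ gr n, δ x = Finsupp.single n x) : DirectSum.IsInternal gr := by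
  classical
  constructor
  · rw [injective_iff_map_eq_zero]
    intro x hx
    have key : ∀ y : ⨁ i, gr i, ∀ n, δ (DirectSum.coeAddMonoidHom gr y) n = (y n : V) := by
      intro y n
      induction y using DirectSum.induction_on with
      | zero => simp
      | of i y =>
        rw [DirectSum.coeAddMonoidHom_of, h₃ i _ y.2, Finsupp.single_apply]
        split_ifs with h
        · subst h; simp
        · rw [DirectSum.of_eq_of_ne _ _ _ (Ne.symm h)]; rfl
      | add y z hy hz => simp [hy, hz]
    refine DFinsupp.ext fun n => Subtype.ext ?_
    rw [← key x n, hx]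
    simp
  · intro v
    refine ⟨∑ n ∈ (δ v).support, DirectSum.of (fun i => gr i) n ⟨δ v n, h₁ v n⟩, ?_⟩
    rw [map_sum]
    conv_rhs => rw [← h₂ v]
    refine Finset.sum_congr rfl fun n _ => ?_
    rw [DirectSum.coeAddMonoidHom_of]

variable {V W T : Type} [AddCommGroup V] [Module k V] [AddCommGroup W] [Module k W]
  [AddCommGroup T] [Module k T]

/-- The linear map sending an element of a graded module to its homogeneous components. -/
noncomputable def components {gr : ℤ → Submodule k V} (h : DirectSum.IsInternal gr) :
    V →ₗ[k] (ℤ →₀ V) :=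
  (DirectSum.toModule k ℤ (ℤ →₀ V) fun i => (Finsupp.lsingle i).comp (gr i).subtype).comp
    (LinearEquiv.ofBijective (DirectSum.coeLinearMap gr) h).symm.toLinearMap

theorem components_of_mem {gr : ℤ → Submodule k V} (h : DirectSum.IsInternal gr) {n : ℤ} {v : V}
    (hv : v ∈ gr n) : components h v = Finsupp.single n v := by
  have : (LinearEquiv.ofBijective (DirectSum.coeLinearMap gr) h).symm v =
      DirectSum.lof k ℤ (fun i => gr i) n ⟨v, hv⟩ := by
    rw [LinearEquiv.symm_apply_eq]
    exact (DirectSum.coeLinearMap_lof gr n ⟨v, hv⟩).symm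
  simp [components, this]

theorem homogeneous_induction {gr : ℤ → Submodule k V} (h : DirectSum.IsInternal gr)
    {p : V → Prop} (v : V) (h₀ : p 0) (hh : ∀ n, ∀ v ∈ gr n, p v)
    (ha : ∀ v w, p v → p w → p (v + w)) : p v := by
  obtain ⟨x, rfl⟩ := h.2 v
  induction x using DirectSum.induction_on with
  | zero => simpa
  | of i y => rw [DirectSum.coeAddMonoidHom_of]; exact hh i _ y.2
  | add y z hy hz => rw [map_add]; exact ha _ _ hy hz

theorem components_mem {gr : ℤ → Submodule k V} (h : DirectSum.IsInternal gr) (v : V) (n : ℤ) :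
    components h v n ∈ gr n := by
  induction v using homogeneous_induction h with
  | h₀ => simp
  | hh m v hv =>
    rw [components_of_mem h hv, Finsupp.single_apply]
    split_ifs with e
    · exact e ▸ hv
    · exact zero_mem _
  | ha v w hv hw => rw [map_add]; exact add_mem hv hw

theorem components_sum {gr : ℤ → Submodule k V} (h : DirectSum.IsInternal gr) (v : V) :
    (components h v).sum (fun _ x => x) = v := by
  induction v using homogeneous_induction h with
  | h₀ => simp
  | hh m v hv => rw [components_of_mem h hv]; simp
  | ha v w hv hw =>
    rw [map_add, Finsupp.sum_add_index' (fun _ => rfl) (fun _ _ _ => rfl), hv, hw]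

/-- The homogeneous components of `t v w` predicted by those of `v` and `w`, for a bilinear `t`. -/
noncomputable def components₂ {gV : ℤ → Submodule k V} {gW : ℤ → Submodule k W}
    (hV : DirectSum.IsInternal gV) (hW : DirectSum.IsInternal gW) (t : V →ₗ[k] W →ₗ[k] T) :
    V →ₗ[k] W →ₗ[k] (ℤ →₀ T) :=
  LinearMap.mk₂ k (fun v w => (components hV v).sum fun i x => (components hW w).sum fun j y =>
      Finsupp.single (i + j) (t x y))
    (fun v v' w => by
      rw [map_add, Finsupp.sum_add_index'] <;> simp)
    (fun c v w => by
      rw [map_smul, Finsupp.sum_smul_index', Finsupp.smul_sum]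
      · simp [Finsupp.smul_sum]
      · simp)
    (fun v w w' => by
      rw [map_add, ← Finsupp.sum_add]
      refine Finsupp.sum_congr fun i _ => ?_
      rw [Finsupp.sum_add_index'] <;> simp)
    (fun c v w => by
      rw [map_smul, Finsupp.smul_sum]
      refine Finsupp.sum_congr fun i _ => ?_
      rw [Finsupp.sum_smul_index', Finsupp.smul_sum] <;> simp)

theorem components₂_of_mem {gV : ℤ → Submodule k V} {gW : ℤ → Submodule k W}
    (hV : DirectSum.IsInternal gV) (hW : DirectSum.IsInternal gW) (t : V →ₗ[k] W →ₗ[k] T)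
    {i j : ℤ} {v : V} {w : W} (hv : v ∈ gV i) (hw : w ∈ gW j) :
    components₂ hV hW t v w = Finsupp.single (i + j) (t v w) := by
  simp [components₂, components_of_mem hV hv, components_of_mem hW hw]

/-- The grading induced on the target of a bilinear map by gradings of the two factors. -/
def tensorGrading (gV : ℤ → Submodule k V) (gW : ℤ → Submodule k W) (t : V →ₗ[k] W →ₗ[k] T)
    (n : ℤ) : Submodule k T :=
  Submodule.span k {z | ∃ i j : ℤ, i + j = n ∧ ∃ v ∈ gV i, ∃ w ∈ gW j, t v w = z}

theorem tmul_mem_tensorGrading {gV : ℤ → Submodule k V} {gW : ℤ → Submodule k W}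
    (t : V →ₗ[k] W →ₗ[k] T) {i j : ℤ} {v : V} {w : W} (hv : v ∈ gV i) (hw : w ∈ gW j) :
    t v w ∈ tensorGrading gV gW t (i + j) :=
  Submodule.subset_span ⟨i, j, rfl, v, hv, w, hw, rfl⟩

theorem tensorGrading_isInternal {gV : ℤ → Submodule k V} {gW : ℤ → Submodule k W}
    (hV : DirectSum.IsInternal gV) (hW : DirectSum.IsInternal gW) (t : V →ₗ[k] W →ₗ[k] T)
    (ht : ∀ z : T, z ∈ Submodule.span k {z | ∃ v w, t v w = z})
    (δ : T →+ (ℤ →₀ T)) (hδk : ∀ (c : k) z, δ (c • z) = c • δ z)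
    (hδ : ∀ v w, δ (t v w) = components₂ hV hW t v w) :
    DirectSum.IsInternal (tensorGrading gV gW t) := by
  have hom : ∀ {i j : ℤ} {v : V} {w : W}, v ∈ gV i → w ∈ gW j →
      δ (t v w) = Finsupp.single (i + j) (t v w) := fun hv hw => by
    rw [hδ, components₂_of_mem hV hW t hv hw]
  have ind : ∀ {p : T → Prop}, p 0 → (∀ z z', p z → p z' → p (z + z')) →
      (∀ (c : k) z, p z → p (c • z)) →
      (∀ i j, ∀ v ∈ gV i, ∀ w ∈ gW j, p (t v w)) → ∀ z, p z := by
    intro p p0 pa ps ph z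
    induction ht z using Submodule.span_induction with
    | mem z hz =>
      obtain ⟨v, w, rfl⟩ := hz
      induction v using homogeneous_induction hV with
      | h₀ => simpa
      | hh m v hv =>
        induction w using homogeneous_induction hW with
        | h₀ => simpa
        | hh m w hw => exact ph _ _ v hv w hw
        | ha w w' hw hw' => rw [map_add]; exact pa _ _ hw hw'
      | ha v v' hv hv' => rw [map_add, LinearMap.add_apply]; exact pa _ _ hv hv'
    | zero => exact p0
    | add z z' _ _ h h' => exact pa _ _ h h'
    | smul c z _ h => exact ps _ _ h
  refine isInternal_of_components _ δ ?_ ?_ ?_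
  · intro z
    refine ind (p := fun z => ∀ n, δ z n ∈ tensorGrading gV gW t n) ?_ ?_ ?_ ?_ z
    · simp
    · intro z z' h h' n
      rw [map_add]
      exact add_mem (h n) (h' n)
    · intro c z h n
      rw [hδk]
      exact Submodule.smul_mem _ _ (h n)
    · intro i j v hv w hw n
      rw [hom hv hw, Finsupp.single_apply]
      split_ifs with e
      · exact e ▸ tmul_mem_tensorGrading t hv hw
      · exact zero_mem _
  · intro z
    refine ind (p := fun z => (δ z).sum (fun _ x => x) = z) ?_ ?_ ?_ ?_ z
    · simp
    · intro z z' h h'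
      rw [map_add, Finsupp.sum_add_index' (fun _ => rfl) (fun _ _ _ => rfl), h, h']
    · intro c z h
      rw [hδk, Finsupp.sum_smul_index' (fun _ => rfl), ← Finsupp.smul_sum, h]
    · intro i j v hv w hw
      rw [hom hv hw]
      simp
  · intro n z hz
    induction hz using Submodule.span_induction with
    | mem z hz =>
      obtain ⟨i, j, rfl, v, hv, w, hw, rfl⟩ := hz
      exact hom hv hw
    | zero => simp
    | add z z' _ _ h h' => rw [map_add, h, h', Finsupp.single_add]
    | smul c z _ h => rw [hδk, h, Finsupp.smul_single]

end Grading

section Bimodules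

variable {k R : Type} [CommRing k] [CommRing R] [Algebra k R]

/-- A graded bimodule over the (commutative) graded `k`-algebra `R = ⨁ 𝒜 i`: a `k`-module with
commuting left and right `R`-actions on which `k` acts centrally, and a `ℤ`-grading compatible
with both actions. `left a m` is `a • m` and `right a m` is `m • a`. -/
structure GrBimod (𝒜 : ℤ → Submodule k R) where
  carrier : Type
  [addCommGroup : AddCommGroup carrier]
  [module : Module k carrier]
  left : R →ₐ[k] Module.End k carrier
  right : R →ₐ[k] Module.End k carrier
  comm : ∀ (a b : R) (m : carrier), left a (right b m) = right b (left a m)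
  gr : ℤ → Submodule k carrier
  internal : DirectSum.IsInternal gr
  left_mem : ∀ {i j : ℤ} {a : R} {m : carrier}, a ∈ 𝒜 i → m ∈ gr j → left a m ∈ gr (i + j)
  right_mem : ∀ {i j : ℤ} {a : R} {m : carrier}, a ∈ 𝒜 i → m ∈ gr j → right a m ∈ gr (j + i)

namespace GrBimod

variable {𝒜 : ℤ → Submodule k R}

instance : CoeSort (GrBimod 𝒜) Type := ⟨carrier⟩

instance (M : GrBimod 𝒜) : AddCommGroup M := M.addCommGroup

instance (M : GrBimod 𝒜) : Module k M := M.module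

/-- The degree-preserving homomorphisms of bimodules. -/
def homSubmodule (M N : GrBimod 𝒜) : Submodule k (M →ₗ[k] N) where
  carrier := {f | (∀ a m, f (M.left a m) = N.left a (f m)) ∧
    (∀ a m, f (M.right a m) = N.right a (f m)) ∧ ∀ n, ∀ m ∈ M.gr n, f m ∈ N.gr n}
  zero_mem' := ⟨by simp, by simp, by simp⟩
  add_mem' := fun {f g} hf hg => ⟨fun a m => by simp [hf.1, hg.1],
    fun a m => by simp [hf.2.1, hg.2.1], fun n m hm => add_mem (hf.2.2 n m hm) (hg.2.2 n m hm)⟩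
  smul_mem' := fun c f hf => ⟨fun a m => by simp [hf.1],
    fun a m => by simp [hf.2.1], fun n m hm => Submodule.smul_mem _ c (hf.2.2 n m hm)⟩

/-- Morphisms of graded bimodules. -/
@[ext]
structure Hom (M N : GrBimod 𝒜) where
  lin : M →ₗ[k] N
  prop : lin ∈ homSubmodule M N

instance : Category (GrBimod 𝒜) where
  Hom := Hom
  id M := ⟨LinearMap.id, by simp [homSubmodule]⟩
  comp f g := ⟨g.lin.comp f.lin, ⟨fun a m => by simp [f.prop.1, g.prop.1],
    fun a m => by simp [f.prop.2.1, g.prop.2.1],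
    fun n m hm => g.prop.2.2 n _ (f.prop.2.2 n m hm)⟩⟩

variable {M N P Q : GrBimod 𝒜}

@[ext]
theorem hom_ext {f g : M ⟶ N} (h : ∀ m, f.lin m = g.lin m) : f = g :=
  Hom.ext (LinearMap.ext h)

@[simp] theorem id_lin (m : M) : (𝟙 M : M ⟶ M).lin m = m := rfl

@[simp] theorem comp_lin (f : M ⟶ N) (g : N ⟶ P) (m : M) : (f ≫ g).lin m = g.lin (f.lin m) := rfl

theorem hom_left (f : M ⟶ N) (a : R) (m : M) : f.lin (M.left a m) = N.left a (f.lin m) :=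
  f.prop.1 a m

theorem hom_right (f : M ⟶ N) (a : R) (m : M) : f.lin (M.right a m) = N.right a (f.lin m) :=
  f.prop.2.1 a m

theorem hom_mem (f : M ⟶ N) {n : ℤ} {m : M} (hm : m ∈ M.gr n) : f.lin m ∈ N.gr n :=
  f.prop.2.2 n m hm

instance : Zero (M ⟶ N) := ⟨⟨0, zero_mem _⟩⟩
instance : Add (M ⟶ N) := ⟨fun f g => ⟨f.lin + g.lin, add_mem f.prop g.prop⟩⟩
instance : Neg (M ⟶ N) := ⟨fun f => ⟨-f.lin, neg_mem f.prop⟩⟩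
instance : Sub (M ⟶ N) := ⟨fun f g => ⟨f.lin - g.lin, sub_mem f.prop g.prop⟩⟩
instance : SMul ℕ (M ⟶ N) := ⟨fun n f => ⟨n • f.lin, nsmul_mem f.prop n⟩⟩
instance : SMul ℤ (M ⟶ N) := ⟨fun n f => ⟨n • f.lin, zsmul_mem f.prop n⟩⟩

theorem lin_injective : Function.Injective (fun f : M ⟶ N => f.lin) := fun _ _ h => Hom.ext h

instance : AddCommGroup (M ⟶ N) :=
  lin_injective.addCommGroup _ rfl (fun _ _ => rfl) (fun _ => rfl) (fun _ _ => rfl)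
    (fun _ _ => rfl) (fun _ _ => rfl)

@[simp] theorem zero_lin (m : M) : (0 : M ⟶ N).lin m = 0 := rfl

@[simp] theorem add_lin (f g : M ⟶ N) (m : M) : (f + g).lin m = f.lin m + g.lin m := rfl

instance : Preadditive (GrBimod 𝒜) where
  add_comp _ _ _ f f' g := by ext; simp
  comp_add _ _ _ f g g' := by ext; simp

/-- Isomorphisms of graded bimodules from mutually inverse morphisms. -/
def mkIso (f : M ⟶ N) (g : N ⟶ M) (h₁ : ∀ m, g.lin (f.lin m) = m) (h₂ : ∀ n, f.lin (g.lin n) = n) :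
    M ≅ N := ⟨f, g, by ext m; exact h₁ m, by ext n; exact h₂ n⟩

/-- The grading shift `M{p}`, with `M{p}_n = M_{n - p}`. -/
def shift (M : GrBimod 𝒜) (p : ℤ) : GrBimod 𝒜 where
  carrier := M
  left := M.left
  right := M.right
  comm := M.comm
  gr n := M.gr (n - p)
  internal := by
    have h : (M.gr ∘ Equiv.subRight p) = fun n => M.gr (n - p) := rfl
    classical
    refine isInternal_of_components _
      (((Finsupp.domLCongr (Equiv.addRight p)).toLinearMap.comp
        (components M.internal) : M →ₗ[k] (ℤ →₀ M)).toAddMonoidHom) ?_ ?_ ?_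
    · intro v n
      simpa [Finsupp.domLCongr, Finsupp.domCongr, sub_eq_add_neg] using
        components_mem M.internal v (n - p)
    · intro v
      conv_rhs => rw [← components_sum M.internal v]
      exact Finsupp.sum_equivMapDomain (Equiv.addRight p) (components M.internal v) (fun _ x => x)
    · intro n x hx
      simp [components_of_mem M.internal hx]
  left_mem ha hm := by
    have := M.left_mem ha hm
    rwa [← add_sub_assoc] at this
  right_mem ha hm := by
    have := M.right_mem ha hm
    rwa [sub_add_eq_add_sub] at this

/-! ### The tensor product over `R` -/

/-- The relations `m a ⊗ n = m ⊗ a n`. -/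
def tensorRel (M N : GrBimod 𝒜) : Submodule k (M ⊗[k] N) :=
  Submodule.span k {z | ∃ (a : R) (m : M) (n : N), M.right a m ⊗ₜ[k] n - m ⊗ₜ[k] N.left a n = z}

/-- The `k`-module `M ⊗_R N`, the quotient of `M ⊗_k N` by the relations `m a ⊗ n = m ⊗ a n`. -/
abbrev TensorCarrier (M N : GrBimod 𝒜) : Type := (M ⊗[k] N) ⧸ tensorRel M N

/-- The canonical bilinear map `(m, n) ↦ m ⊗ n`. -/
def tmul (M N : GrBimod 𝒜) : M →ₗ[k] N →ₗ[k] TensorCarrier M N :=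
  (TensorProduct.mk k M N).compr₂ (tensorRel M N).mkQ

theorem tmul_balanced (a : R) (m : M) (n : N) :
    tmul M N (M.right a m) n = tmul M N m (N.left a n) := by
  refine (Submodule.Quotient.eq _).2 (Submodule.subset_span ⟨a, m, n, rfl⟩)

/-- Linear maps out of `M ⊗_R N` from balanced bilinear maps. -/
def lift {X : Type} [AddCommGroup X] [Module k X] (f : M →ₗ[k] N →ₗ[k] X)
    (hf : ∀ a m n, f (M.right a m) n = f m (N.left a n)) : TensorCarrier M N →ₗ[k] X :=
  (tensorRel M N).liftQ (TensorProduct.lift f) (by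
    rw [tensorRel, Submodule.span_le]
    rintro _ ⟨a, m, n, rfl⟩
    simp [hf])

@[simp]
theorem lift_tmul {X : Type} [AddCommGroup X] [Module k X] (f : M →ₗ[k] N →ₗ[k] X)
    (hf : ∀ a m n, f (M.right a m) n = f m (N.left a n)) (m : M) (n : N) :
    lift f hf (tmul M N m n) = f m n := by
  simp [lift, tmul]

theorem mem_span_tmul (z : TensorCarrier M N) :
    z ∈ Submodule.span k {z | ∃ m n, tmul M N m n = z} := by
  obtain ⟨z, rfl⟩ := Submodule.mkQ_surjective _ z
  induction z using TensorProduct.induction_on with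
  | zero => simp
  | tmul m n => exact Submodule.subset_span ⟨m, n, rfl⟩
  | add x y hx hy => rw [map_add]; exact add_mem hx hy

theorem tensor_induction {p : TensorCarrier M N → Prop} (z : TensorCarrier M N) (h₀ : p 0)
    (ht : ∀ m n, p (tmul M N m n)) (ha : ∀ x y, p x → p y → p (x + y)) : p z := by
  obtain ⟨z, rfl⟩ := Submodule.mkQ_surjective _ z
  induction z using TensorProduct.induction_on with
  | zero => simpa
  | tmul m n => exact ht m n
  | add x y hx hy => rw [map_add]; exact ha _ _ hx hy

theorem tensor_ext {X : Type} [AddCommGroup X] [Module k X] {f g : TensorCarrier M N →ₗ[k] X}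
    (h : ∀ m n, f (tmul M N m n) = g (tmul M N m n)) : f = g := by
  refine LinearMap.ext fun z => ?_
  induction z using tensor_induction with
  | h₀ => simp
  | ht m n => exact h m n
  | ha x y hx hy => rw [map_add, map_add, hx, hy]

/-- The linear map `f ⊗ g`. -/
def mapLin {M' N' : GrBimod 𝒜} (f : M →ₗ[k] M') (g : N →ₗ[k] N')
    (hf : ∀ a m, f (M.right a m) = M'.right a (f m))
    (hg : ∀ a n, g (N.left a n) = N'.left a (g n)) :
    TensorCarrier M N →ₗ[k] TensorCarrier M' N' :=
  lift ((tmul M' N').compl₁₂ f g) (fun a m n => by simp [hf, hg, tmul_balanced])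

@[simp]
theorem mapLin_tmul {M' N' : GrBimod 𝒜} (f : M →ₗ[k] M') (g : N →ₗ[k] N')
    (hf : ∀ a m, f (M.right a m) = M'.right a (f m))
    (hg : ∀ a n, g (N.left a n) = N'.left a (g n)) (m : M) (n : N) :
    mapLin f g hf hg (tmul M N m n) = tmul M' N' (f m) (g n) := by
  simp [mapLin]

theorem components₂_balanced [GradedAlgebra 𝒜] {X : Type} [AddCommGroup X] [Module k X]
    (t : M →ₗ[k] N →ₗ[k] X) (ht : ∀ a m n, t (M.right a m) n = t m (N.left a n))
    (a : R) (m : M) (n : N) :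
    components₂ M.internal N.internal t (M.right a m) n =
      components₂ M.internal N.internal t m (N.left a n) := by
  classical
  induction a using DirectSum.Decomposition.inductionOn 𝒜 with
  | zero => simp
  | add a b ha hb => simp [ha, hb]
  | homogeneous a =>
    rename_i d
    induction m using homogeneous_induction M.internal with
    | h₀ => simp
    | ha m m' h h' => simp only [map_add, LinearMap.add_apply, h, h']
    | hh i m hm =>
      induction n using homogeneous_induction N.internal with
      | h₀ => simp
      | ha n n' h h' => simp only [map_add, h, h']
      | hh j n hn =>
        rw [components₂_of_mem _ _ _ (M.right_mem a.2 hm) hn,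
          components₂_of_mem _ _ _ hm (N.left_mem a.2 hn), ht, add_assoc]

/-- The left action `a (m ⊗ n) = a m ⊗ n`. -/
def tensLeft (M N : GrBimod 𝒜) (a : R) : Module.End k (TensorCarrier M N) :=
  mapLin (M.left a) LinearMap.id (fun b m => M.comm a b m) (fun _ _ => rfl)

/-- The right action `(m ⊗ n) a = m ⊗ n a`. -/
def tensRight (M N : GrBimod 𝒜) (a : R) : Module.End k (TensorCarrier M N) :=
  mapLin LinearMap.id (N.right a) (fun _ _ => rfl) (fun b m => (N.comm b a m).symm)

@[simp]
theorem tensLeft_tmul (a : R) (m : M) (n : N) :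
    tensLeft M N a (tmul M N m n) = tmul M N (M.left a m) n := by
  unfold tensLeft
  rw [mapLin_tmul]
  rfl

@[simp]
theorem tensRight_tmul (a : R) (m : M) (n : N) :
    tensRight M N a (tmul M N m n) = tmul M N m (N.right a n) := by
  unfold tensRight
  rw [mapLin_tmul]
  rfl

/-- The linear map giving the homogeneous components of an element of `M ⊗_R N`. -/
noncomputable def tensComponents [GradedAlgebra 𝒜] (M N : GrBimod 𝒜) :
    TensorCarrier M N →ₗ[k] (ℤ →₀ TensorCarrier M N) :=
  lift (components₂ M.internal N.internal (tmul M N)) (components₂_balanced _ tmul_balanced)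

theorem tensorGrading_tmul_isInternal [GradedAlgebra 𝒜] (M N : GrBimod 𝒜) :
    DirectSum.IsInternal (tensorGrading M.gr N.gr (tmul M N)) :=
  tensorGrading_isInternal M.internal N.internal (tmul M N) mem_span_tmul
    (tensComponents M N).toAddMonoidHom (fun c z => map_smul (tensComponents M N) c z)
    (fun m n => lift_tmul _ (components₂_balanced _ tmul_balanced) m n)

theorem tensLeft_mem [GradedAlgebra 𝒜] {i j : ℤ} {a : R} {z : TensorCarrier M N} (ha : a ∈ 𝒜 i)
    (hz : z ∈ tensorGrading M.gr N.gr (tmul M N) j) :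
    tensLeft M N a z ∈ tensorGrading M.gr N.gr (tmul M N) (i + j) := by
  induction hz using Submodule.span_induction with
  | mem z hz =>
    obtain ⟨p, q, rfl, m, hm, n, hn, rfl⟩ := hz
    rw [← add_assoc, tensLeft_tmul]
    exact tmul_mem_tensorGrading (tmul M N) (M.left_mem ha hm) hn
  | zero => rw [map_zero]; exact zero_mem _
  | add z z' _ _ h h' => rw [map_add]; exact add_mem h h'
  | smul c z _ h => rw [map_smul]; exact Submodule.smul_mem _ _ h

theorem tensRight_mem [GradedAlgebra 𝒜] {i j : ℤ} {a : R} {z : TensorCarrier M N} (ha : a ∈ 𝒜 i)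
    (hz : z ∈ tensorGrading M.gr N.gr (tmul M N) j) :
    tensRight M N a z ∈ tensorGrading M.gr N.gr (tmul M N) (j + i) := by
  induction hz using Submodule.span_induction with
  | mem z hz =>
    obtain ⟨p, q, rfl, m, hm, n, hn, rfl⟩ := hz
    rw [add_assoc, tensRight_tmul]
    exact tmul_mem_tensorGrading (tmul M N) hm (N.right_mem ha hn)
  | zero => rw [map_zero]; exact zero_mem _
  | add z z' _ _ h h' => rw [map_add]; exact add_mem h h'
  | smul c z _ h => rw [map_smul]; exact Submodule.smul_mem _ _ h

/-- The graded bimodule `M ⊗_R N`, with `(M ⊗_R N)_n` spanned by the `M_i ⊗ N_j`, `i + j = n`. -/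
noncomputable def tens [GradedAlgebra 𝒜] (M N : GrBimod 𝒜) : GrBimod 𝒜 where
  carrier := TensorCarrier M N
  left := AlgHom.ofLinearMap
    { toFun := tensLeft M N
      map_add' := fun a b => tensor_ext fun m n => by simp
      map_smul' := fun c a => tensor_ext fun m n => by simp }
    (tensor_ext fun m n => by simp) (fun a b => tensor_ext fun m n => by simp)
  right := AlgHom.ofLinearMap
    { toFun := tensRight M N
      map_add' := fun a b => tensor_ext fun m n => by simp
      map_smul' := fun c a => tensor_ext fun m n => by simp }
    (tensor_ext fun m n => by simp) (fun a b => tensor_ext fun m n => by simp)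
  comm a b z := LinearMap.congr_fun
    (f := (tensLeft M N a).comp (tensRight M N b)) (g := (tensRight M N b).comp (tensLeft M N a))
    (tensor_ext fun m n => by simp) z
  gr := tensorGrading M.gr N.gr (tmul M N)
  internal := tensorGrading_tmul_isInternal M N
  left_mem ha hz := tensLeft_mem ha hz
  right_mem ha hz := tensRight_mem ha hz

theorem left_mul (M : GrBimod 𝒜) (a b : R) (m : M) : M.left (a * b) m = M.left a (M.left b m) := by
  simp

theorem right_mul (M : GrBimod 𝒜) (a b : R) (m : M) :
    M.right (a * b) m = M.right a (M.right b m) := by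
  simp

section Monoidal

variable [GradedAlgebra 𝒜]

/-- The canonical bilinear map `(m, n) ↦ m ⊗ n` into the graded bimodule `M ⊗_R N`. -/
noncomputable def tm (M N : GrBimod 𝒜) : M →ₗ[k] N →ₗ[k] tens M N := tmul M N

theorem tm_balanced (a : R) (m : M) (n : N) :
    tm M N (M.right a m) n = tm M N m (N.left a n) := tmul_balanced a m n

@[simp]
theorem left_tm (a : R) (m : M) (n : N) :
    (tens M N).left a (tm M N m n) = tm M N (M.left a m) n := tensLeft_tmul a m n

@[simp]
theorem right_tm (a : R) (m : M) (n : N) :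
    (tens M N).right a (tm M N m n) = tm M N m (N.right a n) := tensRight_tmul a m n

theorem tm_mem {i j : ℤ} {m : M} {n : N} (hm : m ∈ M.gr i) (hn : n ∈ N.gr j) :
    tm M N m n ∈ (tens M N).gr (i + j) :=
  tmul_mem_tensorGrading (tmul M N) hm hn

theorem tm_induction {p : tens M N → Prop} (z : tens M N) (h₀ : p 0)
    (ht : ∀ m n, p (tm M N m n)) (ha : ∀ x y, p x → p y → p (x + y)) : p z :=
  tensor_induction z h₀ ht ha

theorem tens_gr_induction {n : ℤ} {p : tens M N → Prop} {z : tens M N}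
    (hz : z ∈ (tens M N).gr n) (h₀ : p 0) (ha : ∀ x y, p x → p y → p (x + y))
    (hs : ∀ (c : k) x, p x → p (c • x))
    (ht : ∀ i j, i + j = n → ∀ m ∈ M.gr i, ∀ n ∈ N.gr j, p (tm M N m n)) : p z := by
  refine Submodule.span_induction (p := fun z _ => p z) ?_ h₀ (fun x y _ _ => ha x y)
    (fun c x _ => hs c x) hz
  rintro _ ⟨i, j, h, m, hm, n, hn, rfl⟩
  exact ht i j h m hm n hn

/-- Linear maps out of `M ⊗_R N` from balanced bilinear maps. -/
noncomputable def tmLift {X : Type} [AddCommGroup X] [Module k X] (f : M →ₗ[k] N →ₗ[k] X)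
    (hf : ∀ a m n, f (M.right a m) n = f m (N.left a n)) : tens M N →ₗ[k] X := lift f hf

@[simp]
theorem tmLift_tm {X : Type} [AddCommGroup X] [Module k X] (f : M →ₗ[k] N →ₗ[k] X)
    (hf : ∀ a m n, f (M.right a m) n = f m (N.left a n)) (m : M) (n : N) :
    tmLift f hf (tm M N m n) = f m n := lift_tmul f hf m n

theorem tm_ext {X : Type} [AddCommGroup X] [Module k X] {f g : tens M N →ₗ[k] X}
    (h : ∀ m n, f (tm M N m n) = g (tm M N m n)) : f = g := tensor_ext h

theorem tens_hom_ext {f g : tens M N ⟶ P}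
    (h : ∀ m n, f.lin (tm M N m n) = g.lin (tm M N m n)) : f = g :=
  Hom.ext (tm_ext h)

/-- A linear map out of a tensor product is a morphism of graded bimodules as soon as it is so
on pure tensors. -/
def homOfTm (f : tens M N →ₗ[k] P)
    (hl : ∀ a m n, f (tm M N (M.left a m) n) = P.left a (f (tm M N m n)))
    (hr : ∀ a m n, f (tm M N m (N.right a n)) = P.right a (f (tm M N m n)))
    (hg : ∀ i j, ∀ m ∈ M.gr i, ∀ n ∈ N.gr j, f (tm M N m n) ∈ P.gr (i + j)) :
    tens M N ⟶ P where
  lin := f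
  prop := by
    refine ⟨fun a z => ?_, fun a z => ?_, fun n z hz => ?_⟩
    · induction z using tm_induction with
      | h₀ => simp
      | ht m n => rw [left_tm, hl]
      | ha x y hx hy => simp only [map_add, hx, hy]
    · induction z using tm_induction with
      | h₀ => simp
      | ht m n => rw [right_tm, hr]
      | ha x y hx hy => simp only [map_add, hx, hy]
    · refine tens_gr_induction (p := fun z => f z ∈ P.gr n) hz (by simp) ?_ ?_ ?_
      · intro z z' h h'
        rw [map_add]
        exact add_mem h h'
      · intro c z h
        rw [map_smul]
        exact Submodule.smul_mem _ _ h
      · intro i j h m hm n hn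
        exact h ▸ hg i j m hm n hn

@[simp]
theorem homOfTm_lin (f : tens M N →ₗ[k] P) (hl hr hg) : (homOfTm f hl hr hg).lin = f := rfl

/-- The morphism `f ⊗ g`. -/
noncomputable def tensMap {M' N' : GrBimod 𝒜} (f : M ⟶ M') (g : N ⟶ N') :
    tens M N ⟶ tens M' N' :=
  homOfTm (tmLift ((tm M' N').compl₁₂ f.lin g.lin)
      (fun a m n => by simp [hom_left, hom_right, tm_balanced]))
    (fun a m n => by simp [hom_left])
    (fun a m n => by simp [hom_right])
    (fun i j m hm n hn => by simpa using tm_mem (hom_mem f hm) (hom_mem g hn))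

@[simp]
theorem tensMap_tm {M' N' : GrBimod 𝒜} (f : M ⟶ M') (g : N ⟶ N') (m : M) (n : N) :
    (tensMap f g).lin (tm M N m n) = tm M' N' (f.lin m) (g.lin n) := by
  simp [tensMap]

/-- The regular bimodule `R`. -/
def regular (𝒜 : ℤ → Submodule k R) [GradedAlgebra 𝒜] : GrBimod 𝒜 where
  carrier := R
  left := Algebra.lmul k R
  right := Algebra.lmul k R
  comm a b m := by simp [mul_left_comm]
  gr := 𝒜
  internal := DirectSum.Decomposition.isInternal 𝒜
  left_mem ha hm := SetLike.mul_mem_graded ha hm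
  right_mem {i j a m} ha hm := by
    have := SetLike.mul_mem_graded hm ha
    rwa [mul_comm] at this

theorem tm_ext_apply {X Y : Type} [AddCommGroup X] [Module k X] [AddCommGroup Y] [Module k Y]
    {f g : tens M N →ₗ[k] X →ₗ[k] Y} {x : X}
    (h : ∀ m n, f (tm M N m n) x = g (tm M N m n) x) (z : tens M N) : f z x = g z x :=
  LinearMap.congr_fun (f := f.flip x) (g := g.flip x) (tm_ext h) z

/-- The trilinear map `(m, n, p) ↦ m ⊗ (n ⊗ p)`. -/
noncomputable def assocAux₁ (M N P : GrBimod 𝒜) : M →ₗ[k] N →ₗ[k] P →ₗ[k] tens M (tens N P) :=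
  LinearMap.mk₂ k (fun m n => (tm M (tens N P) m).comp (tm N P n))
    (fun m m' n => by ext p; simp) (fun c m n => by ext p; simp)
    (fun m n n' => by ext p; simp) (fun c m n => by ext p; simp)

@[simp]
theorem assocAux₁_apply (m : M) (n : N) (p : P) :
    assocAux₁ M N P m n p = tm M (tens N P) m (tm N P n p) := rfl

/-- The bilinear map `(m ⊗ n, p) ↦ m ⊗ (n ⊗ p)`. -/
noncomputable def assocAux₂ (M N P : GrBimod 𝒜) : tens M N →ₗ[k] P →ₗ[k] tens M (tens N P) :=
  tmLift (assocAux₁ M N P) (fun a m n => by ext p; simp [tm_balanced])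

@[simp]
theorem assocAux₂_tm (m : M) (n : N) (p : P) :
    assocAux₂ M N P (tm M N m n) p = tm M (tens N P) m (tm N P n p) := by
  simp [assocAux₂]

/-- The associativity map `(m ⊗ n) ⊗ p ↦ m ⊗ (n ⊗ p)` as a linear map. -/
noncomputable def assocLin (M N P : GrBimod 𝒜) : tens (tens M N) P →ₗ[k] tens M (tens N P) :=
  tmLift (assocAux₂ M N P) (fun a z p =>
    tm_ext_apply (f := (assocAux₂ M N P).comp ((tens M N).right a))
      (g := (assocAux₂ M N P).compl₂ (P.left a)) (fun m n => by simp [tm_balanced]) z)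

@[simp]
theorem assocLin_tm (z : tens M N) (p : P) :
    assocLin M N P (tm _ P z p) = assocAux₂ M N P z p :=
  tmLift_tm _ _ _ _

theorem assocAux₂_left (a : R) (z : tens M N) (p : P) :
    assocAux₂ M N P ((tens M N).left a z) p =
      (tens M (tens N P)).left a (assocAux₂ M N P z p) :=
  tm_ext_apply (f := (assocAux₂ M N P).comp ((tens M N).left a))
      (g := (assocAux₂ M N P).compr₂ ((tens M (tens N P)).left a)) (fun m n => by simp) z

theorem assocAux₂_right (a : R) (z : tens M N) (p : P) :
    assocAux₂ M N P z (P.right a p) = (tens M (tens N P)).right a (assocAux₂ M N P z p) :=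
  tm_ext_apply (f := (assocAux₂ M N P).compl₂ (P.right a))
      (g := (assocAux₂ M N P).compr₂ ((tens M (tens N P)).right a)) (fun m n => by simp) z

theorem assocAux₂_mem {i j : ℤ} {z : tens M N} (hz : z ∈ (tens M N).gr i) {p : P}
    (hp : p ∈ P.gr j) : assocAux₂ M N P z p ∈ (tens M (tens N P)).gr (i + j) := by
  refine tens_gr_induction (p := fun z => assocAux₂ M N P z p ∈ (tens M (tens N P)).gr (i + j)) hz
    (by simp) ?_ ?_ ?_
  · intro x y hx hy
    rw [map_add, LinearMap.add_apply]
    exact add_mem hx hy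
  · intro c x hx
    rw [map_smul, LinearMap.smul_apply]
    exact Submodule.smul_mem _ _ hx
  · intro i' j' h m hm n hn
    subst h
    rw [add_assoc, assocAux₂_tm]
    exact tm_mem hm (tm_mem hn hp)

/-- The associativity morphism `(m ⊗ n) ⊗ p ↦ m ⊗ (n ⊗ p)`. -/
noncomputable def assocHom (M N P : GrBimod 𝒜) : tens (tens M N) P ⟶ tens M (tens N P) :=
  homOfTm (assocLin M N P)
    (fun a z p => by rw [assocLin_tm, assocLin_tm, assocAux₂_left])
    (fun a z p => by rw [assocLin_tm, assocLin_tm, assocAux₂_right])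
    (fun i j z hz p hp => by rw [assocLin_tm]; exact assocAux₂_mem hz hp)

@[simp]
theorem assocHom_tm (m : M) (n : N) (p : P) :
    (assocHom M N P).lin (tm _ P (tm M N m n) p) = tm M _ m (tm N P n p) := by
  rw [assocHom, homOfTm_lin, assocLin_tm, assocAux₂_tm]

/-- The trilinear map `(n, p, m) ↦ (m ⊗ n) ⊗ p`. -/
noncomputable def assocInvAux₁ (M N P : GrBimod 𝒜) :
    N →ₗ[k] P →ₗ[k] M →ₗ[k] tens (tens M N) P :=
  LinearMap.mk₂ k (fun n p => ((tm (tens M N) P).flip p).comp ((tm M N).flip n))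
    (fun m m' n => by ext p; simp) (fun c m n => by ext p; simp)
    (fun m n n' => by ext p; simp) (fun c m n => by ext p; simp)

@[simp]
theorem assocInvAux₁_apply (m : M) (n : N) (p : P) :
    assocInvAux₁ M N P n p m = tm (tens M N) P (tm M N m n) p := rfl

/-- The bilinear map `(n ⊗ p, m) ↦ (m ⊗ n) ⊗ p`. -/
noncomputable def assocInvAux₂ (M N P : GrBimod 𝒜) :
    tens N P →ₗ[k] M →ₗ[k] tens (tens M N) P :=
  tmLift (assocInvAux₁ M N P) (fun a n p => by
    ext m
    rw [assocInvAux₁_apply, assocInvAux₁_apply, ← right_tm, tm_balanced])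

@[simp]
theorem assocInvAux₂_tm (m : M) (n : N) (p : P) :
    assocInvAux₂ M N P (tm N P n p) m = tm (tens M N) P (tm M N m n) p := by
  simp [assocInvAux₂]

/-- The map `m ⊗ (n ⊗ p) ↦ (m ⊗ n) ⊗ p` as a linear map. -/
noncomputable def assocInvLin (M N P : GrBimod 𝒜) : tens M (tens N P) →ₗ[k] tens (tens M N) P :=
  tmLift (assocInvAux₂ M N P).flip (fun a m z =>
    tm_ext_apply (f := (assocInvAux₂ M N P).compl₂ (M.right a))
      (g := (assocInvAux₂ M N P).comp ((tens N P).left a))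
      (fun n p => by simp [tm_balanced]) z)

@[simp]
theorem assocInvLin_tm (m : M) (z : tens N P) :
    assocInvLin M N P (tm M _ m z) = assocInvAux₂ M N P z m :=
  tmLift_tm _ _ _ _

theorem assocInvAux₂_left (a : R) (z : tens N P) (m : M) :
    assocInvAux₂ M N P z (M.left a m) =
      (tens (tens M N) P).left a (assocInvAux₂ M N P z m) :=
  tm_ext_apply (f := (assocInvAux₂ M N P).compl₂ (M.left a))
      (g := (assocInvAux₂ M N P).compr₂ ((tens (tens M N) P).left a)) (fun n p => by simp) z

theorem assocInvAux₂_right (a : R) (z : tens N P) (m : M) :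
    assocInvAux₂ M N P ((tens N P).right a z) m =
      (tens (tens M N) P).right a (assocInvAux₂ M N P z m) :=
  tm_ext_apply (f := (assocInvAux₂ M N P).comp ((tens N P).right a))
      (g := (assocInvAux₂ M N P).compr₂ ((tens (tens M N) P).right a)) (fun n p => by simp) z

theorem assocInvAux₂_mem {i j : ℤ} {m : M} (hm : m ∈ M.gr i) {z : tens N P}
    (hz : z ∈ (tens N P).gr j) : assocInvAux₂ M N P z m ∈ (tens (tens M N) P).gr (i + j) := by
  refine tens_gr_induction
    (p := fun z => assocInvAux₂ M N P z m ∈ (tens (tens M N) P).gr (i + j)) hz (by simp) ?_ ?_ ?_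
  · intro x y hx hy
    rw [map_add, LinearMap.add_apply]
    exact add_mem hx hy
  · intro c x hx
    rw [map_smul, LinearMap.smul_apply]
    exact Submodule.smul_mem _ _ hx
  · intro i' j' h n hn p hp
    subst h
    rw [← add_assoc, assocInvAux₂_tm]
    exact tm_mem (tm_mem hm hn) hp

/-- The morphism `m ⊗ (n ⊗ p) ↦ (m ⊗ n) ⊗ p`. -/
noncomputable def assocInv (M N P : GrBimod 𝒜) : tens M (tens N P) ⟶ tens (tens M N) P :=
  homOfTm (assocInvLin M N P)
    (fun a m z => by rw [assocInvLin_tm, assocInvLin_tm, assocInvAux₂_left])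
    (fun a m z => by rw [assocInvLin_tm, assocInvLin_tm, assocInvAux₂_right])
    (fun i j m hm z hz => by rw [assocInvLin_tm]; exact assocInvAux₂_mem hm hz)

@[simp]
theorem assocInv_tm (m : M) (n : N) (p : P) :
    (assocInv M N P).lin (tm M _ m (tm N P n p)) = tm _ P (tm M N m n) p := by
  rw [assocInv, homOfTm_lin, assocInvLin_tm, assocInvAux₂_tm]

theorem tens₃_hom_ext {f g : tens (tens M N) P ⟶ Q}
    (h : ∀ m n p, f.lin (tm _ P (tm M N m n) p) = g.lin (tm _ P (tm M N m n) p)) : f = g := by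
  refine tens_hom_ext fun z p => ?_
  induction z using tm_induction with
  | h₀ => simp
  | ht m n => exact h m n p
  | ha x y hx hy => simp only [map_add, LinearMap.add_apply, hx, hy]

theorem tens₃_hom_ext' {f g : tens M (tens N P) ⟶ Q}
    (h : ∀ m n p, f.lin (tm M _ m (tm N P n p)) = g.lin (tm M _ m (tm N P n p))) : f = g := by
  refine tens_hom_ext fun m z => ?_
  induction z using tm_induction with
  | h₀ => simp
  | ht n p => exact h m n p
  | ha x y hx hy => simp only [map_add, hx, hy]

/-- The associativity isomorphism. -/
noncomputable def assocIso (M N P : GrBimod 𝒜) :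
    tens (tens M N) P ≅ tens M (tens N P) where
  hom := assocHom M N P
  inv := assocInv M N P
  hom_inv_id := tens₃_hom_ext fun m n p => by simp
  inv_hom_id := tens₃_hom_ext' fun m n p => by simp

/-- An element of `R`, as an element of the regular bimodule. -/
def reg : R →ₗ[k] regular 𝒜 := LinearMap.id

/-- An element of the regular bimodule, as an element of `R`. -/
def unreg : regular 𝒜 →ₗ[k] R := LinearMap.id

@[simp] theorem unreg_reg (a : R) : unreg (reg a : regular 𝒜) = a := rfl

@[simp] theorem reg_unreg (b : regular 𝒜) : reg (unreg b) = b := rfl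

@[simp] theorem unreg_left (a : R) (b : regular 𝒜) :
    unreg ((regular 𝒜).left a b) = a * unreg b := rfl

@[simp] theorem unreg_right (a : R) (b : regular 𝒜) :
    unreg ((regular 𝒜).right a b) = a * unreg b := rfl

theorem left_reg (a b : R) : (regular 𝒜).left a (reg b) = reg (a * b) := rfl

theorem right_reg (a b : R) : (regular 𝒜).right a (reg b) = reg (a * b) := rfl

theorem reg_one_mem : (reg 1 : regular 𝒜) ∈ (regular 𝒜).gr 0 := SetLike.one_mem_graded 𝒜

theorem unreg_mem {i : ℤ} {b : regular 𝒜} (hb : b ∈ (regular 𝒜).gr i) : unreg b ∈ 𝒜 i := hb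

/-- The bilinear map `(a, m) ↦ a m`. -/
def actLeft (M : GrBimod 𝒜) : regular 𝒜 →ₗ[k] M →ₗ[k] M :=
  LinearMap.mk₂ k (fun b m => M.left (unreg b) m) (by simp) (by simp) (by simp) (by simp)

/-- The bilinear map `(m, a) ↦ m a`. -/
def actRight (M : GrBimod 𝒜) : M →ₗ[k] regular 𝒜 →ₗ[k] M :=
  LinearMap.mk₂ k (fun m b => M.right (unreg b) m) (by simp) (by simp) (by simp) (by simp)

@[simp] theorem actLeft_apply (b : regular 𝒜) (m : M) : actLeft M b m = M.left (unreg b) m := rfl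

@[simp] theorem actRight_apply (b : regular 𝒜) (m : M) : actRight M m b = M.right (unreg b) m := rfl

/-- The isomorphism `R ⊗_R M ≅ M`, `a ⊗ m ↦ a m`. -/
noncomputable def leftUnitIso (M : GrBimod 𝒜) : tens (regular 𝒜) M ≅ M where
  hom := homOfTm (tmLift (actLeft M) (fun a b m => by
      rw [actLeft_apply, actLeft_apply, unreg_right, mul_comm, left_mul]))
    (fun a b m => by
      rw [tmLift_tm, tmLift_tm, actLeft_apply, actLeft_apply, unreg_left, left_mul])
    (fun a b m => by
      rw [tmLift_tm, tmLift_tm]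
      exact M.comm _ a m)
    (fun i j b hb m hm => by
      rw [tmLift_tm]
      exact M.left_mem (unreg_mem hb) hm)
  inv := ⟨tm (regular 𝒜) M (reg 1), fun a m => by
      rw [left_tm, ← tm_balanced]; rfl, fun a m => by rw [right_tm], fun n m hm => by
      simpa using tm_mem reg_one_mem hm⟩
  hom_inv_id := tens_hom_ext fun b m => by
    rw [comp_lin, homOfTm_lin, tmLift_tm, actLeft_apply, id_lin]
    change tm (regular 𝒜) M (reg 1) (M.left (unreg b) m) = _
    rw [← tm_balanced, right_reg, mul_one, reg_unreg]
  inv_hom_id := by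
    ext m
    rw [comp_lin, homOfTm_lin]
    change tmLift (actLeft M) _ (tm (regular 𝒜) M (reg 1) m) = m
    rw [tmLift_tm, actLeft_apply, unreg_reg, map_one]
    rfl

@[simp]
theorem leftUnitIso_tm (b : regular 𝒜) (m : M) :
    (leftUnitIso M).hom.lin (tm (regular 𝒜) M b m) = M.left (unreg b) m :=
  tmLift_tm (actLeft M) (fun a b m => by
      rw [actLeft_apply, actLeft_apply, unreg_right, mul_comm, left_mul]) b m

/-- The isomorphism `M ⊗_R R ≅ M`, `m ⊗ a ↦ m a`. -/
noncomputable def rightUnitIso (M : GrBimod 𝒜) : tens M (regular 𝒜) ≅ M where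
  hom := homOfTm (tmLift (actRight M) (fun a m b => by
      rw [actRight_apply, actRight_apply, unreg_left, mul_comm, right_mul]))
    (fun a m b => by
      rw [tmLift_tm, tmLift_tm]
      exact (M.comm a _ m).symm)
    (fun a m b => by
      rw [tmLift_tm, tmLift_tm, actRight_apply, actRight_apply, unreg_right, right_mul])
    (fun i j m hm b hb => by
      rw [tmLift_tm]
      exact M.right_mem (unreg_mem hb) hm)
  inv := ⟨(tm M (regular 𝒜)).flip (reg 1), fun a m => by
      rw [LinearMap.flip_apply, LinearMap.flip_apply, left_tm], fun a m => by
      rw [LinearMap.flip_apply, LinearMap.flip_apply, right_tm, tm_balanced]; rfl,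
      fun n m hm => by
      simpa using tm_mem hm reg_one_mem⟩
  hom_inv_id := tens_hom_ext fun m b => by
    rw [comp_lin, homOfTm_lin, tmLift_tm, actRight_apply, id_lin]
    change tm M (regular 𝒜) (M.right (unreg b) m) (reg 1) = _
    rw [tm_balanced, left_reg, mul_one, reg_unreg]
  inv_hom_id := by
    ext m
    rw [comp_lin, homOfTm_lin]
    change tmLift (actRight M) _ (tm M (regular 𝒜) m (reg 1)) = m
    rw [tmLift_tm, actRight_apply, unreg_reg, map_one]
    rfl

@[simp]
theorem rightUnitIso_tm (m : M) (b : regular 𝒜) :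
    (rightUnitIso M).hom.lin (tm M (regular 𝒜) m b) = M.right (unreg b) m :=
  tmLift_tm (actRight M) (fun a m b => by
      rw [actRight_apply, actRight_apply, unreg_left, mul_comm, right_mul]) m b

theorem tensMap_id (M N : GrBimod 𝒜) : tensMap (𝟙 M) (𝟙 N) = 𝟙 (tens M N) :=
  tens_hom_ext fun m n => by simp

theorem tensMap_comp {M₁ M₂ N₁ N₂ P₁ P₂ : GrBimod 𝒜} (f₁ : M₁ ⟶ N₁) (f₂ : M₂ ⟶ N₂)
    (g₁ : N₁ ⟶ P₁) (g₂ : N₂ ⟶ P₂) :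
    tensMap f₁ f₂ ≫ tensMap g₁ g₂ = tensMap (f₁ ≫ g₁) (f₂ ≫ g₂) :=
  tens_hom_ext fun m n => by simp

theorem assocHom_naturality {M₁ M₂ M₃ N₁ N₂ N₃ : GrBimod 𝒜} (f₁ : M₁ ⟶ N₁) (f₂ : M₂ ⟶ N₂)
    (f₃ : M₃ ⟶ N₃) : tensMap (tensMap f₁ f₂) f₃ ≫ (assocIso N₁ N₂ N₃).hom =
      (assocIso M₁ M₂ M₃).hom ≫ tensMap f₁ (tensMap f₂ f₃) :=
  tens₃_hom_ext fun m n p => by simp [assocIso]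

theorem leftUnit_naturality {M N : GrBimod 𝒜} (f : M ⟶ N) :
    tensMap (𝟙 (regular 𝒜)) f ≫ (leftUnitIso N).hom = (leftUnitIso M).hom ≫ f :=
  tens_hom_ext fun a m => by simp [hom_left]

theorem rightUnit_naturality {M N : GrBimod 𝒜} (f : M ⟶ N) :
    tensMap f (𝟙 (regular 𝒜)) ≫ (rightUnitIso N).hom = (rightUnitIso M).hom ≫ f :=
  tens_hom_ext fun m a => by simp [hom_right]

theorem tens_pentagon (M N P Q : GrBimod 𝒜) :
    tensMap (assocIso M N P).hom (𝟙 Q) ≫ (assocIso M (tens N P) Q).hom ≫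
      tensMap (𝟙 M) (assocIso N P Q).hom =
    (assocIso (tens M N) P Q).hom ≫ (assocIso M N (tens P Q)).hom :=
  tens₃_hom_ext fun z p q => by
    induction z using tm_induction with
    | h₀ => simp
    | ht m n => simp [assocIso]
    | ha x y hx hy => simp only [map_add, LinearMap.add_apply, hx, hy]

theorem tens_triangle (M N : GrBimod 𝒜) :
    (assocIso M (regular 𝒜) N).hom ≫ tensMap (𝟙 M) (leftUnitIso N).hom =
      tensMap (rightUnitIso M).hom (𝟙 N) :=
  tens₃_hom_ext fun m a n => by simp [assocIso, tm_balanced]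

theorem tensMap_zero (M : GrBimod 𝒜) : tensMap (𝟙 M) (0 : N ⟶ P) = 0 :=
  tens_hom_ext fun m n => by simp

theorem zero_tensMap (P : GrBimod 𝒜) : tensMap (0 : M ⟶ N) (𝟙 P) = 0 :=
  tens_hom_ext fun m n => by simp

theorem tensMap_add (M : GrBimod 𝒜) (f g : N ⟶ P) :
    tensMap (𝟙 M) (f + g) = tensMap (𝟙 M) f + tensMap (𝟙 M) g :=
  tens_hom_ext fun m n => by simp

theorem add_tensMap (f g : M ⟶ N) (P : GrBimod 𝒜) :
    tensMap (f + g) (𝟙 P) = tensMap f (𝟙 P) + tensMap g (𝟙 P) :=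
  tens_hom_ext fun m n => by simp

noncomputable instance : MonoidalCategoryStruct (GrBimod 𝒜) where
  tensorObj := tens
  whiskerLeft M _ _ g := tensMap (𝟙 M) g
  whiskerRight f N := tensMap f (𝟙 N)
  tensorHom f g := tensMap f g
  tensorUnit := regular 𝒜
  associator := assocIso
  leftUnitor := leftUnitIso
  rightUnitor := rightUnitIso

noncomputable instance : MonoidalCategory (GrBimod 𝒜) :=
  MonoidalCategory.ofTensorHom
    (id_tensorHom_id := tensMap_id)
    (id_tensorHom := fun _ _ _ _ => rfl)
    (tensorHom_id := fun _ _ => rfl)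
    (tensorHom_comp_tensorHom := tensMap_comp)
    (associator_naturality := assocHom_naturality)
    (leftUnitor_naturality := leftUnit_naturality)
    (rightUnitor_naturality := rightUnit_naturality)
    (pentagon := tens_pentagon)
    (triangle := tens_triangle)

theorem whiskerLeft_eq (M : GrBimod 𝒜) (g : N ⟶ P) : M ◁ g = tensMap (𝟙 M) g := rfl

theorem whiskerRight_eq (f : M ⟶ N) (P : GrBimod 𝒜) : f ▷ P = tensMap f (𝟙 P) := rfl

instance : MonoidalPreadditive (GrBimod 𝒜) where
  whiskerLeft_zero {X _ _} := tensMap_zero X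
  zero_whiskerRight {X _ _} := zero_tensMap X
  whiskerLeft_add {X _ _} f g := tensMap_add X f g
  add_whiskerRight {X _ _} f g := add_tensMap f g X

end Monoidal
end GrBimod
end Bimodules

section Coproducts

variable {k R : Type} [CommRing k] [CommRing R] [Algebra k R] {𝒜 : ℤ → Submodule k R}

namespace GrBimod

variable {J : Type} (F : J → GrBimod 𝒜)

open Classical in
/-- Families of endomorphisms act componentwise on a direct sum. -/
noncomputable def sumEnd (φ : ∀ j, R →ₐ[k] Module.End k (F j)) :
    R →ₐ[k] Module.End k (⨁ j, F j) :=
  AlgHom.ofLinearMap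
    { toFun := fun a => DirectSum.lmap fun j => φ j a
      map_add' := fun a b => DirectSum.linearMap_ext _ fun j => LinearMap.ext fun m => by
        simp [DirectSum.lmap_lof]
      map_smul' := fun c a => DirectSum.linearMap_ext _ fun j => LinearMap.ext fun m => by
        simp [DirectSum.lmap_lof] }
    (DirectSum.linearMap_ext _ fun j => LinearMap.ext fun m => by simp [DirectSum.lmap_lof])
    (fun a b => DirectSum.linearMap_ext _ fun j => LinearMap.ext fun m => by
      simp [DirectSum.lmap_lof])

open Classical in
@[simp]
theorem sumEnd_lof (φ : ∀ j, R →ₐ[k] Module.End k (F j)) (a : R) (j : J) (m : F j) :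
    sumEnd F φ a (DirectSum.lof k J (fun j => F j) j m) = DirectSum.lof k J (fun j => F j) j (φ j a m) :=
  DirectSum.lmap_lof _ _ _

@[simp]
theorem sumEnd_apply (φ : ∀ j, R →ₐ[k] Module.End k (F j)) (a : R) (x : ⨁ j, F j) (j : J) :
    sumEnd F φ a x j = φ j a (x j) :=
  DirectSum.lmap_apply _ _ _

open Classical in
/-- The homogeneous components of an element of a direct sum. -/
noncomputable def sumComponents : (⨁ j, F j) →ₗ[k] (ℤ →₀ ⨁ j, F j) :=
  DirectSum.toModule k J _ fun j =>
    (Finsupp.mapRange.linearMap (DirectSum.lof k J (fun j => F j) j)).comp (components (F j).internal)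

open Classical in
theorem sumComponents_lof (j : J) (m : F j) :
    sumComponents F (DirectSum.lof k J (fun j => F j) j m) =
      Finsupp.mapRange.linearMap (DirectSum.lof k J (fun j => F j) j)
        (components (F j).internal m) := by
  rw [sumComponents, DirectSum.toModule_lof]
  rfl

/-- The direct sum of a family of graded bimodules. -/
noncomputable def sum : GrBimod 𝒜 where
  carrier := ⨁ j, F j
  left := sumEnd F fun j => (F j).left
  right := sumEnd F fun j => (F j).right
  comm a b m := DFinsupp.ext fun j => by simp [(F j).comm]
  gr n :=
    { carrier := {x | ∀ j, x j ∈ (F j).gr n}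
      zero_mem' := fun j => zero_mem _
      add_mem' := fun hx hy j => add_mem (hx j) (hy j)
      smul_mem' := fun c x hx j => Submodule.smul_mem _ c (hx j) }
  internal := by
    classical
    have key : ∀ (x : ⨁ j, F j) n j, sumComponents F x n j = components (F j).internal (x j) n := by
      intro x n j
      induction x using DirectSum.induction_on with
      | zero => simp
      | of i x =>
        change sumComponents F (DirectSum.lof k J (fun j => F j) i x) n j = _
        rw [sumComponents_lof]
        by_cases h : i = j
        · subst h
          simp [DirectSum.lof_eq_of]
        · rw [DirectSum.of_eq_of_ne _ _ _ (Ne.symm h)]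
          simp only [Finsupp.mapRange.linearMap_apply,
            Finsupp.mapRange_apply, map_zero, Finsupp.coe_zero, Pi.zero_apply]
          exact DirectSum.of_eq_of_ne _ _ _ (Ne.symm h)
      | add x y hx hy =>
        rw [map_add, Finsupp.add_apply, DirectSum.add_apply, DirectSum.add_apply, map_add,
          Finsupp.add_apply, hx, hy]
    refine isInternal_of_components _ (sumComponents F).toAddMonoidHom ?_ ?_ ?_
    · intro x n j
      change sumComponents F x n j ∈ _
      rw [key]
      exact components_mem _ _ _
    · intro x
      change (sumComponents F x).sum _ = x
      induction x using DirectSum.induction_on with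
      | zero => simp
      | of i x =>
        change (sumComponents F (DirectSum.lof k J (fun j => F j) i x)).sum _ = _
        rw [sumComponents_lof, Finsupp.mapRange.linearMap_apply,
          Finsupp.sum_mapRange_index (fun _ => rfl)]
        conv_rhs => rw [← components_sum (F i).internal x]
        exact (map_finsuppSum (DirectSum.of (fun j => (F j : Type)) i) _ _).symm
      | add x y hx hy =>
        rw [map_add, Finsupp.sum_add_index' (fun _ => rfl) (fun _ _ _ => rfl), hx, hy]
    · intro n x hx
      change sumComponents F x = _
      refine Finsupp.ext fun i => DFinsupp.ext fun j => ?_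
      change sumComponents F x i j = _
      rw [key, components_of_mem _ (hx j)]
      by_cases h : n = i
      · subst h; simp
      · rw [Finsupp.single_eq_of_ne (Ne.symm h), Finsupp.single_eq_of_ne (Ne.symm h)]; rfl
  left_mem ha hm j := by
    rw [sumEnd_apply]
    exact (F j).left_mem ha (hm j)
  right_mem ha hm j := by
    rw [sumEnd_apply]
    exact (F j).right_mem ha (hm j)

open Classical in
/-- The canonical map `F j → ⨁ F` as a linear map. -/
noncomputable def sumOf (j : J) : F j →ₗ[k] sum F := DirectSum.lof k J (fun j => F j) j

theorem left_sumOf (j : J) (a : R) (m : F j) :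
    (sum F).left a (sumOf F j m) = sumOf F j ((F j).left a m) := sumEnd_lof F _ a j m

theorem right_sumOf (j : J) (a : R) (m : F j) :
    (sum F).right a (sumOf F j m) = sumOf F j ((F j).right a m) := sumEnd_lof F _ a j m

theorem sumOf_mem (j : J) {n : ℤ} {m : F j} (hm : m ∈ (F j).gr n) :
    sumOf F j m ∈ (sum F).gr n := by
  classical
  intro i
  change DirectSum.of (fun j => (F j : Type)) j m i ∈ (F i).gr n
  by_cases h : i = j
  · subst h
    rwa [DirectSum.of_eq_same]
  · rw [DirectSum.of_eq_of_ne _ _ _ h]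
    exact zero_mem _

theorem sum_induction {p : sum F → Prop} (x : sum F) (h₀ : p 0) (ho : ∀ j m, p (sumOf F j m))
    (ha : ∀ x y, p x → p y → p (x + y)) : p x := by
  classical
  exact DirectSum.induction_on x h₀ ho ha

theorem sum_gr_induction {n : ℤ} {p : sum F → Prop} {x : sum F} (hx : x ∈ (sum F).gr n)
    (h₀ : p 0) (ho : ∀ j, ∀ m ∈ (F j).gr n, p (sumOf F j m))
    (ha : ∀ x y, p x → p y → p (x + y)) : p x := by
  classical
  let y : ⨁ j, F j := x
  have e : (∑ j ∈ DFinsupp.support y, sumOf F j (y j)) = x :=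
    DirectSum.sum_support_of y
  rw [← e]
  exact Finset.sum_induction _ p ha h₀ fun j _ => ho j _ (hx j)

theorem sum_ext {X : Type} [AddCommGroup X] [Module k X] {f g : sum F →ₗ[k] X}
    (h : ∀ j m, f (sumOf F j m) = g (sumOf F j m)) : f = g := by
  refine LinearMap.ext fun x => ?_
  induction x using sum_induction with
  | h₀ => rw [map_zero, map_zero]
  | ho j m => exact h j m
  | ha x y hx hy => rw [map_add, map_add, hx, hy]

open Classical in
/-- The linear map out of a direct sum given by a family of linear maps. -/
noncomputable def sumLift {X : Type} [AddCommGroup X] [Module k X] (f : ∀ j, F j →ₗ[k] X) :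
    sum F →ₗ[k] X := DirectSum.toModule k J X f

@[simp]
theorem sumLift_sumOf {X : Type} [AddCommGroup X] [Module k X] (f : ∀ j, F j →ₗ[k] X) (j : J)
    (m : F j) : sumLift F f (sumOf F j m) = f j m := by
  classical
  exact DirectSum.toModule_lof k (M := fun j => (F j : Type)) (φ := f) j m

/-- The inclusion of a summand. -/
noncomputable def sumι (j : J) : F j ⟶ sum F :=
  ⟨sumOf F j, fun a m => (left_sumOf F j a m).symm, fun a m => (right_sumOf F j a m).symm,
    fun _ _ hm => sumOf_mem F j hm⟩

@[simp]
theorem sumι_lin (j : J) : (sumι F j).lin = sumOf F j := rfl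

variable {F} in
/-- The morphism out of a direct sum given by a family of morphisms. -/
noncomputable def sumDesc {P : GrBimod 𝒜} (f : ∀ j, F j ⟶ P) : sum F ⟶ P where
  lin := sumLift F fun j => (f j).lin
  prop := by
    refine ⟨fun a x => ?_, fun a x => ?_, fun n x hx => ?_⟩
    · induction x using sum_induction with
      | h₀ => simp
      | ho j m => rw [left_sumOf, sumLift_sumOf, sumLift_sumOf, hom_left]
      | ha x y hx hy => simp only [map_add, hx, hy]
    · induction x using sum_induction with
      | h₀ => simp
      | ho j m => rw [right_sumOf, sumLift_sumOf, sumLift_sumOf, hom_right]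
      | ha x y hx hy => simp only [map_add, hx, hy]
    · refine sum_gr_induction F (p := fun x => sumLift F (fun j => (f j).lin) x ∈ P.gr n) hx
        (by simp) ?_ ?_
      · intro j m hm
        rw [sumLift_sumOf]
        exact hom_mem _ hm
      · intro x y hx hy
        rw [map_add]
        exact add_mem hx hy

@[simp]
theorem sumDesc_sumOf {P : GrBimod 𝒜} (f : ∀ j, F j ⟶ P) (j : J) (m : F j) :
    (sumDesc f).lin (sumOf F j m) = (f j).lin m := sumLift_sumOf F _ j m

theorem sumι_sumDesc {P : GrBimod 𝒜} (f : ∀ j, F j ⟶ P) (j : J) : sumι F j ≫ sumDesc f = f j :=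
  hom_ext fun m => sumDesc_sumOf F f j m

/-- The direct sum is the coproduct. -/
noncomputable def sumIsColimit : IsColimit (Cofan.mk (sum F) (sumι F)) :=
  Cofan.IsColimit.mk _ (fun s => sumDesc s.inj)
    (fun s j => by ext m; exact sumDesc_sumOf F s.inj j m)
    (fun s m hm => Hom.ext (sum_ext F fun j x => by
      rw [sumDesc_sumOf, ← hm j]
      rfl))

instance : HasCoproductsOfShape J (GrBimod 𝒜) :=
  ⟨fun G => by
    have : HasColimit (Discrete.functor (G.obj ∘ Discrete.mk)) := ⟨⟨⟨_, sumIsColimit _⟩⟩⟩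
    exact hasColimit_of_iso Discrete.natIsoFunctor⟩

section Tensor

variable [GradedAlgebra 𝒜] {F} (M : GrBimod 𝒜) {P : GrBimod 𝒜}

/-- The bilinear map `(x, m) ↦ ∑ j, f j (m ⊗ x j)`. -/
noncomputable def tensSumAux (f : ∀ j, tens M (F j) ⟶ P) : sum F →ₗ[k] M →ₗ[k] P :=
  sumLift F fun j => ((tm M (F j)).compr₂ (f j).lin).flip

@[simp]
theorem tensSumAux_sumOf (f : ∀ j, tens M (F j) ⟶ P) (j : J) (n : F j) (m : M) :
    tensSumAux M f (sumOf F j n) m = (f j).lin (tm M (F j) m n) := by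
  simp [tensSumAux]

/-- The morphism `M ⊗ ⨁ F ⟶ P` given by a family of morphisms `M ⊗ F j ⟶ P`. -/
noncomputable def tensSumDesc (f : ∀ j, tens M (F j) ⟶ P) : tens M (sum F) ⟶ P :=
  homOfTm (tmLift (tensSumAux M f).flip (fun a m x => by
      rw [LinearMap.flip_apply, LinearMap.flip_apply]
      induction x using sum_induction with
      | h₀ => simp
      | ho j n => rw [left_sumOf, tensSumAux_sumOf, tensSumAux_sumOf, tm_balanced]
      | ha x y hx hy => simp only [map_add, LinearMap.add_apply, hx, hy]))
    (fun a m x => by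
      rw [tmLift_tm, tmLift_tm, LinearMap.flip_apply, LinearMap.flip_apply]
      induction x using sum_induction with
      | h₀ => simp
      | ho j n => rw [tensSumAux_sumOf, tensSumAux_sumOf, ← left_tm, hom_left]
      | ha x y hx hy => simp only [map_add, LinearMap.add_apply, hx, hy])
    (fun a m x => by
      rw [tmLift_tm, tmLift_tm, LinearMap.flip_apply, LinearMap.flip_apply]
      induction x using sum_induction with
      | h₀ => simp
      | ho j n => rw [right_sumOf, tensSumAux_sumOf, tensSumAux_sumOf, ← right_tm, hom_right]
      | ha x y hx hy => simp only [map_add, LinearMap.add_apply, hx, hy])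
    (fun p q m hm x hx => by
      rw [tmLift_tm, LinearMap.flip_apply]
      refine sum_gr_induction F (p := fun x => tensSumAux M f x m ∈ P.gr (p + q)) hx (by simp) ?_ ?_
      · intro j n hn
        rw [tensSumAux_sumOf]
        exact hom_mem _ (tm_mem hm hn)
      · intro x y hx hy
        rw [map_add, LinearMap.add_apply]
        exact add_mem hx hy)

theorem tensSumDesc_tm (f : ∀ j, tens M (F j) ⟶ P) (m : M) (x : sum F) :
    (tensSumDesc M f).lin (tm M (sum F) m x) = tensSumAux M f x m := by
  rw [tensSumDesc, homOfTm_lin, tmLift_tm, LinearMap.flip_apply]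

/-- The bilinear map `(x, m) ↦ ∑ j, f j (x j ⊗ m)`. -/
noncomputable def sumTensAux (f : ∀ j, tens (F j) M ⟶ P) : sum F →ₗ[k] M →ₗ[k] P :=
  sumLift F fun j => (tm (F j) M).compr₂ (f j).lin

@[simp]
theorem sumTensAux_sumOf (f : ∀ j, tens (F j) M ⟶ P) (j : J) (n : F j) (m : M) :
    sumTensAux M f (sumOf F j n) m = (f j).lin (tm (F j) M n m) := by
  simp [sumTensAux]

/-- The morphism `⨁ F ⊗ M ⟶ P` given by a family of morphisms `F j ⊗ M ⟶ P`. -/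
noncomputable def sumTensDesc (f : ∀ j, tens (F j) M ⟶ P) : tens (sum F) M ⟶ P :=
  homOfTm (tmLift (sumTensAux M f) (fun a x m => by
      induction x using sum_induction with
      | h₀ => simp
      | ho j n => rw [right_sumOf, sumTensAux_sumOf, sumTensAux_sumOf, tm_balanced]
      | ha x y hx hy => simp only [map_add, LinearMap.add_apply, hx, hy]))
    (fun a x m => by
      rw [tmLift_tm, tmLift_tm]
      induction x using sum_induction with
      | h₀ => simp
      | ho j n => rw [left_sumOf, sumTensAux_sumOf, sumTensAux_sumOf, ← left_tm, hom_left]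
      | ha x y hx hy => simp only [map_add, LinearMap.add_apply, hx, hy])
    (fun a x m => by
      rw [tmLift_tm, tmLift_tm]
      induction x using sum_induction with
      | h₀ => simp
      | ho j n => rw [sumTensAux_sumOf, sumTensAux_sumOf, ← right_tm, hom_right]
      | ha x y hx hy => simp only [map_add, LinearMap.add_apply, hx, hy])
    (fun p q x hx m hm => by
      rw [tmLift_tm]
      refine sum_gr_induction F (p := fun x => sumTensAux M f x m ∈ P.gr (p + q)) hx (by simp) ?_ ?_
      · intro j n hn
        rw [sumTensAux_sumOf]
        exact hom_mem _ (tm_mem hn hm)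
      · intro x y hx hy
        rw [map_add, LinearMap.add_apply]
        exact add_mem hx hy)

theorem sumTensDesc_tm (f : ∀ j, tens (F j) M ⟶ P) (x : sum F) (m : M) :
    (sumTensDesc M f).lin (tm (sum F) M x m) = sumTensAux M f x m := by
  rw [sumTensDesc, homOfTm_lin, tmLift_tm]

theorem tensMap_id_sumι_comp (f : ∀ j, tens M (F j) ⟶ P) (j : J) :
    tensMap (𝟙 M) (sumι F j) ≫ tensSumDesc M f = f j :=
  tens_hom_ext fun m n => by
    rw [comp_lin, tensMap_tm, tensSumDesc_tm, sumι_lin, tensSumAux_sumOf, id_lin]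

theorem sumι_tensMap_id_comp (f : ∀ j, tens (F j) M ⟶ P) (j : J) :
    tensMap (sumι F j) (𝟙 M) ≫ sumTensDesc M f = f j :=
  tens_hom_ext fun m n => by
    rw [comp_lin, tensMap_tm, sumTensDesc_tm, sumι_lin, sumTensAux_sumOf, id_lin]

theorem tens_sum_hom_ext {f g : tens M (sum F) ⟶ P}
    (h : ∀ j, tensMap (𝟙 M) (sumι F j) ≫ f = tensMap (𝟙 M) (sumι F j) ≫ g) : f = g :=
  tens_hom_ext fun m x => by
    induction x using sum_induction with
    | h₀ => simp
    | ho j n =>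
      have := congrArg (fun φ => Hom.lin φ (tm M (F j) m n)) (h j)
      simpa only [comp_lin, tensMap_tm, sumι_lin, id_lin] using this
    | ha x y hx hy => simp only [map_add, hx, hy]

theorem sum_tens_hom_ext {f g : tens (sum F) M ⟶ P}
    (h : ∀ j, tensMap (sumι F j) (𝟙 M) ≫ f = tensMap (sumι F j) (𝟙 M) ≫ g) : f = g :=
  tens_hom_ext fun x m => by
    induction x using sum_induction with
    | h₀ => simp
    | ho j n =>
      have := congrArg (fun φ => Hom.lin φ (tm (F j) M n m)) (h j)
      simpa only [comp_lin, tensMap_tm, sumι_lin, id_lin] using this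
    | ha x y hx hy => simp only [map_add, LinearMap.add_apply, hx, hy]

/-- Tensoring on the left preserves coproducts. -/
noncomputable def tensSumIsColimit :
    IsColimit (Cofan.mk (tens M (sum F)) fun j => tensMap (𝟙 M) (sumι F j)) :=
  Cofan.IsColimit.mk _ (fun s => tensSumDesc M s.inj) (fun s j => tensMap_id_sumι_comp M s.inj j)
    (fun s _ hm => tens_sum_hom_ext M fun j =>
      (hm j).trans (tensMap_id_sumι_comp M s.inj j).symm)

/-- Tensoring on the right preserves coproducts. -/
noncomputable def sumTensIsColimit :
    IsColimit (Cofan.mk (tens (sum F) M) fun j => tensMap (sumι F j) (𝟙 M)) :=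
  Cofan.IsColimit.mk _ (fun s => sumTensDesc M s.inj) (fun s j => sumι_tensMap_id_comp M s.inj j)
    (fun s _ hm => sum_tens_hom_ext M fun j =>
      (hm j).trans (sumι_tensMap_id_comp M s.inj j).symm)

instance : PreservesColimitsOfShape (Discrete J) ((curriedTensor (GrBimod 𝒜)).obj M) :=
  have (F : J → GrBimod 𝒜) := preservesColimit_of_preserves_colimit_cocone (sumIsColimit F)
    ((isColimitMapCoconeCofanMkEquiv ((curriedTensor (GrBimod 𝒜)).obj M) _ _).symm (tensSumIsColimit (F := F) M))
  preservesColimitsOfShape_of_discrete _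

instance : PreservesColimitsOfShape (Discrete J) ((curriedTensor (GrBimod 𝒜)).flip.obj M) :=
  have (F : J → GrBimod 𝒜) := preservesColimit_of_preserves_colimit_cocone (sumIsColimit F)
    ((isColimitMapCoconeCofanMkEquiv ((curriedTensor (GrBimod 𝒜)).flip.obj M) _ _).symm (sumTensIsColimit (F := F) M))
  preservesColimitsOfShape_of_discrete _

end Tensor

/-- The zero bimodule. -/
def zeroObj (𝒜 : ℤ → Submodule k R) : GrBimod 𝒜 where
  carrier := PUnit
  left := AlgHom.ofLinearMap 0 (LinearMap.ext fun _ => rfl) (fun _ _ => LinearMap.ext fun _ => rfl)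
  right := AlgHom.ofLinearMap 0 (LinearMap.ext fun _ => rfl) (fun _ _ => LinearMap.ext fun _ => rfl)
  comm _ _ _ := rfl
  gr _ := ⊥
  internal := isInternal_of_components _ 0 (fun _ _ => zero_mem _) (fun _ => rfl)
    (fun n x _ => by
      rw [show x = 0 from rfl, Finsupp.single_zero]
      rfl)
  left_mem _ _ := (Submodule.mem_bot k).2 rfl
  right_mem _ _ := (Submodule.mem_bot k).2 rfl

instance : HasZeroObject (GrBimod 𝒜) :=
  ⟨zeroObj 𝒜, (IsZero.iff_id_eq_zero _).2 (hom_ext fun _ => rfl)⟩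

instance : HasFiniteCoproducts (GrBimod 𝒜) := ⟨fun _ => inferInstance⟩

instance : HasFiniteBiproducts (GrBimod 𝒜) := HasFiniteBiproducts.of_hasFiniteCoproducts

end GrBimod
end Coproducts

section HomotopyMonoidal

open HomotopyCategory

variable {k R : Type} [CommRing k] [CommRing R] [Algebra k R] (𝒜 : ℤ → Submodule k R)
  [GradedAlgebra 𝒜]

/-- Cochain complexes of graded bimodules. With the tensor product `(K ⊗ L)^n = ⨁ K^i ⊗_R L^j`,
`i + j = n`, and differential `d ⊗ 1 + (-1)^i 1 ⊗ d`, they form a monoidal category. -/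
abbrev Complexes : Type 1 := CochainComplex (GrBimod 𝒜) ℤ

/-- The homotopy category of complexes of graded bimodules. -/
abbrev HoComplexes : Type 1 := HomotopyCategory (GrBimod 𝒜) (ComplexShape.up ℤ)

/-- The quotient functor. -/
abbrev toHo : Complexes 𝒜 ⥤ HoComplexes 𝒜 := quotient (GrBimod 𝒜) (ComplexShape.up ℤ)

variable {𝒜}

theorem toHo_tensorHom_congr {K₁ L₁ K₂ L₂ : Complexes 𝒜} {f f' : K₁ ⟶ L₁} {g g' : K₂ ⟶ L₂}
    (hf : (toHo 𝒜).map f = (toHo 𝒜).map f') (hg : (toHo 𝒜).map g = (toHo 𝒜).map g') :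
    (toHo 𝒜).map (f ⊗ₘ g) = (toHo 𝒜).map (f' ⊗ₘ g') :=
  (eq_of_homotopy _ _ (HomologicalComplex.mapBifunctorMapHomotopy₁ (homotopyOfEq _ _ hf) g
      (curriedTensor (GrBimod 𝒜)) (ComplexShape.up ℤ))).trans
    (eq_of_homotopy _ _ (HomologicalComplex.mapBifunctorMapHomotopy₂ f' (homotopyOfEq _ _ hg)
      (curriedTensor (GrBimod 𝒜)) (ComplexShape.up ℤ)))

/-- The tensor product of homotopy classes of maps. -/
noncomputable def hoTensorHom {K₁ L₁ K₂ L₂ : Complexes 𝒜}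
    (f : (toHo 𝒜).obj K₁ ⟶ (toHo 𝒜).obj L₁) (g : (toHo 𝒜).obj K₂ ⟶ (toHo 𝒜).obj L₂) :
    (toHo 𝒜).obj (K₁ ⊗ K₂) ⟶ (toHo 𝒜).obj (L₁ ⊗ L₂) :=
  (toHo 𝒜).map (((toHo 𝒜).map_surjective f).choose ⊗ₘ ((toHo 𝒜).map_surjective g).choose)

theorem hoTensorHom_map {K₁ L₁ K₂ L₂ : Complexes 𝒜} (f : K₁ ⟶ L₁) (g : K₂ ⟶ L₂) :
    hoTensorHom ((toHo 𝒜).map f) ((toHo 𝒜).map g) = (toHo 𝒜).map (f ⊗ₘ g) :=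
  toHo_tensorHom_congr ((toHo 𝒜).map_surjective ((toHo 𝒜).map f)).choose_spec
    ((toHo 𝒜).map_surjective ((toHo 𝒜).map g)).choose_spec

theorem hoTensorHom_id (K L : Complexes 𝒜) :
    hoTensorHom (𝟙 ((toHo 𝒜).obj K)) (𝟙 ((toHo 𝒜).obj L)) = 𝟙 ((toHo 𝒜).obj (K ⊗ L)) := by
  rw [← (toHo 𝒜).map_id, ← (toHo 𝒜).map_id, hoTensorHom_map, id_tensorHom_id, (toHo 𝒜).map_id]

theorem hoTensorHom_comp {K₁ L₁ M₁ K₂ L₂ M₂ : Complexes 𝒜} (f₁ : K₁ ⟶ L₁) (f₂ : K₂ ⟶ L₂)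
    (g₁ : L₁ ⟶ M₁) (g₂ : L₂ ⟶ M₂) :
    hoTensorHom ((toHo 𝒜).map f₁) ((toHo 𝒜).map f₂) ≫
        hoTensorHom ((toHo 𝒜).map g₁) ((toHo 𝒜).map g₂) =
      hoTensorHom ((toHo 𝒜).map f₁ ≫ (toHo 𝒜).map g₁) ((toHo 𝒜).map f₂ ≫ (toHo 𝒜).map g₂) := by
  rw [← (toHo 𝒜).map_comp, ← (toHo 𝒜).map_comp, hoTensorHom_map, hoTensorHom_map,
    hoTensorHom_map, ← (toHo 𝒜).map_comp, tensorHom_comp_tensorHom]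

theorem hoTensorHom_assoc {K₁ K₂ K₃ L₁ L₂ L₃ : Complexes 𝒜} (f₁ : K₁ ⟶ L₁) (f₂ : K₂ ⟶ L₂)
    (f₃ : K₃ ⟶ L₃) :
    hoTensorHom (hoTensorHom ((toHo 𝒜).map f₁) ((toHo 𝒜).map f₂)) ((toHo 𝒜).map f₃) ≫
        (toHo 𝒜).map (α_ L₁ L₂ L₃).hom =
      (toHo 𝒜).map (α_ K₁ K₂ K₃).hom ≫
        hoTensorHom ((toHo 𝒜).map f₁) (hoTensorHom ((toHo 𝒜).map f₂) ((toHo 𝒜).map f₃)) := by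
  rw [hoTensorHom_map, hoTensorHom_map, hoTensorHom_map, hoTensorHom_map, ← (toHo 𝒜).map_comp,
    ← (toHo 𝒜).map_comp, associator_naturality]

theorem hoTensorHom_leftUnitor {K L : Complexes 𝒜} (f : K ⟶ L) :
    hoTensorHom (𝟙 ((toHo 𝒜).obj (𝟙_ (Complexes 𝒜)))) ((toHo 𝒜).map f) ≫
      (toHo 𝒜).map (λ_ L).hom = (toHo 𝒜).map (λ_ K).hom ≫ (toHo 𝒜).map f := by
  rw [← (toHo 𝒜).map_id, hoTensorHom_map, ← (toHo 𝒜).map_comp, ← (toHo 𝒜).map_comp,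
    id_tensorHom, leftUnitor_naturality]

theorem hoTensorHom_rightUnitor {K L : Complexes 𝒜} (f : K ⟶ L) :
    hoTensorHom ((toHo 𝒜).map f) (𝟙 ((toHo 𝒜).obj (𝟙_ (Complexes 𝒜)))) ≫
      (toHo 𝒜).map (ρ_ L).hom = (toHo 𝒜).map (ρ_ K).hom ≫ (toHo 𝒜).map f := by
  rw [← (toHo 𝒜).map_id, hoTensorHom_map, ← (toHo 𝒜).map_comp, ← (toHo 𝒜).map_comp,
    tensorHom_id, rightUnitor_naturality]

theorem hoTensorHom_pentagon (K L M N : Complexes 𝒜) :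
    hoTensorHom ((toHo 𝒜).map (α_ K L M).hom) (𝟙 ((toHo 𝒜).obj N)) ≫
        (toHo 𝒜).map (α_ K (L ⊗ M) N).hom ≫
        hoTensorHom (𝟙 ((toHo 𝒜).obj K)) ((toHo 𝒜).map (α_ L M N).hom) =
      (toHo 𝒜).map (α_ (K ⊗ L) M N).hom ≫ (toHo 𝒜).map (α_ K L (M ⊗ N)).hom := by
  rw [← (toHo 𝒜).map_id, ← (toHo 𝒜).map_id, hoTensorHom_map, hoTensorHom_map,
    ← (toHo 𝒜).map_comp, ← (toHo 𝒜).map_comp, ← (toHo 𝒜).map_comp, tensorHom_id, id_tensorHom,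
    MonoidalCategory.pentagon]

theorem hoTensorHom_triangle (K L : Complexes 𝒜) :
    (toHo 𝒜).map (α_ K (𝟙_ (Complexes 𝒜)) L).hom ≫
        hoTensorHom (𝟙 ((toHo 𝒜).obj K)) ((toHo 𝒜).map (λ_ L).hom) =
      hoTensorHom ((toHo 𝒜).map (ρ_ K).hom) (𝟙 ((toHo 𝒜).obj L)) := by
  rw [← (toHo 𝒜).map_id, ← (toHo 𝒜).map_id, hoTensorHom_map, hoTensorHom_map,
    ← (toHo 𝒜).map_comp, tensorHom_id, id_tensorHom, MonoidalCategory.triangle]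

noncomputable instance : MonoidalCategoryStruct (HoComplexes 𝒜) where
  tensorObj X Y := (toHo 𝒜).obj (X.as ⊗ Y.as)
  whiskerLeft X {Y Z} g :=
    hoTensorHom (K₁ := X.as) (L₁ := X.as) (K₂ := Y.as) (L₂ := Z.as) (𝟙 X) g
  whiskerRight {X Y} f Z :=
    hoTensorHom (K₁ := X.as) (L₁ := Y.as) (K₂ := Z.as) (L₂ := Z.as) f (𝟙 Z)
  tensorHom {X₁ Y₁ X₂ Y₂} f g :=
    hoTensorHom (K₁ := X₁.as) (L₁ := Y₁.as) (K₂ := X₂.as) (L₂ := Y₂.as) f g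
  tensorUnit := (toHo 𝒜).obj (𝟙_ (Complexes 𝒜))
  associator X Y Z := (toHo 𝒜).mapIso (α_ X.as Y.as Z.as)
  leftUnitor X := (toHo 𝒜).mapIso (λ_ X.as)
  rightUnitor X := (toHo 𝒜).mapIso (ρ_ X.as)

/-- The tensor product of complexes descends to the homotopy category. -/
noncomputable instance : MonoidalCategory (HoComplexes 𝒜) :=
  MonoidalCategory.ofTensorHom
    (id_tensorHom_id := fun X Y => hoTensorHom_id X.as Y.as)
    (id_tensorHom := fun _ _ _ _ => rfl)
    (tensorHom_id := fun _ _ => rfl)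
    (tensorHom_comp_tensorHom := fun {X₁ Y₁ Z₁ X₂ Y₂ Z₂} f₁ f₂ g₁ g₂ => by
      obtain ⟨f₁, rfl⟩ := (quotient _ _).map_surjective (X := X₁.as) (Y := Y₁.as) f₁
      obtain ⟨f₂, rfl⟩ := (quotient _ _).map_surjective (X := X₂.as) (Y := Y₂.as) f₂
      obtain ⟨g₁, rfl⟩ := (quotient _ _).map_surjective (X := Y₁.as) (Y := Z₁.as) g₁
      obtain ⟨g₂, rfl⟩ := (quotient _ _).map_surjective (X := Y₂.as) (Y := Z₂.as) g₂
      exact hoTensorHom_comp f₁ f₂ g₁ g₂)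
    (associator_naturality := fun {X₁ X₂ X₃ Y₁ Y₂ Y₃} f₁ f₂ f₃ => by
      obtain ⟨f₁, rfl⟩ := (quotient _ _).map_surjective (X := X₁.as) (Y := Y₁.as) f₁
      obtain ⟨f₂, rfl⟩ := (quotient _ _).map_surjective (X := X₂.as) (Y := Y₂.as) f₂
      obtain ⟨f₃, rfl⟩ := (quotient _ _).map_surjective (X := X₃.as) (Y := Y₃.as) f₃
      exact hoTensorHom_assoc f₁ f₂ f₃)
    (leftUnitor_naturality := fun {X Y} f => by
      obtain ⟨f, rfl⟩ := (quotient _ _).map_surjective (X := X.as) (Y := Y.as) f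
      exact hoTensorHom_leftUnitor f)
    (rightUnitor_naturality := fun {X Y} f => by
      obtain ⟨f, rfl⟩ := (quotient _ _).map_surjective (X := X.as) (Y := Y.as) f
      exact hoTensorHom_rightUnitor f)
    (pentagon := fun W X Y Z => hoTensorHom_pentagon W.as X.as Y.as Z.as)
    (triangle := fun X Y => hoTensorHom_triangle X.as Y.as)

/-! ### Bounded complexes with terms in a given class of bimodules -/

variable (P : ObjectProperty (GrBimod 𝒜))

/-- The class of bounded complexes, up to homotopy, whose terms satisfy `P`. -/
def boundedIn : ObjectProperty (HoComplexes 𝒜) := fun X =>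
  (∀ n, P (X.as.X n)) ∧ ∃ a b : ℤ, ∀ n, n < a ∨ b < n → IsZero (X.as.X n)

variable {P}

theorem isZero_tensor_left {M N : GrBimod 𝒜} (h : IsZero M) : IsZero (M ⊗ N) :=
  (IsZero.iff_id_eq_zero _).2 (by
    rw [← id_whiskerRight, h.eq_of_src (𝟙 M) 0, MonoidalPreadditive.zero_whiskerRight])

theorem isZero_tensor_right {M N : GrBimod 𝒜} (h : IsZero N) : IsZero (M ⊗ N) :=
  (IsZero.iff_id_eq_zero _).2 (by
    rw [← whiskerLeft_id, h.eq_of_src (𝟙 N) 0, MonoidalPreadditive.whiskerLeft_zero])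

theorem isZero_tensor_X {K L : Complexes 𝒜} {n : ℤ}
    (h : ∀ i j, i + j = n → IsZero (K.X i) ∨ IsZero (L.X j)) :
    IsZero ((HomologicalComplex.tensorObj K L).X n) :=
  (IsZero.iff_id_eq_zero _).2 (HomologicalComplex.mapBifunctor.hom_ext fun i j hij => by
    refine IsZero.eq_of_src ?_ _ _
    rcases h i j hij with h | h
    · exact isZero_tensor_left h
    · exact isZero_tensor_right h)

open Classical in
/-- If all but finitely many of the terms `K^i ⊗ L^j`, `i + j = n`, vanish, then `(K ⊗ L)^n` is a
direct summand of the sum of the remaining ones. -/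
noncomputable def tensorXRetract (K L : Complexes 𝒜) (n : ℤ) (S : Set (ℤ × ℤ))
    (h : ∀ i j, (i, j) ∉ S → IsZero (K.X i ⊗ L.X j)) :
    Retract ((HomologicalComplex.tensorObj K L).X n)
      (GrBimod.sum fun p : {p : ℤ × ℤ // p ∈ S ∧ p.1 + p.2 = n} => K.X p.1.1 ⊗ L.X p.1.2) where
  i := HomologicalComplex.mapBifunctorDesc fun i j hij =>
    if hS : (i, j) ∈ S then GrBimod.sumι (fun p : {p : ℤ × ℤ // p ∈ S ∧ p.1 + p.2 = n} =>
      K.X p.1.1 ⊗ L.X p.1.2) ⟨(i, j), hS, hij⟩ else 0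
  r := GrBimod.sumDesc fun p => HomologicalComplex.ιTensorObj K L p.1.1 p.1.2 n p.2.2
  retract := HomologicalComplex.mapBifunctor.hom_ext fun i j hij => by
    by_cases hS : (i, j) ∈ S
    · rw [HomologicalComplex.ι_mapBifunctorDesc_assoc, dif_pos hS, Category.comp_id]
      exact GrBimod.sumι_sumDesc _ _ (⟨(i, j), hS, hij⟩ :
        {p : ℤ × ℤ // p ∈ S ∧ p.1 + p.2 = n})
    · exact (h i j hS).eq_of_src _ _

theorem boundedIn_tensor [P.IsStableUnderRetracts]
    (ht : ∀ M N, P M → P N → P (M ⊗ N))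
    (hs : ∀ (J : Type) [Finite J] (F : J → GrBimod 𝒜), (∀ j, P (F j)) → P (GrBimod.sum F))
    {X Y : HoComplexes 𝒜} (hX : boundedIn P X) (hY : boundedIn P Y) : boundedIn P (X ⊗ Y) := by
  obtain ⟨hX, a, b, hab⟩ := hX
  obtain ⟨hY, c, d, hcd⟩ := hY
  refine ⟨fun n => ?_, a + c, b + d, fun n hn => ?_⟩
  · have : Finite {p : ℤ × ℤ // p ∈ Set.Icc a b ×ˢ Set.Icc c d ∧ p.1 + p.2 = n} :=
      (((Set.finite_Icc a b).prod (Set.finite_Icc c d)).subset fun p hp => hp.1).to_subtype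
    refine P.prop_of_retract (tensorXRetract X.as Y.as n (Set.Icc a b ×ˢ Set.Icc c d) ?_)
      (hs _ _ fun p => ht _ _ (hX _) (hY _))
    intro i j hij
    by_cases hi : i < a ∨ b < i
    · exact isZero_tensor_left (hab i hi)
    · refine isZero_tensor_right (hcd j ?_)
      by_contra hj
      push Not at hi hj
      exact hij ⟨hi, hj⟩
  · refine isZero_tensor_X (K := X.as) (L := Y.as) fun i j hij => ?_
    by_cases hi : i < a ∨ b < i
    · exact Or.inl (hab i hi)
    · exact Or.inr (hcd j (by omega))

theorem boundedIn_single (hz : ∀ M, IsZero M → P M) {M : GrBimod 𝒜} (hM : P M)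
    [P.IsClosedUnderIsomorphisms] (m : ℤ) :
    boundedIn P ((toHo 𝒜).obj ((HomologicalComplex.single _ (ComplexShape.up ℤ) m).obj M)) := by
  have h : ∀ n, n ≠ m →
      IsZero (((HomologicalComplex.single _ (ComplexShape.up ℤ) m).obj M).X n) :=
    fun n hn => HomologicalComplex.isZero_single_obj_X _ _ _ _ hn
  refine ⟨fun n => ?_, m, m, fun n hn => h n (by omega)⟩
  by_cases hn : n = m
  · subst hn
    exact P.prop_of_iso (HomologicalComplex.singleObjXSelf _ _ M).symm hM
  · exact hz _ (h n hn)

theorem boundedIn_double (hz : ∀ M, IsZero M → P M) {M N : GrBimod 𝒜} (hM : P M) (hN : P N)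
    [P.IsClosedUnderIsomorphisms] (f : M ⟶ N) {m n : ℤ} (h : (ComplexShape.up ℤ).Rel m n)
    (hmn : m < n) : boundedIn P ((toHo 𝒜).obj (HomologicalComplex.double f h)) := by
  have h₀ : ∀ l, l ≠ m → l ≠ n → IsZero ((HomologicalComplex.double f h).X l) :=
    fun l hl hl' => HomologicalComplex.isZero_double_X _ _ _ hl hl'
  refine ⟨fun l => ?_, m, n, fun l hl => h₀ l (by omega) (by omega)⟩
  by_cases hl : l = m
  · subst hl
    exact P.prop_of_iso (HomologicalComplex.doubleXIso₀ f h).symm hM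
  · by_cases hl' : l = n
    · subst hl'
      exact P.prop_of_iso (HomologicalComplex.doubleXIso₁ f h hmn.ne).symm hN
    · exact hz _ (h₀ l hl hl')

end HomotopyMonoidal

section PolynomialRing

open MvPolynomial

variable (r : ℕ)

/-- The ring `ℚ[y][x_1, …, x_r]`. The indices are residues modulo `r`, so that `x_r` is `x 0`. -/
abbrev Poly : Type := MvPolynomial (Option (ZMod r)) ℚ

variable {r}

/-- The variable `x_i`. -/
noncomputable def x (i : ZMod r) : Poly r := X (some i)

/-- The variable `y`. -/
noncomputable def y : Poly r := X none

variable (r) in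
/-- The grading of the polynomial ring for which `y` and all the `x_i` have degree `2`. -/
abbrev polyGr : ℤ → Submodule ℚ (Poly r) := weightedHomogeneousSubmodule ℚ fun _ => (2 : ℤ)

noncomputable instance : GradedAlgebra (polyGr r) := weightedGradedAlgebra ℚ fun _ => (2 : ℤ)

/-- The correction term picked up when passing from index `r` to index `1`: it is `y` for `i = r`
and zero for `i = 1, …, r - 1`. -/
noncomputable def wrap (i : ZMod r) : Poly r := if i = 0 then y else 0

variable (r) in
/-- The map `x_i ↦ x_{i+1}` for `i < r`, `x_r ↦ x_1 - y`, `y ↦ y`. -/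
noncomputable def rhoHom : Poly r →ₐ[ℚ] Poly r :=
  aeval fun v => v.elim y fun i => x (i + 1) - wrap i

variable (r) in
/-- The map `x_{i+1} ↦ x_i` for `i < r`, `x_1 ↦ x_r + y`, `y ↦ y`. -/
noncomputable def rhoInvHom : Poly r →ₐ[ℚ] Poly r :=
  aeval fun v => v.elim y fun i => x (i - 1) + wrap (i - 1)

/-- The map `σ_i`. For `i < r` it exchanges `x_i` and `x_{i+1}`, and `σ_r` is given by
`x_r ↦ x_1 - y`, `x_1 ↦ x_r + y`; the other variables are fixed. -/
noncomputable def sigmaHom (i : ZMod r) : Poly r →ₐ[ℚ] Poly r :=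
  aeval fun v => v.elim y fun j =>
    if j = i then x (i + 1) - wrap i else if j = i + 1 then x i + wrap i else x j

@[simp] theorem rhoHom_x (i : ZMod r) : rhoHom r (x i) = x (i + 1) - wrap i := by
  simp [rhoHom, x]

@[simp] theorem rhoHom_y : rhoHom r y = y := by simp [rhoHom, y]

@[simp] theorem rhoInvHom_x (i : ZMod r) : rhoInvHom r (x i) = x (i - 1) + wrap (i - 1) := by
  simp [rhoInvHom, x]

@[simp] theorem rhoInvHom_y : rhoInvHom r y = y := by simp [rhoInvHom, y]

@[simp] theorem rhoHom_wrap (i : ZMod r) : rhoHom r (wrap i) = wrap i := by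
  unfold wrap; split_ifs <;> simp

@[simp] theorem rhoInvHom_wrap (i : ZMod r) : rhoInvHom r (wrap i) = wrap i := by
  unfold wrap; split_ifs <;> simp

theorem sigmaHom_x (i j : ZMod r) : sigmaHom i (x j) =
    if j = i then x (i + 1) - wrap i else if j = i + 1 then x i + wrap i else x j := by
  simp [sigmaHom, x]

@[simp] theorem sigmaHom_y (i : ZMod r) : sigmaHom i y = y := by simp [sigmaHom, y]

@[simp] theorem sigmaHom_wrap (i j : ZMod r) : sigmaHom i (wrap j) = wrap j := by
  unfold wrap; split_ifs <;> simp

theorem poly_hom_ext {A : Type} [CommRing A] [Algebra ℚ A] {f g : Poly r →ₐ[ℚ] A} (hy : f y = g y)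
    (hx : ∀ i, f (x i) = g (x i)) : f = g :=
  algHom_ext fun v => by
    cases v with
    | none => exact hy
    | some i => exact hx i

variable (r) in
/-- The automorphism `ρ` of the polynomial ring. -/
noncomputable def rho : Poly r ≃ₐ[ℚ] Poly r :=
  AlgEquiv.ofAlgHom (rhoHom r) (rhoInvHom r) (poly_hom_ext (by simp) fun i => by simp)
    (poly_hom_ext (by simp) fun i => by simp)

theorem x_mem (i : ZMod r) : (x i : Poly r) ∈ polyGr r 2 := isWeightedHomogeneous_X ℚ _ _

theorem y_mem : (y : Poly r) ∈ polyGr r 2 := isWeightedHomogeneous_X ℚ _ _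

theorem wrap_mem (i : ZMod r) : (wrap i : Poly r) ∈ polyGr r 2 := by
  unfold wrap
  split_ifs
  · exact y_mem
  · exact zero_mem _

theorem aeval_mem {g : Option (ZMod r) → Poly r} (hg : ∀ v, g v ∈ polyGr r 2) {n : ℤ} {p : Poly r}
    (hp : p ∈ polyGr r n) : aeval g p ∈ polyGr r n := by
  rw [p.as_sum, map_sum]
  refine sum_mem fun m hm => ?_
  have hw : Finsupp.weight (fun _ => (2 : ℤ)) m = n := hp (mem_support_iff.1 hm)
  rw [aeval_monomial]
  have h₁ : m.prod (fun v e => g v ^ e) ∈ polyGr r n := by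
    rw [← hw, Finsupp.weight_apply]
    exact IsWeightedHomogeneous.prod _ _ _ fun v _ => IsWeightedHomogeneous.pow (hg v) _
  have := Submodule.smul_mem (polyGr r n) (coeff m p) h₁
  rwa [Algebra.smul_def] at this

theorem rho_mem {n : ℤ} {p : Poly r} (hp : p ∈ polyGr r n) : rho r p ∈ polyGr r n :=
  aeval_mem (fun v => by
    cases v with
    | none => exact y_mem
    | some i => exact sub_mem (x_mem _) (wrap_mem _)) hp

theorem rho_symm_mem {n : ℤ} {p : Poly r} (hp : p ∈ polyGr r n) : (rho r).symm p ∈ polyGr r n :=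
  aeval_mem (fun v => by
    cases v with
    | none => exact y_mem
    | some i => exact add_mem (x_mem _) (wrap_mem _)) hp

theorem sigmaHom_mem (i : ZMod r) {n : ℤ} {p : Poly r} (hp : p ∈ polyGr r n) :
    sigmaHom i p ∈ polyGr r n :=
  aeval_mem (fun v => by
    cases v with
    | none => exact y_mem
    | some j =>
      simp only [Option.elim_some]
      split_ifs
      · exact sub_mem (x_mem _) (wrap_mem _)
      · exact add_mem (x_mem _) (wrap_mem _)
      · exact x_mem _) hp

/-- The subring of elements fixed by `σ_i`. -/
noncomputable def fixedRing (i : ZMod r) : Subalgebra ℚ (Poly r) :=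
  AlgHom.equalizer (sigmaHom i) (AlgHom.id ℚ (Poly r))

theorem mem_fixedRing {i : ZMod r} {p : Poly r} : p ∈ fixedRing i ↔ sigmaHom i p = p := Iff.rfl

/-- The element `X_i = x_{i+1} - x_i` for `i < r`, `X_r = x_1 - x_r - y`. -/
noncomputable def root (i : ZMod r) : Poly r := x (i + 1) - x i - wrap i

theorem root_mem (i : ZMod r) : root i ∈ polyGr r 2 :=
  sub_mem (sub_mem (x_mem _) (x_mem _)) (wrap_mem _)

theorem polyGr_internal : DirectSum.IsInternal (polyGr r) :=
  DirectSum.Decomposition.isInternal _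

theorem components_mem_fixedRing {i : ZMod r} {p : Poly r} (hp : p ∈ fixedRing i) (n : ℤ) :
    components polyGr_internal p n ∈ fixedRing i := by
  have key : ∀ q : Poly r, components polyGr_internal (sigmaHom i q) n =
      sigmaHom i (components polyGr_internal q n) := by
    intro q
    induction q using homogeneous_induction polyGr_internal with
    | h₀ => simp
    | hh m q hq =>
      rw [components_of_mem _ hq, components_of_mem _ (sigmaHom_mem i hq),
        Finsupp.single_apply, Finsupp.single_apply]
      split_ifs <;> simp
    | ha p q hp hq => rw [map_add, map_add, Finsupp.add_apply, map_add, Finsupp.add_apply, hp, hq,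
        map_add]
  rw [mem_fixedRing, ← key, mem_fixedRing.1 hp]

end PolynomialRing

section SoergelBimodules

variable {r : ℕ}

/-- The `ℚ`-bilinear map `(a, b) ↦ a ⊗ b` to `R ⊗ R` over the subring fixed by `σ_i`. -/
noncomputable def soergelTmul (i : ZMod r) :
    Poly r →ₗ[ℚ] Poly r →ₗ[ℚ] Poly r ⊗[fixedRing i] Poly r :=
  LinearMap.mk₂ ℚ (fun a b => a ⊗ₜ[fixedRing i] b) (fun _ _ _ => TensorProduct.add_tmul _ _ _)
    (fun _ _ _ => TensorProduct.smul_tmul' _ _ _) (fun _ _ _ => TensorProduct.tmul_add _ _ _)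
    (fun c a b => by rw [TensorProduct.tmul_smul])

@[simp]
theorem soergelTmul_apply (i : ZMod r) (a b : Poly r) :
    soergelTmul i a b = a ⊗ₜ[fixedRing i] b := rfl

theorem soergelTmul_balanced (i : ZMod r) {s : Poly r} (hs : s ∈ fixedRing i) (a b : Poly r) :
    soergelTmul i (s * a) b = soergelTmul i a (s * b) :=
  TensorProduct.smul_tmul (⟨s, hs⟩ : fixedRing i) a b

theorem soergelComponents_balanced (i : ZMod r) {s : Poly r} (hs : s ∈ fixedRing i)
    (a b : Poly r) :
    components₂ polyGr_internal polyGr_internal (soergelTmul i) (s * a) b =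
      components₂ polyGr_internal polyGr_internal (soergelTmul i) a (s * b) := by
  rw [← components_sum polyGr_internal s, Finsupp.sum, Finset.sum_mul, Finset.sum_mul, map_sum,
    map_sum, LinearMap.sum_apply]
  refine Finset.sum_congr rfl fun d _ => ?_
  have hd := components_mem polyGr_internal s d
  have hd' := components_mem_fixedRing hs d
  generalize components polyGr_internal s d = t at hd hd'
  induction a using homogeneous_induction polyGr_internal with
  | h₀ => simp
  | ha a a' h h' => rw [mul_add, map_add, map_add, LinearMap.add_apply, LinearMap.add_apply, h, h']
  | hh m a ha =>
    induction b using homogeneous_induction polyGr_internal with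
    | h₀ => simp
    | ha b b' h h' => rw [mul_add, map_add, map_add, h, h']
    | hh n b hb =>
      rw [components₂_of_mem _ _ _ (SetLike.mul_mem_graded hd ha) hb,
        components₂_of_mem _ _ _ ha (SetLike.mul_mem_graded hd hb), soergelTmul_balanced i hd']
      congr 1
      ring

/-- The homogeneous components of an element of `R ⊗ R`. -/
noncomputable def soergelComponents (i : ZMod r) :
    (Poly r ⊗[fixedRing i] Poly r) →+ (ℤ →₀ Poly r ⊗[fixedRing i] Poly r) :=
  TensorProduct.liftAddHom
    { toFun := fun a =>
        (components₂ polyGr_internal polyGr_internal (soergelTmul i) a).toAddMonoidHom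
      map_zero' := by ext; simp
      map_add' := fun _ _ => by ext; simp }
    (fun s a b => (soergelComponents_balanced i s.2 a b))

theorem soergel_internal (i : ZMod r) :
    DirectSum.IsInternal (tensorGrading (polyGr r) (polyGr r) (soergelTmul i)) :=
  tensorGrading_isInternal polyGr_internal polyGr_internal (soergelTmul i)
    (fun z => by
      induction z using TensorProduct.induction_on with
      | zero => exact zero_mem _
      | tmul a b => exact Submodule.subset_span ⟨a, b, rfl⟩
      | add z z' h h' => exact add_mem h h')
    (soergelComponents i)
    (fun c z => by
      induction z using TensorProduct.induction_on with
      | zero => simp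
      | tmul a b =>
        change soergelComponents i (soergelTmul i (c • a) b) =
          c • soergelComponents i (soergelTmul i a b)
        change components₂ _ _ _ _ _ = c • components₂ _ _ _ _ _
        rw [map_smul]
        rfl
      | add z z' h h' => rw [smul_add, map_add, map_add, smul_add, h, h'])
    (fun _ _ => rfl)

/-- The graded bimodule `B_i = R ⊗ R`, the tensor product being taken over the subring of `R` fixed
by `σ_i`. -/
noncomputable def B (i : ZMod r) : GrBimod (polyGr r) where
  carrier := Poly r ⊗[fixedRing i] Poly r
  left := (Algebra.lmul ℚ (Poly r ⊗[fixedRing i] Poly r)).comp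
    (Algebra.TensorProduct.includeLeft : Poly r →ₐ[ℚ] Poly r ⊗[fixedRing i] Poly r)
  right := (Algebra.lmul ℚ (Poly r ⊗[fixedRing i] Poly r)).comp
    ((Algebra.TensorProduct.includeRight :
      Poly r →ₐ[fixedRing i] Poly r ⊗[fixedRing i] Poly r).restrictScalars ℚ)
  comm a b m := mul_left_comm _ _ _
  gr := tensorGrading (polyGr r) (polyGr r) (soergelTmul i)
  internal := soergel_internal i
  left_mem {p q a z} ha hz := by
    induction hz using Submodule.span_induction with
    | mem z hz =>
      obtain ⟨p', q', rfl, b, hb, c, hc, rfl⟩ := hz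
      rw [← add_assoc]
      convert tmul_mem_tensorGrading (soergelTmul i) (SetLike.mul_mem_graded ha hb) hc using 1
      simp [Algebra.TensorProduct.tmul_mul_tmul]
    | zero => rw [map_zero]; exact zero_mem _
    | add z z' _ _ h h' => rw [map_add]; exact add_mem h h'
    | smul c z _ h => rw [map_smul]; exact Submodule.smul_mem _ _ h
  right_mem {p q a z} ha hz := by
    induction hz using Submodule.span_induction with
    | mem z hz =>
      obtain ⟨p', q', rfl, b, hb, c, hc, rfl⟩ := hz
      rw [add_assoc]
      convert tmul_mem_tensorGrading (soergelTmul i) hb (SetLike.mul_mem_graded hc ha) using 1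
      simp [Algebra.TensorProduct.tmul_mul_tmul, mul_comm a c]
    | zero => rw [map_zero]; exact zero_mem _
    | add z z' _ _ h h' => rw [map_add]; exact add_mem h h'
    | smul c z _ h => rw [map_smul]; exact Submodule.smul_mem _ _ h

/-- The graded bimodule which is `R` as a left module, with `a` acting on the right as
multiplication by `φ a`. -/
noncomputable def twist (φ : Poly r →ₐ[ℚ] Poly r)
    (hφ : ∀ {n : ℤ} {p : Poly r}, p ∈ polyGr r n → φ p ∈ polyGr r n) : GrBimod (polyGr r) where
  carrier := Poly r
  left := Algebra.lmul ℚ (Poly r)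
  right := (Algebra.lmul ℚ (Poly r)).comp φ
  comm a b m := mul_left_comm _ _ _
  gr := polyGr r
  internal := polyGr_internal
  left_mem ha hm := SetLike.mul_mem_graded ha hm
  right_mem {p q a m} ha hm := by
    have := SetLike.mul_mem_graded hm (hφ ha)
    rwa [mul_comm] at this

variable (r) in
/-- The graded bimodule `B_ρ`. -/
noncomputable def Brho : GrBimod (polyGr r) := twist (rho r) rho_mem

variable (r) in
/-- The graded bimodule `B_{ρ⁻¹}`. -/
noncomputable def BrhoInv : GrBimod (polyGr r) := twist (rho r).symm rho_symm_mem

end SoergelBimodules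

section RouquierComplexes

variable {r : ℕ}

@[simp]
theorem B_left (i : ZMod r) (a : Poly r) (z : Poly r ⊗[fixedRing i] Poly r) :
    (B i).left a z = (a ⊗ₜ[fixedRing i] (1 : Poly r) * z : Poly r ⊗[fixedRing i] Poly r) := rfl

@[simp]
theorem B_right (i : ZMod r) (a : Poly r) (z : Poly r ⊗[fixedRing i] Poly r) :
    (B i).right a z = ((1 : Poly r) ⊗ₜ[fixedRing i] a * z : Poly r ⊗[fixedRing i] Poly r) := rfl

/-- The element `(X_i ⊗ 1 + 1 ⊗ X_i) / 2` of `B_i`. -/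
noncomputable def rbElt (i : ZMod r) : Poly r ⊗[fixedRing i] Poly r :=
  (1 / 2 : ℚ) • (root i ⊗ₜ[fixedRing i] (1 : Poly r) + (1 : Poly r) ⊗ₜ[fixedRing i] root i)

theorem tmul_one_of_mem {i : ZMod r} {s : Poly r} (hs : s ∈ fixedRing i) :
    s ⊗ₜ[fixedRing i] (1 : Poly r) = (1 : Poly r) ⊗ₜ[fixedRing i] s := by
  simpa using soergelTmul_balanced i hs 1 1

theorem sigmaHom_root (hr : 3 ≤ r) (i : ZMod r) : sigmaHom i (root i) = - root i := by
  have h : i + 1 ≠ i := by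
    have : Fact (1 < r) := ⟨by omega⟩
    simp
  simp [root, sigmaHom_x, h]
  ring

theorem root_mul_rbElt (hr : 3 ≤ r) (i : ZMod r) :
    root i ⊗ₜ[fixedRing i] (1 : Poly r) * rbElt i =
      (1 : Poly r) ⊗ₜ[fixedRing i] root i * rbElt i := by
  have h := tmul_one_of_mem (i := i) (s := root i * root i)
    (by rw [mem_fixedRing, map_mul, sigmaHom_root hr]; ring)
  simp only [rbElt, mul_smul_comm, mul_add, Algebra.TensorProduct.tmul_mul_tmul, mul_one, one_mul, h]
  rw [add_comm]

theorem rbElt_central (hr : 3 ≤ r) (i : ZMod r) (a : Poly r) :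
    a ⊗ₜ[fixedRing i] (1 : Poly r) * rbElt i = (1 : Poly r) ⊗ₜ[fixedRing i] a * rbElt i := by
  have h1 : i + 1 ≠ i := by
    have : Fact (1 < r) := ⟨by omega⟩
    simp
  have of_mem : ∀ s ∈ fixedRing i,
      s ⊗ₜ[fixedRing i] (1 : Poly r) * rbElt i = (1 : Poly r) ⊗ₜ[fixedRing i] s * rbElt i :=
    fun s hs => by rw [tmul_one_of_mem hs]
  have hadd : ∀ p q : Poly r,
      p ⊗ₜ[fixedRing i] (1 : Poly r) * rbElt i = (1 : Poly r) ⊗ₜ[fixedRing i] p * rbElt i →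
      q ⊗ₜ[fixedRing i] (1 : Poly r) * rbElt i = (1 : Poly r) ⊗ₜ[fixedRing i] q * rbElt i →
      (p + q) ⊗ₜ[fixedRing i] (1 : Poly r) * rbElt i =
        (1 : Poly r) ⊗ₜ[fixedRing i] (p + q) * rbElt i := fun p q hp hq => by
    rw [TensorProduct.add_tmul, TensorProduct.tmul_add, add_mul, add_mul, hp, hq]
  have hmul : ∀ p q : Poly r,
      p ⊗ₜ[fixedRing i] (1 : Poly r) * rbElt i = (1 : Poly r) ⊗ₜ[fixedRing i] p * rbElt i →
      q ⊗ₜ[fixedRing i] (1 : Poly r) * rbElt i = (1 : Poly r) ⊗ₜ[fixedRing i] q * rbElt i →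
      (p * q) ⊗ₜ[fixedRing i] (1 : Poly r) * rbElt i =
        (1 : Poly r) ⊗ₜ[fixedRing i] (p * q) * rbElt i := fun p q hp hq => by
    have e₁ : (p * q) ⊗ₜ[fixedRing i] (1 : Poly r) =
        p ⊗ₜ[fixedRing i] (1 : Poly r) * q ⊗ₜ[fixedRing i] (1 : Poly r) := by
      rw [Algebra.TensorProduct.tmul_mul_tmul, mul_one]
    have e₂ : (1 : Poly r) ⊗ₜ[fixedRing i] (p * q) =
        (1 : Poly r) ⊗ₜ[fixedRing i] p * (1 : Poly r) ⊗ₜ[fixedRing i] q := by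
      rw [Algebra.TensorProduct.tmul_mul_tmul, mul_one]
    rw [e₁, e₂, mul_assoc, hq, mul_left_comm, hp]
    ring
  have hw : wrap i ∈ fixedRing i := sigmaHom_wrap i i
  have hC : ∀ c : ℚ, MvPolynomial.C c ∈ fixedRing i := fun c => (fixedRing i).algebraMap_mem c
  have hroot := root_mul_rbElt hr i
  have hx : x i = MvPolynomial.C (1 / 2) * (x i + x (i + 1) + - wrap i) +
      MvPolynomial.C (- (1 / 2)) * root i := by
    have h2 : (MvPolynomial.C (1 / 2) : Poly r) * 2 = 1 := by
      rw [show (2 : Poly r) = MvPolynomial.C 2 from rfl, ← MvPolynomial.C_mul]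
      norm_num
    rw [root, MvPolynomial.C_neg]
    linear_combination (- x i : Poly r) * h2
  have hx0 : x i ⊗ₜ[fixedRing i] (1 : Poly r) * rbElt i =
      (1 : Poly r) ⊗ₜ[fixedRing i] x i * rbElt i := by
    have hs : x i + x (i + 1) + - wrap i ∈ fixedRing i := by
      rw [mem_fixedRing]
      simp [sigmaHom_x, h1]
      ring
    rw [hx]
    exact hadd _ _ (hmul _ _ (of_mem _ (hC _)) (of_mem _ hs)) (hmul _ _ (of_mem _ (hC _)) hroot)
  induction a using MvPolynomial.induction_on with
  | C c => exact of_mem _ (hC c)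
  | add p q hp hq => exact hadd p q hp hq
  | mul_X p v hp =>
    refine hmul p _ hp ?_
    cases v with
    | none => exact of_mem _ (sigmaHom_y i)
    | some j =>
      change x j ⊗ₜ[fixedRing i] (1 : Poly r) * rbElt i =
        (1 : Poly r) ⊗ₜ[fixedRing i] x j * rbElt i
      by_cases hj : j = i
      · rw [hj]; exact hx0
      · by_cases hj' : j = i + 1
        · have : x j = x i + (root i + wrap i) := by rw [hj', root]; ring
          rw [this]
          exact hadd _ _ hx0 (hadd _ _ hroot (of_mem _ hw))
        · refine of_mem _ ?_
          rw [mem_fixedRing, sigmaHom_x, if_neg hj, if_neg hj']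

theorem rbElt_mem (i : ZMod r) :
    rbElt i ∈ tensorGrading (polyGr r) (polyGr r) (soergelTmul i) 2 := by
  have h₁ := tmul_mem_tensorGrading (soergelTmul i) (root_mem i)
    (SetLike.one_mem_graded (polyGr r))
  have h₂ := tmul_mem_tensorGrading (soergelTmul i) (SetLike.one_mem_graded (polyGr r))
    (root_mem i)
  exact Submodule.smul_mem _ _ (add_mem h₁ h₂)

/-- The map `a ↦ a (X_i ⊗ 1 + 1 ⊗ X_i) / 2`. -/
noncomputable def rbLin (i : ZMod r) : Poly r →ₗ[ℚ] Poly r ⊗[fixedRing i] Poly r :=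
  (LinearMap.mulRight ℚ (rbElt i)).comp
    (Algebra.TensorProduct.includeLeft : Poly r →ₐ[ℚ] Poly r ⊗[fixedRing i] Poly r).toLinearMap

theorem rbLin_apply (i : ZMod r) (a : Poly r) :
    rbLin i a = a ⊗ₜ[fixedRing i] (1 : Poly r) * rbElt i := rfl

theorem rbLin_mul (i : ZMod r) (a b : Poly r) :
    rbLin i (a * b) = a ⊗ₜ[fixedRing i] (1 : Poly r) * rbLin i b := by
  rw [rbLin_apply, rbLin_apply, ← mul_assoc, Algebra.TensorProduct.tmul_mul_tmul, mul_one]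

theorem rbLin_mul_right (hr : 3 ≤ r) (i : ZMod r) (a b : Poly r) :
    rbLin i (a * b) = (1 : Poly r) ⊗ₜ[fixedRing i] a * rbLin i b := by
  rw [mul_comm, rbLin_mul, rbLin_apply, rbLin_apply, rbElt_central hr, mul_left_comm]

/-- The morphism `R{2} ⟶ B_i`, `1 ↦ (X_i ⊗ 1 + 1 ⊗ X_i) / 2`. -/
noncomputable def rb (hr : 3 ≤ r) (i : ZMod r) : (GrBimod.regular (polyGr r)).shift 2 ⟶ B i where
  lin := rbLin i
  prop := by
    refine ⟨fun a b => rbLin_mul i a b, fun a b => rbLin_mul_right hr i a b, fun n b hb => ?_⟩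
    have h := (B i).left_mem hb (rbElt_mem i)
    rwa [sub_add_cancel] at h

/-- The multiplication map `a ⊗ b ↦ a b`. -/
noncomputable def brLin (i : ZMod r) : (Poly r ⊗[fixedRing i] Poly r) →ₗ[ℚ] Poly r :=
  (Algebra.TensorProduct.lmul' (fixedRing i) (S := Poly r)).toLinearMap.restrictScalars ℚ

theorem brLin_tmul (i : ZMod r) (a b : Poly r) : brLin i (a ⊗ₜ[fixedRing i] b) = a * b := rfl

theorem brLin_mul (i : ZMod r) (z w : Poly r ⊗[fixedRing i] Poly r) :
    brLin i (z * w) = brLin i z * brLin i w :=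
  map_mul (Algebra.TensorProduct.lmul' (fixedRing i) (S := Poly r)) z w

theorem brLin_mem (i : ZMod r) {n : ℤ} {z : Poly r ⊗[fixedRing i] Poly r}
    (hz : z ∈ tensorGrading (polyGr r) (polyGr r) (soergelTmul i) n) : brLin i z ∈ polyGr r n := by
  induction hz using Submodule.span_induction with
  | mem z hz =>
    obtain ⟨p, q, rfl, a, ha, b, hb, rfl⟩ := hz
    rw [soergelTmul_apply, brLin_tmul]
    exact SetLike.mul_mem_graded ha hb
  | zero => rw [map_zero]; exact zero_mem _
  | add z z' _ _ h h' => rw [map_add]; exact add_mem h h'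
  | smul c z _ h => rw [map_smul]; exact Submodule.smul_mem _ _ h

/-- The multiplication morphism `B_i{p} ⟶ R{p}`. -/
noncomputable def br (i : ZMod r) (p : ℤ) :
    (B i).shift p ⟶ (GrBimod.regular (polyGr r)).shift p where
  lin := brLin i
  prop := by
    refine ⟨fun a (z : Poly r ⊗[fixedRing i] Poly r) => ?_,
      fun a (z : Poly r ⊗[fixedRing i] Poly r) => ?_, fun n z hz => brLin_mem i hz⟩
    · change brLin i (a ⊗ₜ[fixedRing i] (1 : Poly r) * z) = a * brLin i z
      rw [brLin_mul, brLin_tmul, mul_one]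
    · change brLin i ((1 : Poly r) ⊗ₜ[fixedRing i] a * z) = a * brLin i z
      rw [brLin_mul, brLin_tmul, one_mul]

end RouquierComplexes

section ExtendedSoergel

/-- The objects of the category of extended Soergel bimodules: the graded bimodules obtained from
`R`, `B_i`, `B_ρ` and `B_{ρ⁻¹}` by tensor products over `R`, finite direct sums and grading
shifts. -/
inductive IsExtBim (r : ℕ) : ObjectProperty (GrBimod (polyGr r))
  | unit : IsExtBim r (𝟙_ _)
  | b (i : ZMod r) : IsExtBim r (B i)
  | rho : IsExtBim r (Brho r)
  | rhoInv : IsExtBim r (BrhoInv r)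
  | tensor {M N : GrBimod (polyGr r)} : IsExtBim r M → IsExtBim r N → IsExtBim r (M ⊗ N)
  | sum {J : Type} [Finite J] (F : J → GrBimod (polyGr r)) :
      (∀ j, IsExtBim r (F j)) → IsExtBim r (GrBimod.sum F)
  | shift {M : GrBimod (polyGr r)} (p : ℤ) : IsExtBim r M → IsExtBim r (M.shift p)

/-- The objects of the Karoubi envelope of the category of extended Soergel bimodules. As every
idempotent endomorphism of a graded bimodule splits, the Karoubi envelope is the full subcategory
of graded bimodules formed by the direct summands of extended Soergel bimodules. -/
abbrev IsKarExtBim (r : ℕ) : ObjectProperty (GrBimod (polyGr r)) := (IsExtBim r).retractClosure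

variable {r : ℕ}

theorem IsKarExtBim.of {M : GrBimod (polyGr r)} (h : IsExtBim r M) : IsKarExtBim r M :=
  (IsExtBim r).le_retractClosure _ h

theorem IsKarExtBim.tensor {M N : GrBimod (polyGr r)} (hM : IsKarExtBim r M)
    (hN : IsKarExtBim r N) : IsKarExtBim r (M ⊗ N) := by
  obtain ⟨M', hM', ⟨e⟩⟩ := hM
  obtain ⟨N', hN', ⟨f⟩⟩ := hN
  exact ⟨M' ⊗ N', hM'.tensor hN', ⟨{
    i := e.i ⊗ₘ f.i
    r := e.r ⊗ₘ f.r
    retract := by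
      rw [tensorHom_comp_tensorHom, e.retract, f.retract, id_tensorHom_id] }⟩⟩

theorem IsKarExtBim.sum {J : Type} [Finite J] (F : J → GrBimod (polyGr r))
    (hF : ∀ j, IsKarExtBim r (F j)) : IsKarExtBim r (GrBimod.sum F) := by
  choose F' hF' e using hF
  have e j := (e j).some
  exact ⟨GrBimod.sum F', .sum F' hF', ⟨{
    i := GrBimod.sumDesc fun j => (e j).i ≫ GrBimod.sumι F' j
    r := GrBimod.sumDesc fun j => (e j).r ≫ GrBimod.sumι F j
    retract := (GrBimod.sumIsColimit F).hom_ext fun ⟨j⟩ => by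
      change GrBimod.sumι F j ≫ _ ≫ _ = GrBimod.sumι F j ≫ 𝟙 _
      rw [← Category.assoc, GrBimod.sumι_sumDesc, Category.assoc, GrBimod.sumι_sumDesc,
        ← Category.assoc, (e j).retract, Category.id_comp, Category.comp_id] }⟩⟩

theorem IsKarExtBim.zero {M : GrBimod (polyGr r)} (hM : IsZero M) : IsKarExtBim r M :=
  ⟨_, .unit, ⟨{ i := 0, r := 0, retract := hM.eq_of_src _ _ }⟩⟩

instance : (boundedIn (IsKarExtBim r)).IsMonoidal where
  prop_unit := boundedIn_single (fun _ => IsKarExtBim.zero) (.of .unit) 0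
  prop_tensor _ _ hX hY := boundedIn_tensor (fun _ _ => IsKarExtBim.tensor)
    (fun _ _ => IsKarExtBim.sum) hX hY

variable (r) in
/-- The homotopy category of bounded complexes over the Karoubi envelope of the category of
extended Soergel bimodules, as a monoidal full subcategory of the homotopy category of complexes of
graded bimodules. -/
abbrev KbKar : Type 1 := (boundedIn (IsKarExtBim r)).FullSubcategory

/-- The complex `R{2} ⟶ B_i` with `B_i` in degree zero. -/
noncomputable def sigmaComplex (hr : 3 ≤ r) (i : ZMod r) : KbKar r where
  obj := (toHo _).obj (HomologicalComplex.double (rb hr i)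
    (show (ComplexShape.up ℤ).Rel (-1) 0 by simp))
  property := boundedIn_double (fun _ => IsKarExtBim.zero) (.of (.shift 2 .unit)) (.of (.b i)) _ _
    (by omega)

/-- The complex `B_i{-2} ⟶ R{-2}` with `B_i{-2}` in degree zero. -/
noncomputable def sigmaInvComplex (i : ZMod r) : KbKar r where
  obj := (toHo _).obj (HomologicalComplex.double (br i (-2))
    (show (ComplexShape.up ℤ).Rel 0 1 by simp))
  property := boundedIn_double (fun _ => IsKarExtBim.zero) (.of (.shift (-2) (.b i)))
    (.of (.shift (-2) .unit)) _ _ (by omega)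

variable (r) in
/-- The bimodule `B_ρ` as a complex concentrated in degree zero. -/
noncomputable def rhoComplex : KbKar r where
  obj := (toHo _).obj ((HomologicalComplex.single _ (ComplexShape.up ℤ) 0).obj (Brho r))
  property := boundedIn_single (fun _ => IsKarExtBim.zero) (.of .rho) 0

variable (r) in
/-- The bimodule `B_{ρ⁻¹}` as a complex concentrated in degree zero. -/
noncomputable def rhoInvComplex : KbKar r where
  obj := (toHo _).obj ((HomologicalComplex.single _ (ComplexShape.up ℤ) 0).obj (BrhoInv r))
  property := boundedIn_single (fun _ => IsKarExtBim.zero) (.of .rhoInv) 0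

end ExtendedSoergel

section BraidGroup

/-- The generators `σ_1, …, σ_r` (indexed by residues modulo `r`) and `ρ`. -/
inductive Gen (r : ℕ) : Type
  | sigma (i : ZMod r) : Gen r
  | rho : Gen r

variable (r : ℕ)

/-- The relators of the extended affine braid group. -/
inductive IsRelator : FreeGroup (Gen r) → Prop
  /-- `σ_i σ_j = σ_j σ_i` for distant `i` and `j`. -/
  | comm (i j : ZMod r) : i ≠ j → i ≠ j + 1 → j ≠ i + 1 →
      IsRelator (.of (.sigma i) * .of (.sigma j) * (.of (.sigma j) * .of (.sigma i))⁻¹)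
  /-- `σ_i σ_{i+1} σ_i = σ_{i+1} σ_i σ_{i+1}`. -/
  | braid (i : ZMod r) :
      IsRelator (.of (.sigma i) * .of (.sigma (i + 1)) * .of (.sigma i) *
        (.of (.sigma (i + 1)) * .of (.sigma i) * .of (.sigma (i + 1)))⁻¹)
  /-- `ρ σ_i ρ⁻¹ = σ_{i+1}`. -/
  | conj (i : ZMod r) :
      IsRelator (.of .rho * .of (.sigma i) * (.of .rho)⁻¹ * (.of (.sigma (i + 1)))⁻¹)

/-- The extended affine braid group. -/
abbrev ExtAffBraid : Type := PresentedGroup {w : FreeGroup (Gen r) | IsRelator r w}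

variable {r}

/-- The complex assigned to a letter: `(s, true)` stands for `s` and `(s, false)` for `s⁻¹`. -/
noncomputable def letterComplex (hr : 3 ≤ r) : Gen r × Bool → KbKar r
  | (.sigma i, true) => sigmaComplex hr i
  | (.sigma i, false) => sigmaInvComplex i
  | (.rho, true) => rhoComplex r
  | (.rho, false) => rhoInvComplex r

/-- The complex assigned to a word: `R` for the empty word, and the tensor product over `R` of the
complexes assigned to the letters in general. -/
noncomputable def wordComplex (hr : 3 ≤ r) : List (Gen r × Bool) → KbKar r
  | [] => 𝟙_ (KbKar r)
  | s :: w => letterComplex hr s ⊗ wordComplex hr w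

/-- The element of the extended affine braid group represented by a word. -/
def wordElt (w : List (Gen r × Bool)) : ExtAffBraid r :=
  PresentedGroup.mk {w : FreeGroup (Gen r) | IsRelator r w} (FreeGroup.mk w)

end BraidGroup

end ExtSoergel

/-!
The complexes `F(σ_i)` and `F(ρ)` are invertible objects of the homotopy category, and they satisfy
the relations of the braid group up to isomorphism. A monoidal functor requires isomorphisms that
are moreover coherent. They are rigidified by points.

A point of a complex is a class in the part of internal degree zero of its cohomology in degree zero
(`HPt`). Points can be multiplied, which makes the points a lax monoidal functor to types
(`hoPointing`), and the endomorphisms of the unit complex correspond to its points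
(`end_unit_bijective`). It follows that an endomorphism of an invertible object with a point is
determined by the image of the point, once the point is part of an inverse pair of pointed objects
(`Pointing.end_eq_of_map_eq`). This has three consequences.

* Pointed isomorphisms between invertible pointed objects are unique (`Pointing.hom_unique`). So a
  homomorphism from a group to the group `Pointing.PicPt` of classes of invertible pointed objects
  lifts to a monoidal functor, all coherence conditions being equations between pointed isomorphisms
  (`Pointing.repFunctor`, `Pointing.repFunctorMonoidal`).
* Invertible pointed objects are isomorphic as soon as there are pointed maps in both directions
  (`Pointing.Pt.equiv_of_hom`). So no homotopies are needed for the relations.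
* Only the invertibility of the generators requires homotopy equivalences.

The point of `F(σ_i)` is the class of `1 ⊗ 1` in `B_i`, that of `F(σ_i⁻¹)` the class of `1 ⊗ x_i -
x_i ⊗ 1`, and that of `F(ρ^{±1})` the class of `1`. The invertibility is shown in
`exists_iso_sigma_inv`, `exists_iso_inv_sigma`, `exists_iso_rho_inv` and `exists_iso_inv_rho`, by
splitting `B_i ⊗ B_i` into two shifts of `B_i` by means of the Demazure operator. The pointed maps
for the relations are constructed in `exists_hom_distant`, `exists_hom_rho_sigma`,
`exists_hom_sigma_rho` and `exists_hom_braid`. The reverse of a braid relation is an instance of the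
same construction with the two reflections exchanged.

In order to handle products of up to three two-term complexes, complexes are decomposed into cells,
and maps are given by matrices (`Cells`). The cells are tensor products of up to three bimodules,
each generated by one element with relations `a e = e a'` (`GrBimod.IsCyclic`). A map out of such a
product is given by the images of the words `e ⊗ b e' ⊗ c e''`, and equations between words are
verified in a commutative ring that has one homomorphism from `R` for each position in a word
(`GrBimod.Slots`).

The braid relation for adjacent `s` and `t` involves only the rank two root system: the two
reflections permute three linear forms `p`, `q`, `u` with sum zero (`Triple`), and the map in
cohomological degree zero is the map `B_s ⊗ B_t ⊗ B_s ⟶ B_t ⊗ B_s ⊗ B_t` of degree zero that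
preserves the generators (`Triple.exists_sixValent`).
-/

namespace ExtSoergel

/-! ### Pointings and invertible pointed objects -/

section Pointings

universe v u w

/-- A lax monoidal functor `obj` from a monoidal category to types, spelled out, such that
endomorphisms of the unit object correspond bijectively to the points of the unit object. A point of
`X` is an element of `obj X`. -/
structure Pointing (C : Type u) [Category.{v} C] [MonoidalCategory C] where
  obj : C → Type w
  map {X Y : C} (f : X ⟶ Y) : obj X → obj Y
  map_id {X : C} (z : obj X) : map (𝟙 X) z = z
  map_comp {X Y Z : C} (f : X ⟶ Y) (g : Y ⟶ Z) (z : obj X) : map (f ≫ g) z = map g (map f z)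
  one : obj (𝟙_ C)
  mul {X Y : C} (z : obj X) (w : obj Y) : obj (X ⊗ Y)
  map_mul {X Y X' Y' : C} (f : X ⟶ X') (g : Y ⟶ Y') (z : obj X) (w : obj Y) :
    map (f ⊗ₘ g) (mul z w) = mul (map f z) (map g w)
  map_associator {X Y Z : C} (z : obj X) (w : obj Y) (v : obj Z) :
    map (α_ X Y Z).hom (mul (mul z w) v) = mul z (mul w v)
  map_leftUnitor {X : C} (z : obj X) : map (λ_ X).hom (mul one z) = z
  map_rightUnitor {X : C} (z : obj X) : map (ρ_ X).hom (mul z one) = z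
  end_unit_bijective : Function.Bijective fun f : 𝟙_ C ⟶ 𝟙_ C => map f one

namespace Pointing

variable {C : Type u} [Category.{v} C] [MonoidalCategory C] (P : Pointing.{v, u, w} C)

/-- The restriction of a pointing to a monoidal full subcategory. -/
def restrict (Q : ObjectProperty C) [Q.IsMonoidal] : Pointing.{v, u, w} Q.FullSubcategory where
  obj X := P.obj X.obj
  map f := P.map f.hom
  map_id := P.map_id
  map_comp f g := P.map_comp f.hom g.hom
  one := P.one
  mul z w := P.mul z w
  map_mul f g := P.map_mul f.hom g.hom
  map_associator := P.map_associator
  map_leftUnitor := P.map_leftUnitor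
  map_rightUnitor := P.map_rightUnitor
  end_unit_bijective := by
    have e : Function.Bijective fun f : 𝟙_ Q.FullSubcategory ⟶ 𝟙_ Q.FullSubcategory => f.hom :=
      ⟨fun f g h => InducedCategory.hom_ext h, fun f => ⟨⟨f⟩, rfl⟩⟩
    exact P.end_unit_bijective.comp e

/-- An object with a chosen point. -/
structure Pt where
  X : C
  z : P.obj X

variable {P}

/-- There is a pointed isomorphism between two pointed objects. -/
abbrev Pt.Equiv (A B : P.Pt) : Prop := ∃ e : A.X ≅ B.X, P.map e.hom A.z = B.z

/-- The tensor product of pointed objects. -/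
abbrev Pt.tensor (A B : P.Pt) : P.Pt := ⟨A.X ⊗ B.X, P.mul A.z B.z⟩

variable (P) in
/-- The unit object with its distinguished point. -/
abbrev Pt.unit : P.Pt := ⟨𝟙_ C, P.one⟩

theorem map_inv_of_map_hom {X Y : C} (e : X ≅ Y) {z : P.obj X} {w : P.obj Y}
    (h : P.map e.hom z = w) : P.map e.inv w = z := by
  rw [← h, ← P.map_comp, e.hom_inv_id, P.map_id]

theorem map_comp_eq {X Y Z : C} {f : X ⟶ Y} {g : Y ⟶ Z} {z : P.obj X} {w : P.obj Y} {v : P.obj Z}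
    (hf : P.map f z = w) (hg : P.map g w = v) : P.map (f ≫ g) z = v := by
  rw [P.map_comp, hf, hg]

theorem map_whiskerRight_eq {X Y U : C} {f : X ⟶ Y} {z : P.obj X} {w : P.obj Y}
    (hf : P.map f z = w) (u : P.obj U) : P.map (f ▷ U) (P.mul z u) = P.mul w u := by
  rw [← tensorHom_id, P.map_mul, hf, P.map_id]

theorem map_whiskerLeft_eq {X Y U : C} {f : X ⟶ Y} {z : P.obj X} {w : P.obj Y} (u : P.obj U)
    (hf : P.map f z = w) : P.map (U ◁ f) (P.mul u z) = P.mul u w := by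
  rw [← id_tensorHom, P.map_mul, hf, P.map_id]

theorem Pt.Equiv.refl (A : P.Pt) : A.Equiv A := ⟨Iso.refl _, P.map_id _⟩

theorem Pt.Equiv.symm {A B : P.Pt} : A.Equiv B → B.Equiv A := fun ⟨e, h⟩ =>
  ⟨e.symm, map_inv_of_map_hom e h⟩

theorem Pt.Equiv.trans {A B D : P.Pt} : A.Equiv B → B.Equiv D → A.Equiv D := fun ⟨e, h⟩ ⟨f, h'⟩ =>
  ⟨e ≪≫ f, by rw [Iso.trans_hom, P.map_comp, h, h']⟩

theorem Pt.Equiv.tensor {A B A' B' : P.Pt} : A.Equiv A' → B.Equiv B' →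
    (A.tensor B).Equiv (A'.tensor B') := fun ⟨e, h⟩ ⟨f, h'⟩ =>
  ⟨MonoidalCategory.tensorIso e f, by
    rw [tensorIso_hom]
    exact (P.map_mul _ _ _ _).trans (by rw [h, h'])⟩

theorem Pt.tensor_assoc (A B D : P.Pt) :
    ((A.tensor B).tensor D).Equiv (A.tensor (B.tensor D)) := ⟨α_ _ _ _, P.map_associator _ _ _⟩

theorem Pt.unit_tensor (A : P.Pt) : ((Pt.unit P).tensor A).Equiv A := ⟨λ_ _, P.map_leftUnitor _⟩

theorem Pt.tensor_unit (A : P.Pt) : (A.tensor (Pt.unit P)).Equiv A := ⟨ρ_ _, P.map_rightUnitor _⟩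

/-- Two pointed objects are inverse to each other. -/
structure Pt.Inverse (A B : P.Pt) : Prop where
  left : (A.tensor B).Equiv (Pt.unit P)
  right : (B.tensor A).Equiv (Pt.unit P)

theorem Pt.Inverse.symm {A B : P.Pt} (h : A.Inverse B) : B.Inverse A := ⟨h.2, h.1⟩

theorem Pt.tensor_cancel_middle {A B A' B' : P.Pt} (hA : (A.tensor A').Equiv (Pt.unit P))
    (hB : (B.tensor B').Equiv (Pt.unit P)) :
    ((A.tensor B).tensor (B'.tensor A')).Equiv (Pt.unit P) := by
  refine (Pt.tensor_assoc _ _ _).trans (.trans (.tensor (.refl A) (.trans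
    (Pt.tensor_assoc B B' A').symm (.trans (.tensor hB (.refl A')) (Pt.unit_tensor A')))) hA)

theorem Pt.Inverse.tensor {A B A' B' : P.Pt} (hA : A.Inverse A') (hB : B.Inverse B') :
    (A.tensor B).Inverse (B'.tensor A') :=
  ⟨Pt.tensor_cancel_middle hA.1 hB.1, Pt.tensor_cancel_middle hB.2 hA.2⟩

/-- Tensoring with an object isomorphic to the unit object is faithful. -/
theorem whiskerRight_injective_of_iso {X Y U : C} (e : U ≅ 𝟙_ C) {f g : X ⟶ Y}
    (h : f ▷ U = g ▷ U) : f = g := by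
  have h' : f ▷ 𝟙_ C = g ▷ 𝟙_ C := by
    rw [← cancel_epi (X ◁ e.hom), whisker_exchange, whisker_exchange, h]
  rwa [whiskerRight_id, whiskerRight_id, cancel_epi, cancel_mono] at h'

/-- An endomorphism of an invertible object is determined by its effect on the distinguished
point: tensoring with the inverse object turns it into an endomorphism of the unit object. -/
theorem end_eq_of_map_eq {A B : P.Pt} (h : A.Inverse B) {f g : A.X ⟶ A.X}
    (hfg : P.map f A.z = P.map g A.z) : f = g := by
  obtain ⟨⟨e, he⟩, ⟨e', -⟩⟩ := h
  have key (k : A.X ⟶ A.X) :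
      P.map (e.inv ≫ k ▷ B.X ≫ e.hom) P.one = P.map e.hom (P.mul (P.map k A.z) B.z) :=
    map_comp_eq (map_inv_of_map_hom e he) (map_comp_eq (map_whiskerRight_eq rfl _) rfl)
  have h1 : e.inv ≫ f ▷ B.X ≫ e.hom = e.inv ≫ g ▷ B.X ≫ e.hom :=
    P.end_unit_bijective.1 (by
      change P.map _ _ = P.map _ _
      rw [key, key, hfg])
  rw [cancel_epi, cancel_mono] at h1
  -- `B ⊗ A` is isomorphic to the unit object as well, so tensoring with `B` is faithful
  refine whiskerRight_injective_of_iso e' ?_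
  change f ▷ (B.X ⊗ A.X) = g ▷ (B.X ⊗ A.X)
  rw [whiskerRight_tensor, whiskerRight_tensor, h1]

/-- Pointed isomorphisms between invertible pointed objects are unique. -/
theorem hom_unique {A A' B : P.Pt} (h : A.Inverse A') (hAB : A.Equiv B) {f g : A.X ⟶ B.X}
    (hf : P.map f A.z = B.z) (hg : P.map g A.z = B.z) : f = g := by
  obtain ⟨e, he⟩ := hAB
  rw [← cancel_mono e.inv]
  refine end_eq_of_map_eq h ?_
  rw [P.map_comp, P.map_comp, hf, hg]

/-- Two invertible pointed objects with pointed morphisms in both directions are isomorphic. -/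
theorem Pt.equiv_of_hom {A A' B B' : P.Pt} (hA : A.Inverse A') (hB : B.Inverse B')
    (f : A.X ⟶ B.X) (hf : P.map f A.z = B.z) (g : B.X ⟶ A.X) (hg : P.map g B.z = A.z) :
    A.Equiv B :=
  ⟨⟨f, g, end_eq_of_map_eq hA (by rw [P.map_comp, P.map_id, hf, hg]),
    end_eq_of_map_eq hB (by rw [P.map_comp, P.map_id, hg, hf])⟩, hf⟩

variable (P) in
/-- The invertible pointed objects. -/
abbrev InvPt : Type _ := {A : P.Pt // ∃ B, A.Inverse B}

variable (P) in
/-- Pointed isomorphism as an equivalence relation. -/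
def invPtSetoid : Setoid P.InvPt where
  r A B := A.1.Equiv B.1
  iseqv := ⟨fun _ => .refl _, .symm, .trans⟩

variable (P) in
/-- The group of isomorphism classes of invertible pointed objects. -/
def PicPt : Type _ := Quotient P.invPtSetoid

/-- The class of an invertible pointed object. -/
def PicPt.mk (A : P.Pt) (hA : ∃ B, A.Inverse B) : P.PicPt := Quotient.mk P.invPtSetoid ⟨A, hA⟩

theorem PicPt.mk_eq_mk {A B : P.Pt} {hA : ∃ A', A.Inverse A'} {hB : ∃ B', B.Inverse B'} :
    PicPt.mk A hA = PicPt.mk B hB ↔ A.Equiv B :=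
  ⟨fun h => Quotient.exact h, fun h => Quotient.sound h⟩

theorem Pt.exists_inverse_tensor {A B : P.Pt} (hA : ∃ A', A.Inverse A') (hB : ∃ B', B.Inverse B') :
    ∃ D, (A.tensor B).Inverse D := by
  obtain ⟨A', hA⟩ := hA
  obtain ⟨B', hB⟩ := hB
  exact ⟨_, hA.tensor hB⟩

theorem Pt.exists_inverse_unit : ∃ B, (Pt.unit P).Inverse B :=
  ⟨Pt.unit P, Pt.unit_tensor _, Pt.unit_tensor _⟩

theorem Pt.Inverse.unique {A A' B B' : P.Pt} (hA : A.Inverse A') (hB : B.Inverse B')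
    (h : A.Equiv B) : A'.Equiv B' :=
  (Pt.tensor_unit A').symm.trans <| (Pt.Equiv.tensor (.refl A') hB.1.symm).trans <|
    (Pt.tensor_assoc A' B B').symm.trans <|
    (Pt.Equiv.tensor ((Pt.Equiv.tensor (.refl A') h.symm).trans hA.2) (.refl B')).trans
    (Pt.unit_tensor B')

/-- The product is the tensor product. The inverse is well defined since pointed isomorphic objects
have pointed isomorphic inverses. -/
noncomputable instance : Group P.PicPt where
  mul := Quotient.map₂ (fun A B => ⟨A.1.tensor B.1, Pt.exists_inverse_tensor A.2 B.2⟩)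
    (fun _ _ h _ _ h' => Pt.Equiv.tensor h h')
  one := PicPt.mk (Pt.unit P) Pt.exists_inverse_unit
  inv := Quotient.map (fun A => ⟨A.2.choose, _, A.2.choose_spec.symm⟩)
    (fun A B h => A.2.choose_spec.unique B.2.choose_spec h)
  mul_assoc := by
    rintro ⟨A⟩ ⟨B⟩ ⟨D⟩
    exact Quotient.sound (Pt.tensor_assoc _ _ _)
  one_mul := by
    rintro ⟨A⟩
    exact Quotient.sound (Pt.unit_tensor _)
  mul_one := by
    rintro ⟨A⟩
    exact Quotient.sound (Pt.tensor_unit _)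
  inv_mul_cancel := by
    rintro ⟨A⟩
    exact Quotient.sound A.2.choose_spec.2

theorem PicPt.mk_mul {A B : P.Pt} (hA : ∃ A', A.Inverse A') (hB : ∃ B', B.Inverse B') :
    PicPt.mk A hA * PicPt.mk B hB = PicPt.mk (A.tensor B) (Pt.exists_inverse_tensor hA hB) := rfl

theorem PicPt.mk_unit : PicPt.mk (Pt.unit P) Pt.exists_inverse_unit = 1 := rfl

theorem PicPt.mk_inv {A B : P.Pt} (h : A.Inverse B) :
    (PicPt.mk A ⟨B, h⟩)⁻¹ = PicPt.mk B ⟨A, h.symm⟩ := by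
  rw [inv_eq_iff_mul_eq_one, PicPt.mk_mul, ← PicPt.mk_unit, PicPt.mk_eq_mk]
  exact h.1

/-! ### Monoidal functors on discrete categories -/

section Functor

variable {G : Type} [Group G] (φ : G →* P.PicPt)

/-- A representative of the class of pointed objects assigned to a group element. -/
noncomputable def rep (g : G) : P.InvPt := Quotient.out (φ g)

theorem rep_spec (g : G) : PicPt.mk (rep φ g).1 (rep φ g).2 = φ g := Quotient.out_eq (φ g)

theorem rep_one : (Pt.unit P).Equiv (rep φ 1).1 := by
  rw [← PicPt.mk_eq_mk (hA := Pt.exists_inverse_unit) (hB := (rep φ 1).2), rep_spec, map_one,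
    PicPt.mk_unit]

theorem rep_mul (g h : G) : ((rep φ g).1.tensor (rep φ h).1).Equiv (rep φ (g * h)).1 := by
  refine (PicPt.mk_eq_mk (hA := Pt.exists_inverse_tensor (rep φ g).2 (rep φ h).2)
    (hB := (rep φ (g * h)).2)).1 ?_
  refine (PicPt.mk_mul (rep φ g).2 (rep φ h).2).symm.trans ?_
  rw [rep_spec, rep_spec, rep_spec, _root_.map_mul]

/-- The functor on a discrete category given by the chosen representatives. -/
noncomputable def repFunctor : Discrete G ⥤ C := Discrete.functor fun g => (rep φ g).1.X

theorem map_repFunctor {g h : Discrete G} (f : g ⟶ h) :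
    P.map ((repFunctor φ).map f) (rep φ g.as).1.z = (rep φ h.as).1.z := by
  obtain ⟨g⟩ := g
  obtain ⟨h⟩ := h
  obtain rfl := Discrete.eq_of_hom f
  obtain rfl : f = 𝟙 _ := Subsingleton.elim _ _
  rw [CategoryTheory.Functor.map_id]
  exact P.map_id _

/-- The isomorphism classes assigned to group elements lift to a monoidal functor. The structure
isomorphisms are chosen to be pointed, and the coherence conditions hold because pointed
isomorphisms are unique. -/
noncomputable abbrev repFunctorMonoidal : (repFunctor φ).Monoidal :=
  Functor.CoreMonoidal.toMonoidal
    { εIso := (rep_one φ).choose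
      μIso := fun g h => (rep_mul φ g.as h.as).choose
      μIso_hom_natural_left := fun {g g'} f h => by
        obtain ⟨A', hA⟩ := Pt.exists_inverse_tensor (rep φ g.as).2 (rep φ h.as).2
        have e : g.as * h.as = g'.as * h.as := by rw [Discrete.eq_of_hom f]
        exact hom_unique (B := (rep φ (g'.as * h.as)).1) hA (e ▸ rep_mul φ g.as h.as)
          (map_comp_eq (map_whiskerRight_eq (map_repFunctor φ f) _)
            (rep_mul φ g'.as h.as).choose_spec)
          (map_comp_eq (rep_mul φ g.as h.as).choose_spec (map_repFunctor φ (f ▷ h)))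
      μIso_hom_natural_right := fun {h h'} g f => by
        obtain ⟨A', hA⟩ := Pt.exists_inverse_tensor (rep φ g.as).2 (rep φ h.as).2
        have e : g.as * h.as = g.as * h'.as := by rw [Discrete.eq_of_hom f]
        exact hom_unique (B := (rep φ (g.as * h'.as)).1) hA (e ▸ rep_mul φ g.as h.as)
          (map_comp_eq (map_whiskerLeft_eq _ (map_repFunctor φ f))
            (rep_mul φ g.as h'.as).choose_spec)
          (map_comp_eq (rep_mul φ g.as h.as).choose_spec (map_repFunctor φ (g ◁ f)))
      associativity := fun g h k => by
        obtain ⟨A', hA⟩ := Pt.exists_inverse_tensor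
          (Pt.exists_inverse_tensor (rep φ g.as).2 (rep φ h.as).2) (rep φ k.as).2
        have e : (((rep φ g.as).1.tensor (rep φ h.as).1).tensor (rep φ k.as).1).Equiv
            (rep φ (g.as * (h.as * k.as))).1 :=
          (Pt.tensor_assoc _ _ _).trans ((Pt.Equiv.tensor (.refl _) (rep_mul φ _ _)).trans
            (rep_mul φ _ _))
        exact hom_unique hA e
          (map_comp_eq (map_whiskerRight_eq (rep_mul φ g.as h.as).choose_spec _)
            (map_comp_eq (rep_mul φ (g.as * h.as) k.as).choose_spec
              (map_repFunctor φ (α_ g h k).hom)))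
          (map_comp_eq (P.map_associator _ _ _)
            (map_comp_eq (map_whiskerLeft_eq _ (rep_mul φ h.as k.as).choose_spec)
              (rep_mul φ g.as (h.as * k.as)).choose_spec))
      left_unitality := fun g => by
        obtain ⟨A', hA⟩ := Pt.exists_inverse_tensor (P := P) Pt.exists_inverse_unit (rep φ g.as).2
        exact hom_unique hA (Pt.unit_tensor _) (P.map_leftUnitor _)
          (map_comp_eq (map_whiskerRight_eq (rep_one φ).choose_spec _)
            (map_comp_eq (rep_mul φ 1 g.as).choose_spec (map_repFunctor φ (λ_ g).hom)))
      right_unitality := fun g => by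
        obtain ⟨A', hA⟩ := Pt.exists_inverse_tensor (P := P) (rep φ g.as).2 Pt.exists_inverse_unit
        exact hom_unique hA (Pt.tensor_unit _) (P.map_rightUnitor _)
          (map_comp_eq (map_whiskerLeft_eq _ (rep_one φ).choose_spec)
            (map_comp_eq (rep_mul φ g.as 1).choose_spec (map_repFunctor φ (ρ_ g).hom))) }

end Functor

end Pointing

end Pointings

/-! ### Summands of tensor products of complexes -/

section Tensor

variable {k R : Type} [CommRing k] [CommRing R] [Algebra k R] {𝒜 : ℤ → Submodule k R}

theorem GrBimod.sub_lin {M N : GrBimod 𝒜} (f g : M ⟶ N) (m : M) :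
    (f - g).lin m = f.lin m - g.lin m := rfl

theorem GrBimod.zsmul_lin {M N : GrBimod 𝒜} (n : ℤ) (f : M ⟶ N) (m : M) :
    (n • f).lin m = n • f.lin m := rfl

theorem GrBimod.lin_congr {M N : GrBimod 𝒜} {f g : M ⟶ N} (h : f = g) (m : M) :
    f.lin m = g.lin m := by rw [h]

theorem inv_f_comp_hom_f {K L : Complexes 𝒜} (e : K ≅ L) (i : ℤ) :
    e.inv.f i ≫ e.hom.f i = 𝟙 (L.X i) := by
  rw [← HomologicalComplex.comp_f, Iso.inv_hom_id, HomologicalComplex.id_f]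

variable [GradedAlgebra 𝒜]

open GrBimod

/-- The inclusion of the summand `Kⁱ ⊗ Lʲ` of `(K ⊗ L)ⁿ`, `i + j = n`. -/
noncomputable def iota (K L : Complexes 𝒜) (i j n : ℤ) (h : i + j = n) :
    tens (K.X i) (L.X j) ⟶ (K ⊗ L).X n :=
  HomologicalComplex.ιTensorObj K L i j n h

/-- The differential of a tensor product of complexes on a summand, with the usual sign. -/
theorem iota_d (K L : Complexes 𝒜) (i j n : ℤ) (h : i + j = n) :
    iota K L i j n h ≫ (K ⊗ L).d n (n + 1) =
      tensMap (K.d i (i + 1)) (𝟙 (L.X j)) ≫ iota K L (i + 1) j (n + 1) (by omega) +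
      (i.negOnePow : ℤ) • (tensMap (𝟙 (K.X i)) (L.d j (j + 1)) ≫
        iota K L i (j + 1) (n + 1) (by omega)) := by
  have h1 := HomologicalComplex.mapBifunctor.d₁_eq K L (curriedTensor (GrBimod 𝒜))
    (ComplexShape.up ℤ) (show (ComplexShape.up ℤ).Rel i (i + 1) by simp) j (n + 1)
    (show i + 1 + j = n + 1 by omega)
  have h2 := HomologicalComplex.mapBifunctor.d₂_eq K L (curriedTensor (GrBimod 𝒜))
    (ComplexShape.up ℤ) i (show (ComplexShape.up ℤ).Rel j (j + 1) by simp) (n + 1)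
    (show i + (j + 1) = n + 1 by omega)
  change HomologicalComplex.ιTensorObj K L i j n h ≫
    (HomologicalComplex.tensorObj K L).d n (n + 1) = _
  rw [HomologicalComplex.mapBifunctor.d_eq, Preadditive.comp_add,
    HomologicalComplex.mapBifunctor.ι_D₁, HomologicalComplex.mapBifunctor.ι_D₂, h1, h2]
  refine congrArg₂ (· + ·) ?_ rfl
  exact one_smul _ _

theorem iota_map {K L M N : Complexes 𝒜} (f : K ⟶ M) (g : L ⟶ N) (i j n : ℤ) (h : i + j = n) :
    iota K L i j n h ≫ (f ⊗ₘ g).f n = tensMap (f.f i) (g.f j) ≫ iota M N i j n h := by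
  refine (HomologicalComplex.ι_mapBifunctorMap f g (curriedTensor (GrBimod 𝒜))
    (ComplexShape.up ℤ) i j n h).trans ?_
  rw [← Category.assoc]
  refine congrArg (· ≫ iota M N i j n h) ?_
  exact (tensMap_comp _ _ _ _).trans (congrArg₂ _ (Category.comp_id _) (Category.id_comp _))

theorem tensor_X_hom_ext {K L : Complexes 𝒜} {n : ℤ} {M : GrBimod 𝒜} {f g : (K ⊗ L).X n ⟶ M}
    (h : ∀ i j hij, iota K L i j n hij ≫ f = iota K L i j n hij ≫ g) : f = g :=
  HomologicalComplex.mapBifunctor.hom_ext h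

/-- A map out of `(K ⊗ L)ⁿ` from maps on the summands. -/
noncomputable def tensorDesc {K L : Complexes 𝒜} {n : ℤ} {M : GrBimod 𝒜}
    (f : ∀ i j : ℤ, i + j = n → (tens (K.X i) (L.X j) ⟶ M)) : (K ⊗ L).X n ⟶ M :=
  HomologicalComplex.mapBifunctorDesc (K₁ := K) (K₂ := L) (F := curriedTensor (GrBimod 𝒜))
    (c := ComplexShape.up ℤ) f

theorem iota_tensorDesc {K L : Complexes 𝒜} {n : ℤ} {M : GrBimod 𝒜}
    (f : ∀ i j : ℤ, i + j = n → (tens (K.X i) (L.X j) ⟶ M)) (i j : ℤ) (h : i + j = n) :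
    iota K L i j n h ≫ tensorDesc f = f i j h :=
  HomologicalComplex.ι_mapBifunctorDesc (K₁ := K) (K₂ := L) (F := curriedTensor (GrBimod 𝒜))
    (c := ComplexShape.up ℤ) f i j h

theorem iota_associator (K L M : Complexes 𝒜) (i j l ij jl n : ℤ) (hij : i + j = ij)
    (hjl : j + l = jl) (h : ij + l = n) :
    tensMap (iota K L i j ij hij) (𝟙 (M.X l)) ≫ iota (K ⊗ L) M ij l n h ≫ (α_ K L M).hom.f n =
      (assocIso (K.X i) (L.X j) (M.X l)).hom ≫ tensMap (𝟙 (K.X i)) (iota L M j l jl hjl) ≫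
        iota K (L ⊗ M) i jl n (by omega) := by
  have h1 := HomologicalComplex.mapBifunctor₁₂.ι_eq (curriedTensor (GrBimod 𝒜))
    (curriedTensor (GrBimod 𝒜)) K L M (ComplexShape.up ℤ) (ComplexShape.up ℤ) i j l ij n hij h
  have h2 := HomologicalComplex.mapBifunctor₂₃.ι_eq (curriedTensor (GrBimod 𝒜))
    (curriedTensor (GrBimod 𝒜)) K L M (ComplexShape.up ℤ) (ComplexShape.up ℤ) (ComplexShape.up ℤ)
    i j l jl n hjl (show i + jl = n by omega)
  have h3 := HomologicalComplex.ι_mapBifunctorAssociatorX_hom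
    (curriedAssociatorNatIso (GrBimod 𝒜)) K L M (ComplexShape.up ℤ) (ComplexShape.up ℤ)
    (ComplexShape.up ℤ) i j l n (show i + j + l = n by omega)
  rw [h1, h2] at h3
  exact (Category.assoc _ _ _).symm.trans h3

/-- The identification of `R` with the term of degree zero of the unit complex. -/
noncomputable def unitIn : regular 𝒜 ⟶ (𝟙_ (Complexes 𝒜)).X 0 :=
  (HomologicalComplex.singleObjXSelf (ComplexShape.up ℤ) 0 (𝟙_ (GrBimod 𝒜))).inv

theorem comp_comp_eq_hom {C : Type*} [Category C] {X Y Z W : C} (e : X ≅ Y) {a : X ⟶ Z} {b : Z ⟶ W}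
    {c : W ⟶ Y} {u : Y ⟶ W} (h : u = e.inv ≫ a ≫ b) (h' : u ≫ c = 𝟙 Y) : a ≫ b ≫ c = e.hom := by
  rw [← cancel_epi e.inv, Iso.inv_hom_id, ← h', h]
  simp only [Category.assoc]

theorem iota_leftUnitor (K : Complexes 𝒜) (i : ℤ) :
    tensMap unitIn (𝟙 (K.X i)) ≫ iota (𝟙_ (Complexes 𝒜)) K 0 i i (zero_add i) ≫
      (λ_ K).hom.f i = (leftUnitIso (K.X i)).hom :=
  comp_comp_eq_hom (leftUnitIso (K.X i)) (HomologicalComplex.leftUnitor'_inv K i)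
    (inv_f_comp_hom_f (λ_ K) i)

theorem iota_rightUnitor (K : Complexes 𝒜) (i : ℤ) :
    tensMap (𝟙 (K.X i)) unitIn ≫ iota K (𝟙_ (Complexes 𝒜)) i 0 i (add_zero i) ≫
      (ρ_ K).hom.f i = (rightUnitIso (K.X i)).hom :=
  comp_comp_eq_hom (rightUnitIso (K.X i)) (HomologicalComplex.rightUnitor'_inv K i)
    (inv_f_comp_hom_f (ρ_ K) i)

end Tensor

/-! ### Cohomology of degree zero -/

section Points

open HomotopyCategory GrBimod

variable {k R : Type} [CommRing k] [CommRing R] [Algebra k R] {𝒜 : ℤ → Submodule k R}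

/-- The homogeneous cycles of internal and cohomological degree zero. -/
@[ext]
structure Cyc (K : Complexes 𝒜) : Type where
  val : K.X 0
  mem : val ∈ (K.X 0).gr 0
  cycle : (K.d 0 1).lin val = 0

/-- Two cycles are homologous. -/
def Homologous {K : Complexes 𝒜} (z w : Cyc K) : Prop :=
  ∃ u ∈ (K.X (-1)).gr 0, (K.d (-1) 0).lin u = z.val - w.val

/-- Being homologous is an equivalence relation. -/
def cycSetoid (K : Complexes 𝒜) : Setoid (Cyc K) where
  r := Homologous
  iseqv := {
    refl := fun z => ⟨0, zero_mem _, by simp⟩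
    symm := fun ⟨u, hu, h⟩ => ⟨-u, neg_mem hu, by rw [map_neg, h, neg_sub]⟩
    trans := fun ⟨u, hu, h⟩ ⟨u', hu', h'⟩ => ⟨u + u', add_mem hu hu', by
      rw [map_add, h, h', sub_add_sub_cancel]⟩ }

/-- The classes of cycles: the part of internal degree zero of the cohomology in degree zero. -/
def HPt (K : Complexes 𝒜) : Type := Quotient (cycSetoid K)

namespace HPt

variable {K L M N : Complexes 𝒜}

/-- The class of a cycle. -/
def mk (z : Cyc K) : HPt K := Quotient.mk (cycSetoid K) z

theorem mk_eq_mk {z w : Cyc K} : mk z = mk w ↔ Homologous z w :=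
  ⟨fun h => Quotient.exact h, fun h => Quotient.sound (s := cycSetoid K) h⟩

theorem mk_congr {z w : Cyc K} (h : z.val = w.val) : mk z = mk w := by
  rw [show z = w from Cyc.ext h]

/-- The image of a cycle under a map of complexes. -/
def mapCyc (f : K ⟶ L) (z : Cyc K) : Cyc L :=
  ⟨(f.f 0).lin z.val, GrBimod.hom_mem _ z.mem, by
    rw [← GrBimod.comp_lin, f.comm, GrBimod.comp_lin, z.cycle, map_zero]⟩

/-- The map induced by a map of complexes. -/
def map (f : K ⟶ L) : HPt K → HPt L :=
  Quotient.map (mapCyc f) (by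
    rintro z w ⟨u, hu, h⟩
    refine ⟨(f.f (-1)).lin u, GrBimod.hom_mem _ hu, ?_⟩
    rw [← GrBimod.comp_lin, f.comm, GrBimod.comp_lin, h, map_sub]
    rfl)

theorem map_id (z : HPt K) : map (𝟙 K) z = z := by
  obtain ⟨z⟩ := z
  rfl

theorem map_comp (f : K ⟶ L) (g : L ⟶ M) (z : HPt K) : map (f ≫ g) z = map g (map f z) := by
  obtain ⟨z⟩ := z
  rfl

theorem map_eq_of_homotopy {f g : K ⟶ L} (h : Homotopy f g) (z : HPt K) : map f z = map g z := by
  obtain ⟨z⟩ := z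
  refine mk_eq_mk.2 ⟨(h.hom 0 (-1)).lin z.val, GrBimod.hom_mem _ z.mem, ?_⟩
  have h0 := GrBimod.lin_congr (h.comm 0) z.val
  rw [dNext_eq h.hom (show (ComplexShape.up ℤ).Rel 0 1 by simp),
    prevD_eq h.hom (show (ComplexShape.up ℤ).Rel (-1) 0 by simp), GrBimod.add_lin,
    GrBimod.add_lin, GrBimod.comp_lin, GrBimod.comp_lin, z.cycle, map_zero, zero_add] at h0
  exact (sub_eq_of_eq_add h0).symm

variable [GradedAlgebra 𝒜]

theorem iota_d_tm (K L : Complexes 𝒜) (i j n i' j' n' : ℤ) (h : i + j = n) (hi : i + 1 = i')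
    (hj : j + 1 = j') (hn : n + 1 = n') (m : K.X i) (l : L.X j) :
    ((K ⊗ L).d n n').lin ((iota K L i j n h).lin (tm _ _ m l)) =
      (iota K L i' j n' (by omega)).lin (tm _ _ ((K.d i i').lin m) l) +
      (i.negOnePow : ℤ) • (iota K L i j' n' (by omega)).lin (tm _ _ m ((L.d j j').lin l)) := by
  subst hi hj hn
  have := lin_congr (iota_d K L i j n h) (tm _ _ m l)
  simpa only [comp_lin, add_lin, zsmul_lin, tensMap_tm, id_lin] using this

theorem iota_tm_mem (K L : Complexes 𝒜) {i j n : ℤ} (h : i + j = n) {m : K.X i} {l : L.X j}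
    {a b c : ℤ} (hm : m ∈ (K.X i).gr a) (hl : l ∈ (L.X j).gr b) (hc : a + b = c) :
    (iota K L i j n h).lin (tm _ _ m l) ∈ ((K ⊗ L).X n).gr c := by
  subst hc
  exact hom_mem _ (tm_mem hm hl)

theorem d_mul_eq_zero (z : Cyc K) (w : Cyc L) :
    ((K ⊗ L).d 0 1).lin ((iota K L 0 0 0 rfl).lin (tm _ _ z.val w.val)) = 0 := by
  rw [iota_d_tm K L 0 0 0 1 1 1 rfl rfl rfl rfl, z.cycle, w.cycle]
  simp only [map_zero, LinearMap.zero_apply, smul_zero, add_zero]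

theorem mul_mem (z : Cyc K) (w : Cyc L) :
    (iota K L 0 0 0 rfl).lin (tm _ _ z.val w.val) ∈ ((K ⊗ L).X 0).gr 0 :=
  iota_tm_mem K L (i := 0) (j := 0) (n := 0) rfl (a := 0) (b := 0) (c := 0) z.mem w.mem rfl

/-- The product of two cycles. -/
noncomputable def mulCyc (z : Cyc K) (w : Cyc L) : Cyc (K ⊗ L) where
  val := (iota K L 0 0 0 rfl).lin (tm _ _ z.val w.val)
  mem := mul_mem z w
  cycle := d_mul_eq_zero z w

theorem mulCyc_homologous {z z' : Cyc K} {w w' : Cyc L} (hz : Homologous z z')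
    (hw : Homologous w w') : Homologous (mulCyc z w) (mulCyc z' w') := by
  obtain ⟨u, hu, hu'⟩ := hz
  obtain ⟨v, hv, hv'⟩ := hw
  refine ⟨(iota K L (-1) 0 (-1) rfl).lin (tm _ _ u w.val) +
    (iota K L 0 (-1) (-1) rfl).lin (tm _ _ z'.val v),
    add_mem (iota_tm_mem K L (i := -1) (j := 0) (n := -1) rfl (a := 0) (b := 0) (c := 0) hu w.mem
      rfl) (iota_tm_mem K L (i := 0) (j := -1) (n := -1) rfl (a := 0) (b := 0) (c := 0) z'.mem hv
      rfl), ?_⟩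
  rw [map_add, iota_d_tm K L (-1) 0 (-1) 0 1 0 rfl rfl rfl rfl,
    iota_d_tm K L 0 (-1) (-1) 1 0 0 rfl rfl rfl rfl, w.cycle, z'.cycle, hu', hv']
  simp only [map_sub, LinearMap.sub_apply, map_zero, LinearMap.zero_apply, smul_zero, add_zero,
    zero_add, Int.negOnePow_zero, Units.val_one, one_smul]
  exact sub_add_sub_cancel _ _ _

/-- The product of two classes. -/
noncomputable def mul (z : HPt K) (w : HPt L) : HPt (K ⊗ L) :=
  Quotient.map₂ mulCyc (fun _ _ h _ _ h' => mulCyc_homologous h h') z w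

theorem map_mul (f : K ⟶ M) (g : L ⟶ N) (z : HPt K) (w : HPt L) :
    map (f ⊗ₘ g) (mul z w) = mul (map f z) (map g w) := by
  obtain ⟨z⟩ := z
  obtain ⟨w⟩ := w
  refine mk_congr ?_
  have h := lin_congr (iota_map f g 0 0 0 rfl) (tm _ _ z.val w.val)
  rw [comp_lin, comp_lin, tensMap_tm] at h
  exact h

theorem map_associator (z : HPt K) (w : HPt L) (v : HPt M) :
    map (α_ K L M).hom (mul (mul z w) v) = mul z (mul w v) := by
  obtain ⟨z⟩ := z
  obtain ⟨w⟩ := w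
  obtain ⟨v⟩ := v
  refine mk_congr ?_
  have h := lin_congr (iota_associator K L M 0 0 0 0 0 0 rfl rfl rfl)
    (tm _ _ (tm _ _ z.val w.val) v.val)
  rw [comp_lin, comp_lin, comp_lin, comp_lin, tensMap_tm] at h
  exact h.trans (congrArg _ ((congrArg _ (assocHom_tm _ _ _)).trans (tensMap_tm _ _ _ _)))

variable (𝒜) in
/-- The cycle `1` of the unit complex. -/
noncomputable def oneCyc : Cyc (𝟙_ (Complexes 𝒜)) :=
  ⟨unitIn.lin (reg 1), hom_mem _ reg_one_mem, by
    rw [show (𝟙_ (Complexes 𝒜)).d 0 1 = 0 from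
      HomologicalComplex.single_obj_d (ComplexShape.up ℤ) 0 (𝟙_ (GrBimod 𝒜)) 0 1]
    rfl⟩

variable (𝒜) in
/-- The class `1` of the unit complex. -/
noncomputable def one : HPt (𝟙_ (Complexes 𝒜)) := mk (oneCyc 𝒜)

theorem map_leftUnitor (z : HPt K) : map (λ_ K).hom (mul (one 𝒜) z) = z := by
  obtain ⟨z⟩ := z
  refine mk_congr ?_
  have h := lin_congr (iota_leftUnitor K 0) (tm _ _ (reg 1) z.val)
  rw [leftUnitIso_tm, unreg_reg, _root_.map_one (K.X 0).left, comp_lin, comp_lin, tensMap_tm] at h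
  exact h

theorem map_rightUnitor (z : HPt K) : map (ρ_ K).hom (mul z (one 𝒜)) = z := by
  obtain ⟨z⟩ := z
  refine mk_congr ?_
  have h := lin_congr (iota_rightUnitor K 0) (tm _ _ z.val (reg 1))
  rw [rightUnitIso_tm, unreg_reg, _root_.map_one (K.X 0).right, comp_lin, comp_lin, tensMap_tm] at h
  exact h

end HPt

end Points

/-! ### The pointing of the homotopy category -/

section HoPointing

open HomotopyCategory GrBimod

variable {k R : Type} [CommRing k] [CommRing R] [Algebra k R] {𝒜 : ℤ → Submodule k R}

/-- The map induced by a homotopy class of maps of complexes, computed on a representative. -/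
noncomputable def HPt.hoMap {X Y : HoComplexes 𝒜} (f : X ⟶ Y) : HPt X.as → HPt Y.as :=
  HPt.map ((toHo 𝒜).map_surjective (X := X.as) (Y := Y.as) f).choose

theorem HPt.hoMap_map {K L : Complexes 𝒜} (f : K ⟶ L) (z : HPt K) :
    HPt.hoMap ((toHo 𝒜).map f) z = HPt.map f z :=
  HPt.map_eq_of_homotopy (homotopyOfEq _ _
    ((toHo 𝒜).map_surjective ((toHo 𝒜).map f)).choose_spec) z

variable [GradedAlgebra 𝒜]

variable (𝒜) in
/-- Multiplication by an element of degree zero, as an endomorphism of `R`. -/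
def regularEnd (a : R) (ha : a ∈ 𝒜 0) : regular 𝒜 ⟶ regular 𝒜 :=
  ⟨(regular 𝒜).left a, fun b m => mul_left_comm a b (unreg m), fun b m => (regular 𝒜).comm _ _ _,
    fun n m hm => by
      simpa using (regular 𝒜).left_mem ha hm⟩

/-- The identification of the term of degree zero of the unit complex with `R`. -/
noncomputable def unitOut : (𝟙_ (Complexes 𝒜)).X 0 ⟶ regular 𝒜 :=
  (HomologicalComplex.singleObjXSelf (ComplexShape.up ℤ) 0 (𝟙_ (GrBimod 𝒜))).hom

theorem unitOut_unitIn (b : regular 𝒜) : (unitOut (𝒜 := 𝒜)).lin (unitIn.lin b) = b :=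
  lin_congr (HomologicalComplex.singleObjXSelf (ComplexShape.up ℤ) 0
    (𝟙_ (GrBimod 𝒜))).inv_hom_id b

theorem unitIn_unitOut (z : (𝟙_ (Complexes 𝒜)).X 0) : unitIn.lin (unitOut.lin z) = z :=
  lin_congr (HomologicalComplex.singleObjXSelf (ComplexShape.up ℤ) 0
    (𝟙_ (GrBimod 𝒜))).hom_inv_id z

theorem unit_d (i j : ℤ) : (𝟙_ (Complexes 𝒜)).d i j = 0 :=
  HomologicalComplex.single_obj_d (ComplexShape.up ℤ) 0 (𝟙_ (GrBimod 𝒜)) i j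

theorem unit_hom_ext {f g : 𝟙_ (Complexes 𝒜) ⟶ 𝟙_ (Complexes 𝒜)}
    (h : (f.f 0).lin (unitIn.lin (reg 1)) = (g.f 0).lin (unitIn.lin (reg 1))) : f = g := by
  refine HomologicalComplex.from_single_hom_ext (hom_ext fun m => ?_)
  have hm : m = ((𝟙_ (Complexes 𝒜)).X 0).left (unreg (unitOut.lin m)) (unitIn.lin (reg 1)) := by
    rw [← hom_left, left_reg, mul_one, reg_unreg, unitIn_unitOut]
  have : (f.f 0).lin m = (g.f 0).lin m := by
    rw [hm, hom_left, hom_left, h]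
  exact this

/-- Both sides are identified with the elements of degree zero of `R`: the unit complex has zero
differential, so chain maps and their homotopy classes, and cycles and their classes, agree. -/
theorem end_unit_bijective : Function.Bijective
    fun f : 𝟙_ (HoComplexes 𝒜) ⟶ 𝟙_ (HoComplexes 𝒜) => HPt.hoMap f (HPt.one 𝒜) := by
  constructor
  · intro f g h
    obtain ⟨f, rfl⟩ := (toHo 𝒜).map_surjective (X := 𝟙_ (Complexes 𝒜)) (Y := 𝟙_ (Complexes 𝒜)) f
    obtain ⟨g, rfl⟩ := (toHo 𝒜).map_surjective (X := 𝟙_ (Complexes 𝒜)) (Y := 𝟙_ (Complexes 𝒜)) g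
    have h' : HPt.map f (HPt.one 𝒜) = HPt.map g (HPt.one 𝒜) :=
      (HPt.hoMap_map f _).symm.trans (h.trans (HPt.hoMap_map g _))
    obtain ⟨u, -, hu⟩ := HPt.mk_eq_mk.1 h'
    rw [unit_d] at hu
    rw [unit_hom_ext (sub_eq_zero.1 hu.symm)]
  · intro (z : HPt (𝟙_ (Complexes 𝒜)))
    obtain ⟨z⟩ := z
    change Cyc (𝟙_ (Complexes 𝒜)) at z
    let a : R := unreg (unitOut.lin z.val)
    have ha : a ∈ 𝒜 0 := unreg_mem (hom_mem _ z.mem)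
    refine ⟨(toHo 𝒜).map ((HomologicalComplex.single (GrBimod 𝒜) (ComplexShape.up ℤ) 0).map
      (regularEnd 𝒜 a ha)), (HPt.hoMap_map _ _).trans (HPt.mk_congr ?_)⟩
    have h := lin_congr (HomologicalComplex.single_map_f_self (c := ComplexShape.up ℤ) (0 : ℤ)
      (regularEnd 𝒜 a ha)) (unitIn.lin (reg 1))
    refine h.trans ?_
    change unitIn.lin ((regularEnd 𝒜 a ha).lin (unitOut.lin (unitIn.lin (reg 1)))) = z.val
    rw [unitOut_unitIn]
    change unitIn.lin ((regular 𝒜).left a (reg 1)) = z.val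
    rw [left_reg, mul_one, reg_unreg, unitIn_unitOut]

variable (𝒜) in
/-- The pointing of the homotopy category of complexes given by the part of internal degree zero of
the cohomology in degree zero. -/
noncomputable def hoPointing : Pointing (HoComplexes 𝒜) where
  obj X := HPt X.as
  map f := HPt.hoMap f
  map_id {X} z := (HPt.hoMap_map (𝟙 X.as) z).trans (HPt.map_id z)
  map_comp {X Y Z} f g z := by
    obtain ⟨f, rfl⟩ := (toHo 𝒜).map_surjective (X := X.as) (Y := Y.as) f
    obtain ⟨g, rfl⟩ := (toHo 𝒜).map_surjective (X := Y.as) (Y := Z.as) g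
    refine (HPt.hoMap_map (f ≫ g) z).trans ((HPt.map_comp f g z).trans ?_)
    exact (HPt.hoMap_map g _).symm.trans (congrArg _ (HPt.hoMap_map f z).symm)
  one := HPt.one 𝒜
  mul z w := HPt.mul z w
  map_mul {X Y X' Y'} f g z w := by
    obtain ⟨f, rfl⟩ := (toHo 𝒜).map_surjective (X := X.as) (Y := X'.as) f
    obtain ⟨g, rfl⟩ := (toHo 𝒜).map_surjective (X := Y.as) (Y := Y'.as) g
    refine (congrArg (fun t => HPt.hoMap t (HPt.mul z w)) (hoTensorHom_map f g)).trans ?_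
    refine (HPt.hoMap_map (f ⊗ₘ g) _).trans ((HPt.map_mul f g z w).trans ?_)
    exact (congrArg₂ _ (HPt.hoMap_map f z) (HPt.hoMap_map g w)).symm
  map_associator {X Y Z} z w v := (HPt.hoMap_map (α_ X.as Y.as Z.as).hom _).trans
    (HPt.map_associator z w v)
  map_leftUnitor {X} z := (HPt.hoMap_map (λ_ X.as).hom _).trans (HPt.map_leftUnitor z)
  map_rightUnitor {X} z := (HPt.hoMap_map (ρ_ X.as).hom _).trans (HPt.map_rightUnitor z)
  end_unit_bijective := end_unit_bijective

end HoPointing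

/-! ### Complexes decomposed into cells -/

section Cells

open GrBimod

variable {k R : Type} [CommRing k] [CommRing R] [Algebra k R] {𝒜 : ℤ → Submodule k R}

variable (𝒜) in
/-- A finite family of graded bimodules, the cells, each placed in a cohomological degree, with the
matrix of a differential. -/
structure CellData (J : Type) where
  deg : J → ℤ
  A : J → GrBimod 𝒜
  d : ∀ j l, A j ⟶ A l
  d_eq_zero : ∀ j l, deg l ≠ deg j + 1 → d j l = 0

variable {J J' : Type}

open Classical in
/-- The identity matrix. -/
noncomputable def cellId (A : J → GrBimod 𝒜) (j l : J) : A j ⟶ A l :=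
  if h : j = l then eqToHom (congrArg A h) else 0

theorem cellId_self (A : J → GrBimod 𝒜) (j : J) : cellId A j j = 𝟙 _ := dif_pos rfl

theorem cellId_ne (A : J → GrBimod 𝒜) {j l : J} (h : j ≠ l) : cellId A j l = 0 := dif_neg h

variable [Fintype J] [Fintype J']

theorem sum_cellId (A : J → GrBimod 𝒜) {M : GrBimod 𝒜} (f : ∀ j, A j ⟶ M) (j : J) :
    ∑ l, cellId A j l ≫ f l = f j := by
  rw [Finset.sum_eq_single j, cellId_self, Category.id_comp]
  · intro l _ hl
    rw [cellId_ne A hl.symm, zero_comp]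
  · exact fun h => (h (Finset.mem_univ _)).elim

/-- A decomposition of a complex into cells. The inclusions and projections are defined in all
degrees, and vanish outside of the degree of the cell. -/
structure Cells (D : CellData 𝒜 J) (K : Complexes 𝒜) where
  ι : ∀ j n, D.A j ⟶ K.X n
  π : ∀ j n, K.X n ⟶ D.A j
  ι_eq_zero : ∀ j n, D.deg j ≠ n → ι j n = 0
  π_eq_zero : ∀ j n, D.deg j ≠ n → π j n = 0
  ι_π_self : ∀ j, ι j (D.deg j) ≫ π j (D.deg j) = 𝟙 _
  ι_π_ne : ∀ j l n, j ≠ l → ι j n ≫ π l n = 0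
  total : ∀ n, ∑ j, π j n ≫ ι j n = 𝟙 _
  ι_d : ∀ j n, ι j n ≫ K.d n (n + 1) = ∑ l, D.d j l ≫ ι l (n + 1)

namespace Cells

variable {D : CellData 𝒜 J} {D' : CellData 𝒜 J'} {K L : Complexes 𝒜}

theorem hom_ext (c : Cells D K) {n : ℤ} {M : GrBimod 𝒜} {f g : K.X n ⟶ M}
    (h : ∀ j, D.deg j = n → c.ι j n ≫ f = c.ι j n ≫ g) : f = g := by
  rw [← Category.id_comp f, ← Category.id_comp g, ← c.total n, Preadditive.sum_comp,
    Preadditive.sum_comp]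
  refine Finset.sum_congr rfl fun j _ => ?_
  rw [Category.assoc, Category.assoc]
  by_cases hj : D.deg j = n
  · rw [h j hj]
  · rw [c.π_eq_zero j n hj, zero_comp, zero_comp]

/-- The map in degree `i`, `i'` with a given matrix. -/
noncomputable def matHom (c : Cells D K) (c' : Cells D' L) (m : ∀ j l, D.A j ⟶ D'.A l)
    (i i' : ℤ) : K.X i ⟶ L.X i' := ∑ j, c.π j i ≫ ∑ l, m j l ≫ c'.ι l i'

theorem ι_matHom (c : Cells D K) (c' : Cells D' L) (m : ∀ j l, D.A j ⟶ D'.A l) (i i' : ℤ)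
    (j : J) (hj : D.deg j = i) : c.ι j i ≫ c.matHom c' m i i' = ∑ l, m j l ≫ c'.ι l i' := by
  subst hj
  rw [matHom, Preadditive.comp_sum, Finset.sum_eq_single j]
  · rw [← Category.assoc, c.ι_π_self, Category.id_comp]
  · intro l _ hl
    rw [← Category.assoc, c.ι_π_ne _ _ _ hl.symm, zero_comp]
  · exact fun h => (h (Finset.mem_univ _)).elim

theorem ι_comp_sum (c' : Cells D' L) {J'' : Type} [Fintype J''] {B : GrBimod 𝒜}
    {A : J'' → GrBimod 𝒜} (m : ∀ j, B ⟶ A j) (m' : ∀ j l, A j ⟶ D'.A l) (n : ℤ) :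
    ∑ j, m j ≫ ∑ l, m' j l ≫ c'.ι l n = ∑ l, (∑ j, m j ≫ m' j l) ≫ c'.ι l n := by
  simp only [Preadditive.comp_sum, Preadditive.sum_comp, Category.assoc]
  exact Finset.sum_comm

theorem ι_d_matHom (c : Cells D K) (c' : Cells D' L) (m : ∀ j l, D.A j ⟶ D'.A l) (j : J)
    (n n' i : ℤ) (hj : D.deg j = n) (hn : n + 1 = n') :
    c.ι j n ≫ K.d n n' ≫ c.matHom c' m n' i =
      ∑ l, (∑ i, D.d j i ≫ m i l) ≫ c'.ι l i := by
  subst hn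
  rw [← Category.assoc, c.ι_d, Preadditive.sum_comp, ← ι_comp_sum]
  refine Finset.sum_congr rfl fun l _ => ?_
  rw [Category.assoc]
  by_cases hl : D.deg l = n + 1
  · rw [ι_matHom _ _ _ _ _ _ hl]
  · rw [D.d_eq_zero j l (by rw [hj]; exact hl), zero_comp, zero_comp]

theorem ι_matHom_d (c : Cells D K) (c' : Cells D' L) (m : ∀ j l, D.A j ⟶ D'.A l) (j : J)
    (n i i' : ℤ) (hj : D.deg j = n) (hi : i + 1 = i') :
    c.ι j n ≫ c.matHom c' m n i ≫ L.d i i' = ∑ l, (∑ i, m j i ≫ D'.d i l) ≫ c'.ι l i' := by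
  subst hi
  rw [← Category.assoc, ι_matHom _ _ _ _ _ _ hj, Preadditive.sum_comp, ← ι_comp_sum]
  refine Finset.sum_congr rfl fun l _ => ?_
  rw [Category.assoc, c'.ι_d]

theorem sum_ι_congr (c' : Cells D' L) {B : GrBimod 𝒜} {m m' : ∀ l, B ⟶ D'.A l} {n : ℤ}
    (h : ∀ l, D'.deg l = n → m l = m' l) :
    ∑ l, m l ≫ c'.ι l n = ∑ l, m' l ≫ c'.ι l n := by
  refine Finset.sum_congr rfl fun l _ => ?_
  by_cases hl : D'.deg l = n
  · rw [h l hl]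
  · rw [c'.ι_eq_zero l n hl, comp_zero, comp_zero]

/-- The map of complexes with a given matrix. Entries between cells of different degrees do not
matter. -/
noncomputable def map (c : Cells D K) (c' : Cells D' L) (m : ∀ j l, D.A j ⟶ D'.A l)
    (hd : ∀ j l, D'.deg l = D.deg j + 1 → ∑ i, D.d j i ≫ m i l = ∑ i, m j i ≫ D'.d i l) :
    K ⟶ L where
  f n := c.matHom c' m n n
  comm' n n' h := by
    refine c.hom_ext fun j hj => ?_
    rw [ι_matHom_d _ _ _ _ _ _ _ hj h, ι_d_matHom _ _ _ _ _ _ _ hj h]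
    exact (c'.sum_ι_congr fun l hl => hd j l (by rw [hj, hl]; exact h.symm)).symm

theorem ι_map (c : Cells D K) (c' : Cells D' L) (m : ∀ j l, D.A j ⟶ D'.A l)
    (hd : ∀ j l, D'.deg l = D.deg j + 1 → ∑ i, D.d j i ≫ m i l = ∑ i, m j i ≫ D'.d i l)
    (j : J) (n : ℤ) (hj : D.deg j = n) :
    c.ι j n ≫ (c.map c' m hd).f n = ∑ l, m j l ≫ c'.ι l n :=
  ι_matHom _ _ _ _ _ _ hj

/-- Homotopies from matrices. Only the entries of `h` that lower the degree by one are used. -/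
noncomputable def homotopy (c : Cells D K) (c' : Cells D' L) {f g : K ⟶ L}
    (mf mg h : ∀ j l, D.A j ⟶ D'.A l)
    (hf : ∀ j n, D.deg j = n → c.ι j n ≫ f.f n = ∑ l, mf j l ≫ c'.ι l n)
    (hg : ∀ j n, D.deg j = n → c.ι j n ≫ g.f n = ∑ l, mg j l ≫ c'.ι l n)
    (hh : ∀ j l, D'.deg l = D.deg j →
      mf j l = ∑ i, D.d j i ≫ h i l + ∑ i, h j i ≫ D'.d i l + mg j l) : Homotopy f g where
  hom n n' := if n' + 1 = n then c.matHom c' h n n' else 0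
  zero n n' hn := if_neg hn
  comm n := by
    rw [dNext_eq _ (show (ComplexShape.up ℤ).Rel n (n + 1) from rfl),
      prevD_eq _ (show (ComplexShape.up ℤ).Rel (n - 1) n by simp), if_pos rfl, if_pos (by omega)]
    refine c.hom_ext fun j hj => ?_
    rw [Preadditive.comp_add, Preadditive.comp_add, ι_d_matHom _ _ _ _ _ _ _ hj rfl,
      ι_matHom_d _ _ _ _ _ _ _ hj (by omega), hf j n hj, hg j n hj,
      ← Finset.sum_add_distrib, ← Finset.sum_add_distrib]
    simp only [← Preadditive.add_comp]
    exact c'.sum_ι_congr fun l hl => hh j l (by rw [hj, hl])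

theorem ι_map_comp_map (c : Cells D K) (c' : Cells D' L) (f : ∀ j l, D.A j ⟶ D'.A l)
    (g : ∀ j l, D'.A j ⟶ D.A l) (hf₀ : ∀ j l, D.deg j ≠ D'.deg l → f j l = 0)
    (hf : ∀ j l, D'.deg l = D.deg j + 1 → ∑ i, D.d j i ≫ f i l = ∑ i, f j i ≫ D'.d i l)
    (hg : ∀ j l, D.deg l = D'.deg j + 1 → ∑ i, D'.d j i ≫ g i l = ∑ i, g j i ≫ D.d i l)
    (j : J) (n : ℤ) (hj : D.deg j = n) :
    c.ι j n ≫ (c.map c' f hf ≫ c'.map c g hg).f n = ∑ l, (∑ i, f j i ≫ g i l) ≫ c.ι l n := by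
  rw [HomologicalComplex.comp_f, ← Category.assoc, ι_map _ _ _ _ _ _ hj, Preadditive.sum_comp,
    ← ι_comp_sum]
  refine Finset.sum_congr rfl fun l _ => ?_
  by_cases hl : D'.deg l = n
  · rw [Category.assoc, ι_map _ _ _ _ _ _ hl]
  · rw [hf₀ j l (by rw [hj]; exact Ne.symm hl), zero_comp, zero_comp, zero_comp]

theorem ι_id (c : Cells D K) (j : J) (n : ℤ) :
    c.ι j n ≫ (𝟙 K : K ⟶ K).f n = ∑ l, cellId D.A j l ≫ c.ι l n := by
  rw [sum_cellId, HomologicalComplex.id_f, Category.comp_id]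

/-- A homotopy equivalence from matrices: `g` after `f` is homotopic to the identity by way of
`h`, and `f` after `g` is equal to the identity. -/
noncomputable def hoIso (c : Cells D K) (c' : Cells D' L) (f : ∀ j l, D.A j ⟶ D'.A l)
    (g : ∀ j l, D'.A j ⟶ D.A l) (h : ∀ j l, D.A j ⟶ D.A l)
    (hf₀ : ∀ j l, D.deg j ≠ D'.deg l → f j l = 0) (hg₀ : ∀ j l, D'.deg j ≠ D.deg l → g j l = 0)
    (hf : ∀ j l, D'.deg l = D.deg j + 1 → ∑ i, D.d j i ≫ f i l = ∑ i, f j i ≫ D'.d i l)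
    (hg : ∀ j l, D.deg l = D'.deg j + 1 → ∑ i, D'.d j i ≫ g i l = ∑ i, g j i ≫ D.d i l)
    (hfg : ∀ j l, D.deg l = D.deg j → ∑ i, f j i ≫ g i l =
      ∑ i, D.d j i ≫ h i l + ∑ i, h j i ≫ D.d i l + cellId D.A j l)
    (hgf : ∀ j l, D'.deg l = D'.deg j → ∑ i, g j i ≫ f i l = cellId D'.A j l) :
    (toHo 𝒜).obj K ≅ (toHo 𝒜).obj L where
  hom := (toHo 𝒜).map (c.map c' f hf)
  inv := (toHo 𝒜).map (c'.map c g hg)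
  hom_inv_id := by
    rw [← (toHo 𝒜).map_comp, ← (toHo 𝒜).map_id]
    exact HomotopyCategory.eq_of_homotopy _ _ (homotopy c c (fun j l => ∑ i, f j i ≫ g i l)
      (cellId D.A) h (ι_map_comp_map c c' f g hf₀ hf hg) (fun j n _ => c.ι_id j n) hfg)
  inv_hom_id := by
    rw [← (toHo 𝒜).map_comp, ← (toHo 𝒜).map_id]
    refine HomotopyCategory.eq_of_homotopy _ _ (homotopy c' c' (fun j l => ∑ i, g j i ≫ f i l)
      (cellId D'.A) (fun _ _ => 0) (ι_map_comp_map c' c g f hg₀ hg hf) (fun j n _ => c'.ι_id j n)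
      fun j l hl => ?_)
    simp only [zero_comp, comp_zero, Finset.sum_const_zero, zero_add]
    exact hgf j l hl

end Cells

end Cells

/-! ### Cells of tensor products -/

section TensorCells

open GrBimod

variable {k R : Type} [CommRing k] [CommRing R] [Algebra k R] {𝒜 : ℤ → Submodule k R}
  {J J' : Type}

theorem GrBimod.sum_lin [Fintype J] {M N : GrBimod 𝒜} (f : J → (M ⟶ N)) (m : M) :
    (∑ j, f j).lin m = ∑ j, (f j).lin m :=
  map_sum ((⟨⟨fun f => f.lin m, rfl⟩, fun _ _ => rfl⟩ : (M ⟶ N) →+ N)) f Finset.univ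

variable [GradedAlgebra 𝒜]

theorem GrBimod.tensMap_zero_left {M M' N N' : GrBimod 𝒜} (g : N ⟶ N') :
    tensMap (0 : M ⟶ M') g = 0 := tens_hom_ext fun m n => by simp

theorem GrBimod.tensMap_zero_right {M M' N N' : GrBimod 𝒜} (f : M ⟶ M') :
    tensMap f (0 : N ⟶ N') = 0 := tens_hom_ext fun m n => by simp

theorem GrBimod.tensMap_sum_left [Fintype J] {M M' N N' : GrBimod 𝒜} (f : J → (M ⟶ M'))
    (g : N ⟶ N') :
    tensMap (∑ j, f j) g = ∑ j, tensMap (f j) g :=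
  tens_hom_ext fun m n => by simp [sum_lin]

theorem GrBimod.tensMap_sum_right [Fintype J] {M M' N N' : GrBimod 𝒜} (f : M ⟶ M')
    (g : J → (N ⟶ N')) :
    tensMap f (∑ j, g j) = ∑ j, tensMap f (g j) :=
  tens_hom_ext fun m n => by simp [sum_lin]

theorem CellData.tensor_d_eq_zero (D : CellData 𝒜 J) (D' : CellData 𝒜 J') (j l : J × J')
    (h : D.deg l.1 + D'.deg l.2 ≠ D.deg j.1 + D'.deg j.2 + 1) :
    tensMap (D.d j.1 l.1) (cellId D'.A j.2 l.2) +
      ((D.deg j.1).negOnePow : ℤ) • tensMap (cellId D.A j.1 l.1) (D'.d j.2 l.2) = 0 := by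
  have h1 : tensMap (D.d j.1 l.1) (cellId D'.A j.2 l.2) = 0 := by
    by_cases e : j.2 = l.2
    · rw [D.d_eq_zero j.1 l.1 (by rw [e] at h; omega), tensMap_zero_left]
    · rw [cellId_ne _ e, tensMap_zero_right]
  have h2 : tensMap (cellId D.A j.1 l.1) (D'.d j.2 l.2) = 0 := by
    by_cases e : j.1 = l.1
    · rw [D'.d_eq_zero j.2 l.2 (by rw [e] at h; omega), tensMap_zero_right]
    · rw [cellId_ne _ e, tensMap_zero_left]
  rw [h1, h2, smul_zero, add_zero]

/-- The cells of a tensor product. -/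
@[reducible]
noncomputable def CellData.tensor (D : CellData 𝒜 J) (D' : CellData 𝒜 J') :
    CellData 𝒜 (J × J') where
  deg j := D.deg j.1 + D'.deg j.2
  A j := tens (D.A j.1) (D'.A j.2)
  d j l := tensMap (D.d j.1 l.1) (cellId D'.A j.2 l.2) +
    ((D.deg j.1).negOnePow : ℤ) • tensMap (cellId D.A j.1 l.1) (D'.d j.2 l.2)
  d_eq_zero := CellData.tensor_d_eq_zero D D'

namespace Cells

variable [Fintype J] [Fintype J'] {D : CellData 𝒜 J} {D' : CellData 𝒜 J'} {K L : Complexes 𝒜}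
  (c : Cells D K) (c' : Cells D' L)

/-- The inclusion of a cell of a tensor product. -/
noncomputable def tensorι (j : J × J') (n : ℤ) : tens (D.A j.1) (D'.A j.2) ⟶ (K ⊗ L).X n :=
  if h : D.deg j.1 + D'.deg j.2 = n then
    tensMap (c.ι j.1 (D.deg j.1)) (c'.ι j.2 (D'.deg j.2)) ≫ iota K L _ _ n h else 0

/-- The projection to a cell of a tensor product. -/
noncomputable def tensorπ (j : J × J') (n : ℤ) : (K ⊗ L).X n ⟶ tens (D.A j.1) (D'.A j.2) :=
  tensorDesc fun a b _ => tensMap (c.π j.1 a) (c'.π j.2 b)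

theorem tensorι_eq (j : J) (j' : J') {a b n : ℤ} (ha : D.deg j = a) (hb : D'.deg j' = b)
    (h : a + b = n) :
    tensorι c c' (j, j') n = tensMap (c.ι j a) (c'.ι j' b) ≫ iota K L a b n h := by
  subst ha hb
  exact dif_pos h

theorem tensMap_comp_tensorι {M M' : GrBimod 𝒜} (j : J) (j' : J') {a b n : ℤ} (h : a + b = n)
    (f : M ⟶ D.A j) (g : M' ⟶ D'.A j') (ha : D.deg j ≠ a → f = 0) (hb : D'.deg j' ≠ b → g = 0) :
    tensMap f g ≫ tensorι c c' (j, j') n =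
      tensMap (f ≫ c.ι j a) (g ≫ c'.ι j' b) ≫ iota K L a b n h := by
  by_cases ha' : D.deg j = a
  · by_cases hb' : D'.deg j' = b
    · rw [tensorι_eq c c' j j' ha' hb' h, ← Category.assoc, tensMap_comp]
    · rw [hb hb', zero_comp, tensMap_zero_right, tensMap_zero_right, zero_comp, zero_comp]
  · rw [ha ha', zero_comp, tensMap_zero_left, tensMap_zero_left, zero_comp, zero_comp]

theorem tensorι_d (j : J × J') (n : ℤ) :
    tensorι c c' j n ≫ (K ⊗ L).d n (n + 1) =
      ∑ l, (D.tensor D').d j l ≫ tensorι c c' l (n + 1) := by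
  obtain ⟨j, j'⟩ := j
  by_cases h : D.deg j + D'.deg j' = n
  · have e1 : ∀ l l', tensMap (D.d j l) (cellId D'.A j' l') ≫ tensorι c c' (l, l') (n + 1) =
        tensMap (D.d j l ≫ c.ι l (D.deg j + 1)) (cellId D'.A j' l' ≫ c'.ι l' (D'.deg j')) ≫
          iota K L (D.deg j + 1) (D'.deg j') (n + 1) (by omega) := fun l l' =>
      tensMap_comp_tensorι c c' l l' _ _ _ (D.d_eq_zero j l)
        (fun e => cellId_ne _ fun e' => e (by rw [e']))
    have e2 : ∀ l l', tensMap (cellId D.A j l) (D'.d j' l') ≫ tensorι c c' (l, l') (n + 1) =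
        tensMap (cellId D.A j l ≫ c.ι l (D.deg j)) (D'.d j' l' ≫ c'.ι l' (D'.deg j' + 1)) ≫
          iota K L (D.deg j) (D'.deg j' + 1) (n + 1) (by omega) := fun l l' =>
      tensMap_comp_tensorι c c' l l' _ _ _ (fun e => cellId_ne _ fun e' => e (by rw [e']))
        (D'.d_eq_zero j' l')
    rw [tensorι_eq c c' j j' rfl rfl h, Category.assoc, iota_d, Preadditive.comp_add,
      Preadditive.comp_zsmul]
    simp only [Preadditive.add_comp, Preadditive.zsmul_comp, Finset.sum_add_distrib,
      Fintype.sum_prod_type, e1, e2, ← Finset.smul_sum, ← Preadditive.sum_comp,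
      ← tensMap_sum_right, ← tensMap_sum_left]
    rw [sum_cellId D'.A (fun l => c'.ι l (D'.deg j')), sum_cellId D.A (fun l => c.ι l (D.deg j)),
      ← c.ι_d, ← c'.ι_d, ← Category.assoc, ← Category.assoc, tensMap_comp, tensMap_comp,
      Category.comp_id, Category.comp_id]
  · rw [show tensorι c c' (j, j') n = 0 from dif_neg h, zero_comp]
    refine (Finset.sum_eq_zero fun l _ => ?_).symm
    by_cases hl : D.deg l.1 + D'.deg l.2 = n + 1
    · rw [(D.tensor D').d_eq_zero (j, j') l (by
        change D.deg l.1 + D'.deg l.2 ≠ D.deg j + D'.deg j' + 1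
        omega), zero_comp]
    · rw [show tensorι c c' l (n + 1) = 0 from dif_neg hl, comp_zero]

/-- The decomposition of a tensor product of complexes into the tensor products of cells. -/
noncomputable def tensor : Cells (D.tensor D') (K ⊗ L) where
  ι := tensorι c c'
  π := tensorπ c c'
  ι_eq_zero j n h := dif_neg h
  π_eq_zero j n h := tensor_X_hom_ext fun a b hab => by
    rw [comp_zero, tensorπ, iota_tensorDesc]
    by_cases ha : D.deg j.1 = a
    · rw [c'.π_eq_zero j.2 b (fun hb => h (by
        change D.deg j.1 + D'.deg j.2 = n
        rw [ha, hb, hab])), tensMap_zero_right]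
    · rw [c.π_eq_zero j.1 a ha, tensMap_zero_left]
  ι_π_self := by
    rintro ⟨j, j'⟩
    rw [tensorι_eq c c' j j' rfl rfl rfl, Category.assoc, tensorπ]
    refine (congrArg _ (iota_tensorDesc _ _ _ _)).trans ((tensMap_comp _ _ _ _).trans ?_)
    rw [c.ι_π_self, c'.ι_π_self]
    exact tensMap_id _ _
  ι_π_ne := by
    rintro ⟨j, j'⟩ ⟨l, l'⟩ n h
    by_cases hn : D.deg j + D'.deg j' = n
    · rw [tensorι_eq c c' j j' rfl rfl hn, Category.assoc, tensorπ]
      refine (congrArg _ (iota_tensorDesc _ _ _ _)).trans ((tensMap_comp _ _ _ _).trans ?_)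
      by_cases hj : j = l
      · rw [c'.ι_π_ne _ _ _ (fun h' => h (by rw [hj, h'])), tensMap_zero_right]
      · rw [c.ι_π_ne _ _ _ hj, tensMap_zero_left]
    · rw [show tensorι c c' (j, j') n = 0 from dif_neg hn, zero_comp]
  total n := tensor_X_hom_ext fun a b hab => by
    rw [Preadditive.comp_sum, Category.comp_id]
    have : ∀ j : J × J', iota K L a b n hab ≫ tensorπ c c' j n ≫ tensorι c c' j n =
        tensMap (c.π j.1 a ≫ c.ι j.1 a) (c'.π j.2 b ≫ c'.ι j.2 b) ≫ iota K L a b n hab := by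
      intro j
      rw [← tensMap_comp_tensorι c c' j.1 j.2 hab _ _ (c.π_eq_zero _ _) (c'.π_eq_zero _ _), tensorπ,
        ← Category.assoc, iota_tensorDesc]
    rw [Finset.sum_congr rfl fun j _ => this j, ← Preadditive.sum_comp, Fintype.sum_prod_type]
    simp only [← tensMap_sum_right, ← tensMap_sum_left]
    rw [c.total, c'.total, tensMap_id, Category.id_comp]
  ι_d := tensorι_d c c'

end Cells

end TensorCells

/-! ### Complexes with one or two cells -/

section DoubleCells

open GrBimod

variable {k R : Type} [CommRing k] [CommRing R] [Algebra k R] {𝒜 : ℤ → Submodule k R}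

/-- A map into `X a`, extended by zero to a family of maps into all `X n`. -/
noncomputable def place {A : GrBimod 𝒜} {X : ℤ → GrBimod 𝒜} {a : ℤ} (f : A ⟶ X a) (n : ℤ) :
    A ⟶ X n := if h : a = n then f ≫ eqToHom (congrArg X h) else 0

theorem place_self {A : GrBimod 𝒜} {X : ℤ → GrBimod 𝒜} {a : ℤ} (f : A ⟶ X a) : place f a = f := by
  rw [place, dif_pos rfl, eqToHom_refl, Category.comp_id]

theorem place_ne {A : GrBimod 𝒜} {X : ℤ → GrBimod 𝒜} {a n : ℤ} (f : A ⟶ X a) (h : a ≠ n) :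
    place f n = 0 := dif_neg h

/-- A map out of `X a`, extended by zero to a family of maps out of all `X n`. -/
noncomputable def coplace {A : GrBimod 𝒜} {X : ℤ → GrBimod 𝒜} {a : ℤ} (f : X a ⟶ A) (n : ℤ) :
    X n ⟶ A := if h : a = n then eqToHom (congrArg X h.symm) ≫ f else 0

theorem coplace_self {A : GrBimod 𝒜} {X : ℤ → GrBimod 𝒜} {a : ℤ} (f : X a ⟶ A) :
    coplace f a = f := by
  rw [coplace, dif_pos rfl, eqToHom_refl, Category.id_comp]

theorem coplace_ne {A : GrBimod 𝒜} {X : ℤ → GrBimod 𝒜} {a n : ℤ} (f : X a ⟶ A) (h : a ≠ n) :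
    coplace f n = 0 := dif_neg h

/-- A single cell. -/
@[reducible]
def singleData (M : GrBimod 𝒜) : CellData 𝒜 Unit where
  deg _ := 0
  A _ := M
  d _ _ := 0
  d_eq_zero _ _ _ := rfl

/-- The decomposition of a complex concentrated in degree zero. -/
noncomputable def singleCells (M : GrBimod 𝒜) :
    Cells (singleData M) ((HomologicalComplex.single (GrBimod 𝒜) (ComplexShape.up ℤ) 0).obj M) where
  ι _ := place (HomologicalComplex.singleObjXSelf (ComplexShape.up ℤ) 0 M).inv
  π _ := coplace (HomologicalComplex.singleObjXSelf (ComplexShape.up ℤ) 0 M).hom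
  ι_eq_zero _ _ h := place_ne _ h
  π_eq_zero _ _ h := coplace_ne _ h
  ι_π_self _ := by
    rw [place_self, coplace_self]
    exact Iso.inv_hom_id _
  ι_π_ne _ _ _ h := (h rfl).elim
  total n := by
    by_cases h : n = 0
    · subst h
      rw [Finset.univ_unique, Finset.sum_singleton, place_self, coplace_self]
      exact Iso.hom_inv_id _
    · exact (HomologicalComplex.isZero_single_obj_X (ComplexShape.up ℤ) 0 M n h).eq_of_src _ _
  ι_d _ n := by
    rw [HomologicalComplex.single_obj_d, comp_zero]
    exact (Finset.sum_eq_zero fun _ _ => zero_comp).symm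

/-- The two cells, in adjacent degrees, of a complex with two terms. -/
@[reducible]
def doubleData {M N : GrBimod 𝒜} (f : M ⟶ N) (a b : ℤ) (hab : a + 1 = b) : CellData 𝒜 Bool where
  deg
    | false => a
    | true => b
  A
    | false => M
    | true => N
  d
    | false, true => f
    | false, false => 0
    | true, false => 0
    | true, true => 0
  d_eq_zero
    | false, true => fun h => (h hab.symm).elim
    | false, false => fun _ => rfl
    | true, false => fun _ => rfl
    | true, true => fun _ => rfl

/-- The decomposition of a complex with two terms. -/
noncomputable def doubleCells {M N : GrBimod 𝒜} (f : M ⟶ N) (a b : ℤ) (hab : a + 1 = b)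
    (h : (ComplexShape.up ℤ).Rel a b) :
    Cells (doubleData f a b hab) (HomologicalComplex.double f h) where
  ι
    | false => place (HomologicalComplex.doubleXIso₀ f h).inv
    | true => place (HomologicalComplex.doubleXIso₁ f h (by omega)).inv
  π
    | false => coplace (HomologicalComplex.doubleXIso₀ f h).hom
    | true => coplace (HomologicalComplex.doubleXIso₁ f h (by omega)).hom
  ι_eq_zero
    | false, _ => place_ne _
    | true, _ => place_ne _
  π_eq_zero
    | false, _ => coplace_ne _
    | true, _ => coplace_ne _
  ι_π_self
    | false => by
      dsimp only
      rw [place_self, coplace_self]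
      exact Iso.inv_hom_id _
    | true => by
      dsimp only
      rw [place_self, coplace_self]
      exact Iso.inv_hom_id _
  ι_π_ne
    | false, false, _, h => (h rfl).elim
    | true, true, _, h => (h rfl).elim
    | false, true, n, _ => by
      by_cases hn : a = n
      · exact (congrArg _ (coplace_ne _ (by omega))).trans comp_zero
      · exact (congrArg (· ≫ _) (place_ne _ hn)).trans zero_comp
    | true, false, n, _ => by
      by_cases hn : a = n
      · exact (congrArg (· ≫ _) (place_ne _ (by omega))).trans zero_comp
      · exact (congrArg _ (coplace_ne _ hn)).trans comp_zero
  total n := by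
    rw [Fintype.sum_bool]
    by_cases ha : a = n
    · subst ha
      dsimp only
      rw [place_self, coplace_self, place_ne _ (by omega), comp_zero, zero_add]
      exact Iso.hom_inv_id _
    · by_cases hb : b = n
      · subst hb
        dsimp only
        rw [place_self, coplace_self, place_ne _ (by omega), comp_zero, add_zero]
        exact Iso.hom_inv_id _
      · exact (HomologicalComplex.isZero_double_X f h n (Ne.symm ha) (Ne.symm hb)).eq_of_src _ _
  ι_d
    | false, n => by
      rw [Fintype.sum_bool]
      dsimp only
      rw [zero_comp, add_zero]
      by_cases ha : a = n
      · subst ha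
        subst hab
        rw [place_self, place_self, HomologicalComplex.double_d f h (by omega),
          Iso.inv_hom_id_assoc]
      · rw [place_ne _ ha, place_ne _ (by omega), zero_comp, comp_zero]
    | true, n => by
      rw [Fintype.sum_bool]
      dsimp only
      rw [zero_comp, zero_comp, add_zero]
      by_cases hb : b = n
      · subst hb
        rw [place_self, HomologicalComplex.double_d_eq_zero₀ _ _ _ _ (by omega), comp_zero]
      · rw [place_ne _ hb, zero_comp]

end DoubleCells

/-! ### Classes supported on a cell -/

section CellPoints

open GrBimod

variable {k R : Type} [CommRing k] [CommRing R] [Algebra k R] {𝒜 : ℤ → Submodule k R}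
  {J J' : Type} {D : CellData 𝒜 J} {D' : CellData 𝒜 J'}

theorem CellData.tensor_d_tm [GradedAlgebra 𝒜] {j : J} {e : D.A j}
    (hd : ∀ l, (D.d j l).lin e = 0) {j' : J'} {e' : D'.A j'} (hd' : ∀ l, (D'.d j' l).lin e' = 0)
    (l : J × J') : ((D.tensor D').d (j, j') l).lin (tm _ _ e e') = 0 := by
  have := hd l.1
  have := hd' l.2
  simp_all [zsmul_lin]

variable [Fintype J] [Fintype J'] {K L : Complexes 𝒜}

/-- The cycle given by an element of a cell. It is zero if the cell does not lie in degree zero. -/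
def Cells.cyc (c : Cells D K) (j : J) (e : D.A j) (he : e ∈ (D.A j).gr 0)
    (hd : ∀ l, (D.d j l).lin e = 0) : Cyc K where
  val := (c.ι j 0).lin e
  mem := hom_mem _ he
  cycle := by
    have h := lin_congr (c.ι_d j 0) e
    rw [sum_lin] at h
    refine h.trans (Finset.sum_eq_zero fun l _ => ?_)
    rw [comp_lin, hd, map_zero]

/-- A map of complexes with matrix `m` maps the class of `e` to that of `e'` if its entries in
degree zero map `e` to `e'` in one cell and to zero in all others. -/
theorem Cells.map_cyc (c : Cells D K) (c' : Cells D' L) (m : ∀ j l, D.A j ⟶ D'.A l)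
    (hm : ∀ j l, D'.deg l = D.deg j + 1 → ∑ i, D.d j i ≫ m i l = ∑ i, m j i ≫ D'.d i l)
    {j : J} (hj : D.deg j = 0) {e : D.A j} (he : e ∈ (D.A j).gr 0) (hd : ∀ l, (D.d j l).lin e = 0)
    {l : J'} {e' : D'.A l} (he' : e' ∈ (D'.A l).gr 0) (hd' : ∀ i, (D'.d l i).lin e' = 0)
    (h : (m j l).lin e = e') (h₀ : ∀ i, i ≠ l → D'.deg i = 0 → (m j i).lin e = 0) :
    HPt.map (c.map c' m hm) (HPt.mk (c.cyc j e he hd)) = HPt.mk (c'.cyc l e' he' hd') := by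
  refine HPt.mk_congr ?_
  have h1 := lin_congr (c.ι_map c' m hm j 0 hj) e
  rw [sum_lin] at h1
  refine h1.trans ((Finset.sum_eq_single l (fun i _ hi => ?_)
    (fun h => (h (Finset.mem_univ _)).elim)).trans ?_)
  · by_cases hi' : D'.deg i = 0
    · rw [comp_lin, h₀ i hi hi', map_zero]
    · rw [comp_lin, c'.ι_eq_zero i 0 hi', zero_lin]
  · rw [comp_lin, h]
    rfl

variable [GradedAlgebra 𝒜]

theorem Cells.mulCyc_cyc (c : Cells D K) (c' : Cells D' L) {j : J} (hj : D.deg j = 0)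
    {e : D.A j} (he : e ∈ (D.A j).gr 0) (hd : ∀ l, (D.d j l).lin e = 0) {j' : J'}
    (hj' : D'.deg j' = 0)
    {e' : D'.A j'} (he' : e' ∈ (D'.A j').gr 0) (hd' : ∀ l, (D'.d j' l).lin e' = 0)
    (he₂ : tm _ _ e e' ∈ (tens (D.A j) (D'.A j')).gr 0) :
    HPt.mul (HPt.mk (c.cyc j e he hd)) (HPt.mk (c'.cyc j' e' he' hd')) =
      HPt.mk ((c.tensor c').cyc (j, j') (tm _ _ e e') he₂ (CellData.tensor_d_tm hd hd')) := by
  refine HPt.mk_congr ?_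
  have := lin_congr (c.tensorι_eq c' j j' hj hj' (zero_add 0)) (tm _ _ e e')
  rw [comp_lin, tensMap_tm] at this
  exact this.symm

end CellPoints

/-! ### Demazure operators -/

section Demazure

variable {r : ℕ}

theorem self_add_one_ne (hr : 3 ≤ r) (i : ZMod r) : i + 1 ≠ i := by
  have : Fact (1 < r) := ⟨by omega⟩
  simp

theorem root_ne_zero (hr : 3 ≤ r) (i : ZMod r) : root i ≠ 0 := by
  intro h
  have h' := congrArg (MvPolynomial.eval fun v => if v = some (i + 1) then (1 : ℚ) else 0) h
  have hw : MvPolynomial.eval (fun v => if v = some (i + 1) then (1 : ℚ) else 0) (wrap i) = 0 := by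
    unfold wrap
    split_ifs <;> simp [y]
  simp [root, x, hw, (self_add_one_ne hr i).symm] at h'

/-- The reflection `σ_i` changes every variable by a multiple of the root. -/
theorem exists_sigmaHom_X (i : ZMod r) (v : Option (ZMod r)) :
    ∃ c : ℚ, sigmaHom i (MvPolynomial.X v) = MvPolynomial.X v - MvPolynomial.C c * root i := by
  cases v with
  | none => exact ⟨0, by rw [MvPolynomial.C_0, zero_mul, sub_zero]; exact sigmaHom_y i⟩
  | some j =>
    by_cases h : j = i
    · refine ⟨-1, (sigmaHom_x i j).trans ?_⟩
      rw [if_pos h, root, ← h, MvPolynomial.C_neg, MvPolynomial.C_1]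
      change _ = x j - _
      ring
    · by_cases h' : j = i + 1
      · refine ⟨1, (sigmaHom_x i j).trans ?_⟩
        rw [if_neg h, if_pos h', root, ← h', MvPolynomial.C_1]
        change _ = x j - _
        ring
      · refine ⟨0, (sigmaHom_x i j).trans ?_⟩
        rw [if_neg h, if_neg h', MvPolynomial.C_0, zero_mul, sub_zero]
        rfl

theorem root_dvd_sub (i : ZMod r) (f : Poly r) : root i ∣ f - sigmaHom i f := by
  induction f using MvPolynomial.induction_on with
  | C c =>
    have : sigmaHom i (MvPolynomial.C c) = MvPolynomial.C c := (sigmaHom i).commutes c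
    rw [this, sub_self]
    exact dvd_zero _
  | add f g hf hg =>
    rw [map_add, add_sub_add_comm]
    exact dvd_add hf hg
  | mul_X f v hf =>
    obtain ⟨c, hc⟩ := exists_sigmaHom_X i v
    rw [map_mul, hc, show f * MvPolynomial.X v - sigmaHom i f *
      (MvPolynomial.X v - MvPolynomial.C c * root i) = (f - sigmaHom i f) * MvPolynomial.X v +
        sigmaHom i f * MvPolynomial.C c * root i by ring]
    exact dvd_add (hf.mul_right _) (Dvd.intro_left _ rfl)

/-- The Demazure operator `f ↦ (f - σ_i f) / X_i`, as a function. -/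
noncomputable def demFun (i : ZMod r) (f : Poly r) : Poly r := (root_dvd_sub i f).choose

theorem root_mul_demFun (i : ZMod r) (f : Poly r) : root i * demFun i f = f - sigmaHom i f :=
  (root_dvd_sub i f).choose_spec.symm

theorem demFun_unique (hr : 3 ≤ r) {i : ZMod r} {f g : Poly r}
    (h : root i * g = f - sigmaHom i f) : demFun i f = g :=
  mul_left_cancel₀ (root_ne_zero hr i) ((root_mul_demFun i f).trans h.symm)

/-- The Demazure operator `f ↦ (f - σ_i f) / X_i`. -/
noncomputable def dem (hr : 3 ≤ r) (i : ZMod r) : Poly r →ₗ[ℚ] Poly r where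
  toFun := demFun i
  map_add' f g := demFun_unique hr (by
    rw [mul_add, root_mul_demFun, root_mul_demFun, map_add]; ring)
  map_smul' c f := demFun_unique hr (by
    rw [RingHom.id_apply, mul_smul_comm, root_mul_demFun, smul_sub, map_smul])

theorem root_mul_dem (hr : 3 ≤ r) (i : ZMod r) (f : Poly r) :
    root i * dem hr i f = f - sigmaHom i f := root_mul_demFun i f

theorem dem_eq (hr : 3 ≤ r) {i : ZMod r} {f g : Poly r}
    (h : root i * g = f - sigmaHom i f) : dem hr i f = g := demFun_unique hr h

theorem dem_of_mem (hr : 3 ≤ r) {i : ZMod r} {f : Poly r} (hf : f ∈ fixedRing i) :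
    dem hr i f = 0 := dem_eq hr (by rw [mem_fixedRing.1 hf, sub_self, mul_zero])

theorem dem_one (hr : 3 ≤ r) (i : ZMod r) : dem hr i 1 = 0 := dem_of_mem hr (one_mem _)

theorem dem_mul (hr : 3 ≤ r) {i : ZMod r} {f : Poly r} (hf : f ∈ fixedRing i) (g : Poly r) :
    dem hr i (f * g) = f * dem hr i g := dem_eq hr (by
  rw [mul_left_comm, root_mul_dem, map_mul, mem_fixedRing.1 hf, mul_sub])

theorem dem_root (hr : 3 ≤ r) (i : ZMod r) : dem hr i (root i) = 2 := dem_eq hr (by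
  rw [sigmaHom_root hr]; ring)

theorem sigmaHom_sigmaHom (hr : 3 ≤ r) (i : ZMod r) (f : Poly r) :
    sigmaHom i (sigmaHom i f) = f := by
  have : (sigmaHom i).comp (sigmaHom i) = AlgHom.id ℚ (Poly r) :=
      MvPolynomial.algHom_ext fun v => by
    obtain ⟨c, hc⟩ := exists_sigmaHom_X i v
    have hC : sigmaHom i (MvPolynomial.C c) = MvPolynomial.C c := (sigmaHom i).commutes c
    rw [AlgHom.comp_apply, hc, map_sub, hc, map_mul, sigmaHom_root hr, hC, AlgHom.id_apply]
    ring
  exact congrArg (fun F => F f) this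

theorem dem_mem (hr : 3 ≤ r) (i : ZMod r) (f : Poly r) : dem hr i f ∈ fixedRing i := by
  refine mem_fixedRing.2 (mul_left_cancel₀ (root_ne_zero hr i) ?_)
  have h := congrArg (sigmaHom i) (root_mul_dem hr i f)
  rw [map_mul, sigmaHom_root hr, map_sub, sigmaHom_sigmaHom hr] at h
  rw [root_mul_dem]
  linear_combination -h

/-- Multiplication by a root is injective and shifts the homogeneous components, so a quotient of a
homogeneous element by a root is homogeneous. -/
theorem mem_polyGr_of_root_mul (hr : 3 ≤ r) {i : ZMod r} {n : ℤ} {g : Poly r}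
    (h : root i * g ∈ polyGr r n) : g ∈ polyGr r (n - 2) := by
  have key : ∀ g : Poly r, ∀ m, components polyGr_internal (root i * g) (m + 2) =
      root i * components polyGr_internal g m := by
    intro g m
    induction g using homogeneous_induction polyGr_internal with
    | h₀ => simp
    | hh d g hg =>
      have h' := SetLike.mul_mem_graded (root_mem i) hg
      rw [components_of_mem _ hg, components_of_mem _ h', Finsupp.single_apply,
        Finsupp.single_apply]
      by_cases e : d = m
      · rw [if_pos e, if_pos (by omega)]
      · rw [if_neg e, if_neg (by omega), mul_zero]
    | ha g g' h h' =>
      rw [mul_add, map_add (components polyGr_internal), map_add (components polyGr_internal),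
        Finsupp.add_apply, Finsupp.add_apply, mul_add, h, h']
  have hz : ∀ m, m ≠ n - 2 → components polyGr_internal g m = 0 := fun m hm =>
    mul_left_cancel₀ (root_ne_zero hr i) (by
      rw [← key, components_of_mem _ h, Finsupp.single_apply, if_neg (by omega), mul_zero])
  have hs : components polyGr_internal g = Finsupp.single (n - 2)
      (components polyGr_internal g (n - 2)) := by
    ext1 m
    by_cases e : m = n - 2
    · rw [e, Finsupp.single_eq_same]
    · rw [hz m e, Finsupp.single_apply, if_neg (Ne.symm e)]
  have := components_sum polyGr_internal g
  rw [hs, Finsupp.sum_single_index rfl] at this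
  rw [← this]
  exact components_mem _ _ _

theorem dem_mem_polyGr (hr : 3 ≤ r) (i : ZMod r) {n : ℤ} {f : Poly r} (hf : f ∈ polyGr r n) :
    dem hr i f ∈ polyGr r (n - 2) := mem_polyGr_of_root_mul hr (i := i) (by
  rw [root_mul_dem]
  exact sub_mem hf (sigmaHom_mem i hf))

/-- The elements `1` and `p` form a basis of the polynomial ring over the `σ_i`-invariants; here
`f = (f + ∂f p) - ∂f p`. -/
theorem add_dem_mul_mem (hr : 3 ≤ r) {i : ZMod r} {p : Poly r} (hp : sigmaHom i p = p + root i)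
    (f : Poly r) : f + dem hr i f * p ∈ fixedRing i := by
  rw [mem_fixedRing, map_add, map_mul, mem_fixedRing.1 (dem_mem hr i f), hp]
  linear_combination root_mul_dem hr i f

theorem dem_of_sigmaHom (hr : 3 ≤ r) {i : ZMod r} {p : Poly r} (hp : sigmaHom i p = p + root i) :
    dem hr i p = -1 := dem_eq hr (by rw [hp]; ring)

/-- If the polynomial ring is `A + A q` for a ring `A` of `σ_i`-invariants and an element `q` that
is not invariant, then `A` consists of all `σ_i`-invariants. -/
theorem fixedRing_le_of_basis {i : ZMod r} {A : Subalgebra ℚ (Poly r)} (hA : A ≤ fixedRing i)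
    {q : Poly r} (hq : sigmaHom i q ≠ q) (hqq : ∃ a ∈ A, ∃ b ∈ A, q * q = a + b * q)
    (hX : ∀ v, ∃ a ∈ A, ∃ b ∈ A, MvPolynomial.X v = a + b * q) : fixedRing i ≤ A := by
  have all : ∀ f : Poly r, ∃ a ∈ A, ∃ b ∈ A, f = a + b * q := by
    intro f
    induction f using MvPolynomial.induction_on with
    | C c => exact ⟨_, A.algebraMap_mem c, 0, A.zero_mem, by rw [zero_mul, add_zero]; rfl⟩
    | add f g hf hg =>
      obtain ⟨a, ha, b, hb, rfl⟩ := hf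
      obtain ⟨a', ha', b', hb', rfl⟩ := hg
      exact ⟨a + a', A.add_mem ha ha', b + b', A.add_mem hb hb', by ring⟩
    | mul_X f v hf =>
      obtain ⟨a, ha, b, hb, rfl⟩ := hf
      obtain ⟨a', ha', b', hb', hv⟩ := hX v
      obtain ⟨a'', ha'', b'', hb'', hq'⟩ := hqq
      refine ⟨a * a' + b * b' * a'',
        A.add_mem (A.mul_mem ha ha') (A.mul_mem (A.mul_mem hb hb') ha''),
        a * b' + b * a' + b * b' * b'', A.add_mem (A.add_mem (A.mul_mem ha hb') (A.mul_mem hb ha'))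
          (A.mul_mem (A.mul_mem hb hb') hb''), ?_⟩
      rw [hv]
      linear_combination b * b' * hq'
  intro f hf
  obtain ⟨a, ha, b, hb, rfl⟩ := all f
  rw [mem_fixedRing, map_add, map_mul, mem_fixedRing.1 (hA ha), mem_fixedRing.1 (hA hb)] at hf
  have hb0 : b * (sigmaHom i q - q) = 0 := by linear_combination hf
  rcases mul_eq_zero.1 hb0 with h | h
  · rw [h, zero_mul, add_zero]
    exact ha
  · exact (hq (sub_eq_zero.1 h)).elim

end Demazure

/-! ### Invariants of pairs of reflections -/

section RankTwo

variable {r : ℕ}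

/-- The `σ_t`-invariants are generated by `p` and by the elements invariant under both `σ_s` and
`σ_t`. -/
abbrev GenFixed (s t : ZMod r) (p : Poly r) : Prop :=
  fixedRing t ≤ Algebra.adjoin ℚ (insert p (fixedRing s ⊓ fixedRing t : Subalgebra ℚ (Poly r)))

/-- It suffices that `1` and some `q` generate the polynomial ring as a module over the algebra
generated by `p` and the common invariants. For the variables this follows from a condition on
linear forms, since the reflections change a variable by multiples of the roots. -/
theorem genFixed_of {s t : ZMod r} {p q : Poly r} (hp : p ∈ fixedRing t)
    (hq : sigmaHom t q ≠ q)
    (hqq : ∃ a ∈ Algebra.adjoin ℚ (insert p (fixedRing s ⊓ fixedRing t : Subalgebra ℚ (Poly r)) :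
        Set (Poly r)), ∃ b ∈ Algebra.adjoin ℚ
        (insert p (fixedRing s ⊓ fixedRing t : Subalgebra ℚ (Poly r)) : Set (Poly r)),
        q * q = a + b * q)
    (hX : ∀ f : Poly r, ∀ c d : ℚ, sigmaHom s f = f - MvPolynomial.C c * root s →
      sigmaHom t f = f - MvPolynomial.C d * root t → ∃ b c : ℚ,
        f - MvPolynomial.C b * p - MvPolynomial.C c * q ∈ fixedRing s ⊓ fixedRing t) :
    GenFixed s t p := by
  have hsub : (fixedRing s ⊓ fixedRing t : Subalgebra ℚ (Poly r)) ≤ Algebra.adjoin ℚ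
      (insert p (fixedRing s ⊓ fixedRing t : Subalgebra ℚ (Poly r))) := fun z hz =>
    Algebra.subset_adjoin (Or.inr hz)
  refine fixedRing_le_of_basis (Algebra.adjoin_le ?_) hq hqq fun v => ?_
  · rintro z (rfl | hz)
    · exact hp
    · exact hz.2
  · obtain ⟨c, hc⟩ := exists_sigmaHom_X s v
    obtain ⟨d, hd⟩ := exists_sigmaHom_X t v
    obtain ⟨a, b, h⟩ := hX _ c d hc hd
    refine ⟨(MvPolynomial.X v - MvPolynomial.C a * p - MvPolynomial.C b * q) +
      MvPolynomial.C a * p, add_mem (hsub h) (mul_mem (Subalgebra.algebraMap_mem _ a)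
        (Algebra.subset_adjoin (Or.inl rfl))), MvPolynomial.C b, Subalgebra.algebraMap_mem _ b, ?_⟩
    ring

theorem sigmaHom_C (i : ZMod r) (c : ℚ) : sigmaHom i (MvPolynomial.C c) = MvPolynomial.C c :=
  (sigmaHom i).commutes c

/-- Two indices modulo `r` are distant: they are neither equal nor adjacent. -/
structure Distant (s t : ZMod r) : Prop where
  ne : s ≠ t
  ne_left : s ≠ t + 1
  ne_right : t ≠ s + 1

theorem Distant.symm {s t : ZMod r} (h : Distant s t) : Distant t s :=
  ⟨h.ne.symm, h.ne_right, h.ne_left⟩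

theorem sigmaHom_x_self (s : ZMod r) : sigmaHom s (x s) = x s + root s := by
  rw [sigmaHom_x, if_pos rfl, root]
  ring

theorem Distant.x_mem {s t : ZMod r} (h : Distant s t) : x s ∈ fixedRing t := by
  rw [mem_fixedRing, sigmaHom_x, if_neg h.ne, if_neg h.ne_left]

theorem Distant.root_mem {s t : ZMod r} (h : Distant s t) : root s ∈ fixedRing t := by
  have h' : x (s + 1) ∈ fixedRing t := by
    rw [mem_fixedRing, sigmaHom_x, if_neg h.ne_right.symm,
      if_neg fun e => h.ne (add_right_cancel e)]
  exact sub_mem (sub_mem h' h.x_mem) (sigmaHom_wrap t s)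

theorem Distant.genFixed (hr : 3 ≤ r) {s t : ZMod r} (h : Distant s t) : GenFixed s t (x s) := by
  have hb := h.symm.root_mem
  have ha := h.root_mem
  have hq := h.symm.x_mem
  have hp := h.x_mem
  rw [mem_fixedRing] at hb ha hq hp
  refine genFixed_of (q := x t) hp ?_ ?_ ?_
  · rw [sigmaHom_x_self]
    exact fun e => root_ne_zero hr t (by linear_combination e)
  · refine ⟨-(x t * (x t + root t)), Algebra.subset_adjoin (Or.inr ⟨?_, ?_⟩),
      x t + (x t + root t), Algebra.subset_adjoin (Or.inr ⟨?_, ?_⟩), by ring⟩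
    · refine mem_fixedRing.2 ?_
      simp only [map_neg, map_mul, map_add, hq, hb]
    · refine mem_fixedRing.2 ?_
      simp only [map_neg, map_mul, map_add, sigmaHom_x_self, sigmaHom_root hr]
      ring
    · refine mem_fixedRing.2 ?_
      simp only [map_add, hq, hb]
    · refine mem_fixedRing.2 ?_
      simp only [map_add, sigmaHom_x_self, sigmaHom_root hr]
      ring
  · intro f c d hc hd
    refine ⟨-c, -d, ?_, ?_⟩
    · refine mem_fixedRing.2 ?_
      simp only [map_neg, map_sub, map_mul, hc, sigmaHom_C, sigmaHom_x_self, hq]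
      ring
    · refine mem_fixedRing.2 ?_
      simp only [map_neg, map_sub, map_mul, hd, sigmaHom_C, sigmaHom_x_self, hp]
      ring

/-- Three linear forms with sum zero, spanning the reflection representation of the symmetric group
generated by the reflections `σ_s` and `σ_t`: they are permuted by this group, `σ_s` exchanging `p`
and `q` and `σ_t` exchanging `q` and `u`. -/
structure Triple (s t : ZMod r) (p q u : Poly r) : Prop where
  sum : p + q + u = 0
  root_left : root s = q - p
  root_right : root t = u - q
  s_p : sigmaHom s p = q
  s_q : sigmaHom s q = p
  s_u : sigmaHom s u = u
  t_p : sigmaHom t p = p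
  t_q : sigmaHom t q = u
  t_u : sigmaHom t u = q
  p_mem : p ∈ polyGr r 2
  q_mem : q ∈ polyGr r 2
  u_mem : u ∈ polyGr r 2

/-- The three forms are the weights of the standard representation, which are thirds of integral
combinations of the roots. -/
theorem exists_triple (hr : 3 ≤ r) {s t : ZMod r} (hst : sigmaHom s (root t) = root s + root t)
    (hts : sigmaHom t (root s) = root s + root t) : ∃ p q u, Triple s t p q u := by
  have h3 : (MvPolynomial.C (1 / 3) : Poly r) * 3 = 1 := by
    rw [show (3 : Poly r) = MvPolynomial.C 3 from rfl, ← MvPolynomial.C_mul]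
    norm_num
  have hs := sigmaHom_root hr s
  have ht := sigmaHom_root hr t
  have hm : ∀ f ∈ polyGr r 2, MvPolynomial.C (1 / 3) * f ∈ polyGr r 2 := fun f hf => by
    rw [MvPolynomial.C_mul']
    exact Submodule.smul_mem _ _ hf
  have ha := root_mem s
  have hb := root_mem t
  refine ⟨MvPolynomial.C (1 / 3) * -(root s + root s + root t),
    MvPolynomial.C (1 / 3) * (root s - root t),
    MvPolynomial.C (1 / 3) * (root s + root t + root t), ⟨?_, ?_, ?_, ?_, ?_, ?_, ?_, ?_, ?_,
      hm _ (neg_mem (add_mem (add_mem ha ha) hb)), hm _ (sub_mem ha hb),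
      hm _ (add_mem (add_mem ha hb) hb)⟩⟩
  · ring
  · linear_combination -root s * h3
  · linear_combination -root t * h3
  all_goals
    simp only [map_mul, map_neg, map_add, map_sub, sigmaHom_C, hs, ht, hst, hts]
    ring

theorem exists_triple_succ (hr : 3 ≤ r) (i : ZMod r) :
    (∃ p q u, Triple i (i + 1) p q u) ∧ ∃ p q u, Triple (i + 1) i p q u := by
  have h1 : i + 1 ≠ i := self_add_one_ne hr i
  have h2 : i + 1 + 1 ≠ i := by
    intro h
    have h2 : ((2 : ℕ) : ZMod r) = 0 := by
      push_cast
      linear_combination h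
    rw [ZMod.natCast_eq_zero_iff] at h2
    exact absurd (Nat.le_of_dvd (by norm_num) h2) (by omega)
  have h3 : i + 1 + 1 ≠ i + 1 := self_add_one_ne hr (i + 1)
  have e1 : sigmaHom (i + 1) (root i) = root i + root (i + 1) := by
    simp only [root, map_sub, sigmaHom_wrap, sigmaHom_x, if_true, if_neg h1.symm, if_neg h2.symm]
    ring
  have e2 : sigmaHom i (root (i + 1)) = root i + root (i + 1) := by
    simp only [root, map_sub, sigmaHom_wrap, sigmaHom_x, if_true, if_neg h1, if_neg h2, if_neg h3]
    ring
  exact ⟨exists_triple hr e2 e1, exists_triple hr (by rw [e1, add_comm]) (by rw [e2, add_comm])⟩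

namespace Triple

variable {s t : ZMod r} {p q u : Poly r}

theorem genFixed (hr : 3 ≤ r) (h : Triple s t p q u) : GenFixed s t p := by
  refine genFixed_of h.t_p ?_ ?_ ?_ (q := q)
  · rw [h.t_q]
    exact fun e => root_ne_zero hr t (by rw [h.root_right, e, sub_self])
  · have hp : p ∈ Algebra.adjoin ℚ
        (insert p (fixedRing s ⊓ fixedRing t : Subalgebra ℚ (Poly r)) : Set (Poly r)) :=
      Algebra.subset_adjoin (Or.inl rfl)
    -- `q` is a root of `X² + p X + (p² + e)`, where `e` is the second elementary symmetric function
    refine ⟨-(p * q + q * u + u * p) + -(p * p),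
      add_mem (Algebra.subset_adjoin (Or.inr ⟨?_, ?_⟩)) (neg_mem (mul_mem hp hp)), -p,
      neg_mem hp, ?_⟩
    · refine mem_fixedRing.2 ?_
      simp only [map_neg, map_mul, map_add, h.s_p, h.s_q, h.s_u]
      ring
    · refine mem_fixedRing.2 ?_
      simp only [map_neg, map_mul, map_add, h.t_p, h.t_q, h.t_u]
      ring
    · linear_combination (p + q) * h.sum
  · intro f c d hc hd
    refine ⟨-d - c, -d, ?_, ?_⟩
    · refine mem_fixedRing.2 ?_
      simp only [map_neg, map_sub, map_mul, hc, sigmaHom_C, h.s_p, h.s_q, h.root_left]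
      ring
    · refine mem_fixedRing.2 ?_
      simp only [map_neg, map_sub, map_mul, hd, sigmaHom_C, h.t_p, h.t_q, h.root_right]
      ring

theorem sigmaHom_p (h : Triple s t p q u) : sigmaHom s p = p + root s := by
  rw [h.s_p, h.root_left]
  ring

end Triple

end RankTwo

/-! ### Tensor products of cyclic bimodules -/

namespace GrBimod

section Cyclic

variable {k R : Type} [CommRing k] [CommRing R] [Algebra k R] {𝒜 : ℤ → Submodule k R}
variable {M N L P : GrBimod 𝒜}

/-- The bimodule `M` is generated by the element `e` of degree `δ`, and presented by the relations
`a e = e a'` whenever `A a a'`. -/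
structure IsCyclic (M : GrBimod 𝒜) (e : M) (δ : ℤ) (A : R → R → Prop) : Prop where
  mem : e ∈ M.gr δ
  pass : ∀ a a', A a a' → M.left a e = M.right a' e
  lift : ∀ {X : Type} [AddCommGroup X] [Module k X] (β : R →ₗ[k] R →ₗ[k] X),
    (∀ a a', A a a' → ∀ b c, β (b * a) c = β b (a' * c)) →
      ∃ f : M →ₗ[k] X, ∀ b c, f (M.left b (M.right c e)) = β b c
  span : ∀ n, M.gr n ≤ Submodule.span k {z | ∃ i j b c, i + j + δ = n ∧ b ∈ 𝒜 i ∧ c ∈ 𝒜 j ∧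
    M.left b (M.right c e) = z}

theorem IsCyclic.shift {e : M} {δ : ℤ} {A : R → R → Prop} (h : IsCyclic M e δ A) (p : ℤ) :
    IsCyclic (M.shift p) e (δ + p) A where
  mem := by
    change e ∈ M.gr (δ + p - p)
    rw [add_sub_cancel_right]
    exact h.mem
  pass := h.pass
  lift := h.lift
  span n := (h.span (n - p)).trans (Submodule.span_mono (by
    rintro _ ⟨i, j, b, c, hn, hb, hc, rfl⟩
    exact ⟨i, j, b, c, by omega, hb, hc, rfl⟩))

theorem lin_ext_of_span {S : ℤ → Set M} (hS : ∀ n, M.gr n ≤ Submodule.span k (S n)) {X : Type}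
    [AddCommGroup X] [Module k X] {f g : M →ₗ[k] X} (h : ∀ n, ∀ z ∈ S n, f z = g z) : f = g := by
  ext m
  induction m using homogeneous_induction M.internal with
  | h₀ => rw [map_zero, map_zero]
  | ha a b ha hb => rw [map_add, map_add, ha, hb]
  | hh n m hm => exact LinearMap.eqOn_span (f := f) (g := g) (h n) (hS n hm)

theorem IsCyclic.lin_ext {e : M} {δ : ℤ} {A : R → R → Prop} (h : IsCyclic M e δ A) {X : Type}
    [AddCommGroup X] [Module k X] {f g : M →ₗ[k] X}
    (hfg : ∀ b c, f (M.left b (M.right c e)) = g (M.left b (M.right c e))) : f = g :=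
  lin_ext_of_span h.span (by
    rintro n _ ⟨i, j, b, c, _, _, _, rfl⟩
    exact hfg b c)

/-- A linear map is a morphism of bimodules if it behaves like one on a set of homogeneous
elements spanning the source. -/
theorem exists_hom_of_span {S : ℤ → Set M} (hS : ∀ n, M.gr n ≤ Submodule.span k (S n))
    (f : M →ₗ[k] P) (hl : ∀ n, ∀ z ∈ S n, ∀ a, f (M.left a z) = P.left a (f z))
    (hr : ∀ n, ∀ z ∈ S n, ∀ a, f (M.right a z) = P.right a (f z))
    (hg : ∀ n, ∀ z ∈ S n, f z ∈ P.gr n) : ∃ F : M ⟶ P, F.lin = f := by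
  refine ⟨⟨f, fun a z => ?_, fun a z => ?_, fun n z hz => ?_⟩, rfl⟩
  · exact LinearMap.congr_fun (lin_ext_of_span hS (f := f.comp (M.left a)) (g := (P.left a).comp f)
      fun n z hz => hl n z hz a) z
  · exact LinearMap.congr_fun (lin_ext_of_span hS (f := f.comp (M.right a))
      (g := (P.right a).comp f) fun n z hz => hr n z hz a) z
  · have : Submodule.span k (S n) ≤ (P.gr n).comap f := Submodule.span_le.2 (hg n)
    exact this (hS n hz)

/-- A cyclic bimodule maps to every bimodule with an element of the same degree that satisfies the
defining relations. -/
theorem IsCyclic.exists_hom {e : M} {δ : ℤ} {A : R → R → Prop} (h : IsCyclic M e δ A) (x : P)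
    (hx : x ∈ P.gr δ) (hA : ∀ a a', A a a' → P.left a x = P.right a' x) :
    ∃ F : M ⟶ P, F.lin e = x := by
  obtain ⟨f, hf⟩ := h.lift (X := P) (LinearMap.mk₂ k (fun b c => P.left b (P.right c x))
    (fun b b' c => by rw [map_add, LinearMap.add_apply])
    (fun s b c => by rw [map_smul, LinearMap.smul_apply])
    (fun b c c' => by rw [map_add, LinearMap.add_apply, map_add])
    (fun s b c => by rw [map_smul, LinearMap.smul_apply, map_smul])) (fun a a' ha b c => by
      change P.left (b * a) (P.right c x) = P.left b (P.right (a' * c) x)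
      rw [left_mul, mul_comm a' c, right_mul, P.comm, hA a a' ha])
  have hf' : ∀ b c, f (M.left b (M.right c e)) = P.left b (P.right c x) := hf
  suffices hF : ∃ F : _ ⟶ P, F.lin = f by
    obtain ⟨F, hF⟩ := hF
    have := hf' 1 1
    rw [map_one, map_one, map_one, map_one] at this
    exact ⟨F, hF ▸ this⟩
  refine exists_hom_of_span h.span f ?_ ?_ ?_
  · rintro n _ ⟨i, j, b, c, _, _, _, rfl⟩ a
    rw [← left_mul, hf', hf', left_mul]
  · rintro n _ ⟨i, j, b, c, _, _, _, rfl⟩ a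
    rw [← M.comm, ← right_mul, hf', hf', ← P.comm, right_mul]
  · rintro n _ ⟨i, j, b, c, hn, hb, hc, rfl⟩
    rw [hf']
    have := P.left_mem hb (P.right_mem hc hx)
    rwa [show i + (δ + j) = n by omega] at this

theorem IsCyclic.hom_ext {e : L} {δ : ℤ} {A : R → R → Prop} (h : IsCyclic L e δ A)
    {f g : L ⟶ P} (hfg : f.lin e = g.lin e) : f = g :=
  Hom.ext (h.lin_ext fun b c => by rw [hom_left, hom_right, hom_left, hom_right, hfg])

variable [GradedAlgebra 𝒜]

/-- Linear maps out of `M ⊗ N` for a cyclic bimodule `M`: they are given by bilinear maps `β` on `R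
× N`, where `β b n` is the value at `b e ⊗ n`. -/
theorem IsCyclic.exists_tmLift {e : M} {δ : ℤ} {A : R → R → Prop} (h : IsCyclic M e δ A) {X : Type}
    [AddCommGroup X] [Module k X] (β : R →ₗ[k] N →ₗ[k] X)
    (hβ : ∀ a a', A a a' → ∀ b n, β (b * a) n = β b (N.left a' n)) :
    ∃ f : tens M N →ₗ[k] X, ∀ b c n,
      f (tm M N (M.left b (M.right c e)) n) = β b (N.left c n) := by
  obtain ⟨f, hf⟩ := h.lift (X := N →ₗ[k] X) (LinearMap.mk₂ k (fun b c => (β b).comp (N.left c))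
    (fun b b' c => by rw [map_add, LinearMap.add_comp])
    (fun s b c => by rw [map_smul, LinearMap.smul_comp])
    (fun b c c' => by rw [map_add]; exact LinearMap.comp_add _ _ _)
    (fun s b c => by rw [map_smul]; exact LinearMap.comp_smul _ _ _)) (fun a a' ha b c => by
      ext n
      change β (b * a) (N.left c n) = β b (N.left (a' * c) n)
      rw [hβ a a' ha, left_mul])
  have hf' : ∀ b c n, f (M.left b (M.right c e)) n = β b (N.left c n) := fun b c n => by
    rw [hf]; rfl
  refine ⟨tmLift f fun a m n => ?_, fun b c n => by rw [tmLift_tm, hf']⟩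
  have : (f.comp (M.right a)) = (LinearMap.lcomp k X (N.left a)).comp f := h.lin_ext fun b c => by
    ext n
    change f (M.right a (M.left b (M.right c e))) n = f (M.left b (M.right c e)) (N.left a n)
    rw [← M.comm, ← right_mul, hf', hf', mul_comm, left_mul]
  exact LinearMap.congr_fun (LinearMap.congr_fun this m) n

/-- The homogeneous components of `M ⊗ N` for a cyclic bimodule `M` are spanned by the elements `a e
⊗ w` with `a` homogeneous and `w` in given spanning sets of the components of `N`. -/
theorem IsCyclic.tens_gr_le {e : M} {δ : ℤ} {A : R → R → Prop} (h : IsCyclic M e δ A)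
    {S : ℤ → Set N} (hS : ∀ n, N.gr n ≤ Submodule.span k (S n))
    (hl : ∀ i j a z, a ∈ 𝒜 i → z ∈ S j → N.left a z ∈ S (i + j)) (n : ℤ) :
    (tens M N).gr n ≤ Submodule.span k {z | ∃ i j a w, i + δ + j = n ∧ a ∈ 𝒜 i ∧ w ∈ S j ∧
      tm M N (M.left a e) w = z} := by
  intro z hz
  refine tens_gr_induction (p := fun z => z ∈ Submodule.span k _) hz (zero_mem _)
    (fun x y hx hy => add_mem hx hy) (fun c x hx => Submodule.smul_mem _ c hx) ?_
  · intro i j hij m hm w hw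
    replace hm := h.span i hm
    induction hm using Submodule.span_induction with
    | zero => rw [map_zero]; exact zero_mem _
    | add x y _ _ hx hy => rw [map_add]; exact add_mem hx hy
    | smul c x _ hx => rw [map_smul]; exact Submodule.smul_mem _ c hx
    | mem x hx =>
      obtain ⟨i', j', b, c, hn, hb, hc, rfl⟩ := hx
      replace hw := hS j hw
      induction hw using Submodule.span_induction with
      | zero => rw [map_zero]; exact zero_mem _
      | add x y _ _ hx hy => rw [map_add]; exact add_mem hx hy
      | smul c x _ hx => rw [map_smul]; exact Submodule.smul_mem _ c hx
      | mem x hx =>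
        refine Submodule.subset_span ⟨i', j' + j, b, N.left c x, by omega, hb, hl _ _ _ _ hc hx, ?_⟩
        rw [M.comm, tm_balanced]

/-- The element `a e b ⊗ e' c` of `M ⊗ N`. -/
noncomputable def word₂ (e : M) (e' : N) (a b c : R) : tens M N :=
  tm M N (M.left a e) (N.left b (N.right c e'))

/-- The element `a e b ⊗ (e' c ⊗ e'' d)` of `L ⊗ (M ⊗ N)`. -/
noncomputable def word₃ (e : L) (e' : M) (e'' : N) (a b c d : R) : tens L (tens M N) :=
  tm L (tens M N) (L.left a e) (word₂ e' e'' b c d)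

theorem left_word₂ (e : M) (e' : N) (x a b c : R) :
    (tens M N).left x (word₂ e e' a b c) = word₂ e e' (x * a) b c := by
  rw [word₂, left_tm, ← left_mul, word₂]

theorem right_word₂ (e : M) (e' : N) (x a b c : R) :
    (tens M N).right x (word₂ e e' a b c) = word₂ e e' a b (c * x) := by
  rw [word₂, right_tm, ← N.comm, ← right_mul, word₂, mul_comm]

theorem left_word₃ (e : L) (e' : M) (e'' : N) (x a b c d : R) :
    (tens L (tens M N)).left x (word₃ e e' e'' a b c d) = word₃ e e' e'' (x * a) b c d := by
  rw [word₃, left_tm, ← left_mul, word₃]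

theorem right_word₃ (e : L) (e' : M) (e'' : N) (x a b c d : R) :
    (tens L (tens M N)).right x (word₃ e e' e'' a b c d) = word₃ e e' e'' a b c (d * x) := by
  rw [word₃, right_tm, right_word₂, word₃]

/-- The words of degree `n` with homogeneous entries, where `δ` is the sum of the degrees of the
generators. -/
def words₂ (e : M) (e' : N) (δ : ℤ) (n : ℤ) : Set (tens M N) :=
  {z | ∃ i j l a b c, i + j + l + δ = n ∧ a ∈ 𝒜 i ∧ b ∈ 𝒜 j ∧ c ∈ 𝒜 l ∧ word₂ e e' a b c = z}

/-- The words of degree `n` with homogeneous entries, where `δ` is the sum of the degrees of the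
generators. -/
def words₃ (e : L) (e' : M) (e'' : N) (δ : ℤ) (n : ℤ) : Set (tens L (tens M N)) :=
  {z | ∃ i j l m a b c d, i + j + l + m + δ = n ∧ a ∈ 𝒜 i ∧ b ∈ 𝒜 j ∧ c ∈ 𝒜 l ∧ d ∈ 𝒜 m ∧
    word₃ e e' e'' a b c d = z}

section

variable {e : L} {e' : M} {e'' : N} {δ δ' δ'' : ℤ} {A A' A'' : R → R → Prop}

theorem IsCyclic.gr_le_words₂ (h : IsCyclic M e' δ' A') (h' : IsCyclic N e'' δ'' A'') (n : ℤ) :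
    (tens M N).gr n ≤ Submodule.span k (words₂ e' e'' (δ' + δ'') n) := by
  refine (h.tens_gr_le h'.span ?_ n).trans (Submodule.span_mono ?_)
  · rintro i j a _ ha ⟨i', j', b, c, rfl, hb, hc, rfl⟩
    exact ⟨i + i', j', a * b, c, by omega, SetLike.mul_mem_graded ha hb, hc, left_mul _ _ _ _⟩
  · rintro _ ⟨i, j, a, _, hn, ha, ⟨i', j', b, c, rfl, hb, hc, rfl⟩, rfl⟩
    exact ⟨i, i', j', a, b, c, by omega, ha, hb, hc, rfl⟩

theorem IsCyclic.gr_le_words₃ (h₁ : IsCyclic L e δ A) (h : IsCyclic M e' δ' A')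
    (h' : IsCyclic N e'' δ'' A'') (n : ℤ) :
    (tens L (tens M N)).gr n ≤ Submodule.span k (words₃ e e' e'' (δ + δ' + δ'') n) := by
  refine (h₁.tens_gr_le (h.gr_le_words₂ h') ?_ n).trans (Submodule.span_mono ?_)
  · rintro i j a _ ha ⟨i', j', l', b, c, d, rfl, hb, hc, hd, rfl⟩
    exact ⟨i + i', j', l', a * b, c, d, by omega, SetLike.mul_mem_graded ha hb, hc, hd,
      (left_word₂ _ _ _ _ _ _).symm⟩
  · rintro _ ⟨i, j, a, _, hn, ha, ⟨i', j', l', b, c, d, rfl, hb, hc, hd, rfl⟩, rfl⟩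
    exact ⟨i, i', j', l', a, b, c, d, by omega, ha, hb, hc, hd, rfl⟩

/-- As a bimodule, the product of two cyclic bimodules is generated by the words with outer entries
`1`. -/
theorem IsCyclic.hom_ext₂ (h : IsCyclic M e' δ' A') (h' : IsCyclic N e'' δ'' A'')
    {f g : tens M N ⟶ P}
    (hfg : ∀ b, f.lin (word₂ e' e'' 1 b 1) = g.lin (word₂ e' e'' 1 b 1)) : f = g := by
  refine Hom.ext (lin_ext_of_span (h.gr_le_words₂ h') ?_)
  rintro n _ ⟨_, _, _, a, b, c, _, _, _, _, rfl⟩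
  rw [← mul_one a, ← left_word₂, ← one_mul c, ← right_word₂, hom_left, hom_left, hom_right,
    hom_right, hfg]

/-- Morphisms out of the product of two cyclic bimodules, given by the values `φ b` at the words
with entries `1`, `b`, `1`. -/
theorem IsCyclic.exists_hom₂ (h : IsCyclic M e' δ' A') (h' : IsCyclic N e'' δ'' A'')
    (φ : R →ₗ[k] P) (hl : ∀ a a', A' a a' → ∀ b, φ (a' * b) = P.left a (φ b))
    (hr : ∀ a a', A'' a a' → ∀ b, φ (b * a) = P.right a' (φ b))
    (hg : ∀ i, ∀ b ∈ 𝒜 i, φ b ∈ P.gr (i + (δ' + δ''))) :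
    ∃ F : tens M N ⟶ P, ∀ a b c, F.lin (word₂ e' e'' a b c) = P.left a (P.right c (φ b)) := by
  obtain ⟨γ, hγ⟩ := h'.lift (X := P) (LinearMap.mk₂ k (fun b c => P.right c (φ b))
    (fun b b' c => by rw [map_add, map_add])
    (fun s b c => by rw [map_smul, map_smul])
    (fun b c c' => by rw [map_add, LinearMap.add_apply])
    (fun s b c => by rw [map_smul, LinearMap.smul_apply])) (fun a a' ha b c => by
      change P.right c (φ (b * a)) = P.right (a' * c) (φ b)
      rw [mul_comm a', right_mul, hr a a' ha])
  replace hγ : ∀ b c, γ (N.left b (N.right c e'')) = P.right c (φ b) := hγ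
  obtain ⟨f, hf⟩ := h.exists_tmLift (N := N) (X := P)
    (LinearMap.mk₂ k (fun a n => P.left a (γ n))
    (fun b b' c => by rw [map_add, LinearMap.add_apply])
    (fun s b c => by rw [map_smul, LinearMap.smul_apply])
    (fun b c c' => by rw [map_add, map_add])
    (fun s b c => by rw [map_smul, map_smul])) (fun a a' ha b n => by
      change P.left (b * a) (γ n) = P.left b (γ (N.left a' n))
      have : (P.left a).comp γ = γ.comp (N.left a') := h'.lin_ext fun c d => by
        change P.left a (γ _) = γ (N.left a' _)
        rw [← left_mul, hγ, hγ, hl a a' ha, P.comm]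
      rw [left_mul]
      exact congrArg _ (LinearMap.congr_fun this n))
  have hf' : ∀ a b c, f (word₂ e' e'' a b c) = P.left a (P.right c (φ b)) := by
    intro a b c
    have := hf a 1 (N.left b (N.right c e''))
    rw [map_one, map_one, Module.End.one_apply, Module.End.one_apply] at this
    exact this.trans (congrArg _ (hγ b c))
  suffices hF : ∃ F : _ ⟶ P, F.lin = f by
    obtain ⟨F, hF⟩ := hF
    exact ⟨F, fun a b c => by rw [hF, hf']⟩
  refine exists_hom_of_span (h.gr_le_words₂ h') f ?_ ?_ ?_
  · rintro n _ ⟨_, _, _, a, b, c, _, _, _, _, rfl⟩ x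
    rw [left_word₂, hf', hf', left_mul]
  · rintro n _ ⟨_, _, _, a, b, c, _, _, _, _, rfl⟩ x
    rw [right_word₂, hf', hf', ← P.comm, mul_comm, right_mul]
  · rintro n _ ⟨i, j, l, a, b, c, hn, ha, hb, hc, rfl⟩
    rw [hf']
    have := P.left_mem ha (P.right_mem hc (hg j b hb))
    rwa [show i + (j + (δ' + δ'') + l) = n by omega] at this

/-- Morphisms out of the product of three cyclic bimodules, given by the values `φ b c` at the words
with entries `1`, `b`, `c`, `1`. -/
theorem IsCyclic.exists_hom₃ (h₁ : IsCyclic L e δ A) (h : IsCyclic M e' δ' A')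
    (h' : IsCyclic N e'' δ'' A'') (φ : R →ₗ[k] R →ₗ[k] P)
    (hl : ∀ a a', A a a' → ∀ b c, φ (a' * b) c = P.left a (φ b c))
    (hm : ∀ a a', A' a a' → ∀ b c, φ (b * a) c = φ b (a' * c))
    (hr : ∀ a a', A'' a a' → ∀ b c, φ b (c * a) = P.right a' (φ b c))
    (hg : ∀ i j, ∀ b ∈ 𝒜 i, ∀ c ∈ 𝒜 j, φ b c ∈ P.gr (i + j + (δ + δ' + δ''))) :
    ∃ F : tens L (tens M N) ⟶ P, ∀ a b c d,
      F.lin (word₃ e e' e'' a b c d) = P.left a (P.right d (φ b c)) := by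
  obtain ⟨κ, hκ⟩ := h'.lift (X := R →ₗ[k] P)
    (LinearMap.mk₂ k (fun c d => (P.right d).comp (φ.flip c))
    (fun b b' c => by rw [map_add]; exact LinearMap.comp_add _ _ _)
    (fun s b c => by rw [map_smul]; exact LinearMap.comp_smul _ _ _)
    (fun b c c' => by rw [map_add, LinearMap.add_comp])
    (fun s b c => by rw [map_smul, LinearMap.smul_comp])) (fun a a' ha c d => by
      ext b
      change P.right d (φ b (c * a)) = P.right (a' * d) (φ b c)
      rw [mul_comm a', right_mul, hr a a' ha])
  replace hκ : ∀ b c d, κ (N.left c (N.right d e'')) b = P.right d (φ b c) := fun b c d => by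
    rw [hκ]; rfl
  obtain ⟨γ, hγ⟩ := h.exists_tmLift (N := N) κ.flip (fun a a' ha b n => by
    have : κ.flip (b * a) = (κ.flip b).comp (N.left a') := h'.lin_ext fun c d => by
      change κ _ (b * a) = κ (N.left a' _) b
      rw [← left_mul, hκ, hκ, hm a a' ha]
    rw [this]
    rfl)
  replace hγ : ∀ b c d, γ (word₂ e' e'' b c d) = P.right d (φ b c) := fun b c d => by
    have := hγ b 1 (N.left c (N.right d e''))
    rw [map_one, map_one, Module.End.one_apply, Module.End.one_apply] at this
    exact this.trans (hκ b c d)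
  obtain ⟨f, hf⟩ := h₁.exists_tmLift (N := tens M N) (X := P)
    (LinearMap.mk₂ k (fun a n => P.left a (γ n))
    (fun b b' c => by rw [map_add, LinearMap.add_apply])
    (fun s b c => by rw [map_smul, LinearMap.smul_apply])
    (fun b c c' => by rw [map_add, map_add])
    (fun s b c => by rw [map_smul, map_smul])) (fun a a' ha b n => by
      change P.left (b * a) (γ n) = P.left b (γ ((tens M N).left a' n))
      have : γ ((tens M N).left a' n) = P.left a (γ n) := by
        induction n using homogeneous_induction (tens M N).internal with
        | h₀ => simp only [map_zero]
        | ha x y hx hy => simp only [map_add, hx, hy]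
        | hh n z hz =>
          refine LinearMap.eqOn_span (f := γ.comp ((tens M N).left a')) (g := (P.left a).comp γ) ?_
            (h.gr_le_words₂ h' n hz)
          rintro _ ⟨_, _, _, b, c, d, _, _, _, _, rfl⟩
          change γ ((tens M N).left a' _) = P.left a (γ _)
          rw [left_word₂, hγ, hγ, hl a a' ha, P.comm]
      rw [left_mul, this])
  have hf' : ∀ a b c d, f (word₃ e e' e'' a b c d) = P.left a (P.right d (φ b c)) := by
    intro a b c d
    have := hf a 1 (word₂ e' e'' b c d)
    rw [map_one, map_one, Module.End.one_apply, Module.End.one_apply] at this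
    exact this.trans (congrArg _ (hγ b c d))
  suffices hF : ∃ F : _ ⟶ P, F.lin = f by
    obtain ⟨F, hF⟩ := hF
    exact ⟨F, fun a b c d => by rw [hF, hf']⟩
  refine exists_hom_of_span (h₁.gr_le_words₃ h h') f ?_ ?_ ?_
  · rintro n _ ⟨_, _, _, _, a, b, c, d, _, _, _, _, _, rfl⟩ x
    rw [left_word₃, hf', hf', left_mul]
  · rintro n _ ⟨_, _, _, _, a, b, c, d, _, _, _, _, _, rfl⟩ x
    rw [right_word₃, hf', hf', ← P.comm, mul_comm, right_mul]
  · rintro n _ ⟨i, j, l, m, a, b, c, d, hn, ha, hb, hc, hd, rfl⟩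
    rw [hf']
    have := P.left_mem ha (P.right_mem hd (hg j l b hb c hc))
    rwa [show i + (j + l + (δ + δ' + δ'') + m) = n by omega] at this

/-- As a bimodule, the product of three cyclic bimodules is generated by the words with outer
entries `1`. -/
theorem IsCyclic.hom_ext₃ (h₁ : IsCyclic L e δ A) (h : IsCyclic M e' δ' A')
    (h' : IsCyclic N e'' δ'' A'') {f g : tens L (tens M N) ⟶ P}
    (hfg : ∀ b c, f.lin (word₃ e e' e'' 1 b c 1) = g.lin (word₃ e e' e'' 1 b c 1)) : f = g := by
  refine Hom.ext (lin_ext_of_span (h₁.gr_le_words₃ h h') ?_)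
  rintro n _ ⟨_, _, _, _, a, b, c, d, _, _, _, _, _, rfl⟩
  rw [← mul_one a, ← left_word₃, ← one_mul d, ← right_word₃, hom_left, hom_left, hom_right,
    hom_right, hfg]

end

end Cyclic

/-! ### Coordinates in commutative rings -/

section Slots

/-- The largest ideal contained in the kernel of an additive map. -/
def coreIdeal {C N : Type} [CommRing C] [AddCommGroup N] (T : C →+ N) : Ideal C where
  carrier := {z | ∀ w, T (w * z) = 0}
  zero_mem' w := by rw [mul_zero, map_zero]
  add_mem' {a b} ha hb w := by rw [mul_add, map_add, ha w, hb w, add_zero]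
  smul_mem' c z hz w := by rw [smul_eq_mul, ← mul_assoc, hz]

/-- The map induced by `T` on the quotient by its core. -/
def coreMap {C N : Type} [CommRing C] [AddCommGroup N] (T : C →+ N) : C ⧸ coreIdeal T →+ N :=
  QuotientAddGroup.lift (coreIdeal T).toAddSubgroup T fun z hz => by
    have := hz 1
    rwa [one_mul] at this

/-- Elements with the same multiples under `T` become equal in the quotient by the core. -/
theorem core_mk_eq {C N : Type} [CommRing C] [AddCommGroup N] (T : C →+ N) {z z' : C}
    (h : ∀ w, T (w * z) = T (w * z')) :
    Ideal.Quotient.mk (coreIdeal T) z = Ideal.Quotient.mk (coreIdeal T) z' :=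
  Ideal.Quotient.eq.2 fun w => by rw [mul_sub, map_sub, h, sub_self]

variable {k R : Type} [CommRing k] [CommRing R] [Algebra k R] {𝒜 : ℤ → Submodule k R}
variable {M N L : GrBimod 𝒜}

/-- Coordinates on a bimodule by a commutative ring `Q`, on which `R` acts from both sides by means
of ring homomorphisms to `Q`. An equation between values of `θ` follows from an equation in `Q`,
where it is a matter of commutative algebra. -/
structure Slots (M : GrBimod 𝒜) where
  Q : Type
  [ring : CommRing Q]
  left : R →+* Q
  right : R →+* Q
  θ : Q →+ M
  θ_left : ∀ a z, θ (left a * z) = M.left a (θ z)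
  θ_right : ∀ a z, θ (right a * z) = M.right a (θ z)

attribute [instance] Slots.ring

/-- Coordinates on a cyclic bimodule: the quotient of `R ⊗ R` by the largest ideal annihilated by `a
⊗ b ↦ a e b`. As the relations `a e = e a'` hold within every `b e c`, they hold in the quotient. -/
theorem IsCyclic.exists_slots {e : M} {δ : ℤ} {A : R → R → Prop} (h : IsCyclic M e δ A) :
    ∃ σ : Slots M, (∀ a b, σ.θ (σ.left a * σ.right b) = M.left a (M.right b e)) ∧
      ∀ a a', A a a' → σ.left a = σ.right a' := by
  let T : R ⊗[k] R →ₗ[k] M := TensorProduct.lift (LinearMap.mk₂ k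
    (fun b c => M.left b (M.right c e))
    (fun b b' c => by rw [map_add, LinearMap.add_apply])
    (fun s b c => by rw [map_smul, LinearMap.smul_apply])
    (fun b c c' => by rw [map_add, LinearMap.add_apply, map_add])
    (fun s b c => by rw [map_smul, LinearMap.smul_apply, map_smul]))
  have hT : ∀ b c, T (b ⊗ₜ[k] c) = M.left b (M.right c e) := fun b c => rfl
  have hl : ∀ a z, T ((a ⊗ₜ[k] 1) * z) = M.left a (T z) := fun a z => by
    induction z using TensorProduct.induction_on with
    | zero => rw [mul_zero, map_zero, map_zero]
    | tmul b c => rw [Algebra.TensorProduct.tmul_mul_tmul, hT, hT, one_mul, left_mul]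
    | add x y hx hy => rw [mul_add, map_add, map_add, map_add, hx, hy]
  have hr : ∀ a z, T ((1 ⊗ₜ[k] a) * z) = M.right a (T z) := fun a z => by
    induction z using TensorProduct.induction_on with
    | zero => rw [mul_zero, map_zero, map_zero]
    | tmul b c => rw [Algebra.TensorProduct.tmul_mul_tmul, hT, hT, one_mul, right_mul, M.comm]
    | add x y hx hy => rw [mul_add, map_add, map_add, map_add, hx, hy]
  let π := Ideal.Quotient.mk (coreIdeal T.toAddMonoidHom)
  refine ⟨{ Q := R ⊗[k] R ⧸ coreIdeal T.toAddMonoidHom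
            left := π.comp (Algebra.TensorProduct.includeLeft : R →ₐ[k] R ⊗[k] R).toRingHom
            right := π.comp (Algebra.TensorProduct.includeRight : R →ₐ[k] R ⊗[k] R).toRingHom
            θ := coreMap T.toAddMonoidHom
            θ_left := fun a z => ?_
            θ_right := fun a z => ?_ }, fun a b => ?_, fun a a' ha => core_mk_eq _ fun w => ?_⟩
  · obtain ⟨z, rfl⟩ := Ideal.Quotient.mk_surjective z
    exact hl a z
  · obtain ⟨z, rfl⟩ := Ideal.Quotient.mk_surjective z
    exact hr a z
  · change T (a ⊗ₜ[k] 1 * 1 ⊗ₜ[k] b) = _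
    rw [Algebra.TensorProduct.tmul_mul_tmul, hT, one_mul, mul_one]
  · change T (w * (a ⊗ₜ[k] 1)) = T (w * (1 ⊗ₜ[k] a'))
    induction w using TensorProduct.induction_on with
    | zero => rw [zero_mul, zero_mul]
    | tmul b c =>
      rw [Algebra.TensorProduct.tmul_mul_tmul, Algebra.TensorProduct.tmul_mul_tmul, mul_one,
        mul_one, hT, hT, right_mul, left_mul, M.comm, h.pass a a' ha]
    | add x y hx hy => rw [add_mul, map_add, hx, hy, add_mul, map_add]

variable [GradedAlgebra 𝒜]

/-- Coordinates on a tensor product over `R`: the quotient of the tensor product over `ℤ` of the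
coordinate rings by the largest ideal annihilated by the map to `M ⊗ N`. -/
theorem Slots.exists_tens (σ : Slots M) (τ : Slots N) :
    ∃ (υ : Slots (tens M N)) (f : σ.Q →+* υ.Q) (g : τ.Q →+* υ.Q),
      (∀ z w, υ.θ (f z * g w) = tm M N (σ.θ z) (τ.θ w)) ∧ (∀ a, f (σ.right a) = g (τ.left a)) ∧
      (∀ a, υ.left a = f (σ.left a)) ∧ ∀ a, υ.right a = g (τ.right a) := by
  let T : σ.Q ⊗[ℤ] τ.Q →+ tens M N := TensorProduct.liftAddHom
    (AddMonoidHom.mk' (fun z => AddMonoidHom.mk' (fun w => tm M N (σ.θ z) (τ.θ w))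
      fun w w' => by rw [map_add, map_add]) fun z z' => by
        ext w
        change tm M N _ _ = tm M N _ _ + tm M N _ _
        rw [map_add, map_add, LinearMap.add_apply])
    fun n z w => by
      change tm M N _ _ = tm M N _ _
      rw [map_zsmul, map_zsmul, map_zsmul, map_zsmul, LinearMap.smul_apply]
  have hT : ∀ z w, T (z ⊗ₜ[ℤ] w) = tm M N (σ.θ z) (τ.θ w) := fun z w => rfl
  have hl : ∀ a z, T ((σ.left a ⊗ₜ[ℤ] 1) * z) = (tens M N).left a (T z) := fun a z => by
    induction z using TensorProduct.induction_on with
    | zero => rw [mul_zero, map_zero, map_zero]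
    | tmul b c => rw [Algebra.TensorProduct.tmul_mul_tmul, hT, hT, one_mul, left_tm, σ.θ_left]
    | add x y hx hy => rw [mul_add, map_add, map_add, map_add, hx, hy]
  have hr : ∀ a z, T ((1 ⊗ₜ[ℤ] τ.right a) * z) = (tens M N).right a (T z) := fun a z => by
    induction z using TensorProduct.induction_on with
    | zero => rw [mul_zero, map_zero, map_zero]
    | tmul b c => rw [Algebra.TensorProduct.tmul_mul_tmul, hT, hT, one_mul, right_tm, τ.θ_right]
    | add x y hx hy => rw [mul_add, map_add, map_add, map_add, hx, hy]
  let π := Ideal.Quotient.mk (coreIdeal T)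
  let f : σ.Q →+* σ.Q ⊗[ℤ] τ.Q ⧸ coreIdeal T :=
    π.comp (Algebra.TensorProduct.includeLeft : σ.Q →ₐ[ℤ] σ.Q ⊗[ℤ] τ.Q).toRingHom
  let g : τ.Q →+* σ.Q ⊗[ℤ] τ.Q ⧸ coreIdeal T :=
    π.comp (Algebra.TensorProduct.includeRight : τ.Q →ₐ[ℤ] σ.Q ⊗[ℤ] τ.Q).toRingHom
  refine ⟨{ Q := σ.Q ⊗[ℤ] τ.Q ⧸ coreIdeal T
            left := f.comp σ.left
            right := g.comp τ.right
            θ := coreMap T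
            θ_left := fun a z => ?_
            θ_right := fun a z => ?_ }, f, g, fun z w => ?_, fun a => core_mk_eq _ fun w => ?_,
    fun _ => rfl, fun _ => rfl⟩
  · obtain ⟨z, rfl⟩ := Ideal.Quotient.mk_surjective z
    exact hl a z
  · obtain ⟨z, rfl⟩ := Ideal.Quotient.mk_surjective z
    exact hr a z
  · change T (z ⊗ₜ[ℤ] 1 * 1 ⊗ₜ[ℤ] w) = _
    rw [Algebra.TensorProduct.tmul_mul_tmul, hT, one_mul, mul_one]
  · change T (w * (σ.right a ⊗ₜ[ℤ] 1)) = T (w * (1 ⊗ₜ[ℤ] τ.left a))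
    induction w using TensorProduct.induction_on with
    | zero => rw [zero_mul, zero_mul]
    | tmul b c =>
      rw [Algebra.TensorProduct.tmul_mul_tmul, Algebra.TensorProduct.tmul_mul_tmul, mul_one,
        mul_one, hT, hT, mul_comm, σ.θ_right, mul_comm, τ.θ_left, tm_balanced]
    | add x y hx hy => rw [add_mul, map_add, hx, hy, add_mul, map_add]

variable {e : L} {e' : M} {e'' : N} {δ δ' δ'' : ℤ} {A A' A'' : R → R → Prop}

/-- Coordinates on the product of two cyclic bimodules: each of the three positions in a word
corresponds to a ring homomorphism to a commutative ring, and the relations of the generators allow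
to pass to an adjacent position. -/
theorem IsCyclic.exists_slots₂ (h : IsCyclic M e' δ' A') (h' : IsCyclic N e'' δ'' A'') :
    ∃ (Q : Type) (_ : CommRing Q) (s₀ s₁ s₂ : R →+* Q) (θ : Q →+ tens M N),
      (∀ a b c, word₂ e' e'' a b c = θ (s₀ a * s₁ b * s₂ c)) ∧
      (∀ a a', A' a a' → s₀ a = s₁ a') ∧ ∀ a a', A'' a a' → s₁ a = s₂ a' := by
  obtain ⟨σ, hσ, hA⟩ := h.exists_slots
  obtain ⟨τ, hτ, hA'⟩ := h'.exists_slots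
  obtain ⟨υ, f, g, hυ, hfg, _, _⟩ := σ.exists_tens τ
  refine ⟨υ.Q, υ.ring, f.comp σ.left, g.comp τ.left, g.comp τ.right, υ.θ, fun a b c => ?_,
    fun a a' ha => ?_, fun a a' ha => congrArg g (hA' a a' ha)⟩
  · have h1 := hσ a 1
    rw [map_one, map_one, mul_one, Module.End.one_apply] at h1
    rw [word₂, ← h1, ← hτ, ← hυ, mul_assoc]
    exact congrArg υ.θ (congrArg _ (_root_.map_mul g _ _))
  · exact (congrArg f (hA a a' ha)).trans (hfg a')

/-- Coordinates on the product of three cyclic bimodules, with one ring homomorphism for each of the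
four positions in a word. -/
theorem IsCyclic.exists_slots₃ (h₁ : IsCyclic L e δ A) (h : IsCyclic M e' δ' A')
    (h' : IsCyclic N e'' δ'' A'') :
    ∃ (σ : Slots (tens L (tens M N))) (s₁ s₂ : R →+* σ.Q),
      (∀ a b c d, word₃ e e' e'' a b c d = σ.θ (σ.left a * s₁ b * s₂ c * σ.right d)) ∧
      (∀ a a', A a a' → σ.left a = s₁ a') ∧ (∀ a a', A' a a' → s₁ a = s₂ a') ∧
      ∀ a a', A'' a a' → s₂ a = σ.right a' := by
  obtain ⟨ι, hι, hA⟩ := h₁.exists_slots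
  obtain ⟨σ, hσ, hA'⟩ := h.exists_slots
  obtain ⟨τ, hτ, hA''⟩ := h'.exists_slots
  obtain ⟨υ, f, g, hυ, hfg, hfl, hgr⟩ := σ.exists_tens τ
  obtain ⟨ω, f', g', hω, hfg', hfl', hgr'⟩ := ι.exists_tens υ
  refine ⟨ω, (g'.comp f).comp σ.left, (g'.comp g).comp τ.left, fun a b c d => ?_,
    fun a a' ha => ?_, fun a a' ha => ?_, fun a a' ha => ?_⟩
  · have h1 := hι a 1
    have h2 := hσ b 1
    rw [map_one, map_one, mul_one, Module.End.one_apply] at h1 h2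
    rw [word₃, word₂, ← h1, ← h2, ← hτ, ← hυ, ← hω, mul_assoc, mul_assoc, hfl', hgr', hgr]
    refine congrArg ω.θ (congrArg _ ((_root_.map_mul g' _ _).trans (congrArg _ ?_)))
    exact (congrArg g' (_root_.map_mul g _ _)).trans (_root_.map_mul g' _ _)
  · exact (hfl' a).trans (((congrArg f' (hA a a' ha)).trans (hfg' a')).trans (congrArg g' (hfl a')))
  · exact congrArg g' ((congrArg f (hA' a a' ha)).trans (hfg a'))
  · exact (congrArg g' ((congrArg g (hA'' a a' ha)).trans (hgr a').symm)).trans (hgr' a').symm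

end Slots
end GrBimod

/-! ### Calculus of words -/

namespace GrBimod

section Words

variable {k R : Type} [CommRing k] [CommRing R] [Algebra k R] {𝒜 : ℤ → Submodule k R}
  [GradedAlgebra 𝒜] {L M N L' M' N' : GrBimod 𝒜}

theorem tensMap_word₂ (f : M ⟶ M') (g : N ⟶ N') (e : M) (e' : N) (a b c : R) :
    (tensMap f g).lin (word₂ e e' a b c) = word₂ (f.lin e) (g.lin e') a b c := by
  rw [word₂, word₂, tensMap_tm, hom_left, hom_left, hom_right]

theorem tensMap_word₃ (f : L ⟶ L') (g : M ⟶ M') (h : N ⟶ N') (e : L) (e' : M) (e'' : N)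
    (a b c d : R) : (tensMap f (tensMap g h)).lin (word₃ e e' e'' a b c d) =
      word₃ (f.lin e) (g.lin e') (h.lin e'') a b c d := by
  rw [word₃, word₃, tensMap_tm, hom_left, tensMap_word₂]

theorem word₂_sub_left (e : M) (e' : N) (u v a b c : R) :
    word₂ (M.left u e - M.right v e) e' a b c =
      word₂ e e' (a * u) b c - word₂ e e' a (v * b) c := by
  rw [word₂, map_sub, map_sub, LinearMap.sub_apply, ← left_mul, M.comm, tm_balanced, ← left_mul,
    word₂, word₂]

theorem word₂_sub_right (e : M) (e' : N) (u v a b c : R) :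
    word₂ e (N.left u e' - N.right v e') a b c =
      word₂ e e' a (b * u) c - word₂ e e' a b (c * v) := by
  rw [word₂, map_sub, map_sub, map_sub, ← N.comm, ← left_mul, ← right_mul, word₂, word₂]

theorem word₃_sub_left (e : L) (e' : M) (e'' : N) (u v a b c d : R) :
    word₃ (L.left u e - L.right v e) e' e'' a b c d =
      word₃ e e' e'' (a * u) b c d - word₃ e e' e'' a (v * b) c d := by
  rw [word₃, map_sub, map_sub, LinearMap.sub_apply, ← left_mul, L.comm, tm_balanced, left_word₂,
    word₃, word₃]

theorem word₃_sub_mid (e : L) (e' : M) (e'' : N) (u v a b c d : R) :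
    word₃ e (M.left u e' - M.right v e') e'' a b c d =
      word₃ e e' e'' a (b * u) c d - word₃ e e' e'' a b (v * c) d := by
  rw [word₃, word₂_sub_left, map_sub, word₃, word₃]

theorem word₃_sub_right (e : L) (e' : M) (e'' : N) (u v a b c d : R) :
    word₃ e e' (N.left u e'' - N.right v e'') a b c d =
      word₃ e e' e'' a b (c * u) d - word₃ e e' e'' a b c (d * v) := by
  rw [word₃, word₂_sub_right, map_sub, word₃, word₃]

theorem word₂_one (e : M) (e' : N) : word₂ e e' 1 1 1 = tm M N e e' := by
  rw [word₂, map_one, map_one, map_one]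
  rfl

theorem word₂_zero (e : M) (e' : N) (a c : R) : word₂ e e' a 0 c = 0 := by
  rw [word₂, map_zero, LinearMap.zero_apply, map_zero]

theorem word₂_mem {e : M} {e' : N} {δ δ' i j l : ℤ} (h : e ∈ M.gr δ) (h' : e' ∈ N.gr δ') {a b c : R}
    (ha : a ∈ 𝒜 i) (hb : b ∈ 𝒜 j) (hc : c ∈ 𝒜 l) {n : ℤ} (hn : i + j + l + (δ + δ') = n) :
    word₂ e e' a b c ∈ (tens M N).gr n := by
  have := tm_mem (M.left_mem ha h) (N.left_mem hb (N.right_mem hc h'))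
  rwa [show i + δ + (j + (δ' + l)) = n by omega] at this

theorem word₃_mem {e : L} {e' : M} {e'' : N} {δ δ' δ'' i j l m : ℤ} (h : e ∈ L.gr δ)
    (h' : e' ∈ M.gr δ') (h'' : e'' ∈ N.gr δ'') {a b c d : R} (ha : a ∈ 𝒜 i) (hb : b ∈ 𝒜 j)
    (hc : c ∈ 𝒜 l) (hd : d ∈ 𝒜 m) {n : ℤ} (hn : i + j + l + m + (δ + δ' + δ'') = n) :
    word₃ e e' e'' a b c d ∈ (tens L (tens M N)).gr n := by
  have := tm_mem (L.left_mem ha h) (word₂_mem h' h'' hb hc hd rfl)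
  rwa [show i + δ + (j + l + m + (δ' + δ'')) = n by omega] at this

theorem IsCyclic.pass_left {e : M} {δ : ℤ} {A : R → R → Prop} (h : IsCyclic M e δ A) (e' : N)
    {a a' : R} (ha : A a a') (x b c : R) :
    word₂ e e' (x * a) b c = word₂ e e' x (a' * b) c := by
  rw [word₂, left_mul, h.pass a a' ha, M.comm, tm_balanced, ← left_mul, word₂]

theorem IsCyclic.pass_right {e' : N} {δ : ℤ} {A : R → R → Prop} (h : IsCyclic N e' δ A) (e : M)
    {a a' : R} (ha : A a a') (x b c : R) :
    word₂ e e' x (b * a) c = word₂ e e' x b (a' * c) := by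
  rw [word₂, word₂, left_mul, N.comm, h.pass a a' ha, mul_comm a', right_mul]

/-- The words with varying middle entry. -/
noncomputable def midLin (e : M) (e' : N) : R →ₗ[k] tens M N :=
  (tm M N e).comp ((LinearMap.applyₗ e').comp N.left.toLinearMap)

theorem midLin_apply (e : M) (e' : N) (b : R) : midLin e e' b = word₂ e e' 1 b 1 := by
  rw [word₂, map_one, map_one]
  rfl

/-- The words with varying first entry. -/
noncomputable def firstLin (e : M) (e' : N) : R →ₗ[k] tens M N :=
  ((tm M N).flip e').comp ((LinearMap.applyₗ e).comp M.left.toLinearMap)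

theorem firstLin_apply (e : M) (e' : N) (b : R) : firstLin e e' b = word₂ e e' b 1 1 := by
  rw [word₂, map_one, map_one]
  rfl

/-- The words with varying last entry. -/
noncomputable def lastLin (e : M) (e' : N) : R →ₗ[k] tens M N :=
  (tm M N e).comp ((LinearMap.applyₗ e').comp N.right.toLinearMap)

theorem lastLin_apply (e : M) (e' : N) (b : R) : lastLin e e' b = word₂ e e' 1 1 b := by
  rw [word₂, map_one, map_one]
  rfl

variable (𝒜) in
theorem regular_isCyclic : IsCyclic (regular 𝒜) (reg 1) 0 Eq where
  mem := SetLike.one_mem_graded 𝒜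
  pass a a' h := by
    subst h
    rfl
  lift {X _ _} β hβ := by
    refine ⟨β.flip 1, fun b c => ?_⟩
    change β (b * (c * 1)) 1 = β b c
    rw [mul_one, hβ c c rfl, mul_one]
  span n z hz := Submodule.subset_span ⟨n, 0, z, 1, by omega, hz, SetLike.one_mem_graded 𝒜, by
    have : ∀ z : R, z * (1 * 1) = z := fun z => by rw [mul_one, mul_one]
    exact this z⟩

end Words
end GrBimod

/-! ### Generators of the elementary bimodules -/

open GrBimod

variable {r : ℕ}

/-- The relations satisfied by the generator of `B_i`. -/
abbrev FixRel (i : ZMod r) (a a' : Poly r) : Prop := a = a' ∧ a ∈ fixedRing i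

/-- The generator `1 ⊗ 1` of `B_i`. -/
noncomputable def bOne (i : ZMod r) : B i := soergelTmul i 1 1

/-- The generator `1` of `R{p}`. -/
noncomputable def rOne (r : ℕ) (p : ℤ) : (regular (polyGr r)).shift p := (1 : Poly r)

theorem B_left_right_bOne (i : ZMod r) (a b : Poly r) :
    (B i).left a ((B i).right b (bOne i)) = soergelTmul i a b := by
  change a ⊗ₜ[fixedRing i] (1 : Poly r) * ((1 : Poly r) ⊗ₜ[fixedRing i] b * (1 ⊗ₜ 1)) = _
  rw [Algebra.TensorProduct.tmul_mul_tmul, Algebra.TensorProduct.tmul_mul_tmul, mul_one, one_mul,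
    mul_one, mul_one, soergelTmul_apply]

theorem B_left_bOne (i : ZMod r) (a : Poly r) :
    (B i).left a (bOne i) = soergelTmul i a 1 := by
  rw [← B_left_right_bOne, map_one]
  rfl

theorem B_right_bOne (i : ZMod r) (a : Poly r) :
    (B i).right a (bOne i) = soergelTmul i 1 a := by
  rw [← B_left_right_bOne, map_one]
  rfl

/-- The universal property of `R ⊗ R` over the `σ_i`-invariants, for linear maps over `ℚ`. -/
theorem B_lift (i : ZMod r) {X : Type} [AddCommGroup X] [Module ℚ X]
    (β : Poly r →ₗ[ℚ] Poly r →ₗ[ℚ] X)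
    (hβ : ∀ s ∈ fixedRing i, ∀ b c, β (b * s) c = β b (s * c)) :
    ∃ f : (Poly r ⊗[fixedRing i] Poly r) →ₗ[ℚ] X, ∀ b c, f (soergelTmul i b c) = β b c := by
  let f : (Poly r ⊗[fixedRing i] Poly r) →+ X := TensorProduct.liftAddHom
      (AddMonoidHom.mk' (fun a => (β a).toAddMonoidHom) fun a b => by
        refine AddMonoidHom.ext fun c => ?_
        change β (a + b) c = β a c + β b c
        rw [map_add, LinearMap.add_apply])
      (fun s a b => by
        change β (s • a) b = β a (s • b)
        rw [Algebra.smul_def, Algebra.smul_def, mul_comm]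
        exact hβ s s.2 a b)
  exact ⟨f.toRatLinearMap, fun b c => rfl⟩

theorem B_pass (i : ZMod r) {a : Poly r} (ha : a ∈ fixedRing i) :
    (B i).left a (bOne i) = (B i).right a (bOne i) := by
  rw [B_left_bOne, B_right_bOne, ← mul_one a, soergelTmul_balanced i ha, mul_one]

theorem bOne_mem (i : ZMod r) : bOne i ∈ (B i).gr 0 := by
  have h := tmul_mem_tensorGrading (soergelTmul i) (SetLike.one_mem_graded (polyGr r))
    (SetLike.one_mem_graded (polyGr r))
  rw [add_zero] at h
  exact h

theorem B_span (i : ZMod r) (n : ℤ) : (B i).gr n ≤ Submodule.span ℚ {z | ∃ j l b c, j + l + 0 = n ∧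
    b ∈ polyGr r j ∧ c ∈ polyGr r l ∧ (B i).left b ((B i).right c (bOne i)) = z} := by
  refine Submodule.span_mono ?_
  rintro _ ⟨j, l, hn, a, ha, b, hb, rfl⟩
  exact ⟨j, l, a, b, by omega, ha, hb, B_left_right_bOne _ _ _⟩

theorem B_isCyclic (i : ZMod r) :
    GrBimod.IsCyclic (B i) (bOne i) 0 (FixRel i) where
  mem := bOne_mem i
  pass a a' h := by
    obtain ⟨rfl, h⟩ := h
    exact B_pass i h
  lift β hβ := by
    obtain ⟨f, hf⟩ := B_lift i β fun s hs => hβ s s ⟨rfl, hs⟩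
    refine ⟨f, fun b c => ?_⟩
    rw [B_left_right_bOne]
    exact hf b c
  span := B_span i

/-- A twist is generated by `1`, subject to the relations `φ(a) 1 = 1 a`. -/
theorem twist_isCyclic (φ : Poly r →ₐ[ℚ] Poly r)
    (hφ : ∀ {n : ℤ} {p : Poly r}, p ∈ polyGr r n → φ p ∈ polyGr r n) :
    GrBimod.IsCyclic (twist φ hφ) (1 : Poly r) 0 fun a a' => a = φ a' where
  mem := SetLike.one_mem_graded (polyGr r)
  pass a a' h := by
    subst h
    rfl
  lift {X _ _} β hβ := by
    refine ⟨β.flip 1, fun b c => ?_⟩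
    change β (b * (φ c * 1)) 1 = β b c
    rw [mul_one, hβ (φ c) c rfl, mul_one]
  span n z hz := Submodule.subset_span ⟨n, 0, z, 1, by omega, hz, SetLike.one_mem_graded _, by
    have : ∀ z : Poly r, z * (φ 1 * 1) = z := fun z => by rw [map_one, mul_one, mul_one]
    exact this z⟩

theorem R_isCyclic (r : ℕ) (p : ℤ) :
    GrBimod.IsCyclic ((regular (polyGr r)).shift p) (rOne r p) p Eq := by
  have := (regular_isCyclic (polyGr r)).shift p
  rwa [zero_add] at this

/-- The map `R{2} ⟶ B_i` in terms of a linear form `p` with `σ_i p = p + X_i`. -/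
theorem rb_rOne (hr : 3 ≤ r) (i : ZMod r) {p : Poly r} (hp : sigmaHom i p = p + root i) :
    (rb hr i).lin (rOne r 2) = (B i).left (p + root i) (bOne i) - (B i).right p (bOne i) := by
  have hs : p + p + root i ∈ fixedRing i := by
    rw [mem_fixedRing, map_add, map_add, hp, sigmaHom_root hr]
    ring
  have h := tmul_one_of_mem hs
  rw [TensorProduct.add_tmul, TensorProduct.add_tmul, TensorProduct.tmul_add,
    TensorProduct.tmul_add] at h
  rw [B_left_bOne, B_right_bOne, map_add, LinearMap.add_apply]
  change (1 : Poly r) ⊗ₜ[fixedRing i] (1 : Poly r) * rbElt i =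
    p ⊗ₜ[fixedRing i] (1 : Poly r) + root i ⊗ₜ[fixedRing i] (1 : Poly r) -
      (1 : Poly r) ⊗ₜ[fixedRing i] p
  rw [← Algebra.TensorProduct.one_def, one_mul, rbElt]
  linear_combination (norm := module) (-(1 / 2) : ℚ) • h

/-- The generator `1 ⊗ 1` of `B_i{p}`. -/
noncomputable def bGen (i : ZMod r) (p : ℤ) : (B i).shift p := bOne i

theorem bGen_isCyclic (i : ZMod r) (p : ℤ) :
    GrBimod.IsCyclic ((B i).shift p) (bGen i p) p (FixRel i) := by
  have := (B_isCyclic i).shift p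
  rwa [zero_add] at this

theorem br_bGen (i : ZMod r) (p : ℤ) : (br i p).lin (bGen i p) = rOne r p := by
  change brLin i ((1 : Poly r) ⊗ₜ[fixedRing i] (1 : Poly r)) = (1 : Poly r)
  rw [brLin_tmul, mul_one]

/-! ### Elimination of contractible summands -/

section Square

open GrBimod

variable {k R : Type} [CommRing k] [CommRing R] [Algebra k R] {𝒜 : ℤ → Submodule k R}
  {J J' : Type} [Fintype J] [Fintype J'] {D : CellData 𝒜 J} {K L : Complexes 𝒜}

/-- The matrix of the differential has square zero. -/
theorem Cells.d_comp_d (c : Cells D K) (j l : J) : ∑ i, D.d j i ≫ D.d i l = 0 := by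
  by_cases hl : D.deg l = D.deg j + 1 + 1
  · have h := c.ι_d j (D.deg j)
    replace h := congrArg (· ≫ K.d (D.deg j + 1) (D.deg j + 1 + 1)) h
    rw [Category.assoc, K.d_comp_d, comp_zero, Preadditive.sum_comp] at h
    simp only [Category.assoc, c.ι_d, Preadditive.comp_sum] at h
    rw [Finset.sum_comm] at h
    simp only [← Category.assoc, ← Preadditive.sum_comp] at h
    replace h := congrArg (· ≫ c.π l (D.deg j + 1 + 1)) h
    rw [zero_comp, Preadditive.sum_comp, Finset.sum_eq_single l] at h
    · rw [Category.assoc, ← hl, c.ι_π_self, Category.comp_id] at h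
      exact h.symm
    · intro i _ hi
      rw [Category.assoc, c.ι_π_ne _ _ _ hi, comp_zero]
    · exact fun h => (h (Finset.mem_univ _)).elim
  · refine Finset.sum_eq_zero fun i _ => ?_
    by_cases hi : D.deg i = D.deg j + 1
    · rw [D.d_eq_zero i l (by omega), comp_zero]
    · rw [D.d_eq_zero j i hi, zero_comp]

/-- The same cells with another index set. -/
@[reducible]
def CellData.reindex (D : CellData 𝒜 J) (e : J' ≃ J) : CellData 𝒜 J' where
  deg j := D.deg (e j)
  A j := D.A (e j)
  d j l := D.d (e j) (e l)
  d_eq_zero _ _ h := D.d_eq_zero _ _ h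

/-- The same cells with another index set. -/
@[reducible]
def Cells.reindex (c : Cells D K) (e : J' ≃ J) : Cells (D.reindex e) K where
  ι j n := c.ι (e j) n
  π j n := c.π (e j) n
  ι_eq_zero _ _ h := c.ι_eq_zero _ _ h
  π_eq_zero _ _ h := c.π_eq_zero _ _ h
  ι_π_self _ := c.ι_π_self _
  ι_π_ne _ _ _ h := c.ι_π_ne _ _ _ fun h' => h (e.injective h')
  total n := (e.sum_comp fun j => c.π j n ≫ c.ι j n).trans (c.total n)
  ι_d j n := (c.ι_d (e j) n).trans (e.sum_comp fun l => D.d (e j) l ≫ c.ι l (n + 1)).symm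

/-- A complex with four cells `A` in degree `-1`, `C₁` and `C₂` in degree `0`, `E` in degree `1`,
such that `A` and `E` are complementary direct summands of `C₁` by way of the differential, is
homotopy equivalent to `C₂`. -/
theorem Cells.exists_iso_of_square {D : CellData 𝒜 (Bool × Bool)} (c : Cells D K)
    (hA : D.deg (false, false) = -1) (hC₁ : D.deg (true, false) = 0)
    (hC₂ : D.deg (false, true) = 0) (hE : D.deg (true, true) = 1)
    {M : GrBimod 𝒜} (c' : Cells (singleData M) L)
    (h₀ : D.A (true, false) ⟶ D.A (false, false)) (h₁ : D.A (true, true) ⟶ D.A (true, false))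
    (h₀_left : D.d (false, false) (true, false) ≫ h₀ = 𝟙 _)
    (h₁_right : h₁ ≫ D.d (true, false) (true, true) = 𝟙 _) (h₁₀ : h₁ ≫ h₀ = 0)
    (hproj : (𝟙 _ - h₀ ≫ D.d (false, false) (true, false)) ≫
      (𝟙 _ - D.d (true, false) (true, true) ≫ h₁) = 0)
    (μ : D.A (false, true) ≅ M) {e : D.A (true, false)} (he : e ∈ (D.A (true, false)).gr 0)
    (hd : ∀ l, (D.d (true, false) l).lin e = 0) {e' : M} (he' : e' ∈ M.gr 0)
    (hee : μ.hom.lin ((D.d (false, false) (false, true)).lin (h₀.lin e)) = -e') :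
    ∃ E : (toHo 𝒜).obj K ≅ (toHo 𝒜).obj L,
      HPt.hoMap E.hom (HPt.mk (c.cyc (true, false) e he hd)) =
        HPt.mk (c'.cyc () e' he' fun _ => rfl) := by
  have hdd := c.d_comp_d (false, false) (true, true)
  simp only [Fintype.sum_prod_type, Fintype.sum_bool,
    D.d_eq_zero (true, true) (true, true) (by omega), comp_zero,
    D.d_eq_zero (false, false) (false, false) (by omega), zero_comp, zero_add, add_zero] at hdd
  -- the equivalence is the identification `μ` of `C₂` with `M`, corrected on `C₁` by the path
  -- through `A`; its inverse is corrected by the path through `E`, and the homotopy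
  -- contracts `A` and `E`
  let f : ∀ (j : Bool × Bool) (_ : Unit), D.A j ⟶ M
    | (true, false), _ => -(h₀ ≫ D.d (false, false) (false, true) ≫ μ.hom)
    | (false, true), _ => μ.hom
    | (false, false), _ => 0
    | (true, true), _ => 0
  let g : ∀ (_ : Unit) (l : Bool × Bool), M ⟶ D.A l
    | _, (true, false) => -(μ.inv ≫ D.d (false, true) (true, true) ≫ h₁)
    | _, (false, true) => μ.inv
    | _, (false, false) => 0
    | _, (true, true) => 0
  let h : ∀ j l, D.A j ⟶ D.A l
    | (true, false), (false, false) => -h₀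
    | (true, true), (true, false) => -h₁
    | (false, _), _ => 0
    | (true, false), (true, _) => 0
    | (true, false), (false, true) => 0
    | (true, true), (true, true) => 0
    | (true, true), (false, _) => 0
  have hdd' : D.d (false, false) (false, true) ≫ D.d (false, true) (true, true) =
      -(D.d (false, false) (true, false) ≫ D.d (true, false) (true, true)) := by
    rw [eq_neg_iff_add_eq_zero, ← hdd, add_comm]
  have hproj' : h₀ ≫ D.d (false, false) (true, false) ≫ D.d (true, false) (true, true) ≫ h₁ =
      h₀ ≫ D.d (false, false) (true, false) + D.d (true, false) (true, true) ≫ h₁ - 𝟙 _ := by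
    simp only [Preadditive.sub_comp, Preadditive.comp_sub, Category.assoc, Category.comp_id,
      Category.id_comp] at hproj
    rw [← sub_eq_zero, ← hproj]
    abel
  have hf₀ : ∀ j l, D.deg j ≠ (singleData M).deg l → f j l = 0 := by
    rintro ⟨_ | _, _ | _⟩ _ hn
    · rfl
    · exact (hn hC₂).elim
    · exact (hn hC₁).elim
    · rfl
  have hg₀ : ∀ j l, (singleData M).deg j ≠ D.deg l → g j l = 0 := by
    rintro _ ⟨_ | _, _ | _⟩ hn
    · rfl
    · exact (hn hC₂.symm).elim
    · exact (hn hC₁.symm).elim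
    · rfl
  have hf : ∀ j l, (singleData M).deg l = D.deg j + 1 →
      ∑ i, D.d j i ≫ f i l = ∑ i, f j i ≫ (singleData M).d i l := by
    rintro ⟨_ | _, _ | _⟩ _ hl
    · simp only [Fintype.sum_prod_type, Fintype.sum_bool, f, comp_zero, zero_add, add_zero,
        Finset.sum_const_zero, Preadditive.comp_neg, reassoc_of% h₀_left]
      exact neg_add_cancel _
    · change 0 = _ at hl; omega
    · change 0 = _ at hl; omega
    · change 0 = _ at hl; omega
  have hg : ∀ j l, D.deg l = (singleData M).deg j + 1 →
      ∑ i, (singleData M).d j i ≫ g i l = ∑ i, g j i ≫ D.d i l := by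
    rintro _ ⟨_ | _, _ | _⟩ hl
    · change _ = 0 + 1 at hl; omega
    · change _ = 0 + 1 at hl; omega
    · change _ = 0 + 1 at hl; omega
    · simp only [Fintype.sum_prod_type, Fintype.sum_bool, g, zero_comp, zero_add, add_zero,
        Finset.sum_const_zero, Preadditive.neg_comp, Category.assoc, h₁_right, Category.comp_id]
      exact (neg_add_cancel _).symm
  refine ⟨c.hoIso c' f g h hf₀ hg₀ hf hg ?_ ?_, ?_⟩
  · rintro ⟨_ | _, _ | _⟩ ⟨_ | _, _ | _⟩ hl
    all_goals first | omega | skip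
    all_goals simp only [Fintype.sum_prod_type, Fintype.sum_bool, f, g, h, zero_comp, zero_add,
      add_zero, comp_zero, Finset.univ_unique, Finset.sum_singleton, Preadditive.comp_neg,
      Preadditive.neg_comp, cellId_self]
    · rw [h₀_left, neg_add_cancel]
    · exact μ.hom_inv_id
    · rw [cellId_ne _ (by simp), add_zero, Iso.hom_inv_id_assoc]
    · rw [cellId_ne _ (by simp), add_zero, Category.assoc, Category.assoc, Iso.hom_inv_id,
        Category.comp_id]
    · rw [neg_neg, Category.assoc, Category.assoc, Iso.hom_inv_id_assoc, reassoc_of% hdd',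
        Preadditive.neg_comp, Preadditive.comp_neg, Category.assoc, hproj']
      abel
    · rw [h₁_right, neg_add_cancel]
  · rintro _ _ _
    simp only [Fintype.sum_prod_type, Fintype.sum_bool, f, g, zero_comp, zero_add,
      add_zero, comp_zero, cellId_self, Preadditive.comp_neg, Preadditive.neg_comp, neg_neg,
      Category.assoc, reassoc_of% h₁₀, μ.inv_hom_id]
  · refine (HPt.hoMap_map _ _).trans (c.map_cyc c' f hf hC₁ he hd he' (fun _ => rfl) ?_ ?_)
    · change -(μ.hom.lin ((D.d (false, false) (false, true)).lin (h₀.lin e))) = e'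
      rw [hee, neg_neg]
    · exact fun i hi => (hi rfl).elim

variable [GradedAlgebra 𝒜]

theorem HPt.one_eq : HPt.one 𝒜 = HPt.mk ((singleCells (regular 𝒜)).cyc () (reg 1) reg_one_mem
    fun _ => rfl) := by
  refine HPt.mk_congr (lin_congr (Eq.symm ?_) (reg 1))
  exact place_self _

end Square

/-! ### Entries of the differential of a tensor product -/

section TensorEntries

open GrBimod

variable {k R : Type} [CommRing k] [CommRing R] [Algebra k R] {𝒜 : ℤ → Submodule k R}
  {J J' : Type} (D : CellData 𝒜 J) (D' : CellData 𝒜 J')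

theorem CellData.d_self (j : J) : D.d j j = 0 := D.d_eq_zero j j (by omega)

variable [GradedAlgebra 𝒜]

theorem CellData.tensor_d_left (j l : J) (j' : J') :
    (D.tensor D').d (j, j') (l, j') = tensMap (D.d j l) (𝟙 (D'.A j')) := by
  change tensMap (D.d j l) (cellId D'.A j' j') +
    ((D.deg j).negOnePow : ℤ) • tensMap (cellId D.A j l) (D'.d j' j') = _
  rw [cellId_self, D'.d_self, tensMap_zero_right, smul_zero, add_zero]

theorem CellData.tensor_d_right (j : J) (j' l' : J') :
    (D.tensor D').d (j, j') (j, l') =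
      ((D.deg j).negOnePow : ℤ) • tensMap (𝟙 (D.A j)) (D'.d j' l') := by
  change tensMap (D.d j j) (cellId D'.A j' l') +
    ((D.deg j).negOnePow : ℤ) • tensMap (cellId D.A j j) (D'.d j' l') = _
  rw [cellId_self, D.d_self, tensMap_zero_left, zero_add]

theorem CellData.tensor_d_ne {j l : J} {j' l' : J'} (h : j ≠ l) (h' : j' ≠ l') :
    (D.tensor D').d (j, j') (l, l') = 0 := by
  change tensMap (D.d j l) (cellId D'.A j' l') +
    ((D.deg j).negOnePow : ℤ) • tensMap (cellId D.A j l) (D'.d j' l') = _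
  rw [cellId_ne _ h, cellId_ne _ h', tensMap_zero_left, tensMap_zero_right, smul_zero, add_zero]

end TensorEntries

/-! ### The complexes of a generator and of its inverse -/

section Inverses

open GrBimod

variable {r : ℕ}

/-- The isomorphism `R{a} ⊗ R{b} ≅ R` when `a + b = 0`. -/
theorem exists_shift_tens_shift (r : ℕ) {a b : ℤ} (hab : a + b = 0) :
    ∃ μ : tens ((regular (polyGr r)).shift a) ((regular (polyGr r)).shift b) ≅ regular (polyGr r),
      μ.hom.lin (word₂ (rOne r a) (rOne r b) 1 1 1) = reg (1 : Poly r) := by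
  have ha := R_isCyclic r a
  have hb := R_isCyclic r b
  obtain ⟨F, hF⟩ := ha.exists_hom₂ hb (P := regular (polyGr r)) LinearMap.id
    (fun a a' h b => by subst h; rfl) (fun a a' h b => by subst h; exact mul_comm b a)
    (fun i b hi => by rw [hab, add_zero]; exact hi)
  have h1 : (1 : Poly r) ∈ polyGr r 0 := SetLike.one_mem_graded _
  obtain ⟨G, hG⟩ := (regular_isCyclic (polyGr r)).exists_hom
    (word₂ (rOne r a) (rOne r b) 1 1 1) (word₂_mem ha.mem hb.mem h1 h1 h1 (by omega))
    (fun x x' h => by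
      subst h
      rw [left_word₂, right_word₂, mul_comm x, ha.pass_left _ (a' := x) rfl, mul_comm x,
        hb.pass_right _ (a' := x) rfl, mul_comm x])
  have hF1 : F.lin (word₂ (rOne r a) (rOne r b) 1 1 1) = reg (1 : Poly r) := by
    rw [hF, map_one, map_one]
    rfl
  refine ⟨⟨F, G, ha.hom_ext₂ hb fun x => ?_, (regular_isCyclic (polyGr r)).hom_ext ?_⟩, hF1⟩
  · have hx : word₂ (rOne r a) (rOne r b) 1 x 1 =
        (tens _ _).left x (word₂ (rOne r a) (rOne r b) 1 1 1) := by
      rw [left_word₂, mul_comm, ha.pass_left _ (a' := x) rfl, mul_one]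
    rw [hx, hom_left, comp_lin, hF1, hG, hom_left, id_lin]
  · rw [comp_lin, hG, hF1, id_lin]

theorem dem_mul_sub (hr : 3 ≤ r) {i : ZMod r} {p : Poly r} (hp : sigmaHom i p = p + root i)
    (b : Poly r) : dem hr i (p * b) = (p + root i) * dem hr i b - b := dem_eq hr (by
  rw [map_mul, hp]
  linear_combination (p + root i) * root_mul_dem hr i b)

/-- The complex `F(σ_i)`. -/
noncomputable abbrev sigmaK (hr : 3 ≤ r) (i : ZMod r) : Complexes (polyGr r) :=
  HomologicalComplex.double (rb hr i) (show (ComplexShape.up ℤ).Rel (-1) 0 by simp)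

/-- The complex `F(σ_i⁻¹)`. -/
noncomputable abbrev sigmaInvK (i : ZMod r) : Complexes (polyGr r) :=
  HomologicalComplex.double (br i (-2)) (show (ComplexShape.up ℤ).Rel 0 1 by simp)

/-- The cells of `F(σ_i)`. -/
noncomputable abbrev sigmaCells (hr : 3 ≤ r) (i : ZMod r) :
    Cells (doubleData (rb hr i) (-1) 0 rfl) (sigmaK hr i) :=
  doubleCells (rb hr i) (-1) 0 rfl _

/-- The cells of `F(σ_i⁻¹)`. -/
noncomputable abbrev sigmaInvCells (i : ZMod r) :
    Cells (doubleData (br i (-2)) 0 1 rfl) (sigmaInvK i) :=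
  doubleCells (br i (-2)) 0 1 rfl _

theorem sigma_d_bOne (hr : 3 ≤ r) (i : ZMod r) (l : Bool) :
    ((doubleData (rb hr i) (-1) 0 rfl).d true l).lin (bOne i) = 0 := by
  cases l <;> rfl

/-- The distinguished point of `F(σ_i)`. -/
noncomputable def sigmaPt (hr : 3 ≤ r) (i : ZMod r) : HPt (sigmaK hr i) :=
  HPt.mk ((sigmaCells hr i).cyc true (bOne i) (bOne_mem i) (sigma_d_bOne hr i))

/-- The element `1 ⊗ x_i - x_i ⊗ 1` of `B_i`. -/
noncomputable def invElt (i : ZMod r) : (B i).shift (-2) :=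
  ((B i).shift (-2)).left (-x i) (bGen i (-2)) - ((B i).shift (-2)).right (-x i) (bGen i (-2))

theorem invElt_mem (i : ZMod r) : invElt i ∈ ((B i).shift (-2)).gr 0 := by
  have h1 := ((B i).shift (-2)).left_mem (neg_mem (x_mem i)) (bGen_isCyclic i (-2)).mem
  have h2 := ((B i).shift (-2)).right_mem (neg_mem (x_mem i)) (bGen_isCyclic i (-2)).mem
  exact sub_mem h1 h2

theorem inv_d_invElt (i : ZMod r) (l : Bool) :
    ((doubleData (br i (-2)) 0 1 rfl).d false l).lin (invElt i) = 0 := by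
  cases l
  · rfl
  · refine (map_sub (br i (-2)).lin _ _).trans ?_
    rw [hom_left, hom_right, br_bGen]
    exact sub_self _

/-- The distinguished point of `F(σ_i⁻¹)`. -/
noncomputable def sigmaInvPt (i : ZMod r) : HPt (sigmaInvK i) :=
  HPt.mk ((sigmaInvCells i).cyc false (invElt i) (invElt_mem i) (inv_d_invElt i))

section

variable {M N P Q : GrBimod (polyGr r)} {e : M} {e' : N} {u : P} {v : Q} {δ δ' ε ε' : ℤ}
  {A A' : Poly r → Poly r → Prop}

/-- The map `1 ⊗ b ⊗ 1 ↦ 1 ⊗ ∂_i b ⊗ 1`. -/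
theorem exists_demHom (hr : 3 ≤ r) {i : ZMod r} (hM : GrBimod.IsCyclic M e δ (FixRel i))
    (hN : GrBimod.IsCyclic N e' δ' (FixRel i)) (hP : GrBimod.IsCyclic P u ε A)
    (hQ : GrBimod.IsCyclic Q v ε' A') (hA : ∀ a ∈ fixedRing i, A a a)
    (hA' : ∀ a ∈ fixedRing i, A' a a) (hδ : ε + ε' = δ + δ' + 2) :
    ∃ F : tens M N ⟶ tens P Q, ∀ a b c,
      F.lin (word₂ e e' a b c) = word₂ u v a (dem hr i b) c := by
  have h1 : (1 : Poly r) ∈ polyGr r 0 := SetLike.one_mem_graded _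
  obtain ⟨F, hF⟩ := hM.exists_hom₂ hN ((midLin u v).comp (dem hr i))
    (fun a a' h y => by
      obtain ⟨rfl, h⟩ := h
      rw [LinearMap.comp_apply, LinearMap.comp_apply, midLin_apply, midLin_apply, left_word₂,
        dem_mul hr h, mul_comm a 1, hP.pass_left _ (hA a h)])
    (fun a a' h y => by
      obtain ⟨rfl, h⟩ := h
      rw [LinearMap.comp_apply, LinearMap.comp_apply, midLin_apply, midLin_apply, right_word₂,
        mul_comm y, dem_mul hr h, mul_comm a, hQ.pass_right _ (hA' a h), mul_comm a])
    (fun j y hy => by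
      rw [LinearMap.comp_apply, midLin_apply]
      exact word₂_mem hP.mem hQ.mem h1 (dem_mem_polyGr hr i hy) h1 (by omega))
  refine ⟨F, fun x y z => ?_⟩
  rw [hF, LinearMap.comp_apply, midLin_apply, right_word₂, left_word₂, mul_one, one_mul]

/-- The map `a ⊗ b ⊗ c ↦ a ⊗ 1 ⊗ b c`. -/
theorem exists_pushRight {i : ZMod r} (hM : GrBimod.IsCyclic M e δ (FixRel i))
    (hN : GrBimod.IsCyclic N e' δ' Eq) (hP : GrBimod.IsCyclic P u ε A)
    (hQ : GrBimod.IsCyclic Q v ε' A') (hA : ∀ a ∈ fixedRing i, A a a)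
    (hA' : ∀ a ∈ fixedRing i, A' a a) (hδ : ε + ε' = δ + δ') :
    ∃ F : tens M N ⟶ tens P Q, ∀ a b c, F.lin (word₂ e e' a b c) = word₂ u v a 1 (b * c) := by
  have h1 : (1 : Poly r) ∈ polyGr r 0 := SetLike.one_mem_graded _
  obtain ⟨F, hF⟩ := hM.exists_hom₂ hN (lastLin u v)
    (fun a a' h y => by
      obtain ⟨rfl, h⟩ := h
      rw [lastLin_apply, lastLin_apply, left_word₂, mul_comm a 1, hP.pass_left _ (hA a h),
        mul_comm a 1, hQ.pass_right _ (hA' a h)])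
    (fun a a' h y => by
      subst h
      rw [lastLin_apply, lastLin_apply, right_word₂])
    (fun j y hy => by
      rw [lastLin_apply]
      exact word₂_mem hP.mem hQ.mem h1 h1 hy (by omega))
  refine ⟨F, fun x y z => ?_⟩
  rw [hF, lastLin_apply, right_word₂, left_word₂, mul_one]

/-- The map `a ⊗ b ⊗ c ↦ a b ⊗ 1 ⊗ c`. -/
theorem exists_pushLeft {i : ZMod r} (hM : GrBimod.IsCyclic M e δ Eq)
    (hN : GrBimod.IsCyclic N e' δ' (FixRel i)) (hP : GrBimod.IsCyclic P u ε A)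
    (hQ : GrBimod.IsCyclic Q v ε' A') (hA : ∀ a ∈ fixedRing i, A a a)
    (hA' : ∀ a ∈ fixedRing i, A' a a) (hδ : ε + ε' = δ + δ') :
    ∃ F : tens M N ⟶ tens P Q, ∀ a b c, F.lin (word₂ e e' a b c) = word₂ u v (a * b) 1 c := by
  have h1 : (1 : Poly r) ∈ polyGr r 0 := SetLike.one_mem_graded _
  obtain ⟨F, hF⟩ := hM.exists_hom₂ hN (firstLin u v)
    (fun a a' h y => by
      subst h
      rw [firstLin_apply, firstLin_apply, left_word₂])
    (fun a a' h y => by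
      obtain ⟨rfl, h⟩ := h
      rw [firstLin_apply, firstLin_apply, right_word₂, hP.pass_left _ (hA a h), mul_comm a 1,
        hQ.pass_right _ (hA' a h), mul_comm a 1])
    (fun j y hy => by
      rw [firstLin_apply]
      exact word₂_mem hP.mem hQ.mem hy h1 h1 (by omega))
  refine ⟨F, fun x y z => ?_⟩
  rw [hF, firstLin_apply, right_word₂, left_word₂, one_mul]

end

end Inverses

/-! ### Invertibility of the complexes of the reflections -/

section InverseMaps

open GrBimod

variable {r : ℕ}

theorem tm_mem_zero {M N : GrBimod (polyGr r)} {m : M} {n : N} (hm : m ∈ M.gr 0) (hn : n ∈ N.gr 0) :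
    tm M N m n ∈ (tens M N).gr 0 := by
  have := tm_mem hm hn
  rwa [add_zero] at this

/-- The product has the cells `R{2} ⊗ B_i{-2}` in degree `-1`, `B_i ⊗ B_i{-2}` and `R{2} ⊗ R{-2}` in
degree `0`, and `B_i ⊗ R{-2}` in degree `1`. As `B_i ⊗ B_i` is the direct sum of two shifts of
`B_i`, the cell `R{2} ⊗ R{-2} ≅ R` remains. The splittings are `a ⊗ b ⊗ c ↦ a ⊗ ∂_i b ⊗ c` and `a ⊗
b ⊗ c ↦ a ⊗ 1 ⊗ b c`. -/
theorem exists_iso_sigma_inv (hr : 3 ≤ r) (i : ZMod r) :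
    ∃ E : (toHo _).obj (sigmaK hr i ⊗ sigmaInvK i) ≅ (toHo _).obj (𝟙_ (Complexes (polyGr r))),
      HPt.hoMap E.hom (HPt.mul (sigmaPt hr i) (sigmaInvPt i)) = HPt.one (polyGr r) := by
  have hp := sigmaHom_x_self i
  have hS := R_isCyclic r 2
  have hB := B_isCyclic i
  have hB' := bGen_isCyclic i (-2)
  have hR' := R_isCyclic r (-2)
  obtain ⟨h₀, hh₀⟩ := exists_demHom hr hB hB' hS hB' (fun _ _ => rfl) (fun _ h => ⟨rfl, h⟩)
    (by omega)
  obtain ⟨h₁, hh₁⟩ := exists_pushRight hB hR' hB hB' (fun _ h => ⟨rfl, h⟩) (fun _ h => ⟨rfl, h⟩)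
    (by omega)
  obtain ⟨μ, hμ⟩ := exists_shift_tens_shift r (show (2 : ℤ) + -2 = 0 by omega)
  have hrb := rb_rOne hr i hp
  have hbr := br_bGen i (-2)
  rw [HPt.one_eq, sigmaPt, sigmaInvPt, (sigmaCells hr i).mulCyc_cyc (sigmaInvCells i) rfl
    (bOne_mem i) (sigma_d_bOne hr i) rfl (invElt_mem i) (inv_d_invElt i)
    (tm_mem_zero (bOne_mem i) (invElt_mem i))]
  refine ((sigmaCells hr i).tensor (sigmaInvCells i)).exists_iso_of_square rfl rfl rfl rfl
    (singleCells (regular (polyGr r))) h₀ h₁ ?_ ?_ ?_ ?_ μ _ _ _ ?_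
  · rw [CellData.tensor_d_left]
    change tensMap (rb hr i) (𝟙 _) ≫ h₀ = 𝟙 (tens _ _)
    refine hS.hom_ext₂ hB' fun b => ?_
    obtain ⟨Q, _, s₀, s₁, s₂, θ, hw, h01, h12⟩ := hS.exists_slots₂ hB'
    rw [comp_lin, tensMap_word₂, hrb, word₂_sub_left, map_sub, id_lin, id_lin, hh₀, hh₀,
      dem_mul_sub hr hp, hw, hw, hw, ← map_sub]
    refine congrArg θ ?_
    simp only [map_mul, map_add, map_sub, map_one, h01 _ _ rfl]
    ring
  · rw [CellData.tensor_d_right]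
    change h₁ ≫ (((0 : ℤ).negOnePow : ℤ) • tensMap (𝟙 (B i)) (br i (-2))) = 𝟙 (tens _ _)
    rw [Int.negOnePow_zero, Units.val_one, one_smul]
    refine hB.hom_ext₂ hR' fun b => ?_
    rw [comp_lin, hh₁, tensMap_word₂, hbr, id_lin, id_lin, ← hR'.pass_right _ rfl, one_mul]
  · refine hB.hom_ext₂ hR' fun b => ?_
    rw [comp_lin, hh₁, hh₀, dem_one, word₂_zero, zero_lin]
  · rw [CellData.tensor_d_left, CellData.tensor_d_right]
    change (𝟙 (tens _ _) - h₀ ≫ tensMap (rb hr i) (𝟙 _)) ≫ (𝟙 (tens _ _) -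
      (((0 : ℤ).negOnePow : ℤ) • tensMap (𝟙 (B i)) (br i (-2))) ≫ h₁) = 0
    rw [Int.negOnePow_zero, Units.val_one, one_smul]
    refine hB.hom_ext₂ hB' fun b => ?_
    obtain ⟨Q, _, s₀, s₁, s₂, θ, hw, h01, h12⟩ := hB.exists_slots₂ hB'
    have h1 := h12 _ _ ⟨rfl, dem_mem hr i b⟩
    have h2 := h12 _ _ ⟨rfl, add_dem_mul_mem hr hp b⟩
    simp only [comp_lin, sub_lin, id_lin, hh₀, tensMap_word₂, hrb, word₂_sub_left, map_sub, hbr,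
      hh₁, zero_lin]
    simp only [hw, ← map_sub θ]
    rw [← map_zero θ]
    refine congrArg θ ?_
    simp only [map_mul, map_add, map_one] at h1 h2 ⊢
    linear_combination h2 - (s₀ (x i) + s₀ (root i)) * h1
  · rw [CellData.tensor_d_right]
    change μ.hom.lin (((((-1 : ℤ).negOnePow : ℤ) •
      tensMap (𝟙 ((regular (polyGr r)).shift 2)) (br i (-2))).lin
        (h₀.lin (tm _ _ (bOne i) (invElt i))))) = _
    have hd : dem hr i (-x i) = 1 := by rw [map_neg, dem_of_sigmaHom hr hp, neg_neg]
    rw [zsmul_lin, ← word₂_one, invElt, word₂_sub_right, map_sub, hh₀, hh₀, dem_one, one_mul, hd,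
      map_sub, tensMap_word₂, hbr, id_lin, word₂_zero, map_zero, sub_zero, map_zsmul, hμ,
      Int.negOnePow_neg, Int.negOnePow_one, Units.val_neg, Units.val_one, neg_one_smul]

theorem dem_mul_add (hr : 3 ≤ r) {i : ZMod r} {p : Poly r} (hp : sigmaHom i p = p + root i)
    (b : Poly r) : dem hr i ((p + root i) * b) = b + p * dem hr i b := dem_eq hr (by
  rw [map_mul, map_add, hp, sigmaHom_root hr]
  linear_combination p * root_mul_dem hr i b)

/-- The splittings of the differential of `F(σ_i⁻¹) ⊗ F(σ_i)`: `h₀` maps `a ⊗ b ⊗ c` to `a ⊗ ∂_i b ⊗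
c`, and `h₁` maps it to `a b ⊗ 1 ⊗ c`. The last equation compares distinguished points. -/
theorem exists_inv_sigma_maps (hr : 3 ≤ r) (i : ZMod r) :
    ∃ (h₀ : tens ((B i).shift (-2)) (B i) ⟶
        tens ((B i).shift (-2)) ((regular (polyGr r)).shift 2))
      (h₁ : tens ((regular (polyGr r)).shift (-2)) (B i) ⟶ tens ((B i).shift (-2)) (B i)),
      tensMap (𝟙 _) (rb hr i) ≫ h₀ = 𝟙 _ ∧ h₁ ≫ tensMap (br i (-2)) (𝟙 _) = 𝟙 _ ∧ h₁ ≫ h₀ = 0 ∧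
      (𝟙 _ - h₀ ≫ tensMap (𝟙 _) (rb hr i)) ≫ (𝟙 _ - tensMap (br i (-2)) (𝟙 _) ≫ h₁) = 0 ∧
      (tensMap (br i (-2)) (𝟙 _)).lin (h₀.lin (tm _ _ (invElt i) (bOne i))) =
        -word₂ (rOne r (-2)) (rOne r 2) 1 1 1 := by
  have hp := sigmaHom_x_self i
  have hS := R_isCyclic r 2
  have hB := B_isCyclic i
  have hB' := bGen_isCyclic i (-2)
  have hR' := R_isCyclic r (-2)
  obtain ⟨h₀, hh₀⟩ := exists_demHom hr hB' hB hB' hS (fun _ h => ⟨rfl, h⟩) (fun _ _ => rfl)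
    (by omega)
  obtain ⟨h₁, hh₁⟩ := exists_pushLeft hR' hB hB' hB (fun _ h => ⟨rfl, h⟩) (fun _ h => ⟨rfl, h⟩)
    (by omega)
  have hrb := rb_rOne hr i hp
  have hbr := br_bGen i (-2)
  refine ⟨h₀, h₁, hB'.hom_ext₂ hS fun b => ?_, hR'.hom_ext₂ hB fun b => ?_,
    hR'.hom_ext₂ hB fun b => ?_, hB'.hom_ext₂ hB fun b => ?_, ?_⟩
  · obtain ⟨Q, _, s₀, s₁, s₂, θ, hw, h01, h12⟩ := hB'.exists_slots₂ hS
    rw [comp_lin, tensMap_word₂, hrb, word₂_sub_right, map_sub, id_lin, id_lin, hh₀, hh₀,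
      one_mul, mul_comm b, dem_mul_add hr hp, hw, hw, hw, ← map_sub]
    refine congrArg θ ?_
    simp only [map_mul, map_add, map_one, h12 _ _ rfl]
    ring
  · rw [comp_lin, hh₁, tensMap_word₂, hbr, id_lin, id_lin, hR'.pass_left _ rfl, mul_one]
  · rw [comp_lin, hh₁, hh₀, dem_one, word₂_zero, zero_lin]
  · obtain ⟨Q, _, s₀, s₁, s₂, θ, hw, h01, h12⟩ := hB'.exists_slots₂ hB
    have h1' := h01 _ _ ⟨rfl, dem_mem hr i b⟩
    have h2 := h01 _ _ ⟨rfl, add_dem_mul_mem hr hp b⟩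
    have h3 := h01 _ _ ⟨rfl, add_dem_mul_mem hr hp (root i)⟩
    simp only [comp_lin, sub_lin, id_lin, hh₀, tensMap_word₂, hrb, word₂_sub_right, map_sub, hbr,
      hh₁, zero_lin]
    simp only [hw, ← map_sub θ]
    rw [← map_zero θ]
    refine congrArg θ ?_
    rw [dem_root] at h3
    simp only [map_mul, map_add, map_one, map_ofNat] at h1' h2 h3 ⊢
    linear_combination -h2 + s₀ (dem hr i b) * h3 +
      (2 * s₁ (x i) + s₁ (root i) - s₂ (x i)) * h1'
  · have hd : dem hr i (-x i) = 1 := by rw [map_neg, dem_of_sigmaHom hr hp, neg_neg]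
    rw [← word₂_one, invElt, word₂_sub_left, map_sub, hh₀, hh₀, dem_one, mul_one (-x i), hd,
      word₂_zero, zero_sub, map_neg, tensMap_word₂, hbr, id_lin]

theorem exists_iso_inv_sigma (hr : 3 ≤ r) (i : ZMod r) :
    ∃ E : (toHo _).obj (sigmaInvK i ⊗ sigmaK hr i) ≅ (toHo _).obj (𝟙_ (Complexes (polyGr r))),
      HPt.hoMap E.hom (HPt.mul (sigmaInvPt i) (sigmaPt hr i)) = HPt.one (polyGr r) := by
  obtain ⟨h₀, h₁, e₁, e₂, e₃, e₄, e₅⟩ := exists_inv_sigma_maps hr i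
  obtain ⟨μ, hμ⟩ := exists_shift_tens_shift r (show (-2 : ℤ) + 2 = 0 by omega)
  rw [HPt.one_eq, sigmaPt, sigmaInvPt, (sigmaInvCells i).mulCyc_cyc (sigmaCells hr i) rfl
    (invElt_mem i) (inv_d_invElt i) rfl (bOne_mem i) (sigma_d_bOne hr i)
    (tm_mem_zero (invElt_mem i) (bOne_mem i))]
  have a₁ : ((doubleData (br i (-2)) 0 1 rfl).tensor (doubleData (rb hr i) (-1) 0 rfl)).d
      (false, false) (false, true) = tensMap (𝟙 _) (rb hr i) := by
    rw [CellData.tensor_d_right]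
    change ((0 : ℤ).negOnePow : ℤ) • _ = _
    rw [Int.negOnePow_zero, Units.val_one, one_smul]
  have a₂ : ((doubleData (br i (-2)) 0 1 rfl).tensor (doubleData (rb hr i) (-1) 0 rfl)).d
      (false, true) (true, true) = tensMap (br i (-2)) (𝟙 _) :=
    CellData.tensor_d_left _ _ false true true
  have a₃ : ((doubleData (br i (-2)) 0 1 rfl).tensor (doubleData (rb hr i) (-1) 0 rfl)).d
      (false, false) (true, false) = tensMap (br i (-2)) (𝟙 _) :=
    CellData.tensor_d_left _ _ false true false
  have a₄ := (congrArg₂ (fun (f : tens ((B i).shift (-2)) ((regular (polyGr r)).shift 2) ⟶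
      tens ((B i).shift (-2)) (B i)) (g : tens ((B i).shift (-2)) (B i) ⟶
      tens ((regular (polyGr r)).shift (-2)) (B i)) =>
    (𝟙 (tens ((B i).shift (-2)) (B i)) - h₀ ≫ f) ≫ (𝟙 (tens ((B i).shift (-2)) (B i)) - g ≫ h₁))
      a₁ a₂).trans e₄
  -- here `B_i{-2} ⊗ R{2}` is in degree `-1`, so the roles of the two indices are exchanged
  have h := (((sigmaInvCells i).tensor (sigmaCells hr i)).reindex
      (Equiv.prodComm Bool Bool)).exists_iso_of_square rfl rfl rfl rfl
      (singleCells (regular (polyGr r))) h₀ h₁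
      ((congrArg (· ≫ h₀) a₁).trans e₁) ((congrArg (h₁ ≫ ·) a₂).trans e₂) e₃
      a₄ μ
      (tm_mem_zero (invElt_mem i) (bOne_mem i))
      (fun l => CellData.tensor_d_tm (inv_d_invElt i) (sigma_d_bOne hr i) (l.2, l.1)) reg_one_mem
      ((congrArg μ.hom.lin ((lin_congr a₃ _).trans e₅)).trans ((map_neg _ _).trans
        (congrArg Neg.neg hμ)))
  exact h

end InverseMaps

/-! ### Chain maps from entries -/

section SmallCells

open GrBimod

variable {k R : Type} [CommRing k] [CommRing R] [Algebra k R] {𝒜 : ℤ → Submodule k R}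
  {K L : Complexes 𝒜}

/-- An isomorphism of modules gives an isomorphism of complexes with a single cell. -/
theorem Cells.exists_iso_of_iso {J J' : Type} [Unique J] [Unique J'] {D : CellData 𝒜 J}
    {D' : CellData 𝒜 J'} (c : Cells D K) (c' : Cells D' L) (h : D.deg default = 0)
    (h' : D'.deg default = 0) (μ : D.A default ≅ D'.A default) {e : D.A default}
    (he : e ∈ (D.A default).gr 0) (hd : ∀ l, (D.d default l).lin e = 0) {e' : D'.A default}
    (he' : e' ∈ (D'.A default).gr 0) (hd' : ∀ l, (D'.d default l).lin e' = 0)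
    (hee : μ.hom.lin e = e') :
    ∃ E : (toHo 𝒜).obj K ≅ (toHo 𝒜).obj L,
      HPt.hoMap E.hom (HPt.mk (c.cyc default e he hd)) = HPt.mk (c'.cyc default e' he' hd') := by
  have hD : ∀ j l, D.d j l = 0 := fun j l => by
    rw [Subsingleton.elim j l]
    exact D.d_self _
  have hD' : ∀ j l, D'.d j l = 0 := fun j l => by
    rw [Subsingleton.elim j l]
    exact D'.d_self _
  let f : ∀ (j : J) (l : J'), D.A j ⟶ D'.A l := fun j l =>
    eqToHom (congrArg D.A (Unique.eq_default j)) ≫ μ.hom ≫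
      eqToHom (congrArg D'.A (Unique.default_eq l))
  let g : ∀ (j : J') (l : J), D'.A j ⟶ D.A l := fun j l =>
    eqToHom (congrArg D'.A (Unique.eq_default j)) ≫ μ.inv ≫
      eqToHom (congrArg D.A (Unique.default_eq l))
  have hf : f default default = μ.hom := by simp [f]
  have hg : g default default = μ.inv := by simp [g]
  refine ⟨c.hoIso c' f g (fun _ _ => 0) ?_ ?_ ?_ ?_ ?_ ?_, ?_⟩
  · intro j l hn
    rw [Unique.eq_default j, Unique.eq_default l, h, h'] at hn
    exact (hn rfl).elim
  · intro j l hn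
    rw [Unique.eq_default j, Unique.eq_default l, h, h'] at hn
    exact (hn rfl).elim
  · intro j l _
    simp [hD, hD']
  · intro j l _
    simp [hD, hD']
  · intro j l _
    obtain rfl := Unique.eq_default j
    obtain rfl := Unique.eq_default l
    rw [Fintype.sum_unique, hf, hg, cellId_self]
    simp
  · intro j l _
    obtain rfl := Unique.eq_default j
    obtain rfl := Unique.eq_default l
    rw [Fintype.sum_unique, hf, hg, cellId_self]
    simp
  · refine (HPt.hoMap_map _ _).trans (c.map_cyc c' f _ h he hd he' hd' ?_ ?_)
    · rw [hf, hee]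
    · exact fun i hi => (hi (Unique.eq_default i)).elim

/-- A family of maps between the cells with the same index that commutes with the entries of the
differentials gives a map of complexes. -/
theorem Cells.exists_hom_of_diag {J : Type} [Fintype J] {D D' : CellData 𝒜 J} (c : Cells D K)
    (c' : Cells D' L) (f : ∀ j, D.A j ⟶ D'.A j)
    (hf : ∀ j l, D'.deg l = D.deg j + 1 → D.d j l ≫ f l = f j ≫ D'.d j l) {j : J}
    (hj : D.deg j = 0) {e : D.A j} (he : e ∈ (D.A j).gr 0) (hd : ∀ l, (D.d j l).lin e = 0)
    {e' : D'.A j} (he' : e' ∈ (D'.A j).gr 0) (hd' : ∀ l, (D'.d j l).lin e' = 0)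
    (hee : (f j).lin e = e') :
    ∃ F : K ⟶ L, HPt.map F (HPt.mk (c.cyc j e he hd)) = HPt.mk (c'.cyc j e' he' hd') := by
  have hm : ∀ j l, D'.deg l = D.deg j + 1 →
      ∑ i, D.d j i ≫ f i ≫ cellId D'.A i l = ∑ i, (f j ≫ cellId D'.A j i) ≫ D'.d i l := by
    intro j l hl
    simp only [Category.assoc]
    rw [← Preadditive.comp_sum, sum_cellId D'.A (fun i => D'.d i l), ← hf j l hl,
      Finset.sum_eq_single l, cellId_self, Category.comp_id]
    · intro i _ hi
      rw [cellId_ne _ hi, comp_zero, comp_zero]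
    · exact fun h => (h (Finset.mem_univ _)).elim
  refine ⟨c.map c' _ hm, c.map_cyc c' _ hm hj he hd he' hd' ?_ fun i hi _ => ?_⟩
  · rw [cellId_self, Category.comp_id, hee]
  · rw [cellId_ne _ hi.symm, comp_zero, zero_lin]

/-- A commutative square gives a map of complexes with two cells. -/
theorem Cells.exists_hom_of_square {D D' : CellData 𝒜 Bool} (c : Cells D K) (c' : Cells D' L)
    (h₀ : D.deg false = -1) (h₁ : D.deg true = 0) (h₀' : D'.deg false = -1) (h₁' : D'.deg true = 0)
    (f₀ : D.A false ⟶ D'.A false) (f₁ : D.A true ⟶ D'.A true)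
    (hf : D.d false true ≫ f₁ = f₀ ≫ D'.d false true) {e : D.A true}
    (he : e ∈ (D.A true).gr 0) (hd : ∀ l, (D.d true l).lin e = 0) {e' : D'.A true}
    (he' : e' ∈ (D'.A true).gr 0) (hd' : ∀ l, (D'.d true l).lin e' = 0) (hee : f₁.lin e = e') :
    ∃ f : K ⟶ L, HPt.map f (HPt.mk (c.cyc true e he hd)) = HPt.mk (c'.cyc true e' he' hd') := by
  refine c.exists_hom_of_diag c' (fun | false => f₀ | true => f₁) ?_ h₁ he hd he' hd' hee
  rintro (_ | _) (_ | _) hl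
  · omega
  · exact hf
  · omega
  · omega

end SmallCells

/-! ### The rotation -/

section Rotation

open GrBimod

variable {r : ℕ}

theorem rhoHom_sigmaHom (i : ZMod r) (a : Poly r) :
    rhoHom r (sigmaHom i a) = sigmaHom (i + 1) (rhoHom r a) := by
  have h : (rhoHom r).comp (sigmaHom i) = (sigmaHom (i + 1)).comp (rhoHom r) := by
    refine poly_hom_ext (by simp) fun j => ?_
    simp only [AlgHom.comp_apply, sigmaHom_x, rhoHom_x, map_sub, sigmaHom_wrap, add_left_inj]
    split_ifs with h1 h2
    · subst h1
      simp
    · subst h2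
      simp
    · simp
  exact DFunLike.congr_fun h a

theorem rho_sigmaHom (i : ZMod r) (a : Poly r) :
    rho r (sigmaHom i a) = sigmaHom (i + 1) (rho r a) := rhoHom_sigmaHom i a

theorem rho_mem_fixedRing {i : ZMod r} {a : Poly r} :
    rho r a ∈ fixedRing (i + 1) ↔ a ∈ fixedRing i := by
  rw [mem_fixedRing, mem_fixedRing, ← rho_sigmaHom, (rho r).injective.eq_iff]

theorem rho_root (i : ZMod r) : rho r (root i) = root (i + 1) := by
  have h := rho_sigmaHom i (x i)
  rw [sigmaHom_x_self, map_add] at h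
  change rhoHom r (x i) + _ = sigmaHom (i + 1) (rhoHom r (x i)) at h
  rw [rhoHom_x, map_sub, sigmaHom_x_self, sigmaHom_wrap] at h
  linear_combination h

variable {φ ψ : Poly r →ₐ[ℚ] Poly r} {M N P Q : GrBimod (polyGr r)} {e : M} {e' : N} {u : P} {v : Q}
  {δ δ' ε ε' : ℤ}

/-- The product of the twists by `φ` and `ψ` is `R` if `φ` is inverse to `ψ`. -/
theorem exists_twist_tens_twist (hM : GrBimod.IsCyclic M e δ fun a a' => a = φ a')
    (hN : GrBimod.IsCyclic N e' δ' fun a a' => a = ψ a') (hδ : δ + δ' = 0)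
    (hφ : ∀ {n : ℤ} {p : Poly r}, p ∈ polyGr r n → φ p ∈ polyGr r n)
    (hφψ : ∀ a, φ (ψ a) = a) :
    ∃ μ : tens M N ≅ regular (polyGr r), μ.hom.lin (tm _ _ e e') = reg (1 : Poly r) := by
  have h1 : (1 : Poly r) ∈ polyGr r 0 := SetLike.one_mem_graded _
  obtain ⟨F, hF⟩ := hM.exists_hom₂ hN (P := regular (polyGr r)) φ.toLinearMap
    (fun a a' h b => by subst h; exact map_mul φ a' b)
    (fun a a' h b => by
      subst h
      refine (map_mul φ b _).trans ?_
      rw [hφψ]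
      exact mul_comm (φ b) a')
    (fun i b hi => by rw [hδ, add_zero]; exact hφ hi)
  have hp : ∀ x, word₂ e e' x 1 1 = word₂ e e' 1 (ψ x) 1 := fun x => by
    have := hM.pass_left e' (a := x) (a' := ψ x) (hφψ x).symm 1 1 1
    rwa [one_mul, mul_one] at this
  have hq : ∀ x, word₂ e e' 1 1 x = word₂ e e' 1 (ψ x) 1 := fun x => by
    have := hN.pass_right e (a := ψ x) (a' := x) rfl 1 1 1
    rw [one_mul, mul_one] at this
    exact this.symm
  obtain ⟨G, hG⟩ := (regular_isCyclic (polyGr r)).exists_hom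
    (word₂ e e' 1 1 1) (word₂_mem hM.mem hN.mem h1 h1 h1 (by omega))
    (fun x x' h => by
      subst h
      rw [left_word₂, right_word₂, mul_one, one_mul, hp, hq])
  have hF1 : F.lin (word₂ e e' 1 1 1) = reg (1 : Poly r) := by
    rw [hF, map_one, map_one]
    exact map_one φ
  refine ⟨⟨F, G, hM.hom_ext₂ hN fun x => ?_, (regular_isCyclic (polyGr r)).hom_ext ?_⟩, ?_⟩
  · have hx : word₂ e e' 1 x 1 = (tens _ _).left (φ x) (word₂ e e' 1 1 1) := by
      have := hM.pass_left e' (a := φ x) rfl 1 1 1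
      rw [left_word₂, mul_one, ← one_mul (φ x), this, mul_one]
    rw [hx, hom_left, comp_lin, hF1, hG, hom_left, id_lin]
  · rw [comp_lin, hG, hF1, id_lin]
  · rw [← word₂_one, hF1]

/-- The map `a ⊗ b ⊗ c ↦ a φ(b) ⊗ 1 ⊗ c`, moving a twist to the right. -/
theorem exists_twist_right {A A' : Poly r → Poly r → Prop}
    (hM : GrBimod.IsCyclic M e δ fun a a' => a = φ a') (hN : GrBimod.IsCyclic N e' δ' A)
    (hP : GrBimod.IsCyclic P u ε A') (hQ : GrBimod.IsCyclic Q v ε' fun a a' => a = φ a')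
    (hφ : ∀ {n : ℤ} {p : Poly r}, p ∈ polyGr r n → φ p ∈ polyGr r n)
    (hA : ∀ a a', A a a' → A' (φ a) (φ a')) (hδ : ε + ε' = δ + δ') :
    ∃ F : tens M N ⟶ tens P Q, ∀ a b c,
      F.lin (word₂ e e' a b c) = word₂ u v (a * φ b) 1 c := by
  have h1 : (1 : Poly r) ∈ polyGr r 0 := SetLike.one_mem_graded _
  obtain ⟨F, hF⟩ := hM.exists_hom₂ hN ((firstLin u v).comp φ.toLinearMap)
    (fun a a' h y => by
      subst h
      rw [LinearMap.comp_apply, LinearMap.comp_apply, firstLin_apply, firstLin_apply, left_word₂,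
        AlgHom.toLinearMap_apply, map_mul, AlgHom.toLinearMap_apply])
    (fun a a' h y => by
      rw [LinearMap.comp_apply, LinearMap.comp_apply, firstLin_apply, firstLin_apply, right_word₂,
        AlgHom.toLinearMap_apply, map_mul, AlgHom.toLinearMap_apply, hP.pass_left _ (hA a a' h),
        mul_comm (φ a'), hQ.pass_right _ rfl, mul_comm])
    (fun j y hy => by
      rw [LinearMap.comp_apply, firstLin_apply]
      exact word₂_mem hP.mem hQ.mem (hφ hy) h1 h1 (by omega))
  refine ⟨F, fun x y z => ?_⟩
  rw [hF, LinearMap.comp_apply, firstLin_apply, right_word₂, left_word₂, one_mul,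
    AlgHom.toLinearMap_apply]

/-- The map `a ⊗ b ⊗ c ↦ a ⊗ 1 ⊗ ψ(b) c`, moving a twist to the left. -/
theorem exists_twist_left {A A' : Poly r → Poly r → Prop}
    (hM : GrBimod.IsCyclic M e δ A) (hN : GrBimod.IsCyclic N e' δ' fun a a' => a = φ a')
    (hP : GrBimod.IsCyclic P u ε fun a a' => a = φ a') (hQ : GrBimod.IsCyclic Q v ε' A')
    (hψ : ∀ {n : ℤ} {p : Poly r}, p ∈ polyGr r n → ψ p ∈ polyGr r n)
    (hφψ : ∀ a, φ (ψ a) = a) (hψφ : ∀ a, ψ (φ a) = a)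
    (hA : ∀ a a', A a a' → A' (ψ a) (ψ a')) (hδ : ε + ε' = δ + δ') :
    ∃ F : tens M N ⟶ tens P Q, ∀ a b c,
      F.lin (word₂ e e' a b c) = word₂ u v a 1 (ψ b * c) := by
  have h1 : (1 : Poly r) ∈ polyGr r 0 := SetLike.one_mem_graded _
  obtain ⟨F, hF⟩ := hM.exists_hom₂ hN ((lastLin u v).comp ψ.toLinearMap)
    (fun a a' h y => by
      rw [LinearMap.comp_apply, LinearMap.comp_apply, lastLin_apply, lastLin_apply, left_word₂,
        AlgHom.toLinearMap_apply, map_mul, AlgHom.toLinearMap_apply, mul_comm a,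
        hP.pass_left _ (hφψ a).symm, mul_comm (ψ a) 1, hQ.pass_right _ (hA a a' h)])
    (fun a a' h y => by
      subst h
      rw [LinearMap.comp_apply, LinearMap.comp_apply, lastLin_apply, lastLin_apply, right_word₂,
        AlgHom.toLinearMap_apply, map_mul, AlgHom.toLinearMap_apply, hψφ, mul_comm])
    (fun j y hy => by
      rw [LinearMap.comp_apply, lastLin_apply]
      exact word₂_mem hP.mem hQ.mem h1 h1 (hψ hy) (by omega))
  refine ⟨F, fun x y z => ?_⟩
  rw [hF, LinearMap.comp_apply, lastLin_apply, right_word₂, left_word₂, mul_one,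
    AlgHom.toLinearMap_apply, mul_comm]

end Rotation

/-! ### Invertibility and conjugation by the rotation -/

section RotationMaps

open GrBimod

variable {r : ℕ}

variable (r) in
/-- The generator of `B_ρ`. -/
noncomputable def rhoOne : Brho r := (1 : Poly r)

variable (r) in
/-- The generator of `B_{ρ⁻¹}`. -/
noncomputable def rhoInvOne : BrhoInv r := (1 : Poly r)

theorem rho_isCyclic (r : ℕ) :
    GrBimod.IsCyclic (Brho r) (rhoOne r) 0 fun a a' => a = (rho r : Poly r →ₐ[ℚ] Poly r) a' :=
  twist_isCyclic (rho r : Poly r →ₐ[ℚ] Poly r) rho_mem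

theorem rhoInv_isCyclic (r : ℕ) :
    GrBimod.IsCyclic (BrhoInv r) (rhoInvOne r) 0
      fun a a' => a = ((rho r).symm : Poly r →ₐ[ℚ] Poly r) a' :=
  twist_isCyclic ((rho r).symm : Poly r →ₐ[ℚ] Poly r) rho_symm_mem

variable (r) in
/-- The complex `F(ρ)`. -/
noncomputable abbrev rhoK : Complexes (polyGr r) :=
  (HomologicalComplex.single _ (ComplexShape.up ℤ) 0).obj (Brho r)

variable (r) in
/-- The complex `F(ρ⁻¹)`. -/
noncomputable abbrev rhoInvK : Complexes (polyGr r) :=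
  (HomologicalComplex.single _ (ComplexShape.up ℤ) 0).obj (BrhoInv r)

variable (r) in
/-- The distinguished point of `F(ρ)`. -/
noncomputable def rhoPt : HPt (rhoK r) :=
  HPt.mk ((singleCells (Brho r)).cyc () (rhoOne r) (rho_isCyclic r).mem fun _ => rfl)

variable (r) in
/-- The distinguished point of `F(ρ⁻¹)`. -/
noncomputable def rhoInvPt : HPt (rhoInvK r) :=
  HPt.mk ((singleCells (BrhoInv r)).cyc () (rhoInvOne r) (rhoInv_isCyclic r).mem fun _ => rfl)

/-- Bimodules whose product is `R` give complexes, concentrated in degree zero, whose product is the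
unit complex. -/
theorem exists_iso_single_single {M N : GrBimod (polyGr r)} {e : M} {e' : N} (he : e ∈ M.gr 0)
    (he' : e' ∈ N.gr 0) (μ : tens M N ≅ regular (polyGr r)) (hμ : μ.hom.lin (tm _ _ e e') = reg 1) :
    ∃ E : (toHo _).obj ((HomologicalComplex.single _ (ComplexShape.up ℤ) 0).obj M ⊗
        (HomologicalComplex.single _ (ComplexShape.up ℤ) 0).obj N) ≅
          (toHo _).obj (𝟙_ (Complexes (polyGr r))),
      HPt.hoMap E.hom (HPt.mul (HPt.mk ((singleCells M).cyc () e he fun _ => rfl))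
        (HPt.mk ((singleCells N).cyc () e' he' fun _ => rfl))) = HPt.one (polyGr r) := by
  rw [HPt.one_eq, (singleCells M).mulCyc_cyc (singleCells N) rfl he (fun _ => rfl) rfl he'
    (fun _ => rfl) (tm_mem_zero he he')]
  exact (((singleCells M).tensor (singleCells N)).reindex
    (Equiv.prodPUnit Unit).symm).exists_iso_of_iso
    (singleCells (regular (polyGr r))) (zero_add 0) rfl μ (tm_mem_zero he he')
    (fun l => CellData.tensor_d_tm (fun _ => rfl) (fun _ => rfl) (l, ())) reg_one_mem
    (fun _ => rfl) hμ

theorem exists_iso_rho_inv (r : ℕ) :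
    ∃ E : (toHo _).obj (rhoK r ⊗ rhoInvK r) ≅ (toHo _).obj (𝟙_ (Complexes (polyGr r))),
      HPt.hoMap E.hom (HPt.mul (rhoPt r) (rhoInvPt r)) = HPt.one (polyGr r) := by
  obtain ⟨μ, hμ⟩ := exists_twist_tens_twist (rho_isCyclic r) (rhoInv_isCyclic r) (zero_add 0)
    rho_mem (rho r).apply_symm_apply
  exact exists_iso_single_single _ _ μ hμ

theorem exists_iso_inv_rho (r : ℕ) :
    ∃ E : (toHo _).obj (rhoInvK r ⊗ rhoK r) ≅ (toHo _).obj (𝟙_ (Complexes (polyGr r))),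
      HPt.hoMap E.hom (HPt.mul (rhoInvPt r) (rhoPt r)) = HPt.one (polyGr r) := by
  obtain ⟨μ, hμ⟩ := exists_twist_tens_twist (rhoInv_isCyclic r) (rho_isCyclic r) (zero_add 0)
    rho_symm_mem (rho r).symm_apply_apply
  exact exists_iso_single_single _ _ μ hμ

/-- The components of the map `F(ρ) F(σ_i) ⟶ F(σ_{i+1}) F(ρ)`. They are given by
`a ⊗ b ⊗ c ↦ a ρ(b) ⊗ 1 ⊗ c`, which makes sense as `ρ` maps `σ_i`-invariants to
`σ_{i+1}`-invariants. -/
theorem exists_rho_sigma_maps (hr : 3 ≤ r) (i : ZMod r) :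
    ∃ (f₀ : tens (Brho r) ((regular (polyGr r)).shift 2) ⟶
        tens ((regular (polyGr r)).shift 2) (Brho r))
      (f₁ : tens (Brho r) (B i) ⟶ tens (B (i + 1)) (Brho r)),
      tensMap (𝟙 _) (rb hr i) ≫ f₁ = f₀ ≫ tensMap (rb hr (i + 1)) (𝟙 _) ∧
      f₁.lin (tm _ _ (rhoOne r) (bOne i)) = tm _ _ (bOne (i + 1)) (rhoOne r) := by
  have hM := rho_isCyclic r
  have hS := R_isCyclic r 2
  obtain ⟨f₀, h₀⟩ := exists_twist_right hM hS hS hM rho_mem (fun a a' h => by rw [h]) (by omega)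
  obtain ⟨f₁, h₁⟩ := exists_twist_right hM (B_isCyclic i) (B_isCyclic (i + 1)) hM rho_mem
    (fun a a' h => ⟨by rw [h.1], rho_mem_fixedRing.2 h.2⟩) (by omega)
  simp only [AlgEquiv.coe_toAlgHom] at h₀ h₁
  have hp := sigmaHom_x_self i
  have hp' : sigmaHom (i + 1) (rho r (x i)) = rho r (x i) + root (i + 1) := by
    rw [← rho_sigmaHom, hp, map_add, rho_root]
  have hrb := rb_rOne hr i hp
  have hrb' := rb_rOne hr (i + 1) hp'
  refine ⟨f₀, f₁, hM.hom_ext₂ hS fun b => ?_, ?_⟩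
  · rw [comp_lin, comp_lin, tensMap_word₂, hrb, word₂_sub_right, map_sub, id_lin, h₁, h₁, h₀,
      tensMap_word₂, hrb', word₂_sub_left, id_lin]
    have := hM.pass_right (bOne (i + 1)) (a := rho r (x i)) (a' := x i) rfl (1 * rho r b) 1 1
    rw [mul_comm _ (1 : Poly r), this, map_mul, map_add, rho_root, one_mul, one_mul, one_mul,
      mul_one (x i)]
  · rw [← word₂_one, ← word₂_one, h₁, map_one, one_mul]

/-- The components of the map `F(σ_{i+1}) F(ρ) ⟶ F(ρ) F(σ_i)`, given by
`a ⊗ b ⊗ c ↦ a ⊗ 1 ⊗ ρ⁻¹(b) c`. -/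
theorem exists_sigma_rho_maps (hr : 3 ≤ r) (i : ZMod r) :
    ∃ (f₀ : tens ((regular (polyGr r)).shift 2) (Brho r) ⟶
        tens (Brho r) ((regular (polyGr r)).shift 2))
      (f₁ : tens (B (i + 1)) (Brho r) ⟶ tens (Brho r) (B i)),
      tensMap (rb hr (i + 1)) (𝟙 _) ≫ f₁ = f₀ ≫ tensMap (𝟙 _) (rb hr i) ∧
      f₁.lin (tm _ _ (bOne (i + 1)) (rhoOne r)) = tm _ _ (rhoOne r) (bOne i) := by
  have hM := rho_isCyclic r
  have hS := R_isCyclic r 2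
  have e₁ : ∀ a, (rho r : Poly r →ₐ[ℚ] Poly r) (((rho r).symm : Poly r →ₐ[ℚ] Poly r) a) = a :=
    fun a => (rho r).apply_symm_apply a
  have e₂ : ∀ a, ((rho r).symm : Poly r →ₐ[ℚ] Poly r) ((rho r : Poly r →ₐ[ℚ] Poly r) a) = a :=
    fun a => (rho r).symm_apply_apply a
  have e₃ : ∀ a a', FixRel (i + 1) a a' → FixRel i (((rho r).symm : Poly r →ₐ[ℚ] Poly r) a)
      (((rho r).symm : Poly r →ₐ[ℚ] Poly r) a') := by
    rintro a _ ⟨rfl, h⟩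
    refine ⟨rfl, rho_mem_fixedRing.1 ?_⟩
    rw [AlgEquiv.coe_toAlgHom, AlgEquiv.apply_symm_apply]
    exact h
  obtain ⟨f₀, h₀⟩ := exists_twist_left hS hM hM hS rho_symm_mem e₁ e₂ (fun a a' h => by rw [h])
    (by omega)
  obtain ⟨f₁, h₁⟩ := exists_twist_left (B_isCyclic (i + 1)) hM hM (B_isCyclic i) rho_symm_mem e₁ e₂
    e₃ (by omega)
  simp only [AlgEquiv.coe_toAlgHom] at h₀ h₁
  have hp := sigmaHom_x_self i
  have hp' : sigmaHom (i + 1) (rho r (x i)) = rho r (x i) + root (i + 1) := by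
    rw [← rho_sigmaHom, hp, map_add, rho_root]
  have hrb := rb_rOne hr i hp
  have hrb' := rb_rOne hr (i + 1) hp'
  refine ⟨f₀, f₁, hS.hom_ext₂ hM fun b => ?_, ?_⟩
  · rw [comp_lin, comp_lin, tensMap_word₂, hrb', word₂_sub_left, map_sub, id_lin, h₁, h₁, h₀,
      tensMap_word₂, hrb, word₂_sub_right, id_lin]
    have := hM.pass_left (bOne i) (a := rho r (x i) + root (i + 1)) (a' := x i + root i) (by
      rw [AlgEquiv.coe_toAlgHom, map_add, rho_root]) 1 1 ((rho r).symm b * 1)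
    rw [this, map_mul, AlgEquiv.symm_apply_apply, mul_assoc, mul_comm (x i + root i),
      mul_comm _ (x i)]
  · rw [← word₂_one, ← word₂_one, h₁, map_one, one_mul]

theorem exists_hom_rho_sigma (hr : 3 ≤ r) (i : ZMod r) :
    ∃ f : rhoK r ⊗ sigmaK hr i ⟶ sigmaK hr (i + 1) ⊗ rhoK r,
      HPt.map f (HPt.mul (rhoPt r) (sigmaPt hr i)) = HPt.mul (sigmaPt hr (i + 1)) (rhoPt r) := by
  obtain ⟨f₀, f₁, h, h'⟩ := exists_rho_sigma_maps hr i
  have hm := (rho_isCyclic r).mem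
  have hb := bOne_mem i
  have hb' := bOne_mem (i + 1)
  have hd := CellData.tensor_d_tm (D := singleData (Brho r)) (j := ()) (e := rhoOne r)
    (fun _ => rfl) (sigma_d_bOne hr i)
  have hd' := CellData.tensor_d_tm (sigma_d_bOne hr (i + 1)) (D' := singleData (Brho r)) (j' := ())
    (e' := rhoOne r) (fun _ => rfl)
  rw [sigmaPt, sigmaPt, rhoPt, (sigmaCells hr (i + 1)).mulCyc_cyc (singleCells (Brho r)) rfl hb'
    (sigma_d_bOne hr (i + 1)) rfl hm (fun _ => rfl) (tm_mem_zero hb' hm),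
    (singleCells (Brho r)).mulCyc_cyc (sigmaCells hr i) rfl hm (fun _ => rfl) rfl hb
    (sigma_d_bOne hr i) (tm_mem_zero hm hb)]
  have a₁ : ((singleData (Brho r)).tensor (doubleData (rb hr i) (-1) 0 rfl)).d
      ((), false) ((), true) = tensMap (𝟙 _) (rb hr i) := by
    rw [CellData.tensor_d_right]
    change ((0 : ℤ).negOnePow : ℤ) • _ = _
    rw [Int.negOnePow_zero, Units.val_one, one_smul]
  have a₂ : ((doubleData (rb hr (i + 1)) (-1) 0 rfl).tensor (singleData (Brho r))).d
      (false, ()) (true, ()) = tensMap (rb hr (i + 1)) (𝟙 _) :=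
    CellData.tensor_d_left _ _ false true ()
  have := (((singleCells (Brho r)).tensor (sigmaCells hr i)).reindex
    (Equiv.punitProd Bool).symm).exists_hom_of_square
    (((sigmaCells hr (i + 1)).tensor (singleCells (Brho r))).reindex (Equiv.prodPUnit Bool).symm)
    rfl rfl rfl rfl f₀ f₁ ((congrArg (· ≫ f₁) a₁).trans (h.trans (congrArg (f₀ ≫ ·) a₂.symm)))
    (tm_mem_zero hm hb) (fun l => hd ((), l)) (tm_mem_zero hb' hm) (fun l => hd' (l, ())) h'
  exact this

theorem exists_hom_sigma_rho (hr : 3 ≤ r) (i : ZMod r) :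
    ∃ f : sigmaK hr (i + 1) ⊗ rhoK r ⟶ rhoK r ⊗ sigmaK hr i,
      HPt.map f (HPt.mul (sigmaPt hr (i + 1)) (rhoPt r)) = HPt.mul (rhoPt r) (sigmaPt hr i) := by
  obtain ⟨f₀, f₁, h, h'⟩ := exists_sigma_rho_maps hr i
  have hm := (rho_isCyclic r).mem
  have hb := bOne_mem i
  have hb' := bOne_mem (i + 1)
  have hd := CellData.tensor_d_tm (D := singleData (Brho r)) (j := ()) (e := rhoOne r)
    (fun _ => rfl) (sigma_d_bOne hr i)
  have hd' := CellData.tensor_d_tm (sigma_d_bOne hr (i + 1)) (D' := singleData (Brho r)) (j' := ())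
    (e' := rhoOne r) (fun _ => rfl)
  rw [sigmaPt, sigmaPt, rhoPt, (sigmaCells hr (i + 1)).mulCyc_cyc (singleCells (Brho r)) rfl hb'
    (sigma_d_bOne hr (i + 1)) rfl hm (fun _ => rfl) (tm_mem_zero hb' hm),
    (singleCells (Brho r)).mulCyc_cyc (sigmaCells hr i) rfl hm (fun _ => rfl) rfl hb
    (sigma_d_bOne hr i) (tm_mem_zero hm hb)]
  have a₁ : ((singleData (Brho r)).tensor (doubleData (rb hr i) (-1) 0 rfl)).d
      ((), false) ((), true) = tensMap (𝟙 _) (rb hr i) := by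
    rw [CellData.tensor_d_right]
    change ((0 : ℤ).negOnePow : ℤ) • _ = _
    rw [Int.negOnePow_zero, Units.val_one, one_smul]
  have a₂ : ((doubleData (rb hr (i + 1)) (-1) 0 rfl).tensor (singleData (Brho r))).d
      (false, ()) (true, ()) = tensMap (rb hr (i + 1)) (𝟙 _) :=
    CellData.tensor_d_left _ _ false true ()
  have := (((sigmaCells hr (i + 1)).tensor (singleCells (Brho r))).reindex
    (Equiv.prodPUnit Bool).symm).exists_hom_of_square
    (((singleCells (Brho r)).tensor (sigmaCells hr i)).reindex (Equiv.punitProd Bool).symm)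
    rfl rfl rfl rfl f₀ f₁ ((congrArg (· ≫ f₁) a₂).trans (h.trans (congrArg (f₀ ≫ ·) a₁.symm)))
    (tm_mem_zero hb' hm) (fun l => hd' (l, ())) (tm_mem_zero hm hb) (fun l => hd ((), l)) h'
  exact this

end RotationMaps

/-! ### Decomposition over the invariants of a reflection -/

section Decomposition

open GrBimod

variable {r : ℕ}

/-- It suffices to check that a bilinear map is balanced over the `σ_t`-invariants on generators. -/
theorem GenFixed.balanced {s t : ZMod r} {p : Poly r} (h : GenFixed s t p) {X : Type}
    [AddCommGroup X] [Module ℚ X] (β : Poly r →ₗ[ℚ] Poly r →ₗ[ℚ] X)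
    (hp : ∀ b c, β (b * p) c = β b (p * c))
    (h₀ : ∀ a ∈ fixedRing s, a ∈ fixedRing t → ∀ b c, β (b * a) c = β b (a * c))
    (a : Poly r) (ha : a ∈ fixedRing t) (b c : Poly r) : β (b * a) c = β b (a * c) := by
  replace ha := h ha
  induction ha using Algebra.adjoin_induction generalizing b c with
  | mem z hz =>
    rcases hz with rfl | hz
    · exact hp b c
    · exact h₀ z hz.1 hz.2 b c
  | algebraMap q =>
    rw [← Algebra.commutes, ← Algebra.smul_def, ← Algebra.smul_def, map_smul, LinearMap.smul_apply,
      map_smul]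
  | add z w _ _ hz hw =>
    rw [mul_add, add_mul, map_add, map_add, LinearMap.add_apply, hz, hw]
  | mul z w _ _ hz hw =>
    rw [← mul_assoc, hw, hz, mul_assoc]

/-- The `σ_i`-invariant `b'` in the decomposition `b = b' - ∂_i(b) p`. -/
noncomputable def invPart (hr : 3 ≤ r) (i : ZMod r) (p : Poly r) : Poly r →ₗ[ℚ] Poly r :=
  LinearMap.id + (LinearMap.mulRight ℚ p).comp (dem hr i)

theorem invPart_apply (hr : 3 ≤ r) (i : ZMod r) (p b : Poly r) :
    invPart hr i p b = b + dem hr i b * p := rfl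

variable {i : ZMod r} {p : Poly r}

theorem invPart_mem (hr : 3 ≤ r) (hp : sigmaHom i p = p + root i) (b : Poly r) :
    invPart hr i p b ∈ fixedRing i := add_dem_mul_mem hr hp b

theorem invPart_of_mem (hr : 3 ≤ r) {b : Poly r} (hb : b ∈ fixedRing i) :
    invPart hr i p b = b := by
  rw [invPart_apply, dem_of_mem hr hb, zero_mul, add_zero]

theorem invPart_one (hr : 3 ≤ r) : invPart hr i p 1 = 1 := invPart_of_mem hr (one_mem _)

theorem invPart_self (hr : 3 ≤ r) (hp : sigmaHom i p = p + root i) : invPart hr i p p = 0 := by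
  rw [invPart_apply, dem_of_sigmaHom hr hp]
  ring

theorem invPart_mul (hr : 3 ≤ r) {f : Poly r} (hf : f ∈ fixedRing i) (g : Poly r) :
    invPart hr i p (f * g) = f * invPart hr i p g := by
  rw [invPart_apply, invPart_apply, dem_mul hr hf]
  ring

theorem invPart_mul_self (hr : 3 ≤ r) (hp : sigmaHom i p = p + root i) (b : Poly r) :
    invPart hr i p (b * p) = p * (p + root i) * dem hr i b := by
  rw [invPart_apply, mul_comm b, dem_mul_sub hr hp]
  ring

theorem dem_mul_self (hr : 3 ≤ r) (hp : sigmaHom i p = p + root i) (b : Poly r) :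
    dem hr i (b * p) = (p + (p + root i)) * dem hr i b - invPart hr i p b := by
  rw [invPart_apply, mul_comm b, dem_mul_sub hr hp]
  ring

theorem invPart_mem_polyGr (hr : 3 ≤ r) (hp : p ∈ polyGr r 2) {n : ℤ} {b : Poly r}
    (hb : b ∈ polyGr r n) : invPart hr i p b ∈ polyGr r n := by
  refine add_mem hb ?_
  have := SetLike.mul_mem_graded (dem_mem_polyGr hr i hb) hp
  rwa [show n - 2 + 2 = n by omega] at this

end Decomposition

/-! ### Distant reflections -/

section DistantMaps

open GrBimod

variable {r : ℕ}

/-- The map `B_s ⊗ B_t ⟶ B_t ⊗ B_s` for distant `s` and `t` that preserves the standard generators.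
The middle entry is written as `b = b' - ∂_s(b) x_s`; then the `σ_s`-invariants `b'` and `∂_s(b)`
move to the left, and the `σ_t`-invariant `x_s` moves to the right. -/
theorem exists_swap (hr : 3 ≤ r) {s t : ZMod r} (h : Distant s t) :
    ∃ F : tens (B s) (B t) ⟶ tens (B t) (B s), ∀ a b c,
      F.lin (word₂ (bOne s) (bOne t) a b c) =
        word₂ (bOne t) (bOne s) (a * invPart hr s (x s) b) 1 c -
        word₂ (bOne t) (bOne s) (a * dem hr s b) 1 (x s * c) := by
  have hp := sigmaHom_x_self s
  have hs := B_isCyclic s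
  have ht := B_isCyclic t
  have h1 : (1 : Poly r) ∈ polyGr r 0 := SetLike.one_mem_graded _
  let φ : Poly r →ₗ[ℚ] tens (B t) (B s) := (firstLin (bOne t) (bOne s)).comp (invPart hr s (x s)) -
    ((tens (B t) (B s)).right (x s)).comp ((firstLin (bOne t) (bOne s)).comp (dem hr s))
  have hφ : ∀ b, φ b = word₂ (bOne t) (bOne s) (invPart hr s (x s) b) 1 1 -
      word₂ (bOne t) (bOne s) (dem hr s b) 1 (x s) := fun b => by
    change firstLin (bOne t) (bOne s) _ -
      (tens (B t) (B s)).right (x s) (firstLin (bOne t) (bOne s) _) = _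
    rw [firstLin_apply, firstLin_apply, right_word₂, one_mul]
  have through : ∀ a ∈ fixedRing s, a ∈ fixedRing t → ∀ b c,
      word₂ (bOne t) (bOne s) (a * b) 1 c = word₂ (bOne t) (bOne s) b 1 (a * c) :=
    fun a has hat b c => by
      rw [mul_comm, ht.pass_left _ ⟨rfl, hat⟩, mul_comm, hs.pass_right _ ⟨rfl, has⟩]
  have bal := (h.genFixed hr).balanced ((tens (B t) (B s)).right.toLinearMap.flip.comp φ)
    (fun b c => by
      change (tens (B t) (B s)).right c (φ (b * x s)) = (tens (B t) (B s)).right (x s * c) (φ b)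
      have hTs : x s + (x s + root s) ∈ fixedRing s := by
        rw [mem_fixedRing, map_add, map_add, hp, sigmaHom_root hr]
        ring
      have hNs : x s * (x s + root s) ∈ fixedRing s := by
        rw [mem_fixedRing, map_mul, map_add, hp, sigmaHom_root hr]
        ring
      have hTt := add_mem h.x_mem (add_mem h.x_mem h.root_mem)
      have hNt := mul_mem h.x_mem (add_mem h.x_mem h.root_mem)
      rw [hφ, hφ, invPart_mul_self hr hp, dem_mul_self hr hp]
      obtain ⟨Q, _, s₀, s₁, s₂, θ, hw, h01, h12⟩ := ht.exists_slots₂ hs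
      have e₁ := (h01 _ _ ⟨rfl, hTt⟩).trans (h12 _ _ ⟨rfl, hTs⟩)
      have e₂ := (h01 _ _ ⟨rfl, hNt⟩).trans (h12 _ _ ⟨rfl, hNs⟩)
      simp only [map_sub, right_word₂]
      simp only [hw, ← map_sub θ]
      refine congrArg θ ?_
      simp only [map_mul, map_add, map_one, map_sub] at e₁ e₂ ⊢
      linear_combination s₀ (dem hr s b) * s₂ c * e₂ - s₀ (dem hr s b) * s₂ (x s) * s₂ c * e₁)
    (fun a has hat b c => by
      change (tens (B t) (B s)).right c (φ (b * a)) = (tens (B t) (B s)).right (a * c) (φ b)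
      rw [hφ, hφ, mul_comm b, invPart_mul hr has, dem_mul hr has]
      simp only [map_sub, right_word₂]
      rw [through a has hat, through a has hat, one_mul, one_mul, mul_left_comm])
  obtain ⟨F, hF⟩ := hs.exists_hom₂ ht φ
    (fun a a' h y => by
      obtain ⟨rfl, h⟩ := h
      rw [hφ, hφ, invPart_mul hr h, dem_mul hr h, map_sub, left_word₂, left_word₂])
    (fun a a' h y => by
      obtain ⟨rfl, h⟩ := h
      have := bal a h y 1
      change (tens (B t) (B s)).right 1 (φ (y * a)) = (tens (B t) (B s)).right (a * 1) (φ y) at this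
      rwa [map_one, mul_one] at this)
    (fun j y hy => by
      rw [hφ]
      exact sub_mem (word₂_mem ht.mem hs.mem (invPart_mem_polyGr hr (x_mem s) hy) h1 h1 (by omega))
        (word₂_mem ht.mem hs.mem (dem_mem_polyGr hr s hy) h1 (x_mem s) (by omega)))
  refine ⟨F, fun a b c => ?_⟩
  rw [hF, hφ, map_sub, map_sub, right_word₂, right_word₂, left_word₂, left_word₂, one_mul]

end DistantMaps

/-! ### The chain map for distant reflections -/

section DistantChainMaps

open GrBimod

section

variable {k R : Type} [CommRing k] [CommRing R] [Algebra k R] {𝒜 : ℤ → Submodule k R}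
  [GradedAlgebra 𝒜] {M N P : GrBimod 𝒜} {e : M} {e' : N} {δ δ' : ℤ} {A : R → R → Prop}

/-- If the second generator commutes with `R`, then the word of units generates. -/
theorem IsCyclic.hom_ext₂_right (h : GrBimod.IsCyclic M e δ A) (h' : GrBimod.IsCyclic N e' δ' Eq)
    {f g : tens M N ⟶ P} (hfg : f.lin (word₂ e e' 1 1 1) = g.lin (word₂ e e' 1 1 1)) : f = g :=
  h.hom_ext₂ h' fun b => by
    have : word₂ e e' 1 b 1 = (tens M N).right b (word₂ e e' 1 1 1) := by
      rw [right_word₂, mul_comm, ← h'.pass_right e rfl, one_mul]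
    rw [this, hom_right, hom_right, hfg]

/-- If the first generator commutes with `R`, then the word of units generates. -/
theorem IsCyclic.hom_ext₂_left (h : GrBimod.IsCyclic M e δ Eq) (h' : GrBimod.IsCyclic N e' δ' A)
    {f g : tens M N ⟶ P} (hfg : f.lin (word₂ e e' 1 1 1) = g.lin (word₂ e e' 1 1 1)) : f = g :=
  h.hom_ext₂ h' fun b => by
    have : word₂ e e' 1 b 1 = (tens M N).left b (word₂ e e' 1 1 1) := by
      rw [left_word₂, mul_comm b, h.pass_left e' rfl, mul_one]
    rw [this, hom_left, hom_left, hfg]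

end

variable {r : ℕ}

/-- The components of the map `F(σ_s) F(σ_t) ⟶ F(σ_t) F(σ_s)` for distant `s` and `t`, and their
compatibility with the differentials, up to the signs of the tensor product. The component on `R{2}
⊗ R{2}` is the identity. -/
theorem exists_distant_maps (hr : 3 ≤ r) {s t : ZMod r} (h : Distant s t) :
    ∃ (f₁₀ : tens (B s) ((regular (polyGr r)).shift 2) ⟶
        tens ((regular (polyGr r)).shift 2) (B s))
      (f₀₁ : tens ((regular (polyGr r)).shift 2) (B t) ⟶
        tens (B t) ((regular (polyGr r)).shift 2))
      (f₁₁ : tens (B s) (B t) ⟶ tens (B t) (B s)),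
      tensMap (rb hr s) (𝟙 _) ≫ f₁₀ = tensMap (𝟙 _) (rb hr s) ∧
      tensMap (𝟙 _) (rb hr t) ≫ f₀₁ = tensMap (rb hr t) (𝟙 _) ∧
      tensMap (𝟙 _) (rb hr t) ≫ f₁₁ = f₁₀ ≫ tensMap (rb hr t) (𝟙 _) ∧
      tensMap (rb hr s) (𝟙 _) ≫ f₁₁ = f₀₁ ≫ tensMap (𝟙 _) (rb hr s) ∧
      f₁₁.lin (tm _ _ (bOne s) (bOne t)) = tm _ _ (bOne t) (bOne s) := by
  have hS := R_isCyclic r 2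
  have hs := B_isCyclic s
  have ht := B_isCyclic t
  have hp := sigmaHom_x_self s
  have hq := sigmaHom_x_self t
  have rs := rb_rOne hr s hp
  have rt := rb_rOne hr t hq
  obtain ⟨f₁₀, h₁₀⟩ := exists_pushRight hs hS hS hs (fun _ _ => rfl) (fun _ h => ⟨rfl, h⟩)
    (by omega)
  obtain ⟨f₀₁, h₀₁⟩ := exists_pushLeft hS ht ht hS (fun _ h => ⟨rfl, h⟩) (fun _ _ => rfl)
    (by omega)
  obtain ⟨f₁₁, h₁₁⟩ := exists_swap hr h
  have p1 : invPart hr s (x s) 1 = 1 := invPart_one hr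
  have d1 := dem_one hr s
  have pm : ∀ b ∈ fixedRing s, invPart hr s (x s) b = b := fun b => invPart_of_mem hr
  have dm : ∀ b ∈ fixedRing s, dem hr s b = 0 := fun b => dem_of_mem hr
  refine ⟨f₁₀, f₀₁, f₁₁, ?_, ?_, ?_, ?_, ?_⟩
  · refine IsCyclic.hom_ext₂_left hS hS ?_
    rw [comp_lin, tensMap_word₂, tensMap_word₂, rs, word₂_sub_left, word₂_sub_right, map_sub,
      id_lin, h₁₀, h₁₀]
    obtain ⟨Q, _, s₀, s₁, s₂, θ, hw, h01, h12⟩ := hS.exists_slots₂ hs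
    simp only [hw, ← map_sub θ]
    refine congrArg θ ?_
    simp only [map_one, mul_one, one_mul, h01 _ _ rfl]
  · refine IsCyclic.hom_ext₂_left hS hS ?_
    rw [comp_lin, tensMap_word₂, tensMap_word₂, rt, word₂_sub_left, word₂_sub_right, map_sub,
      id_lin, h₀₁, h₀₁]
    obtain ⟨Q, _, s₀, s₁, s₂, θ, hw, h01, h12⟩ := ht.exists_slots₂ hS
    simp only [hw, ← map_sub θ]
    refine congrArg θ ?_
    simp only [map_one, mul_one, one_mul, h12 _ _ rfl]
  · refine IsCyclic.hom_ext₂_right hs hS ?_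
    have hu := add_mem h.symm.x_mem h.symm.root_mem
    rw [comp_lin, comp_lin, tensMap_word₂, rt, word₂_sub_right, map_sub, h₁₀, tensMap_word₂, rt,
      word₂_sub_left, id_lin, h₁₁, h₁₁, p1, d1, pm _ (by rwa [one_mul]),
      dm _ (by rwa [one_mul])]
    obtain ⟨Q, _, s₀, s₁, s₂, θ, hw, h01, h12⟩ := ht.exists_slots₂ hs
    simp only [hw, ← map_sub θ]
    refine congrArg θ ?_
    simp only [map_mul, map_one, map_zero, mul_one, one_mul, zero_mul, mul_zero, sub_zero,
      h12 _ _ ⟨rfl, h.symm.x_mem⟩]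
  · refine IsCyclic.hom_ext₂_left hS ht ?_
    have hu := add_mem h.x_mem h.root_mem
    rw [comp_lin, comp_lin, tensMap_word₂, rs, word₂_sub_left, map_sub, h₀₁, tensMap_word₂, rs,
      word₂_sub_right, id_lin, h₁₁, h₁₁, p1, d1, mul_one (x s), invPart_self hr hp,
      dem_of_sigmaHom hr hp]
    obtain ⟨Q, _, s₀, s₁, s₂, θ, hw, h01, h12⟩ := ht.exists_slots₂ hs
    simp only [hw, ← map_sub θ]
    refine congrArg θ ?_
    simp only [map_one, map_zero, map_neg, mul_one, one_mul, zero_mul, mul_zero, zero_sub,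
      sub_zero, h01 _ _ ⟨rfl, hu⟩]
    ring
  · rw [← word₂_one, ← word₂_one, h₁₁, p1, d1]
    obtain ⟨Q, _, s₀, s₁, s₂, θ, hw, -⟩ := ht.exists_slots₂ hs
    simp only [hw, mul_zero, mul_one, map_zero, zero_mul, sub_zero]

/-- The cells of `F(σ_i)`: `false` stands for `R{2}` and `true` for `B_i`. -/
noncomputable abbrev sigmaData (hr : 3 ≤ r) (i : ZMod r) : CellData (polyGr r) Bool :=
  doubleData (rb hr i) (-1) 0 rfl

/-- The degrees of the two cells of `F(σ_i)`. -/
def bitDeg : Bool → ℤ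
  | false => -1
  | true => 0

theorem sigma_deg (hr : 3 ≤ r) (i : ZMod r) (b : Bool) : (sigmaData hr i).deg b = bitDeg b := by
  cases b <;> rfl

/-- The differential of `F(σ_s) ⊗ F(σ_t)`. -/
theorem sigma_tensor_d (hr : 3 ≤ r) (s t : ZMod r) :
    ((sigmaData hr s).tensor (sigmaData hr t)).d (false, false) (true, false) =
      tensMap (rb hr s) (𝟙 _) ∧
    ((sigmaData hr s).tensor (sigmaData hr t)).d (false, true) (true, true) =
      tensMap (rb hr s) (𝟙 _) ∧
    ((sigmaData hr s).tensor (sigmaData hr t)).d (false, false) (false, true) =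
      -tensMap (𝟙 _) (rb hr t) ∧
    ((sigmaData hr s).tensor (sigmaData hr t)).d (true, false) (true, true) =
      tensMap (𝟙 _) (rb hr t) := by
  refine ⟨CellData.tensor_d_left _ _ false true false, CellData.tensor_d_left _ _ false true true,
    (CellData.tensor_d_right _ _ false false true).trans ?_,
    (CellData.tensor_d_right _ _ true false true).trans ?_⟩
  · change ((-1 : ℤ).negOnePow : ℤ) • _ = _
    rw [Int.negOnePow_neg, Int.negOnePow_one, Units.val_neg, Units.val_one, neg_one_smul]
  · change ((0 : ℤ).negOnePow : ℤ) • _ = _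
    rw [Int.negOnePow_zero, Units.val_one, one_smul]

/-- For distant `s` and `t` there is a pointed map of complexes `F(σ_s) F(σ_t) ⟶ F(σ_t) F(σ_s)`. -/
theorem exists_hom_distant (hr : 3 ≤ r) {s t : ZMod r} (h : Distant s t) :
    ∃ f : sigmaK hr s ⊗ sigmaK hr t ⟶ sigmaK hr t ⊗ sigmaK hr s,
      HPt.map f (HPt.mul (sigmaPt hr s) (sigmaPt hr t)) =
        HPt.mul (sigmaPt hr t) (sigmaPt hr s) := by
  obtain ⟨f₁₀, f₀₁, f₁₁, e₁, e₂, e₃, e₄, e₅⟩ := exists_distant_maps hr h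
  obtain ⟨a₁, a₂, a₃, a₄⟩ := sigma_tensor_d hr s t
  obtain ⟨b₁, b₂, b₃, b₄⟩ := sigma_tensor_d hr t s
  have hs := bOne_mem s
  have ht := bOne_mem t
  rw [sigmaPt, sigmaPt, (sigmaCells hr s).mulCyc_cyc (sigmaCells hr t) rfl hs
    (sigma_d_bOne hr s) rfl ht (sigma_d_bOne hr t) (tm_mem_zero hs ht),
    (sigmaCells hr t).mulCyc_cyc (sigmaCells hr s) rfl ht
    (sigma_d_bOne hr t) rfl hs (sigma_d_bOne hr s) (tm_mem_zero ht hs)]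
  -- exchanging the two factors of degree `-1` takes a sign
  let f₀₀ : tens ((regular (polyGr r)).shift 2) ((regular (polyGr r)).shift 2) ⟶
    tens ((regular (polyGr r)).shift 2) ((regular (polyGr r)).shift 2) := -𝟙 _
  have e₁' : tensMap (rb hr s) (𝟙 _) ≫ f₁₀ = f₀₀ ≫ (-tensMap (𝟙 _) (rb hr s)) := by
    rw [e₁, Preadditive.neg_comp_neg, Category.id_comp]
  have e₂' : (-tensMap (𝟙 _) (rb hr t)) ≫ f₀₁ = f₀₀ ≫ tensMap (rb hr t) (𝟙 _) := by
    rw [Preadditive.neg_comp, e₂, Preadditive.neg_comp, Category.id_comp]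
  let f : ∀ j : Bool × Bool, ((sigmaData hr s).tensor (sigmaData hr t)).A j ⟶
        ((sigmaData hr t).tensor (sigmaData hr s)).A (j.2, j.1)
    | (false, false) => f₀₀
    | (true, false) => f₁₀
    | (false, true) => f₀₁
    | (true, true) => f₁₁
  have hf : ∀ j l : Bool × Bool, bitDeg l.2 + bitDeg l.1 = bitDeg j.1 + bitDeg j.2 + 1 →
      ((sigmaData hr s).tensor (sigmaData hr t)).d j l ≫ f l =
        f j ≫ ((sigmaData hr t).tensor (sigmaData hr s)).d (j.2, j.1) (l.2, l.1) := by
    rintro ⟨_ | _, _ | _⟩ ⟨_ | _, _ | _⟩ hl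
    all_goals first | exact absurd hl (by decide) | skip
    · exact (congrArg (· ≫ f₀₁) a₃).trans (e₂'.trans (congrArg (f₀₀ ≫ ·) b₁).symm)
    · exact (congrArg (· ≫ f₁₀) a₁).trans (e₁'.trans (congrArg (f₀₀ ≫ ·) b₃).symm)
    · exact (congrArg (· ≫ f₁₁) a₂).trans (e₄.trans (congrArg (f₀₁ ≫ ·) b₄).symm)
    · exact (congrArg (· ≫ f₁₁) a₄).trans (e₃.trans (congrArg (f₁₀ ≫ ·) b₂).symm)
  have := ((sigmaCells hr s).tensor (sigmaCells hr t)).exists_hom_of_diag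
    (((sigmaCells hr t).tensor (sigmaCells hr s)).reindex (Equiv.prodComm Bool Bool)) f
    (fun j l hl => hf j l (by
      rw [← sigma_deg hr t l.2, ← sigma_deg hr s l.1, ← sigma_deg hr s j.1, ← sigma_deg hr t j.2]
      exact hl))
    (zero_add 0) (tm_mem_zero hs ht)
    (CellData.tensor_d_tm (sigma_d_bOne hr s) (sigma_d_bOne hr t)) (tm_mem_zero ht hs)
    (fun l => CellData.tensor_d_tm (sigma_d_bOne hr t) (sigma_d_bOne hr s) (l.2, l.1)) e₅
  exact this

end DistantChainMaps

/-! ### Maps between triple tensor products -/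

section TripleWords

open GrBimod

section

variable {k R : Type} [CommRing k] [CommRing R] [Algebra k R] {𝒜 : ℤ → Submodule k R}
  [GradedAlgebra 𝒜] {L M N P : GrBimod 𝒜} {e : L} {e' : M} {e'' : N} {δ δ' δ'' : ℤ}
  {A A' A'' : R → R → Prop}

/-- Two maps agree if they agree on two words that generate. -/
theorem GrBimod.IsCyclic.hom_ext_of_words (h₁ : GrBimod.IsCyclic L e δ A)
    (h : GrBimod.IsCyclic M e' δ' A') (h' : GrBimod.IsCyclic N e'' δ'' A'')
    {f g : tens L (tens M N) ⟶ P} (w w' : tens L (tens M N)) (hw : f.lin w = g.lin w)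
    (hw' : f.lin w' = g.lin w')
    (hgen : ∀ b c, ∃ x y x' y', word₃ e e' e'' 1 b c 1 = (tens L (tens M N)).left x
      ((tens L (tens M N)).right y w) - (tens L (tens M N)).left x'
        ((tens L (tens M N)).right y' w')) : f = g :=
  h₁.hom_ext₃ h h' fun b c => by
    obtain ⟨x, y, x', y', e⟩ := hgen b c
    rw [e, map_sub, map_sub]
    simp only [hom_left, hom_right, hw, hw']

end

variable {r : ℕ} {L M N P : GrBimod (polyGr r)} {e : L} {e' : M} {e'' : N} {δ δ' δ'' : ℤ}
  {A A' A'' : Poly r → Poly r → Prop}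

/-- A map out of a triple tensor product, given in terms of coordinates on the target. -/
theorem exists_hom_of_slots (h₁ : GrBimod.IsCyclic L e δ A) (h : GrBimod.IsCyclic M e' δ' A')
    (h' : GrBimod.IsCyclic N e'' δ'' A'') (σ : Slots P) (F : Poly r → Poly r → σ.Q)
    (hF₁ : ∀ b b' c, F (b + b') c = F b c + F b' c) (hF₂ : ∀ b c c', F b (c + c') = F b c + F b c')
    (hl : ∀ a a', A a a' → ∀ b c, F (a' * b) c = σ.left a * F b c)
    (hm : ∀ a a', A' a a' → ∀ b c, σ.θ (F (b * a) c) = σ.θ (F b (a' * c)))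
    (hr : ∀ a a', A'' a a' → ∀ b c, F b (c * a) = σ.right a' * F b c)
    (hg : ∀ i j, ∀ b ∈ polyGr r i, ∀ c ∈ polyGr r j,
      σ.θ (F b c) ∈ P.gr (i + j + (δ + δ' + δ''))) :
    ∃ G : tens L (tens M N) ⟶ P, ∀ a b c d,
      G.lin (word₃ e e' e'' a b c d) = σ.θ (σ.left a * (σ.right d * F b c)) := by
  let φ : Poly r →ₗ[ℚ] Poly r →ₗ[ℚ] P :=
    (AddMonoidHom.mk' (fun b => (AddMonoidHom.mk' (fun c => σ.θ (F b c))
      fun c c' => by rw [hF₂, map_add]).toRatLinearMap) fun b b' => LinearMap.ext fun c => by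
        change σ.θ (F (b + b') c) = σ.θ (F b c) + σ.θ (F b' c)
        rw [hF₁, map_add]).toRatLinearMap
  obtain ⟨G, hG⟩ := h₁.exists_hom₃ h h' φ
    (fun a a' ha b c => (congrArg σ.θ (hl a a' ha b c)).trans (σ.θ_left _ _)) hm
    (fun a a' ha b c => (congrArg σ.θ (hr a a' ha b c)).trans (σ.θ_right _ _)) hg
  refine ⟨G, fun a b c d => ?_⟩
  rw [hG, σ.θ_left, σ.θ_right]
  rfl

/-- The differential of `F(σ_i)` in the first of three factors. -/
noncomputable abbrev diff₁ (hr : 3 ≤ r) (i : ZMod r) (M N : GrBimod (polyGr r)) :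
    tens ((regular (polyGr r)).shift 2) (tens M N) ⟶ tens (B i) (tens M N) :=
  tensMap (rb hr i) (𝟙 (tens M N))

/-- The differential of `F(σ_i)` in the second of three factors. -/
noncomputable abbrev diff₂ (hr : 3 ≤ r) (i : ZMod r) (L N : GrBimod (polyGr r)) :
    tens L (tens ((regular (polyGr r)).shift 2) N) ⟶ tens L (tens (B i) N) :=
  tensMap (𝟙 L) (tensMap (rb hr i) (𝟙 N))

/-- The differential of `F(σ_i)` in the third of three factors. -/
noncomputable abbrev diff₃ (hr : 3 ≤ r) (i : ZMod r) (L M : GrBimod (polyGr r)) :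
    tens L (tens M ((regular (polyGr r)).shift 2)) ⟶ tens L (tens M (B i)) :=
  tensMap (𝟙 L) (tensMap (𝟙 M) (rb hr i))

variable {i : ZMod r} {p q : Poly r}

theorem diff₁_word₃ (hr : 3 ≤ r) (hp : sigmaHom i p = q) (hq : root i = q - p) (e' : M) (e'' : N)
    (a b c d : Poly r) : (diff₁ hr i M N).lin (word₃ (rOne r 2) e' e'' a b c d) =
      word₃ (bOne i) e' e'' (a * q) b c d - word₃ (bOne i) e' e'' a (p * b) c d := by
  have hq' : p + root i = q := by rw [hq]; ring
  rw [diff₁, ← tensMap_id, tensMap_word₃, rb_rOne hr i (p := p) (by rw [hp, hq']), hq',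
    word₃_sub_left]
  rfl

theorem diff₂_word₃ (hr : 3 ≤ r) (hp : sigmaHom i p = q) (hq : root i = q - p) (e : L) (e'' : N)
    (a b c d : Poly r) : (diff₂ hr i L N).lin (word₃ e (rOne r 2) e'' a b c d) =
      word₃ e (bOne i) e'' a (b * q) c d - word₃ e (bOne i) e'' a b (p * c) d := by
  have hq' : p + root i = q := by rw [hq]; ring
  rw [diff₂, tensMap_word₃, rb_rOne hr i (p := p) (by rw [hp, hq']), hq', word₃_sub_mid]
  rfl

theorem diff₃_word₃ (hr : 3 ≤ r) (hp : sigmaHom i p = q) (hq : root i = q - p) (e : L) (e' : M)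
    (a b c d : Poly r) : (diff₃ hr i L M).lin (word₃ e e' (rOne r 2) a b c d) =
      word₃ e e' (bOne i) a b (c * q) d - word₃ e e' (bOne i) a b c (d * p) := by
  have hq' : p + root i = q := by rw [hq]; ring
  rw [diff₃, tensMap_word₃, rb_rOne hr i (p := p) (by rw [hp, hq']), hq', word₃_sub_right]
  rfl

end TripleWords

/-! ### Generating words of triple tensor products -/

section WordExt

open GrBimod

variable {r : ℕ} {s t : ZMod r}

section

variable {L M N P : GrBimod (polyGr r)} {e : L} {e' : M} {e'' : N} {δ δ' δ'' : ℤ}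
  {A : Poly r → Poly r → Prop}

/-- If the first two generators commute with `R`, then all entries of a word can be moved to its
ends, so the word of units generates. -/
theorem hom_ext_left_left (h₁ : GrBimod.IsCyclic L e δ Eq) (h : GrBimod.IsCyclic M e' δ' Eq)
    (h' : GrBimod.IsCyclic N e'' δ'' A) {f g : tens L (tens M N) ⟶ P}
    (hfg : f.lin (word₃ e e' e'' 1 1 1 1) = g.lin (word₃ e e' e'' 1 1 1 1)) : f = g := by
  obtain ⟨σ, s₁, s₂, hw, h01, h12, h23⟩ := h₁.exists_slots₃ h h'
  refine h₁.hom_ext_of_words h h' _ _ hfg hfg fun b c => ⟨b * c, 1, 0, 1, ?_⟩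
  simp only [hw, ← σ.θ_left, ← σ.θ_right, ← map_sub]
  refine congrArg σ.θ ?_
  simp only [map_mul, map_one, map_zero, h01 _ _ rfl, h12 _ _ rfl]
  ring

/-- The word of units generates if the last two generators commute with `R`. -/
theorem hom_ext_right_right (h₁ : GrBimod.IsCyclic L e δ A) (h : GrBimod.IsCyclic M e' δ' Eq)
    (h' : GrBimod.IsCyclic N e'' δ'' Eq) {f g : tens L (tens M N) ⟶ P}
    (hfg : f.lin (word₃ e e' e'' 1 1 1 1) = g.lin (word₃ e e' e'' 1 1 1 1)) : f = g := by
  obtain ⟨σ, s₁, s₂, hw, h01, h12, h23⟩ := h₁.exists_slots₃ h h'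
  refine h₁.hom_ext_of_words h h' _ _ hfg hfg fun b c => ⟨1, b * c, 0, 1, ?_⟩
  simp only [hw, ← σ.θ_left, ← σ.θ_right, ← map_sub]
  refine congrArg σ.θ ?_
  simp only [map_mul, map_one, map_zero, h12 _ _ rfl, h23 _ _ rfl]
  ring

/-- The word of units generates if the first and the third generator commute with `R`. -/
theorem hom_ext_left_right (h₁ : GrBimod.IsCyclic L e δ Eq) (h : GrBimod.IsCyclic M e' δ' A)
    (h' : GrBimod.IsCyclic N e'' δ'' Eq) {f g : tens L (tens M N) ⟶ P}
    (hfg : f.lin (word₃ e e' e'' 1 1 1 1) = g.lin (word₃ e e' e'' 1 1 1 1)) : f = g := by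
  obtain ⟨σ, s₁, s₂, hw, h01, h12, h23⟩ := h₁.exists_slots₃ h h'
  refine h₁.hom_ext_of_words h h' _ _ hfg hfg fun b c => ⟨b, c, 0, 1, ?_⟩
  simp only [hw, ← σ.θ_left, ← σ.θ_right, ← map_sub]
  refine congrArg σ.θ ?_
  simp only [map_one, map_zero, h01 _ _ rfl, h23 _ _ rfl]
  ring

variable {p : Poly r}

/-- The decomposition `b = b' - ∂_s(b) p`. -/
theorem invPart_sub (hr : 3 ≤ r) (s : ZMod r) (p b : Poly r) :
    b = invPart hr s p b - dem hr s b * p := by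
  rw [invPart_apply]
  ring

/-- The word of units generates `B_s ⊗ B_t ⊗ R`: in the decomposition `b = b' - ∂_s(b) p` of the
entry between `B_s` and `B_t`, the form `p` is `σ_t`-invariant. -/
theorem hom_ext_fix_fix_eq (hr : 3 ≤ r) (hp : sigmaHom s p = p + root s) (ht : p ∈ fixedRing t)
    (h₁ : GrBimod.IsCyclic L e δ (FixRel s)) (h : GrBimod.IsCyclic M e' δ' (FixRel t))
    (h' : GrBimod.IsCyclic N e'' δ'' Eq) {f g : tens L (tens M N) ⟶ P}
    (hfg : f.lin (word₃ e e' e'' 1 1 1 1) = g.lin (word₃ e e' e'' 1 1 1 1)) : f = g := by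
  obtain ⟨σ, s₁, s₂, hw, h01, h12, h23⟩ := h₁.exists_slots₃ h h'
  refine h₁.hom_ext_of_words h h' _ _ hfg hfg fun b c =>
    ⟨invPart hr s p b, c, dem hr s b, p * c, ?_⟩
  simp only [hw, ← σ.θ_left, ← σ.θ_right, ← map_sub]
  refine congrArg σ.θ ?_
  have hb := congrArg s₁ (invPart_sub hr s p b)
  simp only [map_sub, map_mul, h12 _ _ ⟨rfl, ht⟩, ← h01 _ _ ⟨rfl, invPart_mem hr hp b⟩,
    ← h01 _ _ ⟨rfl, dem_mem hr s b⟩] at hb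
  simp only [map_mul, map_one, hb, ← h23 _ _ rfl]
  ring

/-- The word of units generates `R ⊗ B_t ⊗ B_s`. -/
theorem hom_ext_eq_fix_fix (hr : 3 ≤ r) (hp : sigmaHom s p = p + root s) (ht : p ∈ fixedRing t)
    (h₁ : GrBimod.IsCyclic L e δ Eq) (h : GrBimod.IsCyclic M e' δ' (FixRel t))
    (h' : GrBimod.IsCyclic N e'' δ'' (FixRel s)) {f g : tens L (tens M N) ⟶ P}
    (hfg : f.lin (word₃ e e' e'' 1 1 1 1) = g.lin (word₃ e e' e'' 1 1 1 1)) : f = g := by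
  obtain ⟨σ, s₁, s₂, hw, h01, h12, h23⟩ := h₁.exists_slots₃ h h'
  refine h₁.hom_ext_of_words h h' _ _ hfg hfg fun b c =>
    ⟨b, invPart hr s p c, b * p, dem hr s c, ?_⟩
  simp only [hw, ← σ.θ_left, ← σ.θ_right, ← map_sub]
  refine congrArg σ.θ ?_
  have hb := congrArg s₂ (invPart_sub hr s p c)
  simp only [map_sub, map_mul, ← h12 _ _ ⟨rfl, ht⟩, h23 _ _ ⟨rfl, invPart_mem hr hp c⟩,
    h23 _ _ ⟨rfl, dem_mem hr s c⟩] at hb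
  simp only [map_mul, map_one, hb, h01 _ _ rfl]
  ring

/-- The words of units, and with the middle entry `p`, generate `B_s ⊗ R ⊗ N`, because `1` and `p`
generate the polynomial ring over the `σ_s`-invariants. -/
theorem hom_ext_fix_eq_fix (hr : 3 ≤ r) (hp : sigmaHom s p = p + root s)
    (h₁ : GrBimod.IsCyclic L e δ (FixRel s)) (h : GrBimod.IsCyclic M e' δ' Eq)
    (h' : GrBimod.IsCyclic N e'' δ'' A) {f g : tens L (tens M N) ⟶ P}
    (hfg : f.lin (word₃ e e' e'' 1 1 1 1) = g.lin (word₃ e e' e'' 1 1 1 1))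
    (hfg' : f.lin (word₃ e e' e'' 1 p 1 1) = g.lin (word₃ e e' e'' 1 p 1 1)) : f = g := by
  obtain ⟨σ, s₁, s₂, hw, h01, h12, h23⟩ := h₁.exists_slots₃ h h'
  refine h₁.hom_ext_of_words h h' _ _ hfg hfg' fun b c =>
    ⟨invPart hr s p (b * c), 1, dem hr s (b * c), 1, ?_⟩
  simp only [hw, ← σ.θ_left, ← σ.θ_right, ← map_sub]
  refine congrArg σ.θ ?_
  have hb := congrArg s₁ (invPart_sub hr s p (b * c))
  simp only [map_sub, map_mul s₁, ← h01 _ _ ⟨rfl, invPart_mem hr hp _⟩,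
    ← h01 _ _ ⟨rfl, dem_mem hr s _⟩] at hb
  simp only [map_one, ← h12 _ _ rfl]
  linear_combination hb

end

end WordExt

/-! ### Components of the braid relation -/

section BraidMaps

open GrBimod

variable {r : ℕ} {s t : ZMod r} {L M N L' M' N' : GrBimod (polyGr r)} {e : L} {e' : M} {e'' : N}
  {u₁ : L'} {u₂ : M'} {u₃ : N'} {δ δ' δ'' ε ε' ε'' : ℤ} {A A' A'' C C' C'' : Poly r → Poly r → Prop}

theorem one_mem_polyGr : (1 : Poly r) ∈ polyGr r 0 := SetLike.one_mem_graded _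

/-- The map `a ⊗ b ⊗ c ⊗ d ↦ a b ⊗ 1 ⊗ 1 ⊗ c d`. -/
theorem exists_outer (h₁ : GrBimod.IsCyclic L e δ A) (h : GrBimod.IsCyclic M e' δ' A')
    (h' : GrBimod.IsCyclic N e'' δ'' A'') (k₁ : GrBimod.IsCyclic L' u₁ ε C)
    (k : GrBimod.IsCyclic M' u₂ ε' C') (k' : GrBimod.IsCyclic N' u₃ ε'' C'')
    (hA : ∀ a a', A a a' → a = a') (hA' : ∀ a a', A' a a' → a = a' ∧ C a a ∧ C' a a ∧ C'' a a)
    (hA'' : ∀ a a', A'' a a' → a = a') (hδ : ε + ε' + ε'' = δ + δ' + δ'') :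
    ∃ F : tens L (tens M N) ⟶ tens L' (tens M' N'), ∀ a b c d,
      F.lin (word₃ e e' e'' a b c d) = word₃ u₁ u₂ u₃ (a * b) 1 1 (c * d) := by
  obtain ⟨σ, s₁, s₂, hw, h01, h12, h23⟩ := k₁.exists_slots₃ k k'
  obtain ⟨F, hF⟩ := exists_hom_of_slots h₁ h h' σ (fun b c => σ.left b * σ.right c)
    (fun _ _ _ => by rw [map_add, add_mul]) (fun _ _ _ => by rw [map_add, mul_add])
    (fun a a' ha b c => by rw [hA a a' ha, map_mul, mul_assoc])
    (fun a a' ha b c => by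
      obtain ⟨rfl, h1, h2, h3⟩ := hA' a a' ha
      have : σ.left a = σ.right a := (h01 _ _ h1).trans ((h12 _ _ h2).trans (h23 _ _ h3))
      exact congrArg σ.θ (by rw [map_mul, map_mul, this, mul_assoc]))
    (fun a a' ha b c => by rw [hA'' a a' ha, map_mul]; ring)
    (fun i j b hb c hc => by
      have := hw b 1 1 c
      rw [map_one, map_one, mul_one, mul_one] at this
      rw [← this]
      exact word₃_mem k₁.mem k.mem k'.mem hb one_mem_polyGr one_mem_polyGr hc (by omega))
  refine ⟨F, fun a b c d => ?_⟩
  rw [hF, hw]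
  refine congrArg σ.θ ?_
  simp only [map_mul, map_one]
  ring

/-- The map `a ⊗ b ⊗ c ⊗ d ↦ a ⊗ 1 ⊗ b ⊗ c d`. -/
theorem exists_shiftRight (h₁ : GrBimod.IsCyclic L e δ (FixRel s))
    (h : GrBimod.IsCyclic M e' δ' (FixRel t)) (h' : GrBimod.IsCyclic N e'' δ'' Eq)
    (k₁ : GrBimod.IsCyclic L' u₁ ε Eq) (k : GrBimod.IsCyclic M' u₂ ε' (FixRel s))
    (k' : GrBimod.IsCyclic N' u₃ ε'' (FixRel t)) (hδ : ε + ε' + ε'' = δ + δ' + δ'') :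
    ∃ F : tens L (tens M N) ⟶ tens L' (tens M' N'), ∀ a b c d,
      F.lin (word₃ e e' e'' a b c d) = word₃ u₁ u₂ u₃ a 1 b (c * d) := by
  obtain ⟨σ, s₁, s₂, hw, h01, h12, h23⟩ := k₁.exists_slots₃ k k'
  obtain ⟨F, hF⟩ := exists_hom_of_slots h₁ h h' σ (fun b c => s₂ b * σ.right c)
    (fun _ _ _ => by rw [map_add, add_mul]) (fun _ _ _ => by rw [map_add, mul_add])
    (fun a a' ha b c => by
      obtain ⟨rfl, ha⟩ := ha
      rw [h01 _ _ rfl, h12 _ _ ⟨rfl, ha⟩, map_mul, mul_assoc])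
    (fun a a' ha b c => by
      obtain ⟨rfl, ha⟩ := ha
      exact congrArg σ.θ (by rw [map_mul, map_mul, h23 _ _ ⟨rfl, ha⟩, mul_assoc]))
    (fun a a' ha b c => by rw [ha, map_mul]; ring)
    (fun i j b hb c hc => by
      have := hw 1 1 b c
      rw [map_one, map_one, one_mul, one_mul] at this
      rw [← this]
      exact word₃_mem k₁.mem k.mem k'.mem one_mem_polyGr one_mem_polyGr hb hc (by omega))
  refine ⟨F, fun a b c d => ?_⟩
  rw [hF, hw]
  refine congrArg σ.θ ?_
  simp only [map_mul, map_one]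
  ring

/-- The map `a ⊗ b ⊗ c ⊗ d ↦ a b ⊗ c ⊗ d ⊗ 1`. -/
theorem exists_shiftLeft (h₁ : GrBimod.IsCyclic L e δ Eq)
    (h : GrBimod.IsCyclic M e' δ' (FixRel t)) (h' : GrBimod.IsCyclic N e'' δ'' (FixRel s))
    (k₁ : GrBimod.IsCyclic L' u₁ ε (FixRel t)) (k : GrBimod.IsCyclic M' u₂ ε' (FixRel s))
    (k' : GrBimod.IsCyclic N' u₃ ε'' Eq) (hδ : ε + ε' + ε'' = δ + δ' + δ'') :
    ∃ F : tens L (tens M N) ⟶ tens L' (tens M' N'), ∀ a b c d,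
      F.lin (word₃ e e' e'' a b c d) = word₃ u₁ u₂ u₃ (a * b) c d 1 := by
  obtain ⟨σ, s₁, s₂, hw, h01, h12, h23⟩ := k₁.exists_slots₃ k k'
  obtain ⟨F, hF⟩ := exists_hom_of_slots h₁ h h' σ (fun b c => σ.left b * s₁ c)
    (fun _ _ _ => by rw [map_add, add_mul]) (fun _ _ _ => by rw [map_add, mul_add])
    (fun a a' ha b c => by rw [ha, map_mul, mul_assoc])
    (fun a a' ha b c => by
      obtain ⟨rfl, ha⟩ := ha
      exact congrArg σ.θ (by rw [map_mul, map_mul, h01 _ _ ⟨rfl, ha⟩, mul_assoc]))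
    (fun a a' ha b c => by
      obtain ⟨rfl, ha⟩ := ha
      rw [← h23 _ _ rfl, ← h12 _ _ ⟨rfl, ha⟩, map_mul]
      ring)
    (fun i j b hb c hc => by
      have := hw b c 1 1
      rw [map_one, map_one, mul_one, mul_one] at this
      rw [← this]
      exact word₃_mem k₁.mem k.mem k'.mem hb hc one_mem_polyGr one_mem_polyGr (by omega))
  refine ⟨F, fun a b c d => ?_⟩
  rw [hF, hw]
  refine congrArg σ.θ ?_
  simp only [map_mul, map_one, ← h23 _ _ rfl]
  ring

/-- The map `a ⊗ b ⊗ c ⊗ d ↦ a ⊗ 1 ⊗ b c d ⊗ 1`. -/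
theorem exists_center (h₁ : GrBimod.IsCyclic L e δ (FixRel s))
    (h : GrBimod.IsCyclic M e' δ' Eq) (h' : GrBimod.IsCyclic N e'' δ'' Eq)
    (k₁ : GrBimod.IsCyclic L' u₁ ε Eq) (k : GrBimod.IsCyclic M' u₂ ε' (FixRel s))
    (k' : GrBimod.IsCyclic N' u₃ ε'' Eq) (hδ : ε + ε' + ε'' = δ + δ' + δ'') :
    ∃ F : tens L (tens M N) ⟶ tens L' (tens M' N'), ∀ a b c d,
      F.lin (word₃ e e' e'' a b c d) = word₃ u₁ u₂ u₃ a 1 (b * c * d) 1 := by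
  obtain ⟨σ, s₁, s₂, hw, h01, h12, h23⟩ := k₁.exists_slots₃ k k'
  obtain ⟨F, hF⟩ := exists_hom_of_slots h₁ h h' σ (fun b c => σ.right b * σ.right c)
    (fun _ _ _ => by rw [map_add, add_mul]) (fun _ _ _ => by rw [map_add, mul_add])
    (fun a a' ha b c => by
      obtain ⟨rfl, ha⟩ := ha
      rw [h01 _ _ rfl, h12 _ _ ⟨rfl, ha⟩, h23 _ _ rfl, map_mul, mul_assoc])
    (fun a a' ha b c => congrArg σ.θ (by rw [ha, map_mul, map_mul, mul_assoc]))
    (fun a a' ha b c => by rw [ha, map_mul]; ring)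
    (fun i j b hb c hc => by
      have := hw 1 1 b c
      rw [map_one, map_one, one_mul, one_mul, h23 _ _ rfl] at this
      rw [← this]
      exact word₃_mem k₁.mem k.mem k'.mem one_mem_polyGr one_mem_polyGr hb hc (by omega))
  refine ⟨F, fun a b c d => ?_⟩
  rw [hF, hw]
  refine congrArg σ.θ ?_
  simp only [map_mul, map_one, h23 _ _ rfl]
  ring

variable {p q u : Poly r}

theorem Triple.q_add_u_mem (h : Triple s t p q u) : q + u ∈ fixedRing t := by
  rw [mem_fixedRing, map_add, h.t_q, h.t_u, add_comm]

theorem Triple.q_mul_u_mem (h : Triple s t p q u) : q * u ∈ fixedRing t := by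
  rw [mem_fixedRing, map_mul, h.t_q, h.t_u, mul_comm]

/-- If two ring homomorphisms agree on the `σ_t`-invariants, then `u ⊗ 1 - 1 ⊗ q` commutes with the
polynomial ring. -/
theorem Triple.central (h : Triple s t p q u) (hr : 3 ≤ r) {Q : Type} [CommRing Q]
    {f g : Poly r →+* Q} (hfg : ∀ a ∈ fixedRing t, f a = g a) (a : Poly r) :
    f a * (f u - g q) = g a * (f u - g q) := by
  have hq : sigmaHom t q = q + root t := by
    rw [h.t_q, h.root_right]
    ring
  have ha := invPart_sub hr t q a
  have h1 := hfg _ (invPart_mem hr hq a)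
  have h2 := hfg _ (dem_mem hr t a)
  have h3 := hfg _ h.q_add_u_mem
  have h4 := hfg _ h.q_mul_u_mem
  have hf := congrArg f ha
  have hg := congrArg g ha
  simp only [map_add, map_mul, map_sub] at h3 h4 hf hg
  rw [hf, hg, h1, h2]
  linear_combination -g (dem hr t a) * h4 + g (dem hr t a) * g q * h3

/-- The map `a ⊗ b ⊗ c ⊗ d ↦ a ∂_s(b c) (u ⊗ 1 - 1 ⊗ q) ⊗ d ⊗ 1`. -/
theorem Triple.exists_demLeft (h : Triple s t p q u) (hr : 3 ≤ r)
    (h₁ : GrBimod.IsCyclic L e δ (FixRel s)) (h₂ : GrBimod.IsCyclic M e' δ' Eq)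
    (h₃ : GrBimod.IsCyclic N e'' δ'' (FixRel s)) (k₁ : GrBimod.IsCyclic L' u₁ ε (FixRel t))
    (k : GrBimod.IsCyclic M' u₂ ε' (FixRel s)) (k' : GrBimod.IsCyclic N' u₃ ε'' Eq)
    (hδ : ε + ε' + ε'' = δ + δ' + δ'') :
    ∃ F : tens L (tens M N) ⟶ tens L' (tens M' N'), ∀ a b c d,
      F.lin (word₃ e e' e'' a b c d) = word₃ u₁ u₂ u₃ (a * dem hr s (b * c) * u) 1 d 1 -
        word₃ u₁ u₂ u₃ (a * dem hr s (b * c)) q d 1 := by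
  obtain ⟨σ, s₁, s₂, hw, h01, h12, h23⟩ := k₁.exists_slots₃ k k'
  have hc := h.central hr (f := σ.left) (g := s₁) fun a ha => h01 _ _ ⟨rfl, ha⟩
  obtain ⟨F, hF⟩ := exists_hom_of_slots h₁ h₂ h₃ σ
    (fun b c => σ.left (dem hr s (b * c)) * (σ.left u - s₁ q))
    (fun _ _ _ => by rw [add_mul, map_add, map_add, add_mul])
    (fun _ _ _ => by rw [mul_add, map_add, map_add, add_mul])
    (fun a a' ha b c => by
      obtain ⟨rfl, ha⟩ := ha
      rw [mul_assoc a, dem_mul hr ha, map_mul, mul_assoc])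
    (fun a a' ha b c => by rw [ha, mul_assoc b])
    (fun a a' ha b c => by
      obtain ⟨rfl, ha⟩ := ha
      rw [← mul_assoc b, mul_comm (b * c), dem_mul hr ha, map_mul, ← h23 _ _ rfl,
        ← h12 _ _ ⟨rfl, ha⟩]
      linear_combination σ.left (dem hr s (b * c)) * hc a)
    (fun i j b hb c hc => by
      have h1 := hw (dem hr s (b * c) * u) 1 1 1
      have h2 := hw (dem hr s (b * c)) q 1 1
      have hd := dem_mem_polyGr hr s (SetLike.mul_mem_graded hb hc)
      simp only [map_one, mul_one, map_mul σ.left] at h1 h2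
      rw [mul_sub, map_sub, ← h1, ← h2]
      refine sub_mem ?_ ?_
      · exact word₃_mem k₁.mem k.mem k'.mem (SetLike.mul_mem_graded hd h.u_mem) one_mem_polyGr
          one_mem_polyGr one_mem_polyGr (by omega)
      · exact word₃_mem k₁.mem k.mem k'.mem hd h.q_mem one_mem_polyGr one_mem_polyGr (by omega))
  refine ⟨F, fun a b c d => ?_⟩
  rw [hF, hw, hw, ← map_sub]
  refine congrArg σ.θ ?_
  simp only [map_mul σ.left, map_one, ← h23 _ _ rfl]
  ring

end BraidMaps

/-! ### The six-valent map -/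

section SixValent

open GrBimod

variable {r : ℕ} {s t : ZMod r} {L M N L' M' N' : GrBimod (polyGr r)} {e : L} {e' : M} {e'' : N}
  {u₁ : L'} {u₂ : M'} {u₃ : N'} {δ δ' δ'' ε ε' ε'' : ℤ} {p q u : Poly r}

/-- The map `a ⊗ b ⊗ c ⊗ d ↦ a ∂_s(b c) d (u ⊗ 1 - 1 ⊗ q)`. -/
theorem Triple.exists_demOuter (h : Triple s t p q u) (hr : 3 ≤ r)
    (h₁ : GrBimod.IsCyclic L e δ (FixRel s)) (h₂ : GrBimod.IsCyclic M e' δ' Eq)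
    (h₃ : GrBimod.IsCyclic N e'' δ'' (FixRel s)) (k₁ : GrBimod.IsCyclic L' u₁ ε (FixRel t))
    (k : GrBimod.IsCyclic M' u₂ ε' Eq) (k' : GrBimod.IsCyclic N' u₃ ε'' (FixRel t))
    (hδ : ε + ε' + ε'' = δ + δ' + δ'') :
    ∃ F : tens L (tens M N) ⟶ tens L' (tens M' N'), ∀ a b c d,
      F.lin (word₃ e e' e'' a b c d) = word₃ u₁ u₂ u₃ (a * dem hr s (b * c) * d * u) 1 1 1 -
        word₃ u₁ u₂ u₃ (a * dem hr s (b * c) * d) 1 1 q := by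
  obtain ⟨σ, s₁, s₂, hw, h01, h12, h23⟩ := k₁.exists_slots₃ k k'
  have hc := h.central hr (f := σ.left) (g := σ.right) fun a ha =>
    (h01 _ _ ⟨rfl, ha⟩).trans ((h12 _ _ rfl).trans (h23 _ _ ⟨rfl, ha⟩))
  obtain ⟨F, hF⟩ := exists_hom_of_slots h₁ h₂ h₃ σ
    (fun b c => σ.left (dem hr s (b * c)) * (σ.left u - σ.right q))
    (fun _ _ _ => by rw [add_mul, map_add, map_add, add_mul])
    (fun _ _ _ => by rw [mul_add, map_add, map_add, add_mul])
    (fun a a' ha b c => by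
      obtain ⟨rfl, ha⟩ := ha
      rw [mul_assoc a, dem_mul hr ha, map_mul, mul_assoc])
    (fun a a' ha b c => by rw [ha, mul_assoc b])
    (fun a a' ha b c => by
      obtain ⟨rfl, ha⟩ := ha
      rw [← mul_assoc b, mul_comm (b * c), dem_mul hr ha, map_mul]
      linear_combination σ.left (dem hr s (b * c)) * hc a)
    (fun i j b hb c hc => by
      have h1 := hw (dem hr s (b * c) * u) 1 1 1
      have h2 := hw (dem hr s (b * c)) 1 1 q
      have hd := dem_mem_polyGr hr s (SetLike.mul_mem_graded hb hc)
      simp only [map_one, mul_one, map_mul σ.left] at h1 h2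
      rw [mul_sub, map_sub, ← h1, ← h2]
      refine sub_mem ?_ ?_
      · exact word₃_mem k₁.mem k.mem k'.mem (SetLike.mul_mem_graded hd h.u_mem) one_mem_polyGr
          one_mem_polyGr one_mem_polyGr (by omega)
      · exact word₃_mem k₁.mem k.mem k'.mem hd one_mem_polyGr one_mem_polyGr h.q_mem (by omega))
  refine ⟨F, fun a b c d => ?_⟩
  rw [hF, hw, hw, ← map_sub]
  refine congrArg σ.θ ?_
  simp only [map_mul σ.left, map_one]
  linear_combination -σ.left a * σ.left (dem hr s (b * c)) * hc d

/-- The map of degree zero `B_s ⊗ B_t ⊗ B_s ⟶ B_t ⊗ B_s ⊗ B_t` that preserves the standard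
generators. With `b = b' - ∂_s(b) p` and `c = c' - ∂_s(c) p`, moving `p` to the outer factors is
multiplication by `τ = -(u ⊗ 1 + 1 ⊗ u)`, and moving both copies of `p` gives
`-τ (u ⊗ 1) - p q ⊗ 1`. This is compatible with the middle factor `B_t`, because its invariants are
generated by `p` and the common invariants. -/
theorem Triple.exists_sixValent (h : Triple s t p q u) (hr : 3 ≤ r)
    (h₁ : GrBimod.IsCyclic L e δ (FixRel s)) (h₂ : GrBimod.IsCyclic M e' δ' (FixRel t))
    (h₃ : GrBimod.IsCyclic N e'' δ'' (FixRel s)) (k₁ : GrBimod.IsCyclic L' u₁ ε (FixRel t))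
    (k : GrBimod.IsCyclic M' u₂ ε' (FixRel s)) (k' : GrBimod.IsCyclic N' u₃ ε'' (FixRel t))
    (hδ : ε + ε' + ε'' = δ + δ' + δ'') :
    ∃ F : tens L (tens M N) ⟶ tens L' (tens M' N'), ∀ a b c d,
      F.lin (word₃ e e' e'' a b c d) =
        word₃ u₁ u₂ u₃ (a * invPart hr s p b) 1 1 (invPart hr s p c * d) +
        word₃ u₁ u₂ u₃ (a * (dem hr s b * u)) 1 1 (invPart hr s p c * d) +
        word₃ u₁ u₂ u₃ (a * dem hr s b) 1 1 (invPart hr s p c * u * d) +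
        word₃ u₁ u₂ u₃ (a * (invPart hr s p b * u)) 1 1 (dem hr s c * d) +
        word₃ u₁ u₂ u₃ (a * invPart hr s p b) 1 1 (dem hr s c * u * d) +
        word₃ u₁ u₂ u₃ (a * (dem hr s b * (u * u - p * q))) 1 1 (dem hr s c * d) +
        word₃ u₁ u₂ u₃ (a * (dem hr s b * u)) 1 1 (dem hr s c * u * d) := by
  obtain ⟨σ, s₁, s₂, hw, h01, h12, h23⟩ := k₁.exists_slots₃ k k'
  have hp := h.sigmaHom_p
  have hpq : p + root s = q := by
    rw [h.root_left]
    ring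
  have hLR : ∀ a ∈ fixedRing s, a ∈ fixedRing t → σ.left a = σ.right a := fun a hs ht =>
    (h01 _ _ ⟨rfl, ht⟩).trans ((h12 _ _ ⟨rfl, hs⟩).trans (h23 _ _ ⟨rfl, ht⟩))
  -- the elementary symmetric functions of `p`, `q`, `u` are invariant under both reflections, so
  -- that they agree in the outer positions
  have e2 := hLR (p * q + q * u + u * p)
    (by rw [mem_fixedRing]; simp only [map_mul, map_add, h.s_p, h.s_q, h.s_u]; ring)
    (by rw [mem_fixedRing]; simp only [map_mul, map_add, h.t_p, h.t_q, h.t_u]; ring)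
  have e3 := hLR (p * q * u)
    (by rw [mem_fixedRing]; simp only [map_mul, h.s_p, h.s_q, h.s_u]; ring)
    (by rw [mem_fixedRing]; simp only [map_mul, h.t_p, h.t_q, h.t_u]; ring)
  have hL := congrArg σ.left h.sum
  have hR := congrArg σ.right h.sum
  simp only [map_mul, map_add, map_zero] at e2 e3 hL hR
  have hmem : ∀ {i j n : ℤ} {f g : Poly r}, f ∈ polyGr r i → g ∈ polyGr r j →
      i + j + (δ + δ' + δ'') = n → σ.θ (σ.left f * σ.right g) ∈ (tens L' (tens M' N')).gr n := by
    intro i j n f g hf hg hn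
    have := hw f 1 1 g
    rw [map_one, map_one, mul_one, mul_one] at this
    rw [← this]
    exact word₃_mem k₁.mem k.mem k'.mem hf one_mem_polyGr one_mem_polyGr hg (by omega)
  let F : Poly r → Poly r → σ.Q := fun b c =>
    σ.left (invPart hr s p b) * σ.right (invPart hr s p c) +
    σ.left (dem hr s b * u) * σ.right (invPart hr s p c) +
    σ.left (dem hr s b) * σ.right (invPart hr s p c * u) +
    σ.left (invPart hr s p b * u) * σ.right (dem hr s c) +
    σ.left (invPart hr s p b) * σ.right (dem hr s c * u) +
    σ.left (dem hr s b * (u * u - p * q)) * σ.right (dem hr s c) +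
    σ.left (dem hr s b * u) * σ.right (dem hr s c * u)
  have hFl : ∀ a ∈ fixedRing s, ∀ b c, F (a * b) c = σ.left a * F b c := fun a ha b c => by
    simp only [F, invPart_mul hr ha, dem_mul hr ha, map_mul σ.left]
    ring
  have hFr : ∀ a ∈ fixedRing s, ∀ b c, F b (a * c) = σ.right a * F b c := fun a ha b c => by
    simp only [F, invPart_mul hr ha, dem_mul hr ha, map_mul σ.right]
    ring
  have hF₁ : ∀ b b' c, F (b + b') c = F b c + F b' c := fun b b' c => by
    simp only [F, map_add, add_mul]
    ring
  have hF₂ : ∀ b c c', F b (c + c') = F b c + F b c' := fun b c c' => by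
    simp only [F, map_add, add_mul, mul_add]
    ring
  let φ : Poly r →ₗ[ℚ] Poly r →ₗ[ℚ] tens L' (tens M' N') :=
    (AddMonoidHom.mk' (fun b => (AddMonoidHom.mk' (fun c => σ.θ (F b c))
      fun c c' => by rw [hF₂, map_add]).toRatLinearMap) fun b b' => LinearMap.ext fun c => by
        change σ.θ (F (b + b') c) = σ.θ (F b c) + σ.θ (F b' c)
        rw [hF₁, map_add]).toRatLinearMap
  have bal := (h.genFixed hr).balanced φ
    (fun b c => by
      change σ.θ (F (b * p) c) = σ.θ (F b (p * c))
      refine congrArg σ.θ ?_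
      rw [mul_comm p c]
      simp only [F, invPart_mul_self hr hp, dem_mul_self hr hp, hpq, map_mul, map_add, map_sub]
      linear_combination σ.left (dem hr s b) * σ.right (invPart hr s p c) *
          (σ.left u + σ.right u) * hL +
        σ.left (invPart hr s p b) * σ.right (dem hr s c) *
          (e2 - σ.left u * hL - σ.left u * hR) +
        σ.left (dem hr s b) * σ.right (dem hr s c) *
          (e3 + σ.left u * (e2 - σ.left u * hL + σ.right u * hR) +
            (σ.left u * (σ.left u + σ.right u) - σ.left p * σ.left q) * (hL - hR)))
    (fun a has hat b c => by
      change σ.θ (F (b * a) c) = σ.θ (F b (a * c))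
      rw [mul_comm b a, hFl a has, hFr a has, hLR a has hat])
  obtain ⟨G, hG⟩ := exists_hom_of_slots h₁ h₂ h₃ σ F hF₁ hF₂
    (fun a a' ha b c => by
      obtain ⟨rfl, ha⟩ := ha
      exact hFl a ha b c)
    (fun a a' ha b c => by
      obtain ⟨rfl, ha⟩ := ha
      exact bal a ha b c)
    (fun a a' ha b c => by
      obtain ⟨rfl, ha⟩ := ha
      rw [mul_comm c a]
      exact hFr a ha b c)
    (fun i j b hb c hc => by
      have b0 := invPart_mem_polyGr (i := s) hr h.p_mem hb
      have c0 := invPart_mem_polyGr (i := s) hr h.p_mem hc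
      have b1 := dem_mem_polyGr hr s hb
      have c1 := dem_mem_polyGr hr s hc
      have huu := sub_mem (SetLike.mul_mem_graded h.u_mem h.u_mem)
        (SetLike.mul_mem_graded h.p_mem h.q_mem)
      simp only [F, map_add σ.θ]
      refine add_mem (add_mem (add_mem (add_mem (add_mem (add_mem ?_ ?_) ?_) ?_) ?_) ?_) ?_
      · exact hmem b0 c0 rfl
      · exact hmem (SetLike.mul_mem_graded b1 h.u_mem) c0 (by omega)
      · exact hmem b1 (SetLike.mul_mem_graded c0 h.u_mem) (by omega)
      · exact hmem (SetLike.mul_mem_graded b0 h.u_mem) c1 (by omega)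
      · exact hmem b0 (SetLike.mul_mem_graded c1 h.u_mem) (by omega)
      · exact hmem (SetLike.mul_mem_graded b1 huu) c1 (by omega)
      · exact hmem (SetLike.mul_mem_graded b1 h.u_mem) (SetLike.mul_mem_graded c1 h.u_mem)
          (by omega))
  refine ⟨G, fun a b c d => ?_⟩
  rw [hG]
  simp only [hw, ← map_add σ.θ]
  refine congrArg σ.θ ?_
  simp only [F, map_mul σ.left, map_mul σ.right, map_one]
  ring

end SixValent

/-! ### Compatibility of the components of the braid relation -/

section BraidCube

open GrBimod

variable {r : ℕ} {s t : ZMod r} {p q u : Poly r}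

theorem word₃_one {L M N : GrBimod (polyGr r)} (e : L) (e' : M) (e'' : N) :
    word₃ e e' e'' 1 1 1 1 = tm _ _ e (tm _ _ e' e'') := by
  rw [word₃, word₂_one, map_one]
  rfl

/-- The bimodule `R{2}`. -/
noncomputable abbrev baseTwo (r : ℕ) : GrBimod (polyGr r) := (regular (polyGr r)).shift 2

theorem Triple.dem_p (h : Triple s t p q u) (hr : 3 ≤ r) : dem hr s p = -1 :=
  dem_of_sigmaHom hr h.sigmaHom_p

theorem Triple.dem_q (h : Triple s t p q u) (hr : 3 ≤ r) : dem hr s q = 1 := by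
  have hq : q = p + q - p := by ring
  have hs : p + q ∈ fixedRing s := by rw [mem_fixedRing, map_add, h.s_p, h.s_q, add_comm]
  rw [hq, map_sub, h.dem_p, dem_of_mem hr hs]
  ring

theorem Triple.invPart_q (h : Triple s t p q u) (hr : 3 ≤ r) : invPart hr s p q = p + q := by
  rw [invPart_apply, h.dem_q]
  ring

theorem Triple.e₂_mem (h : Triple s t p q u) :
    p * q + q * u + u * p ∈ fixedRing s ∧ p * q + q * u + u * p ∈ fixedRing t := by
  simp only [mem_fixedRing, map_mul, map_add, h.s_p, h.s_q, h.s_u, h.t_p, h.t_q, h.t_u]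
  constructor <;> ring

/-- The components of the map of complexes from `F(σ_s) F(σ_t) F(σ_s)` to `F(σ_t) F(σ_s) F(σ_t)`:
the `b` in degree `-2`, the `a` in degree `-1` and `g` in degree `0`. The equations express the
compatibility with the differentials, up to the signs of the tensor product. They are grouped by the
cell at which they start: first `R R R`, where the component is the identity, then `B_s R R`, `R B_t
R` and `R R B_s`, where the last has component zero, and at last the cells of degree `-1`. Each of
them is checked on generating words, in coordinates on the target. -/
theorem Triple.exists_braid_maps (h : Triple s t p q u) (hr : 3 ≤ r) :
    ∃ (b₁ : tens (B s) (tens (baseTwo r) (baseTwo r)) ⟶ tens (baseTwo r) (tens (B s) (baseTwo r)))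
      (b₂ : tens (baseTwo r) (tens (B t) (baseTwo r)) ⟶ tens (B t) (tens (baseTwo r) (baseTwo r)))
      (b₃ : tens (baseTwo r) (tens (B t) (baseTwo r)) ⟶ tens (baseTwo r) (tens (baseTwo r) (B t)))
      (a₁ : tens (B s) (tens (B t) (baseTwo r)) ⟶ tens (baseTwo r) (tens (B s) (B t)))
      (a₂ : tens (B s) (tens (B t) (baseTwo r)) ⟶ tens (B t) (tens (baseTwo r) (B t)))
      (a₃ : tens (baseTwo r) (tens (B t) (B s)) ⟶ tens (B t) (tens (B s) (baseTwo r)))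
      (a₄ : tens (baseTwo r) (tens (B t) (B s)) ⟶ tens (B t) (tens (baseTwo r) (B t)))
      (a₅ : tens (B s) (tens (baseTwo r) (B s)) ⟶ tens (B t) (tens (B s) (baseTwo r)))
      (a₆ : tens (B s) (tens (baseTwo r) (B s)) ⟶ tens (B t) (tens (baseTwo r) (B t)))
      (g : tens (B s) (tens (B t) (B s)) ⟶ tens (B t) (tens (B s) (B t))),
      (diff₂ hr t (baseTwo r) (baseTwo r) ≫ b₂ = diff₁ hr t (baseTwo r) (baseTwo r) ∧
      diff₁ hr s (baseTwo r) (baseTwo r) ≫ b₁ = diff₂ hr s (baseTwo r) (baseTwo r) ∧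
      diff₂ hr t (baseTwo r) (baseTwo r) ≫ b₃ = diff₃ hr t (baseTwo r) (baseTwo r)) ∧
      (diff₃ hr s (B s) (baseTwo r) ≫ a₅ = b₁ ≫ diff₁ hr t (B s) (baseTwo r) ∧
      diff₂ hr t (B s) (baseTwo r) ≫ a₂ = diff₃ hr s (B s) (baseTwo r) ≫ a₆ ∧
      diff₂ hr t (B s) (baseTwo r) ≫ a₁ = b₁ ≫ diff₃ hr t (baseTwo r) (B s)) ∧
      (diff₃ hr s (baseTwo r) (B t) ≫ a₃ = b₂ ≫ diff₂ hr s (B t) (baseTwo r) ∧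
      diff₁ hr s (B t) (baseTwo r) ≫ a₂ - diff₃ hr s (baseTwo r) (B t) ≫ a₄ =
        b₂ ≫ diff₃ hr t (B t) (baseTwo r) - b₃ ≫ diff₁ hr t (baseTwo r) (B t) ∧
      diff₁ hr s (B t) (baseTwo r) ≫ a₁ = b₃ ≫ diff₂ hr s (baseTwo r) (B t)) ∧
      (diff₁ hr s (baseTwo r) (B s) ≫ a₅ = diff₂ hr t (baseTwo r) (B s) ≫ a₃ ∧
      diff₁ hr s (baseTwo r) (B s) ≫ a₆ = diff₂ hr t (baseTwo r) (B s) ≫ a₄) ∧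
      (diff₃ hr s (B s) (B t) ≫ g = a₁ ≫ diff₁ hr t (B s) (B t) + a₂ ≫ diff₂ hr s (B t) (B t) ∧
      diff₂ hr t (B s) (B s) ≫ g = a₅ ≫ diff₃ hr t (B t) (B s) + a₆ ≫ diff₂ hr s (B t) (B t) ∧
      diff₁ hr s (B t) (B s) ≫ g = a₃ ≫ diff₃ hr t (B t) (B s) + a₄ ≫ diff₂ hr s (B t) (B t)) ∧
      g.lin (tm _ _ (bOne s) (tm _ _ (bOne t) (bOne s))) =
        tm _ _ (bOne t) (tm _ _ (bOne s) (bOne t)) := by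
  have hs := B_isCyclic s
  have ht := B_isCyclic t
  have hR := R_isCyclic r 2
  obtain ⟨b₁, hb₁⟩ := exists_center hs hR hR hR hs hR (by norm_num)
  obtain ⟨b₂, hb₂⟩ := exists_outer hR ht hR ht hR hR (fun _ _ h => h)
    (fun a a' h => ⟨h.1, ⟨rfl, h.2⟩, rfl, rfl⟩) (fun _ _ h => h) (by norm_num)
  obtain ⟨b₃, hb₃⟩ := exists_outer hR ht hR hR hR ht (fun _ _ h => h)
    (fun a a' h => ⟨h.1, rfl, rfl, ⟨rfl, h.2⟩⟩) (fun _ _ h => h) (by norm_num)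
  obtain ⟨a₁, ha₁⟩ := exists_shiftRight hs ht hR hR hs ht (by norm_num)
  obtain ⟨a₂, ha₂⟩ := exists_outer hs ht hR ht hR ht (fun _ _ h => h.1)
    (fun a a' h => ⟨h.1, ⟨rfl, h.2⟩, rfl, ⟨rfl, h.2⟩⟩) (fun _ _ h => h) (by norm_num)
  obtain ⟨a₃, ha₃⟩ := exists_shiftLeft hR ht hs ht hs hR (by norm_num)
  obtain ⟨a₄, ha₄⟩ := exists_outer hR ht hs ht hR ht (fun _ _ h => h)
    (fun a a' h => ⟨h.1, ⟨rfl, h.2⟩, rfl, ⟨rfl, h.2⟩⟩) (fun _ _ h => h.1) (by norm_num)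
  obtain ⟨a₅, ha₅⟩ := h.exists_demLeft hr hs hR hs ht hs hR (by norm_num)
  obtain ⟨a₆, ha₆⟩ := h.exists_demOuter hr hs hR hs ht hR ht (by norm_num)
  obtain ⟨g, hg⟩ := h.exists_sixValent hr hs ht hs ht hs ht (by norm_num)
  have us : u ∈ fixedRing s := mem_fixedRing.2 h.s_u
  have pt : p ∈ fixedRing t := mem_fixedRing.2 h.t_p
  have hv := h.dem_q hr
  have hv' := h.dem_p hr
  have hi := h.invPart_q hr
  have hi' := invPart_self hr h.sigmaHom_p
  have hv1 := dem_one hr s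
  have hi1 : invPart hr s p 1 = 1 := invPart_one hr
  have hvu : dem hr s u = 0 := dem_of_mem hr us
  have hiu : invPart hr s p u = u := invPart_of_mem hr us
  have hvpu : dem hr s (p * u) = -u := by rw [mul_comm, dem_mul hr us, hv', mul_neg_one]
  have hipu : invPart hr s p (p * u) = 0 := by rw [mul_comm, invPart_mul hr us, hi', mul_zero]
  have d₁s := @diff₁_word₃ (hr := hr) (hp := h.s_p) (hq := h.root_left)
  have d₁t := @diff₁_word₃ (hr := hr) (hp := h.t_q) (hq := h.root_right)
  have d₂s := @diff₂_word₃ (hr := hr) (hp := h.s_p) (hq := h.root_left)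
  have d₂t := @diff₂_word₃ (hr := hr) (hp := h.t_q) (hq := h.root_right)
  have d₃s := @diff₃_word₃ (hr := hr) (hp := h.s_p) (hq := h.root_left)
  have d₃t := @diff₃_word₃ (hr := hr) (hp := h.t_q) (hq := h.root_right)
  refine ⟨b₁, b₂, b₃, a₁, a₂, a₃, a₄, a₅, a₆, g, ⟨?_, ?_, ?_⟩, ⟨?_, ?_, ?_⟩, ⟨?_, ?_, ?_⟩, ⟨?_, ?_⟩,
    ⟨?_, ?_, ?_⟩, ?_⟩
  · refine hom_ext_left_left hR hR hR ?_
    simp only [comp_lin, map_sub, d₂t, d₁t, hb₂, one_mul, mul_one]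
    obtain ⟨σ, s₁, s₂, hw, h01, h12, h23⟩ := ht.exists_slots₃ hR hR
    simp only [hw, ← map_sub σ.θ]
    refine congrArg σ.θ ?_
    simp only [map_one, h12 _ _ rfl, h23 _ _ rfl]
    ring
  · refine hom_ext_left_left hR hR hR ?_
    simp only [comp_lin, map_sub, d₁s, d₂s, hb₁, one_mul, mul_one]
    obtain ⟨σ, s₁, s₂, hw, h01, h12, h23⟩ := hR.exists_slots₃ hs hR
    simp only [hw, ← map_sub σ.θ]
    refine congrArg σ.θ ?_
    simp only [map_one, h01 _ _ rfl, h23 _ _ rfl]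
    ring
  · refine hom_ext_left_left hR hR hR ?_
    simp only [comp_lin, map_sub, d₂t, d₃t, hb₃, one_mul, mul_one]
    obtain ⟨σ, s₁, s₂, hw, h01, h12, h23⟩ := hR.exists_slots₃ hR ht
    simp only [hw, ← map_sub σ.θ]
    refine congrArg σ.θ ?_
    simp only [map_one, h01 _ _ rfl, h12 _ _ rfl]
    ring
  · refine hom_ext_right_right hs hR hR ?_
    simp only [comp_lin, map_sub, d₃s, d₁t, ha₅, hb₁, hv, hv1, one_mul, mul_one]
    obtain ⟨σ, s₁, s₂, hw, h01, h12, h23⟩ := ht.exists_slots₃ hs hR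
    simp only [hw, ← map_sub σ.θ]
    refine congrArg σ.θ ?_
    simp only [map_mul, map_one, map_zero, h23 _ _ rfl]
    ring
  · refine hom_ext_right_right hs hR hR ?_
    simp only [comp_lin, map_sub, d₂t, d₃s, ha₂, ha₆, hv, hv1, one_mul, mul_one]
    obtain ⟨σ, s₁, s₂, hw, h01, h12, h23⟩ := ht.exists_slots₃ hR ht
    simp only [hw, ← map_sub σ.θ]
    refine congrArg σ.θ ?_
    simp only [map_mul, map_one, map_zero, h12 _ _ rfl]
    ring
  · refine hom_ext_right_right hs hR hR ?_
    simp only [comp_lin, map_sub, d₂t, d₃t, ha₁, hb₁, one_mul, mul_one]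
  · refine hom_ext_left_right hR ht hR ?_
    simp only [comp_lin, map_sub, d₃s, d₂s, ha₃, hb₂, one_mul, mul_one]
  · refine hom_ext_left_right hR ht hR ?_
    simp only [comp_lin, sub_lin, map_sub, d₁s, d₃s, d₃t, d₁t, ha₂, ha₄, hb₂, hb₃, one_mul, mul_one]
    obtain ⟨σ, s₁, s₂, hw, h01, h12, h23⟩ := ht.exists_slots₃ hR ht
    simp only [hw, ← map_sub σ.θ]
    refine congrArg σ.θ ?_
    have k := h01 _ _ ⟨rfl, pt⟩
    have k' := h01 _ _ ⟨rfl, h.q_add_u_mem⟩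
    have k'' := h23 _ _ ⟨rfl, pt⟩
    simp only [map_add, map_one, ← h12 _ _ rfl] at *
    linear_combination k' - k - k''
  · refine hom_ext_left_right hR ht hR ?_
    simp only [comp_lin, map_sub, d₁s, d₂s, ha₁, hb₃, one_mul, mul_one]
    obtain ⟨σ, s₁, s₂, hw, h01, h12, h23⟩ := hR.exists_slots₃ hs ht
    simp only [hw, ← map_sub σ.θ]
    refine congrArg σ.θ ?_
    simp only [map_one, h01 _ _ rfl]
    ring
  · refine hom_ext_left_left hR hR hs ?_
    simp only [comp_lin, map_sub, d₁s, d₂t, ha₅, ha₃, hv', hv1, one_mul, mul_one]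
    obtain ⟨σ, s₁, s₂, hw, h01, h12, h23⟩ := ht.exists_slots₃ hs hR
    simp only [hw, ← map_sub σ.θ]
    refine congrArg σ.θ ?_
    simp only [map_mul, map_one, map_neg, map_zero, h23 _ _ rfl]
    ring
  · refine hom_ext_left_left hR hR hs ?_
    simp only [comp_lin, map_sub, d₁s, d₂t, ha₆, ha₄, hv', hv1, one_mul, mul_one]
    obtain ⟨σ, s₁, s₂, hw, h01, h12, h23⟩ := ht.exists_slots₃ hR ht
    simp only [hw, ← map_sub σ.θ]
    refine congrArg σ.θ ?_
    simp only [map_mul, map_one, map_neg, map_zero, h12 _ _ rfl]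
    ring
  · refine hom_ext_fix_fix_eq hr h.sigmaHom_p pt hs ht hR ?_
    simp only [comp_lin, add_lin, map_sub, d₃s, d₁t, d₂s, hg, ha₁, ha₂, hv, hv1, hi, hi1,
      one_mul, mul_one]
    obtain ⟨σ, s₁, s₂, hw, h01, h12, h23⟩ := ht.exists_slots₃ hs ht
    simp only [hw, ← map_sub σ.θ, ← map_add σ.θ]
    refine congrArg σ.θ ?_
    have k := congrArg σ.right h.sum
    simp only [map_mul, map_add, map_sub, map_one, map_zero, h23 _ _ ⟨rfl, pt⟩] at *
    linear_combination k
  · refine hom_ext_fix_eq_fix hr h.sigmaHom_p hs hR hs ?_ ?_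
    · simp only [comp_lin, add_lin, map_sub, d₂t, d₃t, d₂s, hg, ha₅, ha₆, hv, hv1, hi, hi1, hvu,
        hiu, one_mul, mul_one]
      obtain ⟨σ, s₁, s₂, hw, h01, h12, h23⟩ := ht.exists_slots₃ hs ht
      simp only [hw, ← map_sub σ.θ, ← map_add σ.θ]
      refine congrArg σ.θ ?_
      have k := congrArg σ.right h.sum
      simp only [map_mul, map_add, map_sub, map_one, map_zero] at *
      linear_combination -k
    · simp only [comp_lin, add_lin, map_sub, d₂t, d₃t, d₂s, hg, ha₅, ha₆, hv, hv', hv1, hi, hi',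
        hi1, hvpu, hipu, one_mul, mul_one]
      obtain ⟨σ, s₁, s₂, hw, h01, h12, h23⟩ := ht.exists_slots₃ hs ht
      simp only [hw, ← map_sub σ.θ, ← map_add σ.θ]
      refine congrArg σ.θ ?_
      have kl := congrArg σ.left h.sum
      have k' := h01 _ _ ⟨rfl, h.q_add_u_mem⟩
      have k'' := h12 _ _ ⟨rfl, us⟩
      have k₃ := h01 _ _ ⟨rfl, h.q_mul_u_mem⟩
      have k₄ := (h01 _ _ ⟨rfl, h.e₂_mem.2⟩).trans ((h12 _ _ ⟨rfl, h.e₂_mem.1⟩).trans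
        (h23 _ _ ⟨rfl, h.e₂_mem.2⟩))
      simp only [map_mul, map_add, map_sub, map_neg, map_one, map_zero, h23 _ _ ⟨rfl, pt⟩] at *
      linear_combination k₃ + s₁ q * k'' - k₄ - σ.left u * (k' + k'' - kl)
  · refine hom_ext_eq_fix_fix hr h.sigmaHom_p pt hR ht hs ?_
    simp only [comp_lin, add_lin, map_sub, d₁s, d₃t, d₂s, hg, ha₃, ha₄, hv', hv1, hi', hi1,
      one_mul, mul_one]
    obtain ⟨σ, s₁, s₂, hw, h01, h12, h23⟩ := ht.exists_slots₃ hs ht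
    simp only [hw, ← map_sub σ.θ, ← map_add σ.θ]
    refine congrArg σ.θ ?_
    have k := congrArg σ.right h.sum
    have k' := h01 _ _ ⟨rfl, h.q_add_u_mem⟩
    have k'' := h12 _ _ ⟨rfl, us⟩
    simp only [map_mul, map_add, map_sub, map_neg, map_one, map_zero, h23 _ _ ⟨rfl, pt⟩] at *
    linear_combination k + k' + k''
  · have := hg 1 1 1 1
    rw [hi1, hv1, word₃_one] at this
    refine this.trans (Eq.trans ?_ (word₃_one _ _ _))
    obtain ⟨σ, s₁, s₂, hw, -⟩ := ht.exists_slots₃ hs ht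
    simp only [hw, ← map_add σ.θ]
    refine congrArg σ.θ ?_
    simp only [map_one, map_zero, mul_one, mul_zero, zero_mul, add_zero]

end BraidCube

/-! ### Chain maps between cubes -/

section Cube

open GrBimod

variable {k R : Type} [CommRing k] [CommRing R] [Algebra k R] {𝒜 : ℤ → Submodule k R}
  {K L : Complexes 𝒜}

set_option maxHeartbeats 1000000 in
/-- A map between complexes with the cells of a cube, given by its entries. -/
theorem Cells.exists_hom_of_cube {D D' : CellData 𝒜 (Bool × Bool × Bool)} (c : Cells D K)
    (c' : Cells D' L) (hD : ∀ j, D.deg j = bitDeg j.1 + (bitDeg j.2.1 + bitDeg j.2.2))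
    (hD' : ∀ j, D'.deg j = bitDeg j.1 + (bitDeg j.2.1 + bitDeg j.2.2))
    (hn : ∀ j l, j.1 ≠ l.1 → j.2 ≠ l.2 → D.d j l = 0)
    (hn' : ∀ j l, j.1 ≠ l.1 → j.2 ≠ l.2 → D'.d j l = 0)
    (f₀ : D.A (false, false, false) ⟶ D'.A (false, false, false))
    (b₁ : D.A (true, false, false) ⟶ D'.A (false, true, false))
    (b₂ : D.A (false, true, false) ⟶ D'.A (true, false, false))
    (b₃ : D.A (false, true, false) ⟶ D'.A (false, false, true))
    (a₁ : D.A (true, true, false) ⟶ D'.A (false, true, true))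
    (a₂ : D.A (true, true, false) ⟶ D'.A (true, false, true))
    (a₃ : D.A (false, true, true) ⟶ D'.A (true, true, false))
    (a₄ : D.A (false, true, true) ⟶ D'.A (true, false, true))
    (a₅ : D.A (true, false, true) ⟶ D'.A (true, true, false))
    (a₆ : D.A (true, false, true) ⟶ D'.A (true, false, true))
    (g : D.A (true, true, true) ⟶ D'.A (true, true, true))
    (h₁ : D.d (false, false, false) (false, true, false) ≫ b₃ =
      f₀ ≫ D'.d (false, false, false) (false, false, true))
    (h₂ : D.d (false, false, false) (true, false, false) ≫ b₁ =
      f₀ ≫ D'.d (false, false, false) (false, true, false))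
    (h₃ : D.d (false, false, false) (false, true, false) ≫ b₂ =
      f₀ ≫ D'.d (false, false, false) (true, false, false))
    (h₄ : D.d (false, false, true) (true, false, true) ≫ a₆ +
      D.d (false, false, true) (false, true, true) ≫ a₄ = 0)
    (h₅ : D.d (false, false, true) (true, false, true) ≫ a₅ +
      D.d (false, false, true) (false, true, true) ≫ a₃ = 0)
    (h₆ : D.d (false, true, false) (true, true, false) ≫ a₁ =
      b₃ ≫ D'.d (false, false, true) (false, true, true))
    (h₇ : D.d (false, true, false) (true, true, false) ≫ a₂ +
      D.d (false, true, false) (false, true, true) ≫ a₄ =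
      b₂ ≫ D'.d (true, false, false) (true, false, true) +
        b₃ ≫ D'.d (false, false, true) (true, false, true))
    (h₈ : D.d (false, true, false) (false, true, true) ≫ a₃ =
      b₂ ≫ D'.d (true, false, false) (true, true, false))
    (h₉ : D.d (false, true, true) (true, true, true) ≫ g =
      a₃ ≫ D'.d (true, true, false) (true, true, true) +
        a₄ ≫ D'.d (true, false, true) (true, true, true))
    (h₁₀ : D.d (true, false, false) (true, true, false) ≫ a₁ =
      b₁ ≫ D'.d (false, true, false) (false, true, true))
    (h₁₁ : D.d (true, false, false) (true, true, false) ≫ a₂ +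
      D.d (true, false, false) (true, false, true) ≫ a₆ = 0)
    (h₁₂ : D.d (true, false, false) (true, false, true) ≫ a₅ =
      b₁ ≫ D'.d (false, true, false) (true, true, false))
    (h₁₃ : D.d (true, false, true) (true, true, true) ≫ g =
      a₅ ≫ D'.d (true, true, false) (true, true, true) +
        a₆ ≫ D'.d (true, false, true) (true, true, true))
    (h₁₄ : D.d (true, true, false) (true, true, true) ≫ g =
      a₂ ≫ D'.d (true, false, true) (true, true, true) +
        a₁ ≫ D'.d (false, true, true) (true, true, true))
    {e : D.A (true, true, true)} (he : e ∈ (D.A (true, true, true)).gr 0)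
    (hd : ∀ l, (D.d (true, true, true) l).lin e = 0) {e' : D'.A (true, true, true)}
    (he' : e' ∈ (D'.A (true, true, true)).gr 0) (hd' : ∀ l, (D'.d (true, true, true) l).lin e' = 0)
    (hee : g.lin e = e') :
    ∃ F : K ⟶ L, HPt.map F (HPt.mk (c.cyc (true, true, true) e he hd)) =
      HPt.mk (c'.cyc (true, true, true) e' he' hd') := by
  let m : ∀ j l : Bool × Bool × Bool, D.A j ⟶ D'.A l
    | (false, false, false), (false, false, false) => f₀
    | (true, false, false), (false, true, false) => b₁
    | (false, true, false), (true, false, false) => b₂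
    | (false, true, false), (false, false, true) => b₃
    | (true, true, false), (false, true, true) => a₁
    | (true, true, false), (true, false, true) => a₂
    | (false, true, true), (true, true, false) => a₃
    | (false, true, true), (true, false, true) => a₄
    | (true, false, true), (true, true, false) => a₅
    | (true, false, true), (true, false, true) => a₆
    | (true, true, true), (true, true, true) => g
    | _, _ => 0
  have n₁ := hn (true, false, false) (false, true, true) (by decide) (by decide)
  have n₁' := hn' (true, false, false) (false, true, true) (by decide) (by decide)
  have n₂ := hn (false, true, false) (true, false, true) (by decide) (by decide)
  have n₂' := hn' (false, true, false) (true, false, true) (by decide) (by decide)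
  have n₃ := hn (false, false, true) (true, true, false) (by decide) (by decide)
  have n₃' := hn' (false, false, true) (true, true, false) (by decide) (by decide)
  have hm : ∀ j l : Bool × Bool × Bool, bitDeg l.1 + (bitDeg l.2.1 + bitDeg l.2.2) =
      bitDeg j.1 + (bitDeg j.2.1 + bitDeg j.2.2) + 1 →
      ∑ i, D.d j i ≫ m i l = ∑ i, m j i ≫ D'.d i l := by
    rintro ⟨_ | _, _ | _, _ | _⟩ ⟨_ | _, _ | _, _ | _⟩ hl
    all_goals first | exact absurd hl (by decide) | skip
    all_goals
      simp only [Fintype.sum_prod_type, Fintype.sum_bool, m, n₁, n₂, n₃, n₁', n₂', n₃', comp_zero,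
        zero_comp, add_zero, zero_add]
    exacts [h₁, h₂, h₃, h₄, h₅, h₆, h₇, h₈, h₉, h₁₀, h₁₁, h₁₂, h₁₃, h₁₄]
  have h₀ : ∀ i : Bool × Bool × Bool, i ≠ (true, true, true) → m (true, true, true) i = 0 := by
    rintro ⟨_ | _, _ | _, _ | _⟩ hi
    all_goals first | rfl | exact absurd rfl hi
  exact ⟨c.map c' m fun j l hl => hm j l (by rw [← hD' l, ← hD j]; exact hl),
    c.map_cyc c' m _ (hD _) he hd he' hd' hee fun i hi _ => by rw [h₀ i hi, zero_lin]⟩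

end Cube

/-! ### The chain map for the braid relation -/

section BraidChainMap

open GrBimod

variable {r : ℕ}

theorem GrBimod.tensMap_zsmul_right {M M' N N' : GrBimod (polyGr r)} (f : M ⟶ M') (n : ℤ)
    (g : N ⟶ N') : tensMap f (n • g) = n • tensMap f g :=
  tens_hom_ext fun x y => by simp [zsmul_lin]

/-- The cells of `F(σ_s) ⊗ (F(σ_t) ⊗ F(σ_v))`. -/
noncomputable abbrev tripleData (hr : 3 ≤ r) (s t v : ZMod r) :
    CellData (polyGr r) (Bool × Bool × Bool) :=
  (sigmaData hr s).tensor ((sigmaData hr t).tensor (sigmaData hr v))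

theorem tripleData_d₁ (hr : 3 ≤ r) (s t v : ZMod r) (x y : Bool) :
    (tripleData hr s t v).d (false, x, y) (true, x, y) =
      diff₁ hr s ((sigmaData hr t).A x) ((sigmaData hr v).A y) :=
  CellData.tensor_d_left _ _ false true (x, y)

theorem tripleData_d₂ (hr : 3 ≤ r) (s t v : ZMod r) (x y : Bool) :
    (tripleData hr s t v).d (x, false, y) (x, true, y) =
      ((bitDeg x).negOnePow : ℤ) • diff₂ hr t ((sigmaData hr s).A x) ((sigmaData hr v).A y) := by
  refine (CellData.tensor_d_right _ _ x (false, y) (true, y)).trans ?_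
  rw [CellData.tensor_d_left, sigma_deg]

theorem tripleData_d₃ (hr : 3 ≤ r) (s t v : ZMod r) (x y : Bool) :
    (tripleData hr s t v).d (x, y, false) (x, y, true) =
      ((bitDeg x + bitDeg y).negOnePow : ℤ) •
        diff₃ hr v ((sigmaData hr s).A x) ((sigmaData hr t).A y) := by
  refine (CellData.tensor_d_right _ _ x (y, false) (y, true)).trans ?_
  rw [CellData.tensor_d_right, sigma_deg, sigma_deg, tensMap_zsmul_right, smul_smul,
    Int.negOnePow_add, Units.val_mul]

/-- The differential of the triple product. The sign counts the factors of degree `-1` in front of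
the differentiated one. -/
theorem tripleData_d (hr : 3 ≤ r) (s t v : ZMod r) :
    (∀ x y, (tripleData hr s t v).d (false, x, y) (true, x, y) =
      diff₁ hr s ((sigmaData hr t).A x) ((sigmaData hr v).A y)) ∧
    (∀ y, (tripleData hr s t v).d (false, false, y) (false, true, y) =
      -diff₂ hr t (baseTwo r) ((sigmaData hr v).A y)) ∧
    (∀ y, (tripleData hr s t v).d (true, false, y) (true, true, y) =
      diff₂ hr t (B s) ((sigmaData hr v).A y)) ∧
    (tripleData hr s t v).d (false, false, false) (false, false, true) =
      diff₃ hr v (baseTwo r) (baseTwo r) ∧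
    (tripleData hr s t v).d (false, true, false) (false, true, true) =
      -diff₃ hr v (baseTwo r) (B t) ∧
    (tripleData hr s t v).d (true, false, false) (true, false, true) =
      -diff₃ hr v (B s) (baseTwo r) ∧
    (tripleData hr s t v).d (true, true, false) (true, true, true) = diff₃ hr v (B s) (B t) :=
  ⟨tripleData_d₁ hr s t v,
    fun y => (tripleData_d₂ hr s t v false y).trans (neg_one_zsmul _),
    fun y => (tripleData_d₂ hr s t v true y).trans (one_zsmul _),
    (tripleData_d₃ hr s t v false false).trans (one_zsmul _),
    (tripleData_d₃ hr s t v false true).trans (neg_one_zsmul _),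
    (tripleData_d₃ hr s t v true false).trans (neg_one_zsmul _),
    (tripleData_d₃ hr s t v true true).trans (one_zsmul _)⟩

/-! The entries of a differential are substituted by way of the following lemmas, since the types of
the entries agree with those of the substituted maps only after unfolding the triple product. -/

section

variable {C : Type*} [Category C] {X Y Y' Z Z' W : C} {f f₁ : X ⟶ Y}
  {f' f₁' : X ⟶ Y'} {g : Y ⟶ W} {g' : Y' ⟶ W} {l : X ⟶ Z} {l' : X ⟶ Z'} {k k₁ : Z ⟶ W}
  {k' k₁' : Z' ⟶ W}

theorem comp_eq_comp_congr (hf : f = f₁) (hk : k = k₁) (h : f₁ ≫ g = l ≫ k₁) :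
    f ≫ g = l ≫ k := by rw [hf, hk, h]

variable [Preadditive C]

theorem comp_eq_add_congr (hf : f = f₁) (hk : k = k₁) (hk' : k' = k₁')
    (h : f₁ ≫ g = l ≫ k₁ + l' ≫ k₁') : f ≫ g = l ≫ k + l' ≫ k' := by rw [hf, hk, hk', h]

theorem add_eq_zero_congr (hf : f = f₁) (hf' : f' = f₁') (h : f₁ ≫ g + f₁' ≫ g' = 0) :
    f ≫ g + f' ≫ g' = 0 := by rw [hf, hf', h]

theorem add_eq_add_congr (hf : f = f₁) (hf' : f' = f₁') (hk : k = k₁) (hk' : k' = k₁')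
    (h : f₁ ≫ g + f₁' ≫ g' = l ≫ k₁ + l' ≫ k₁') :
    f ≫ g + f' ≫ g' = l ≫ k + l' ≫ k' := by rw [hf, hf', hk, hk', h]

end

theorem tripleData_deg (hr : 3 ≤ r) (s t v : ZMod r) (j : Bool × Bool × Bool) :
    (tripleData hr s t v).deg j = bitDeg j.1 + (bitDeg j.2.1 + bitDeg j.2.2) := by
  rw [← sigma_deg hr s, ← sigma_deg hr t, ← sigma_deg hr v]

theorem tripleData_d_bOne (hr : 3 ≤ r) (s t v : ZMod r) (l : Bool × Bool × Bool) :
    ((tripleData hr s t v).d (true, true, true) l).lin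
      (tm _ _ (bOne s) (tm _ _ (bOne t) (bOne v))) = 0 :=
  CellData.tensor_d_tm (sigma_d_bOne hr s)
    (fun l => CellData.tensor_d_tm (sigma_d_bOne hr t) (sigma_d_bOne hr v) l) l

/-- The distinguished point of a triple product. -/
theorem triple_mul (hr : 3 ≤ r) (s t v : ZMod r) :
    HPt.mul (sigmaPt hr s) (HPt.mul (sigmaPt hr t) (sigmaPt hr v)) =
      HPt.mk (((sigmaCells hr s).tensor ((sigmaCells hr t).tensor (sigmaCells hr v))).cyc
        (true, true, true) (tm _ _ (bOne s) (tm _ _ (bOne t) (bOne v)))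
        (tm_mem_zero (bOne_mem s) (tm_mem_zero (bOne_mem t) (bOne_mem v)))
        (tripleData_d_bOne hr s t v)) := by
  have hs := bOne_mem s
  have ht := bOne_mem t
  have hv := bOne_mem v
  rw [sigmaPt, sigmaPt, sigmaPt, (sigmaCells hr t).mulCyc_cyc (sigmaCells hr v) rfl ht
    (sigma_d_bOne hr t) rfl hv (sigma_d_bOne hr v) (tm_mem_zero ht hv),
    (sigmaCells hr s).mulCyc_cyc ((sigmaCells hr t).tensor (sigmaCells hr v)) rfl hs
    (sigma_d_bOne hr s) rfl (tm_mem_zero ht hv)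
    (CellData.tensor_d_tm (sigma_d_bOne hr t) (sigma_d_bOne hr v))
    (tm_mem_zero hs (tm_mem_zero ht hv))]

/-- There is a pointed map of complexes `F(σ_s) F(σ_t) F(σ_s) ⟶ F(σ_t) F(σ_s) F(σ_t)` for adjacent
`s` and `t`. -/
theorem exists_hom_braid (hr : 3 ≤ r) {s t : ZMod r} {p q u : Poly r} (h : Triple s t p q u) :
    ∃ f : sigmaK hr s ⊗ (sigmaK hr t ⊗ sigmaK hr s) ⟶ sigmaK hr t ⊗ (sigmaK hr s ⊗ sigmaK hr t),
      HPt.map f (HPt.mul (sigmaPt hr s) (HPt.mul (sigmaPt hr t) (sigmaPt hr s))) =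
        HPt.mul (sigmaPt hr t) (HPt.mul (sigmaPt hr s) (sigmaPt hr t)) := by
  obtain ⟨b₁, b₂, b₃, a₁, a₂, a₃, a₄, a₅, a₆, g, ⟨e₁, e₂, e₃⟩, ⟨e₄, e₅, e₆⟩, ⟨e₇, e₈, e₉⟩,
    ⟨e₁₀, e₁₁⟩, ⟨e₁₂, e₁₃, e₁₄⟩, hg⟩ := h.exists_braid_maps hr
  obtain ⟨x₁, x₂, x₂', x₃, x₃', x₃'', x₃'''⟩ := tripleData_d hr s t s
  obtain ⟨y₁, y₂, y₂', y₃, y₃', y₃'', y₃'''⟩ := tripleData_d hr t s t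
  rw [triple_mul, triple_mul]
  let R₂ := baseTwo r
  -- the signs of the tensor product differentials are absorbed by the sign of the components of
  -- degree `-2`
  refine ((sigmaCells hr s).tensor ((sigmaCells hr t).tensor (sigmaCells hr s))).exists_hom_of_cube
    ((sigmaCells hr t).tensor ((sigmaCells hr s).tensor (sigmaCells hr t)))
    (tripleData_deg hr s t s) (tripleData_deg hr t s t)
    (fun j l h h' => CellData.tensor_d_ne _ _ h h') (fun j l h h' => CellData.tensor_d_ne _ _ h h')
    (𝟙 (tens R₂ (tens R₂ R₂))) (-b₁) (-b₂) (-b₃) a₁ a₂ a₃ a₄ a₅ a₆ g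
    ?_ ?_ ?_ ?_ ?_ ?_ ?_ ?_ ?_ ?_ ?_ ?_ ?_ ?_ _ _ _ _ hg
  · refine comp_eq_comp_congr (x₂ false) y₃ ?_
    rw [Preadditive.neg_comp_neg]
    exact e₃.trans (Category.id_comp _).symm
  · refine comp_eq_comp_congr (x₁ false false) (y₂ false) ?_
    rw [Preadditive.comp_neg, Preadditive.comp_neg]
    exact congrArg Neg.neg (e₂.trans (Category.id_comp _).symm)
  · refine comp_eq_comp_congr (x₂ false) (y₁ false false) ?_
    rw [Preadditive.neg_comp_neg]
    exact e₁.trans (Category.id_comp _).symm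
  · refine add_eq_zero_congr (x₁ false true) (x₂ true) ?_
    rw [Preadditive.neg_comp, ← sub_eq_add_neg]
    exact sub_eq_zero.2 e₁₁
  · refine add_eq_zero_congr (x₁ false true) (x₂ true) ?_
    rw [Preadditive.neg_comp, ← sub_eq_add_neg]
    exact sub_eq_zero.2 e₁₀
  · refine comp_eq_comp_congr (x₁ true false) (y₂ true) ?_
    rw [Preadditive.neg_comp_neg]
    exact e₉
  · refine add_eq_add_congr (x₁ true false) x₃' y₃'' (y₁ false true) ?_
    rw [Preadditive.neg_comp, Preadditive.neg_comp_neg, Preadditive.neg_comp, ← sub_eq_add_neg,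
      ← sub_eq_add_neg]
    exact e₈
  · refine comp_eq_comp_congr x₃' (y₂' false) ?_
    rw [Preadditive.neg_comp, Preadditive.neg_comp]
    exact congrArg Neg.neg e₇
  · exact comp_eq_add_congr (x₁ true true) y₃''' (y₂' true) e₁₄
  · refine comp_eq_comp_congr (x₂' false) y₃' ?_
    rw [Preadditive.neg_comp_neg]
    exact e₆
  · refine add_eq_zero_congr (x₂' false) x₃'' ?_
    rw [Preadditive.neg_comp, ← sub_eq_add_neg]
    exact sub_eq_zero.2 e₅
  · refine comp_eq_comp_congr x₃'' (y₁ true false) ?_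
    rw [Preadditive.neg_comp, Preadditive.neg_comp]
    exact congrArg Neg.neg e₄
  · exact comp_eq_add_congr (x₂' true) y₃''' (y₂' true) e₁₃
  · exact comp_eq_add_congr x₃''' (y₂' true) (y₁ true true) (e₁₂.trans (add_comm _ _))

end BraidChainMap

/-! ### The action of the extended affine braid group -/

section Action

open GrBimod Pointing

variable {r : ℕ}

variable (r) in
/-- The pointing of the homotopy category of bounded complexes of extended Soergel bimodules. -/
noncomputable abbrev karPointing : Pointing (KbKar r) :=
  (hoPointing (polyGr r)).restrict (boundedIn (IsKarExtBim r))

/-- The complex assigned to a letter, with its distinguished point. -/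
noncomputable def letterPt (hr : 3 ≤ r) : Gen r × Bool → (karPointing r).Pt
  | (.sigma i, true) => ⟨sigmaComplex hr i, sigmaPt hr i⟩
  | (.sigma i, false) => ⟨sigmaInvComplex i, sigmaInvPt i⟩
  | (.rho, true) => ⟨rhoComplex r, rhoPt r⟩
  | (.rho, false) => ⟨rhoInvComplex r, rhoInvPt r⟩

theorem letterPt_X (hr : 3 ≤ r) (s : Gen r × Bool) : (letterPt hr s).X = letterComplex hr s := by
  obtain ⟨_ | _, _ | _⟩ := s <;> rfl

/-- Isomorphisms in the homotopy category of all complexes are isomorphisms in the full subcategory.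
-/
theorem equiv_of_ho_iso {A B : (karPointing r).Pt} (E : A.X.obj ≅ B.X.obj)
    (hE : HPt.hoMap E.hom A.z = B.z) : A.Equiv B :=
  ⟨ObjectProperty.isoMk _ E, hE⟩

theorem letterPt_inverse (hr : 3 ≤ r) (s : Gen r) :
    (letterPt hr (s, true)).Inverse (letterPt hr (s, false)) := by
  cases s with
  | sigma i =>
    obtain ⟨E, hE⟩ := exists_iso_sigma_inv hr i
    obtain ⟨E', hE'⟩ := exists_iso_inv_sigma hr i
    exact ⟨equiv_of_ho_iso E hE, equiv_of_ho_iso E' hE'⟩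
  | rho =>
    obtain ⟨E, hE⟩ := exists_iso_rho_inv r
    obtain ⟨E', hE'⟩ := exists_iso_inv_rho r
    exact ⟨equiv_of_ho_iso E hE, equiv_of_ho_iso E' hE'⟩

theorem letterPt_invertible (hr : 3 ≤ r) (s : Gen r × Bool) : ∃ B, (letterPt hr s).Inverse B := by
  obtain ⟨s, _ | _⟩ := s
  · exact ⟨_, (letterPt_inverse hr s).symm⟩
  · exact ⟨_, letterPt_inverse hr s⟩

/-- The class of a letter. -/
noncomputable def letterClass (hr : 3 ≤ r) (s : Gen r × Bool) : (karPointing r).PicPt :=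
  PicPt.mk (letterPt hr s) (letterPt_invertible hr s)

theorem letterClass_inv (hr : 3 ≤ r) (s : Gen r) :
    letterClass hr (s, false) = (letterClass hr (s, true))⁻¹ :=
  (PicPt.mk_inv (letterPt_inverse hr s)).symm

/-- Two invertible pointed complexes have the same class if there are pointed maps of complexes in
both directions. -/
theorem mk_eq_mk_of_maps {A B : (karPointing r).Pt} (hA : ∃ A', A.Inverse A')
    (hB : ∃ B', B.Inverse B') (f : A.X.obj.as ⟶ B.X.obj.as) (hf : HPt.map f A.z = B.z)
    (g : B.X.obj.as ⟶ A.X.obj.as) (hg : HPt.map g B.z = A.z) : PicPt.mk A hA = PicPt.mk B hB := by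
  obtain ⟨A', hA'⟩ := hA
  obtain ⟨B', hB'⟩ := hB
  exact PicPt.mk_eq_mk.2 (Pt.equiv_of_hom hA' hB' ⟨(toHo _).map f⟩ ((HPt.hoMap_map f _).trans hf)
    ⟨(toHo _).map g⟩ ((HPt.hoMap_map g _).trans hg))

theorem letterClass_comm (hr : 3 ≤ r) {i j : ZMod r} (h : Distant i j) :
    letterClass hr (.sigma i, true) * letterClass hr (.sigma j, true) =
      letterClass hr (.sigma j, true) * letterClass hr (.sigma i, true) := by
  obtain ⟨f, hf⟩ := exists_hom_distant hr h
  obtain ⟨g, hg⟩ := exists_hom_distant hr h.symm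
  rw [letterClass, letterClass, PicPt.mk_mul, PicPt.mk_mul]
  exact mk_eq_mk_of_maps _ _ f hf g hg

theorem letterClass_braid (hr : 3 ≤ r) (i : ZMod r) :
    letterClass hr (.sigma i, true) * letterClass hr (.sigma (i + 1), true) *
      letterClass hr (.sigma i, true) = letterClass hr (.sigma (i + 1), true) *
        letterClass hr (.sigma i, true) * letterClass hr (.sigma (i + 1), true) := by
  obtain ⟨⟨p, q, u, h⟩, ⟨p', q', u', h'⟩⟩ := exists_triple_succ hr i
  obtain ⟨f, hf⟩ := exists_hom_braid hr h
  obtain ⟨g, hg⟩ := exists_hom_braid hr h'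
  rw [mul_assoc, mul_assoc, letterClass, letterClass, PicPt.mk_mul, PicPt.mk_mul, PicPt.mk_mul,
    PicPt.mk_mul]
  exact mk_eq_mk_of_maps _ _ f hf g hg

theorem letterClass_conj (hr : 3 ≤ r) (i : ZMod r) :
    letterClass hr (.rho, true) * letterClass hr (.sigma i, true) =
      letterClass hr (.sigma (i + 1), true) * letterClass hr (.rho, true) := by
  obtain ⟨f, hf⟩ := exists_hom_rho_sigma hr i
  obtain ⟨g, hg⟩ := exists_hom_sigma_rho hr i
  rw [letterClass, letterClass, letterClass, PicPt.mk_mul, PicPt.mk_mul]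
  exact mk_eq_mk_of_maps _ _ f hf g hg

/-- The homomorphism from the extended affine braid group to the group of invertible pointed
complexes. -/
noncomputable def braidHom (hr : 3 ≤ r) : ExtAffBraid r →* (karPointing r).PicPt :=
  PresentedGroup.toGroup (f := fun s => letterClass hr (s, true)) (by
    rintro w (⟨i, j, h₁, h₂, h₃⟩ | ⟨i⟩ | ⟨i⟩)
    · simp only [_root_.map_mul, map_inv, FreeGroup.lift_apply_of]
      rw [mul_inv_eq_one]
      exact letterClass_comm hr ⟨h₁, h₂, h₃⟩
    · simp only [_root_.map_mul, map_inv, FreeGroup.lift_apply_of]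
      rw [mul_inv_eq_one]
      exact letterClass_braid hr i
    · simp only [_root_.map_mul, map_inv, FreeGroup.lift_apply_of]
      rw [mul_inv_eq_one, mul_inv_eq_iff_eq_mul]
      exact letterClass_conj hr i)

theorem braidHom_wordElt (hr : 3 ≤ r) (w : List (Gen r × Bool)) :
    braidHom hr (wordElt w) = (w.map (letterClass hr)).prod := by
  have h : braidHom hr (wordElt w) =
      FreeGroup.lift (fun s => letterClass hr (s, true)) (FreeGroup.mk w) := rfl
  rw [h, FreeGroup.lift_mk]
  refine congrArg List.prod (List.map_congr_left fun s _ => ?_)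
  obtain ⟨s, _ | _⟩ := s
  · exact (letterClass_inv hr s).symm
  · rfl

/-- The complex of a word, with the product of the distinguished points of its letters, represents
the product of the classes of its letters. -/
theorem exists_wordPt (hr : 3 ≤ r) (w : List (Gen r × Bool)) :
    ∃ (A : (karPointing r).Pt) (hA : ∃ B, A.Inverse B), A.X = wordComplex hr w ∧
      PicPt.mk A hA = (w.map (letterClass hr)).prod := by
  induction w with
  | nil => exact ⟨Pt.unit _, Pt.exists_inverse_unit, rfl, PicPt.mk_unit⟩
  | cons s w ih =>
    obtain ⟨A, hA, hX, h⟩ := ih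
    refine ⟨(letterPt hr s).tensor A,
      Pt.exists_inverse_tensor (letterPt_invertible hr s) hA, ?_, ?_⟩
    · rw [wordComplex, ← hX, ← letterPt_X]
    · rw [List.map_cons, List.prod_cons, ← h, ← PicPt.mk_mul]
      rfl

theorem exists_monoidal_functor (hr : 3 ≤ r) :
    ∃ (Φ : Discrete (ExtAffBraid r) ⥤ KbKar r) (_ : Φ.Monoidal), ∀ w : List (Gen r × Bool),
      Nonempty (Φ.obj ⟨wordElt w⟩ ≅ wordComplex hr w) := by
  refine ⟨repFunctor (braidHom hr), repFunctorMonoidal (braidHom hr), fun w => ?_⟩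
  obtain ⟨A, hA, hX, h⟩ := exists_wordPt hr w
  obtain ⟨e, -⟩ := PicPt.mk_eq_mk.1 ((rep_spec (braidHom hr) (wordElt w)).trans
    ((braidHom_wordElt hr w).trans h.symm))
  exact ⟨e ≪≫ eqToIso hX⟩

end Action

end ExtSoergel

theorem mainTheorem9 (r : ℕ) (hr : 3 ≤ r) :
    ∃ (Φ : Discrete (ExtSoergel.ExtAffBraid r) ⥤ ExtSoergel.KbKar r) (_ : Φ.Monoidal),
      ∀ w : List (ExtSoergel.Gen r × Bool),
        Nonempty (Φ.obj ⟨ExtSoergel.wordElt w⟩ ≅ ExtSoergel.wordComplex hr w) := by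
  exact ExtSoergel.exists_monoidal_functor hr
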